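/- **Conventions.** All fields are smooth. Hodge duals satisfy $\alpha\wedge *\beta=\langle\alpha,\beta\rangle\,\mathrm{vol}$. Let $U\subset\mathbb R^6$ (coordinates $x^\mu$) be open, let $\Omega\subset\mathbb R^4$ (coordinates $y^m$) be open and non-empty, and let $H>0$ be harmonic on $\Omega$, $\partial_m\partial_m H=0$. Let $*_\delta$ be the flat Hodge dual on $\Omega$, oriented by $dy^1\wedge\dots\wedge dy^4$; $U$ is oriented by $dx^0\wedge\dots\wedge dx^5$ and $U\times\Omega$ by the product orientation. Repeated indices $m=1,\dots,4$ are summed. **Type IIA.** The (bosonic, massless, Einstein-frame) type IIA equations for a Lorentzian metric $\hat g$, a dilaton $\hat\Phi$ and forms $\hat H_3,\hat F_2,\hat F_4$ are $$d\hat H_3=0,\qquad d\hat F_2=0,\qquad d\hat F_4=\hat F_2\wedge\hat H_3,$$ $$d(e^{\frac32\hat\Phi}\hat*\hat F_2)=-e^{\frac12\hat\Phi}\hat H_3\wedge\hat*\hat F_4,\qquad d(e^{\frac12\hat\Phi}\hat*\hat F_4)=-\hat H_3\wedge\hat F_4,$$ $$d(e^{-\hat\Phi}\hat*\hat H_3)=e^{\frac12\hat\Phi}\hat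 F_2\wedge\hat*\hat F_4+\tfrac12\hat F_4\wedge\hat F_4,$$ $$d\hat*d\hat\Phi=-\tfrac12e^{-\hat\Phi}\hat H_3\wedge\hat*\hat H_3+\tfrac34e^{\frac32\hat\Phi}\hat F_2\wedge\hat*\hat F_2+\tfrac14e^{\frac12\hat\Phi}\hat F_4\wedge\hat*\hat F_4,$$ $$\hat R_{MN}=\tfrac12\partial_M\hat\Phi\partial_N\hat\Phi+\tfrac14e^{-\hat\Phi}\big(\hat H^2_{MN}-\tfrac1{12}\hat g_{MN}\hat H^2\big)+\tfrac12e^{\frac32\hat\Phi}\big((\hat F_2)^2_{MN}-\tfrac1{16}\hat g_{MN}\hat F_2^2\big)+\tfrac1{12}e^{\frac12\hat\Phi}\big((\hat F_4)^2_{MN}-\tfrac3{32}\hat g_{MN}\hat F_4^2\big),$$ where $F^2_{MN}=F_{MP\cdots}F_N{}^{P\cdots}$ and $F^2=F_{P\cdots}F^{P\cdots}$. The NS5-brane background is $$d\hat s^2=H^{-1/4}\eta_{\mu\nu}dx^\mu dx^\nu+H^{3/4}\delta_{mn}dy^mdy^n,\qquad \hat H_3=-*_\delta dH,\qquad e^{\hat\Phi}=H^{1/2},\qquad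 \hat F_2=\hat F_4=0.$$ **Ansatz.** For a Lorentzian metric $g$, scalars $\sigma,\phi^m$ and three-forms $H_3^0,H_3^m$ on $U$, put on $U\times\Omega$ $$d\hat s^2=H^{-\frac14}e^{-\frac{1}{2\sqrt2}\sigma}g_{\mu\nu}dx^\mu dx^\nu+H^{\frac34}e^{\frac1{2\sqrt2}\sigma}\delta_{mn}dy^mdy^n,\qquad e^{\hat\Phi}=H^{\frac12}e^{-\frac1{\sqrt2}\sigma},$$ $$\hat H_3=-*_\delta dH+H^0_3,\qquad \hat F_2=\tfrac1{\sqrt2}d\phi^m\wedge dy^m,\qquad \hat F_4=H^m_3\wedge dy^m+\tfrac1{\sqrt2}H\,d\phi^m\wedge *_\delta dy^m .$$ **Six-dimensional equations.** * (B) $dH_3^0=0$ and $dH_3^m=\tfrac1{\sqrt2}H_3^0\wedge d\phi^m$; * (SD) $H_3^m=*_gH_3^m$; * (E) $$d(e^{\sqrt2\sigma}*_gH^0_3)+\sqrt2H^m_3\wedge d\phi^m=0,\qquad d(e^{-\sqrt2\sigma}*_gd\phi^m)+\sqrt2H^0_3\wedge H^m_3=0,$$ $$d*_gd\sigma+\tfrac1{\sqrt2}e^{-\sqrt2\sigma}d\phi^m\wedge*_gd\phi^m-\tfrac1{\sqrt2}e^{\sqrt2\sigma}H^0_3\wedge*_gH^0_3=0,$$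 $$R_{\mu\nu}=\tfrac12\partial_\mu\sigma\partial_\nu\sigma+\tfrac12e^{-\sqrt2\sigma}\partial_\mu\phi^m\partial_\nu\phi^m+\tfrac14H^m_{\mu\rho\lambda}H^m_\nu{}^{\rho\lambda}+\tfrac14e^{\sqrt2\sigma}\big(H^0_{\mu\rho\lambda}H^0_\nu{}^{\rho\lambda}-\tfrac16g_{\mu\nu}H^0_{\rho\lambda\kappa}H^{0\,\rho\lambda\kappa}\big).$$ **Covariant form.** Let $\eta=\mathrm{diag}(1,1,1,1,1,-1)$, let $SO_0(1,5)$ be the identity component of $SO(1,5)$, and embed $SO(5)$ in it as $\mathrm{diag}(k,1)$. The bosonic equations of 6d $\mathcal N=(2,0)$ supergravity with one tensor multiplet are the following, for a metric $g$, a map $\mathcal V=(v^i{}_I,x_I):U\to SO_0(1,5)$ (rows $v^1,\dots,v^5,x$), taken modulo left multiplication by $SO(5)$-valued functions, and three-forms $G^I$ ($I=1,\dots,6$). Put $\mathcal H^i=v^i{}_IG^I$, $\mathcal H^x=x_IG^I$, $P^i=x^Idv^i{}_I$ and $Q^{ij}=v^{iI}dv^j{}_I$, with $I$ raised by $\eta$.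 Then $$dG^I=0,\qquad *\mathcal H^i=\mathcal H^i,\qquad *\mathcal H^x=-\mathcal H^x,\qquad d*P^i+Q^{ij}\wedge*P^j=-\mathcal H^i\wedge*\mathcal H^x,$$ $$R_{\mu\nu}=P^i_\mu P^i_\nu+\tfrac14\big(\mathcal H^i_{\mu\rho\lambda}\mathcal H^i_\nu{}^{\rho\lambda}+\mathcal H^x_{\mu\rho\lambda}\mathcal H^x_\nu{}^{\rho\lambda}\big).$$ Let $a=e^{-\sigma/\sqrt2}$, $b=e^{\sigma/\sqrt2}$, $\phi^2=\phi^m\phi^m$ and $$\mathcal V(\sigma,\phi)=\begin{pmatrix}\delta_{mn}&-\frac1{\sqrt2}\phi^m&\frac1{\sqrt2}\phi^m\\ \frac1{\sqrt2}a\phi^n&\frac14[a(2-\phi^2)+2b]&\frac14[a(2+\phi^2)-2b]\\ \frac1{\sqrt2}a\phi^n&\frac14[a(2-\phi^2)-2b]&\frac14[a(2+\phi^2)+2b]\end{pmatrix}.$$ **Theorem.** 1. The ansatz with $g=\eta_{\mu\nu}$ (the flat metric $\mathrm{diag}(-1,1,1,1,1,1)$) and all other 6d fields zero is the NS5-brane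 background, which is a smooth solution of the type IIA equations. 2. (Consistent truncation.) For all 6d fields the ansatz gives smooth type IIA fields with a Lorentzian metric. If (SD) holds, they satisfy the type IIA equations of motion and Bianchi identities on $U\times\Omega$ if and only if (B) and (E) hold on $U$. 3. If no non-zero constant vector $c$ satisfies $c^m\partial_mH=0$ on all of $\Omega$, then for arbitrary three-forms $H^m_3$ the type IIA equations are equivalent to (B), (E) and (SD). 4. For all two-forms $B^0,B^m$, the field strengths $H^0_3=dB^0$ and $H^m_3=dB^m-\frac1{\sqrt2}\phi^mdB^0$ satisfy (B). 5. (Scalar manifold.) $\mathcal V(\sigma,\phi)\in SO_0(1,5)$. Every $\Lambda\in SO_0(1,5)$ equals $\mathrm{diag}(k,1)\,\mathcal V(\sigma,\phi)$ for some $k\in SO(5)$ and a unique $(\sigma,\phi)\in\mathbb R\times\mathbb R^4$, so $(\sigma,\phi)$ are global coordinates on $SO(1,5)/SO(5)$ (the hyperbolic space $\mathbb H^5$). The invariant metric is $P^iP^i=\frac12\big(d\sigma^2+e^{-\sqrt2\sigma}d\phi^md\phi^m\big)$. 6. (The truncated theory.) Let $\mathcal V=\mathcal V(\sigma,\phi)$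 and let $G^I$ be defined by $\mathcal V G=\big(H_3^m,\ \tfrac12e^{\sigma/\sqrt2}(*H_3^0+H_3^0),\ \tfrac12e^{\sigma/\sqrt2}(*H_3^0-H_3^0)\big)$. Then $(g,\mathcal V,G)$ are smooth fields of the covariant theory, and (B), (E), (SD) hold if and only if $(g,\mathcal V,G)$ solves the equations of $(2,0)$ supergravity with one tensor multiplet. Conversely, every smooth solution $(g,\mathcal V',G)$ of the latter on $U$ arises in this way, with $\mathcal V'=\mathrm{diag}(k,1)\mathcal V(\sigma,\phi)$ for an $SO(5)$-valued $k$. -/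

import Mathlib

open scoped ContDiff

noncomputable section

/-! ### Differential forms and pseudo-Riemannian geometry in coordinates -/

/-- Alternating `p`-forms on the coordinate space `ι → ℝ`. -/
abbrev Form (ι : Type) [Fintype ι] (p : ℕ) : Type :=
  (ι → ℝ) [⋀^Fin p]→L[ℝ] ℝ

/-- The coordinate vector `∂_i`. -/
abbrev coordVec {ι : Type} [DecidableEq ι] (i : ι) : ι → ℝ := Pi.single i 1

theorem alternatingMap_continuous {ι : Type} [Fintype ι] [DecidableEq ι] {p : ℕ}
    (f : (ι → ℝ) [⋀^Fin p]→ₗ[ℝ] ℝ) : Continuous f := by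
  have h : ∀ v : Fin p → ι → ℝ,
      f v = ∑ I : Fin p → ι, (∏ k, v k (I k)) * f (fun k => coordVec (I k)) := by
    intro v
    have hv : v = fun k => ∑ i : ι, v k i • (coordVec i : ι → ℝ) := by
      funext k
      exact pi_eq_sum_univ' (v k)
    conv_lhs => rw [hv]
    rw [← AlternatingMap.coe_multilinearMap, MultilinearMap.map_sum]
    refine Finset.sum_congr rfl fun I _ => ?_
    rw [MultilinearMap.map_smul_univ]
    rfl
  have h' : (f : (Fin p → ι → ℝ) → ℝ) = fun v =>
      ∑ I : Fin p → ι, (∏ k, v k (I k)) * f (fun k => coordVec (I k)) := funext h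
  rw [h']
  fun_prop

/-- An algebraic alternating map on a coordinate space, as a (continuous) form. -/
def toForm {ι : Type} [Fintype ι] [DecidableEq ι] {p : ℕ}
    (f : (ι → ℝ) [⋀^Fin p]→ₗ[ℝ] ℝ) : Form ι p :=
  { f with cont := alternatingMap_continuous f }

/-- The wedge product, the sum over `(p, q)`-shuffles. -/
def wedge {ι : Type} [Fintype ι] [DecidableEq ι] {p q : ℕ}
    (a : Form ι p) (b : Form ι q) : Form ι (p + q) :=
  toForm (((LinearMap.mul' ℝ ℝ).compAlternatingMap
    (a.toAlternatingMap.domCoprod b.toAlternatingMap)).domDomCongr finSumFinEquiv)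

/-- The differential of a function, as a one-form. -/
def dScalar {ι : Type} [Fintype ι] (f : (ι → ℝ) → ℝ) (x : ι → ℝ) : Form ι 1 :=
  ContinuousAlternatingMap.ofSubsingleton ℝ (ι → ℝ) ℝ (0 : Fin 1) (fderiv ℝ f x)

/-- The constant coordinate one-form `dx^i`. -/
def dCoord {ι : Type} [Fintype ι] (i : ι) : Form ι 1 :=
  ContinuousAlternatingMap.ofSubsingleton ℝ (ι → ℝ) ℝ (0 : Fin 1)
    (ContinuousLinearMap.proj (R := ℝ) i)

/-- Plug the vectors `w` into the first `p` slots of `D`. -/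
def insertLeft {E : Type} [AddCommGroup E] [Module ℝ E] {p q : ℕ}
    (D : E [⋀^Fin (p + q)]→ₗ[ℝ] ℝ) (w : Fin p → E) : E [⋀^Fin q]→ₗ[ℝ] ℝ where
  toFun v := D (Fin.append w v)
  map_update_add' := by
    intro inst v i x y
    have hd : inst = instDecidableEqFin q := Subsingleton.elim _ _
    subst hd
    have key : ∀ z : E, Fin.append w (Function.update v i z) =
        Function.update (Fin.append w v) (Fin.natAdd p i) z := by
      intro z
      funext j
      refine Fin.addCases (fun a => ?_) (fun a => ?_) j
      · rw [Fin.append_left, Function.update_of_ne, Fin.append_left]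
        intro h
        have := congrArg Fin.val h
        simp at this
        omega
      · rw [Fin.append_right]
        by_cases hai : a = i
        · subst hai
          simp
        · rw [Function.update_of_ne hai, Function.update_of_ne, Fin.append_right]
          intro h
          exact hai (Fin.natAdd_injective _ _ h)
    rw [key, key, key, AlternatingMap.map_update_add]
  map_update_smul' := by
    intro inst v i c x
    have hd : inst = instDecidableEqFin q := Subsingleton.elim _ _
    subst hd
    have key : ∀ z : E, Fin.append w (Function.update v i z) =
        Function.update (Fin.append w v) (Fin.natAdd p i) z := by
      intro z
      funext j
      refine Fin.addCases (fun a => ?_) (fun a => ?_) j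
      · rw [Fin.append_left, Function.update_of_ne, Fin.append_left]
        intro h
        have := congrArg Fin.val h
        simp at this
        omega
      · rw [Fin.append_right]
        by_cases hai : a = i
        · subst hai
          simp
        · rw [Function.update_of_ne hai, Function.update_of_ne, Fin.append_right]
          intro h
          exact hai (Fin.natAdd_injective _ _ h)
    rw [key, key, AlternatingMap.map_update_smul]
  map_eq_zero_of_eq' := by
    intro v i j hv hij
    refine D.map_eq_zero_of_eq _ (i := Fin.natAdd p i) (j := Fin.natAdd p j) ?_ ?_
    · rw [Fin.append_right, Fin.append_right, hv]
    · intro h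
      exact hij (Fin.natAdd_injective _ _ h)

/-- The Hodge dual for the metric `g` (with matrix entries `g_{ij}`) and the orientation given by
the ordering `e` of the coordinates:
`(*θ)_{j₁…j_q} = (1/p!) √|det g| θ^{i₁…i_p} ε_{i₁…i_p j₁…j_q}`.
The `i`-th row of `g⁻¹` is the vector obtained from `dx^i` by raising the index. With this
convention `α ∧ *β = ⟨α, β⟩ vol`. -/
def hodge {ι : Type} [Fintype ι] [DecidableEq ι] {p q : ℕ} (e : ι ≃ Fin (p + q))
    (g : Matrix ι ι ℝ) (θ : Form ι p) : Form ι q :=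
  toForm ((√|g.det| / (p.factorial : ℝ)) • ∑ I : Fin p → ι,
    θ (fun k => g⁻¹ (I k)) •
      insertLeft ((Pi.basisFun ℝ ι).reindex e).det (fun k => (coordVec (I k) : ι → ℝ)))

/-- `θ_{i₁…i_p} θ^{i₁…i_p}` (full contraction, without `1/p!`). -/
def normSq {ι : Type} [Fintype ι] [DecidableEq ι] {p : ℕ} (g : Matrix ι ι ℝ) (θ : Form ι p) : ℝ :=
  ∑ I : Fin p → ι, θ (fun k => coordVec (I k)) * θ (fun k => g⁻¹ (I k))

/-- `θ_{i k₁…k_p} θ_j^{k₁…k_p}`. -/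
def contract {ι : Type} [Fintype ι] [DecidableEq ι] {p : ℕ} (g : Matrix ι ι ℝ)
    (θ : Form ι (p + 1)) (i j : ι) : ℝ :=
  ∑ I : Fin p → ι,
    θ (Fin.cons (coordVec i : ι → ℝ) (fun k => (coordVec (I k) : ι → ℝ))) *
      θ (Fin.cons (coordVec j : ι → ℝ) (fun k => g⁻¹ (I k)))

/-- The partial derivative `∂_i f`. -/
def pd {ι : Type} [Fintype ι] [DecidableEq ι] (i : ι) (f : (ι → ℝ) → ℝ) (x : ι → ℝ) : ℝ :=
  fderiv ℝ f x (coordVec i)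

/-- The Christoffel symbols `Γ^k_{ij}`. -/
def christoffel {ι : Type} [Fintype ι] [DecidableEq ι] (g : (ι → ℝ) → Matrix ι ι ℝ)
    (k i j : ι) (x : ι → ℝ) : ℝ :=
  (1 / 2) * ∑ l, (g x)⁻¹ k l *
    (pd i (fun z => g z j l) x + pd j (fun z => g z i l) x - pd l (fun z => g z i j) x)

/-- The Ricci tensor
`R_{ij} = ∂_k Γ^k_{ij} - ∂_j Γ^k_{ik} + Γ^k_{kl} Γ^l_{ij} - Γ^k_{jl} Γ^l_{ik}`. -/
def ricci {ι : Type} [Fintype ι] [DecidableEq ι] (g : (ι → ℝ) → Matrix ι ι ℝ)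
    (i j : ι) (x : ι → ℝ) : ℝ :=
  ∑ k, (pd k (christoffel g k i j) x - pd j (christoffel g k i k) x) +
    ∑ k, ∑ l, (christoffel g k k l x * christoffel g l i j x -
      christoffel g k j l x * christoffel g l i k x)

/-- Symmetric of signature `(-,+,…,+)`. -/
def IsLorentzian {ι : Type} [Fintype ι] [DecidableEq ι] (g : Matrix ι ι ℝ) : Prop :=
  ∃ (t : ι) (P : Matrix ι ι ℝ), IsUnit P.det ∧
    P.transpose * g * P = Matrix.diagonal (fun i => if i = t then -1 else 1)

/-- A smooth Lorentzian metric on `U`. -/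
def IsLorentzianMetricOn {ι : Type} [Fintype ι] [DecidableEq ι] (g : (ι → ℝ) → Matrix ι ι ℝ)
    (U : Set (ι → ℝ)) : Prop :=
  (∀ i j, ContDiffOn ℝ ∞ (fun x => g x i j) U) ∧ ∀ x ∈ U, IsLorentzian (g x)

/-! ### Type IIA supergravity (bosonic sector, Einstein frame) -/

/-- Ten-dimensional coordinate indices: six coordinates `x^μ` and four coordinates `y^m`. -/
abbrev Ten : Type := Fin 6 ⊕ Fin 4

/-- The Hodge dual in ten dimensions, oriented by `dx⁰ ∧ … ∧ dx⁵ ∧ dy¹ ∧ … ∧ dy⁴`. -/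
def star10 (p q : ℕ) (h : 6 + 4 = p + q) (g : Matrix Ten Ten ℝ) (θ : Form Ten p) : Form Ten q :=
  hodge (finSumFinEquiv.trans (finCongr h)) g θ

/-- Bosonic fields of type IIA supergravity: metric, dilaton, and the three field strengths. -/
structure IIAFields where
  metric : (Ten → ℝ) → Matrix Ten Ten ℝ
  Phi : (Ten → ℝ) → ℝ
  H3 : (Ten → ℝ) → Form Ten 3
  F2 : (Ten → ℝ) → Form Ten 2
  F4 : (Ten → ℝ) → Form Ten 4

namespace IIAFields

/-- Smooth fields, with a Lorentzian metric. -/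
structure Regular (S : IIAFields) (W : Set (Ten → ℝ)) : Prop where
  metric : IsLorentzianMetricOn S.metric W
  Phi : ContDiffOn ℝ ∞ S.Phi W
  H3 : ContDiffOn ℝ ∞ S.H3 W
  F2 : ContDiffOn ℝ ∞ S.F2 W
  F4 : ContDiffOn ℝ ∞ S.F4 W

/-- The Bianchi identities and the field equations of (massless) type IIA supergravity. -/
structure IsSolution (S : IIAFields) (W : Set (Ten → ℝ)) : Prop where
  bianchi_H3 : ∀ z ∈ W, extDeriv S.H3 z = 0
  bianchi_F2 : ∀ z ∈ W, extDeriv S.F2 z = 0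
  bianchi_F4 : ∀ z ∈ W, extDeriv S.F4 z = wedge (S.F2 z) (S.H3 z)
  eom_F2 : ∀ z ∈ W,
    extDeriv (fun w => Real.exp (3 / 2 * S.Phi w) • star10 2 8 rfl (S.metric w) (S.F2 w)) z =
      -(Real.exp (1 / 2 * S.Phi z) • wedge (S.H3 z) (star10 4 6 rfl (S.metric z) (S.F4 z)))
  eom_F4 : ∀ z ∈ W,
    extDeriv (fun w => Real.exp (1 / 2 * S.Phi w) • star10 4 6 rfl (S.metric w) (S.F4 w)) z =
      -wedge (S.H3 z) (S.F4 z)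
  eom_H3 : ∀ z ∈ W,
    extDeriv (fun w => Real.exp (-S.Phi w) • star10 3 7 rfl (S.metric w) (S.H3 w)) z =
      Real.exp (1 / 2 * S.Phi z) • wedge (S.F2 z) (star10 4 6 rfl (S.metric z) (S.F4 z)) +
        (1 / 2 : ℝ) • wedge (S.F4 z) (S.F4 z)
  eom_Phi : ∀ z ∈ W,
    extDeriv (fun w => star10 1 9 rfl (S.metric w) (dScalar S.Phi w)) z =
      -((1 / 2 * Real.exp (-S.Phi z)) •
          wedge (S.H3 z) (star10 3 7 rfl (S.metric z) (S.H3 z))) +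
        (3 / 4 * Real.exp (3 / 2 * S.Phi z)) •
          wedge (S.F2 z) (star10 2 8 rfl (S.metric z) (S.F2 z)) +
        (1 / 4 * Real.exp (1 / 2 * S.Phi z)) •
          wedge (S.F4 z) (star10 4 6 rfl (S.metric z) (S.F4 z))
  einstein : ∀ z ∈ W, ∀ M N : Ten,
    ricci S.metric M N z =
      1 / 2 * pd M S.Phi z * pd N S.Phi z +
        1 / 4 * Real.exp (-S.Phi z) *
          (contract (S.metric z) (S.H3 z) M N -
            1 / 12 * S.metric z M N * normSq (S.metric z) (S.H3 z)) +
        1 / 2 * Real.exp (3 / 2 * S.Phi z) *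
          (contract (S.metric z) (S.F2 z) M N -
            1 / 16 * S.metric z M N * normSq (S.metric z) (S.F2 z)) +
        1 / 12 * Real.exp (1 / 2 * S.Phi z) *
          (contract (S.metric z) (S.F4 z) M N -
            3 / 32 * S.metric z M N * normSq (S.metric z) (S.F4 z))

end IIAFields

/-! ### The six-dimensional fields and equations -/

/-- The Hodge dual in six dimensions, oriented by `dx⁰ ∧ … ∧ dx⁵`. -/
def star6 (p q : ℕ) (h : 6 = p + q) (g : Matrix (Fin 6) (Fin 6) ℝ) (θ : Form (Fin 6) p) :
    Form (Fin 6) q :=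
  hodge (finCongr h) g θ

/-- The Hodge dual of the flat metric on the transverse space, oriented by `dy¹ ∧ … ∧ dy⁴`. -/
def starDelta (p q : ℕ) (h : 4 = p + q) (θ : Form (Fin 4) p) : Form (Fin 4) q :=
  hodge (finCongr h) 1 θ

/-- The six-dimensional fields: the metric, `σ`, `φ^m`, and the three-form field strengths
`H^0` and `H^m`. -/
structure SixFields where
  metric : (Fin 6 → ℝ) → Matrix (Fin 6) (Fin 6) ℝ
  sigma : (Fin 6 → ℝ) → ℝ
  phi : Fin 4 → (Fin 6 → ℝ) → ℝ
  H0 : (Fin 6 → ℝ) → Form (Fin 6) 3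
  Hm : Fin 4 → (Fin 6 → ℝ) → Form (Fin 6) 3

namespace SixFields

/-- Smooth fields, with a Lorentzian metric. -/
structure Regular (F : SixFields) (U : Set (Fin 6 → ℝ)) : Prop where
  metric : IsLorentzianMetricOn F.metric U
  sigma : ContDiffOn ℝ ∞ F.sigma U
  phi : ∀ m, ContDiffOn ℝ ∞ (F.phi m) U
  H0 : ContDiffOn ℝ ∞ F.H0 U
  Hm : ∀ m, ContDiffOn ℝ ∞ (F.Hm m) U

/-- `H^m = *_g H^m`. -/
def SelfDual (F : SixFields) (U : Set (Fin 6 → ℝ)) : Prop :=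
  ∀ m, ∀ x ∈ U, F.Hm m x = star6 3 3 rfl (F.metric x) (F.Hm m x)

/-- `dH^0 = 0` and `dH^m = (1/√2) H^0 ∧ dφ^m`. -/
structure Bianchi (F : SixFields) (U : Set (Fin 6 → ℝ)) : Prop where
  H0 : ∀ x ∈ U, extDeriv F.H0 x = 0
  Hm : ∀ m, ∀ x ∈ U, extDeriv (F.Hm m) x = (1 / √2) • wedge (F.H0 x) (dScalar (F.phi m) x)

/-- The six-dimensional equations of motion. -/
structure EOM (F : SixFields) (U : Set (Fin 6 → ℝ)) : Prop where
  eom_H0 : ∀ x ∈ U,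
    extDeriv (fun w => Real.exp (√2 * F.sigma w) • star6 3 3 rfl (F.metric w) (F.H0 w)) x +
      √2 • ∑ m, wedge (F.Hm m x) (dScalar (F.phi m) x) = 0
  eom_phi : ∀ m, ∀ x ∈ U,
    extDeriv (fun w => Real.exp (-(√2 * F.sigma w)) •
        star6 1 5 rfl (F.metric w) (dScalar (F.phi m) w)) x +
      √2 • wedge (F.H0 x) (F.Hm m x) = 0
  eom_sigma : ∀ x ∈ U,
    extDeriv (fun w => star6 1 5 rfl (F.metric w) (dScalar F.sigma w)) x +
      (1 / √2 * Real.exp (-(√2 * F.sigma x))) •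
        ∑ m, wedge (dScalar (F.phi m) x) (star6 1 5 rfl (F.metric x) (dScalar (F.phi m) x)) -
      (1 / √2 * Real.exp (√2 * F.sigma x)) •
        wedge (F.H0 x) (star6 3 3 rfl (F.metric x) (F.H0 x)) = 0
  einstein : ∀ x ∈ U, ∀ μ ν : Fin 6,
    ricci F.metric μ ν x =
      1 / 2 * pd μ F.sigma x * pd ν F.sigma x +
        1 / 2 * Real.exp (-(√2 * F.sigma x)) * ∑ m, pd μ (F.phi m) x * pd ν (F.phi m) x +
        1 / 4 * ∑ m, contract (F.metric x) (F.Hm m x) μ ν +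
        1 / 4 * Real.exp (√2 * F.sigma x) *
          (contract (F.metric x) (F.H0 x) μ ν -
            1 / 6 * F.metric x μ ν * normSq (F.metric x) (F.H0 x))

/-- A solution of the six-dimensional theory. -/
def IsSolution (F : SixFields) (U : Set (Fin 6 → ℝ)) : Prop :=
  F.Bianchi U ∧ F.EOM U ∧ F.SelfDual U

/-- The fields built from the metric, the scalars and two-form potentials `B^0`, `B^m`:
`H^0 = dB^0` and `H^m = dB^m - (1/√2) φ^m dB^0`. -/
def ofPotentials (g : (Fin 6 → ℝ) → Matrix (Fin 6) (Fin 6) ℝ) (σ : (Fin 6 → ℝ) → ℝ)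
    (φ : Fin 4 → (Fin 6 → ℝ) → ℝ) (B0 : (Fin 6 → ℝ) → Form (Fin 6) 2)
    (Bm : Fin 4 → (Fin 6 → ℝ) → Form (Fin 6) 2) : SixFields where
  metric := g
  sigma := σ
  phi := φ
  H0 := extDeriv B0
  Hm := fun m x => extDeriv (Bm m) x - (1 / √2 * φ m x) • extDeriv B0 x

/-- The vacuum: flat metric, all other fields zero. -/
def vacuum : SixFields where
  metric := fun _ => Matrix.diagonal (fun μ => if μ = 0 then -1 else 1)
  sigma := 0
  phi := 0
  H0 := 0
  Hm := 0

end SixFields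

/-! ### The NS5-brane background and the truncation ansatz -/

/-- The projection `(x, y) ↦ x`. -/
def projX : (Ten → ℝ) →L[ℝ] (Fin 6 → ℝ) :=
  ContinuousLinearMap.pi fun μ => ContinuousLinearMap.proj (R := ℝ) (Sum.inl μ)

/-- The projection `(x, y) ↦ y`. -/
def projY : (Ten → ℝ) →L[ℝ] (Fin 4 → ℝ) :=
  ContinuousLinearMap.pi fun m => ContinuousLinearMap.proj (R := ℝ) (Sum.inr m)

/-- The product region `U × Ω`. -/
def region (U : Set (Fin 6 → ℝ)) (Ω : Set (Fin 4 → ℝ)) : Set (Ten → ℝ) :=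
  {z | projX z ∈ U ∧ projY z ∈ Ω}

/-- Pull a form on the six-dimensional space back to ten dimensions. -/
def pullX {p : ℕ} (θ : Form (Fin 6) p) : Form Ten p := θ.compContinuousLinearMap projX

/-- Pull a form on the transverse space back to ten dimensions. -/
def pullY {p : ℕ} (θ : Form (Fin 4) p) : Form Ten p := θ.compContinuousLinearMap projY

/-- The NS5-brane background
`ds² = H^{-1/4} η + H^{3/4} δ`, `H₃ = -*_δ dH`, `e^Φ = H^{1/2}`, without RR fluxes. -/
def ns5Background (H : (Fin 4 → ℝ) → ℝ) : IIAFields where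
  metric := fun z => Matrix.fromBlocks
    (H (projY z) ^ (-(1 / 4) : ℝ) • Matrix.diagonal (fun μ => if μ = 0 then -1 else 1)) 0 0
    (H (projY z) ^ (3 / 4 : ℝ) • 1)
  Phi := fun z => Real.log (H (projY z) ^ (1 / 2 : ℝ))
  H3 := fun z => -pullY (starDelta 1 3 rfl (dScalar H (projY z)))
  F2 := 0
  F4 := 0

/-- The truncation ansatz
`ds² = H^{-1/4} e^{-σ/(2√2)} g + H^{3/4} e^{σ/(2√2)} δ`, `e^Φ = H^{1/2} e^{-σ/√2}`,
`H₃ = -*_δ dH + H^0`, `F₂ = (1/√2) dφ^m ∧ dy^m`,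
`F₄ = H^m ∧ dy^m + (1/√2) H dφ^m ∧ *_δ dy^m`. -/
def uplift (H : (Fin 4 → ℝ) → ℝ) (F : SixFields) : IIAFields where
  metric := fun z => Matrix.fromBlocks
    ((H (projY z) ^ (-(1 / 4) : ℝ) * Real.exp (-(1 / (2 * √2) * F.sigma (projX z)))) •
      F.metric (projX z)) 0 0
    ((H (projY z) ^ (3 / 4 : ℝ) * Real.exp (1 / (2 * √2) * F.sigma (projX z))) • 1)
  Phi := fun z =>
    Real.log (H (projY z) ^ (1 / 2 : ℝ) * Real.exp (-(1 / √2 * F.sigma (projX z))))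
  H3 := fun z =>
    -pullY (starDelta 1 3 rfl (dScalar H (projY z))) + pullX (F.H0 (projX z))
  F2 := fun z =>
    (1 / √2) • ∑ m, wedge (pullX (dScalar (F.phi m) (projX z))) (pullY (dCoord m))
  F4 := fun z =>
    ∑ m, wedge (pullX (F.Hm m (projX z))) (pullY (dCoord m)) +
      (1 / √2 * H (projY z)) • ∑ m, wedge (pullX (dScalar (F.phi m) (projX z)))
        (pullY (starDelta 1 3 rfl (dCoord m)))

/-! ### The coset `SO(1,5)/SO(5)` and `(2,0)` supergravity with one tensor multiplet -/

/-- `η = diag(1,1,1,1,1,-1)`. -/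
def eta : Matrix (Fin 6) (Fin 6) ℝ := Matrix.diagonal ![1, 1, 1, 1, 1, -1]

/-- Membership in the identity component of `SO(1,5)`. -/
def IsSO15 (Λ : Matrix (Fin 6) (Fin 6) ℝ) : Prop :=
  Λ.transpose * eta * Λ = eta ∧ Λ.det = 1 ∧ 0 < Λ 5 5

/-- The embedding of `5 × 5` matrices as `diag(k, 1)`. -/
def embed5 (k : Matrix (Fin 5) (Fin 5) ℝ) : Matrix (Fin 6) (Fin 6) ℝ :=
  Matrix.reindex finSumFinEquiv finSumFinEquiv
    (Matrix.fromBlocks k 0 0 (1 : Matrix (Fin 1) (Fin 1) ℝ))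

/-- The coset representative in horospherical coordinates `(σ, φ)`. Rows are labelled by the
`SO(5)` index `i = 1, …, 5` (rows `v^i`) and the singlet (last row `x`), columns by the
`SO(1,5)` index `I`. -/
def cosetRep (σ : ℝ) (φ : Fin 4 → ℝ) : Matrix (Fin 6) (Fin 6) ℝ :=
  let a := Real.exp (-(σ / √2))
  let b := Real.exp (σ / √2)
  let n := ∑ m, φ m ^ 2
  !![1, 0, 0, 0, -(φ 0 / √2), φ 0 / √2;
     0, 1, 0, 0, -(φ 1 / √2), φ 1 / √2;
     0, 0, 1, 0, -(φ 2 / √2), φ 2 / √2;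
     0, 0, 0, 1, -(φ 3 / √2), φ 3 / √2;
     a * φ 0 / √2, a * φ 1 / √2, a * φ 2 / √2, a * φ 3 / √2,
       (a * (2 - n) + 2 * b) / 4, (a * (2 + n) - 2 * b) / 4;
     a * φ 0 / √2, a * φ 1 / √2, a * φ 2 / √2, a * φ 3 / √2,
       (a * (2 - n) - 2 * b) / 4, (a * (2 + n) + 2 * b) / 4]

/-- Bosonic fields of six-dimensional `(2,0)` supergravity with one tensor multiplet: metric,
coset representative `V = (v^i_I, x_I)` and six three-form field strengths `G^I`. -/
structure TwoZeroFields where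
  metric : (Fin 6 → ℝ) → Matrix (Fin 6) (Fin 6) ℝ
  V : (Fin 6 → ℝ) → Matrix (Fin 6) (Fin 6) ℝ
  G : Fin 6 → (Fin 6 → ℝ) → Form (Fin 6) 3

namespace TwoZeroFields

/-- Smooth fields, with a Lorentzian metric and `V` valued in `SO(1,5)`. -/
structure Regular (T : TwoZeroFields) (U : Set (Fin 6 → ℝ)) : Prop where
  metric : IsLorentzianMetricOn T.metric U
  V : ∀ A I, ContDiffOn ℝ ∞ (fun x => T.V x A I) U
  isSO15 : ∀ x ∈ U, IsSO15 (T.V x)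
  G : ∀ I, ContDiffOn ℝ ∞ (T.G I) U

/-- The dressed field strengths `V^A_I G^I`. -/
def dressed (T : TwoZeroFields) (A : Fin 6) (x : Fin 6 → ℝ) : Form (Fin 6) 3 :=
  ∑ I, T.V x A I • T.G I x

/-- The one-form `η^{IJ} V^A_I dV^B_J`. -/
def maurerCartan (T : TwoZeroFields) (A B : Fin 6) (x : Fin 6 → ℝ) : Form (Fin 6) 1 :=
  ∑ I, (eta I I * T.V x A I) • dScalar (fun w => T.V w B I) x

/-- The scalar vielbein `P^i = x^I dv_I^i`. -/
def P (T : TwoZeroFields) (i : Fin 5) (x : Fin 6 → ℝ) : Form (Fin 6) 1 :=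
  T.maurerCartan (Fin.last 5) i.castSucc x

/-- The composite `SO(5)` connection `Q^{ij} = v^{iI} dv_I^j`. -/
def Q (T : TwoZeroFields) (i j : Fin 5) (x : Fin 6 → ℝ) : Form (Fin 6) 1 :=
  T.maurerCartan i.castSucc j.castSucc x

/-- The bosonic field equations: closed field strengths, of which the dressed ones in the
`SO(5)` vector are self-dual and the dressed singlet is anti-self-dual; the scalar equation
`D*P^i = -H^i ∧ *H^x`, with `D` covariant under local `SO(5)`; and the Einstein equation. -/
structure IsSolution (T : TwoZeroFields) (U : Set (Fin 6 → ℝ)) : Prop where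
  closed : ∀ I, ∀ x ∈ U, extDeriv (T.G I) x = 0
  self_dual : ∀ i : Fin 5, ∀ x ∈ U,
    star6 3 3 rfl (T.metric x) (T.dressed i.castSucc x) = T.dressed i.castSucc x
  anti_self_dual : ∀ x ∈ U,
    star6 3 3 rfl (T.metric x) (T.dressed (Fin.last 5) x) = -T.dressed (Fin.last 5) x
  scalar : ∀ i : Fin 5, ∀ x ∈ U,
    extDeriv (fun w => star6 1 5 rfl (T.metric w) (T.P i w)) x +
      ∑ j, wedge (T.Q i j x) (star6 1 5 rfl (T.metric x) (T.P j x)) =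
      -wedge (T.dressed i.castSucc x)
        (star6 3 3 rfl (T.metric x) (T.dressed (Fin.last 5) x))
  einstein : ∀ x ∈ U, ∀ μ ν : Fin 6,
    ricci T.metric μ ν x =
      ∑ i, T.P i x (fun _ => coordVec μ) * T.P i x (fun _ => coordVec ν) +
        1 / 4 * ∑ A, contract (T.metric x) (T.dressed A x) μ ν

end TwoZeroFields

namespace SixFields

/-- The dressed field strengths of the truncation:
`H^m`, `½ e^{σ/√2} (*H^0 + H^0)` and `½ e^{σ/√2} (*H^0 - H^0)`. -/
def dressedForms (F : SixFields) (x : Fin 6 → ℝ) : Fin 6 → Form (Fin 6) 3 :=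
  ![F.Hm 0 x, F.Hm 1 x, F.Hm 2 x, F.Hm 3 x,
    (1 / 2 * Real.exp (F.sigma x / √2)) • (star6 3 3 rfl (F.metric x) (F.H0 x) + F.H0 x),
    (1 / 2 * Real.exp (F.sigma x / √2)) • (star6 3 3 rfl (F.metric x) (F.H0 x) - F.H0 x)]

/-- The truncation in `SO(1,5)`-covariant variables; `η Vᵀ η` is the inverse of `V`. -/
def toTwoZero (F : SixFields) : TwoZeroFields where
  metric := F.metric
  V := fun x => cosetRep (F.sigma x) (fun m => F.phi m x)
  G := fun I x => ∑ A,
    (eta * (cosetRep (F.sigma x) (fun m => F.phi m x)).transpose * eta) I A • F.dressedForms x A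

end SixFields

end

set_option linter.unusedSectionVars false

noncomputable section

open Finset (sum_congr mul_sum sum_add_distrib sum_comm sum_sub_distrib smul_sum sum_const_zero)
open Finset (sum_eq_single sum_neg_distrib sum_mul mem_univ sum_ite_eq' sum_smul sum_eq_zero sum_ite_eq)
open Fin (castAdd natAdd append addCases lastCases)
open Real (exp exp_pos exp_add mul_self_sqrt log exp_log sq_sqrt exp_neg sqrt_pos exp_nat_mul)
open Sum (inl inr)
open Matrix (fromBlocks fromBlocks_apply₁₁ fromBlocks_apply₁₂ fromBlocks_apply₂₁ fromBlocks_apply₂₂)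
open Matrix (specialOrthogonalGroup transpose_apply det_one diagonal_apply_eq mul_diagonal)
open Equiv (Perm)

/-- Six-dimensional spacetime, the transverse space, and ten-dimensional spacetime. -/
notation "ℝ⁶" => Fin 6 → ℝ
notation "ℝ⁴" => Fin 4 → ℝ
notation "ℝ¹⁰" => Ten → ℝ

/-- Forms on the two factors. -/
notation "Λ⁶" => Form (Fin 6)
notation "Λ⁴" => Form (Fin 4)

/-- `6 × 6` matrices. -/
notation "Mat₆" => Matrix (Fin 6) (Fin 6) ℝ

/-- The Hodge dual of one- and three-forms in six dimensions. -/
notation "⋆₁" => star6 1 5 rfl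
notation "⋆₃" => star6 3 3 rfl

/-- The two components of a point of ten-dimensional spacetime. -/
prefix:max "♯" => projX
prefix:max "♭" => projY

/-- Real differentiability at a point. -/
notation "Diff" => DifferentiableAt ℝ

/-- The Kronecker delta. -/
notation "δ[" i "," j "]" => (if i = j then (1 : ℝ) else 0)

variable {ι : Type} [Fintype ι] [DecidableEq ι] {p q : ℕ}

namespace Form

variable {ι : Type} [Fintype ι] {p : ℕ} (a b : Form ι p) (v : Fin p → ι → ℝ)

theorem smul_apply (c : ℝ) : (c • a) v = c * a v := rfl
theorem neg_apply : (-a) v = -a v := rfl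
theorem add_apply : (a + b) v = a v + b v := rfl
theorem sub_apply : (a - b) v = a v - b v := rfl
theorem sum_apply {S : Type*} (s : Finset S) (f : S → Form ι p) :
    (∑ i ∈ s, f i) v = ∑ i ∈ s, f i v := ContinuousAlternatingMap.sum_apply _ _

end Form

section Forms

variable {p q r : ℕ}

lemma toForm_apply (f : (ι → ℝ) [⋀^Fin p]→ₗ[ℝ] ℝ) (v : Fin p → ι → ℝ) : toForm f v = f v := rfl

lemma form_ext_coord {a b : Form ι p}
    (h : ∀ I : Fin p → ι, a (fun k => coordVec (I k)) = b (fun k => coordVec (I k))) : a = b := by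
  apply ContinuousAlternatingMap.toAlternatingMap_injective
  apply Module.Basis.ext_alternating (Pi.basisFun ℝ ι)
  intro v _
  simpa using h v

/-- The wedge product as a normalised sum over all permutations. -/
lemma wedge_apply (a : Form ι p) (b : Form ι q) (v : Fin (p + q) → ι → ℝ) :
    wedge a b v = ((p.factorial : ℝ) * q.factorial)⁻¹ *
      ∑ σ : Perm (Fin (p + q)), ((Equiv.Perm.sign σ : ℤ) : ℝ) *
        (a (fun i => v (σ (castAdd q i))) * b (fun j => v (σ (natAdd p j)))) := by
  have h := congrArg (fun f => LinearMap.mul' ℝ ℝ (f (fun k => v (finSumFinEquiv k))))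
    (MultilinearMap.domCoprod_alternization_eq a.toAlternatingMap b.toAlternatingMap)
  simp only [Fintype.card_fin] at h
  have hw : wedge a b v = LinearMap.mul' ℝ ℝ
      ((a.toAlternatingMap.domCoprod b.toAlternatingMap) (fun k => v (finSumFinEquiv k))) := rfl
  rw [hw]
  rw [AlternatingMap.smul_apply, map_nsmul, MultilinearMap.alternatization_apply, map_sum] at h
  rw [eq_inv_mul_iff_mul_eq₀ (by positivity)]
  rw [nsmul_eq_mul] at h
  push_cast at h
  rw [← h]
  refine Fintype.sum_equiv (finSumFinEquiv.permCongr) _ _ fun σ => ?_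
  rw [Equiv.Perm.sign_permCongr, Units.smul_def, map_zsmul]
  simp [MultilinearMap.domDomCongr_apply, MultilinearMap.domCoprod_apply]

lemma wedge_eq_sum_cosets (a : Form ι p) (b : Form ι q) (v : Fin (p + q) → ι → ℝ) :
    wedge a b v = ∑ σ : Equiv.Perm.ModSumCongr (Fin p) (Fin q),
      LinearMap.mul' ℝ ℝ (AlternatingMap.domCoprod.summand a.toAlternatingMap b.toAlternatingMap σ
        (fun k => v (finSumFinEquiv k))) := by
  have hw : wedge a b v = LinearMap.mul' ℝ ℝ
      ((a.toAlternatingMap.domCoprod b.toAlternatingMap) (fun k => v (finSumFinEquiv k))) := rfl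
  rw [hw, AlternatingMap.domCoprod_apply, sum_apply, map_sum]

/-- If only the trivial shuffle contributes, the wedge product is a product of values. -/
lemma wedge_apply_of_vanish (a : Form ι p) (b : Form ι q) (v : Fin (p + q) → ι → ℝ)
    (h : ∀ σ : Perm (Fin (p + q)), (∃ i j, σ (castAdd q i) = natAdd p j) →
      (∃ i j, σ (natAdd p j) = castAdd q i) →
      a (fun i => v (σ (castAdd q i))) * b (fun j => v (σ (natAdd p j))) = 0) :
    wedge a b v = a (fun i => v (castAdd q i)) * b (fun j => v (natAdd p j)) := by
  rw [wedge_eq_sum_cosets]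
  refine (sum_eq_single (Quotient.mk'' 1 : Equiv.Perm.ModSumCongr (Fin p) (Fin q))
    ?_ ?_).trans ?_
  rotate_left 2
  · rw [AlternatingMap.domCoprod.summand_mk'']
    simp [MultilinearMap.domDomCongr_apply, MultilinearMap.domCoprod_apply]
  · intro τ _ hτ
    induction τ using Quotient.inductionOn' with | _ σ
    have hσ : σ ∉ (Equiv.Perm.sumCongrHom (Fin p) (Fin q)).range := by
      intro hm
      apply hτ
      rw [Quotient.eq'', QuotientGroup.leftRel_apply]
      simpa using Subgroup.inv_mem _ hm
    have h1 : ∃ i j, σ (inl i) = inr j := by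
      by_contra hc
      push Not at hc
      apply hσ
      apply Equiv.Perm.mem_sumCongrHom_range_of_perm_mapsTo_inl
      rintro _ ⟨i, rfl⟩
      rcases hh : σ (inl i) with k | k
      · exact ⟨k, rfl⟩
      · exact absurd hh (hc i k)
    have h2 : ∃ i j, σ (inr j) = inl i := by
      by_contra hc
      push Not at hc
      apply hσ
      apply Equiv.Perm.mem_sumCongrHom_range_of_perm_mapsTo_inl
      rw [Equiv.Perm.perm_mapsTo_inl_iff_mapsTo_inr]
      rintro _ ⟨j, rfl⟩
      rcases hh : σ (inr j) with k | k
      · exact absurd hh (hc k j)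
      · exact ⟨k, rfl⟩
    have := h (finSumFinEquiv.permCongr σ)
      (by obtain ⟨i, j, hij⟩ := h1; exact ⟨i, j, by simp [hij]⟩)
      (by obtain ⟨i, j, hij⟩ := h2; exact ⟨i, j, by simp [hij]⟩)
    rw [AlternatingMap.domCoprod.summand_mk'']
    rw [smul_apply, Units.smul_def, map_zsmul]
    simpa [MultilinearMap.domDomCongr_apply, MultilinearMap.domCoprod_apply] using this
  · simp

end Forms

section Forms

variable {ι κ : Type} [Fintype ι] [DecidableEq ι] [Fintype κ] [DecidableEq κ] {p q r : ℕ}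

lemma wedge_add_left (a a' : Form ι p) (b : Form ι q) :
    wedge (a + a') b = wedge a b + wedge a' b := by
  ext v
  simp [wedge_apply, add_mul, mul_add, sum_add_distrib]

lemma wedge_add_right (a : Form ι p) (b b' : Form ι q) :
    wedge a (b + b') = wedge a b + wedge a b' := by
  ext v
  simp [wedge_apply, mul_add, sum_add_distrib]

lemma wedge_smul_left (c : ℝ) (a : Form ι p) (b : Form ι q) : wedge (c • a) b = c • wedge a b := by
  ext v
  simp only [wedge_apply, Form.smul_apply, mul_sum]
  exact sum_congr rfl fun _ _ => by ring

lemma wedge_smul_right (c : ℝ) (a : Form ι p) (b : Form ι q) : wedge a (c • b) = c • wedge a b := by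
  ext v
  simp only [wedge_apply, Form.smul_apply, mul_sum]
  exact sum_congr rfl fun _ _ => by ring

/-- The wedge product as a bilinear map. -/
def wedgeLin (ι : Type) [Fintype ι] [DecidableEq ι] (p q : ℕ) :
    Form ι p →ₗ[ℝ] Form ι q →ₗ[ℝ] Form ι (p + q) :=
  LinearMap.mk₂ ℝ wedge wedge_add_left wedge_smul_left wedge_add_right wedge_smul_right

lemma wedgeLin_apply (a : Form ι p) (b : Form ι q) : wedgeLin ι p q a b = wedge a b := rfl

lemma wedge_zero_left (b : Form ι q) : wedge (0 : Form ι p) b = 0 := by simp [← wedgeLin_apply]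

lemma wedge_zero_right (a : Form ι p) : wedge a (0 : Form ι q) = 0 := by simp [← wedgeLin_apply]

lemma wedge_neg_left (a : Form ι p) (b : Form ι q) : wedge (-a) b = -wedge a b := by
  simp [← wedgeLin_apply]

lemma wedge_neg_right (a : Form ι p) (b : Form ι q) : wedge a (-b) = -wedge a b := by
  simp [← wedgeLin_apply]

lemma wedge_sub_right (a : Form ι p) (b b' : Form ι q) :
    wedge a (b - b') = wedge a b - wedge a b' := by simp [← wedgeLin_apply]

lemma wedge_sum_left {S : Type*} (s : Finset S) (a : S → Form ι p) (b : Form ι q) :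
    wedge (∑ i ∈ s, a i) b = ∑ i ∈ s, wedge (a i) b := by simp [← wedgeLin_apply]

lemma wedge_sum_right {S : Type*} (s : Finset S) (a : Form ι p) (b : S → Form ι q) :
    wedge a (∑ i ∈ s, b i) = ∑ i ∈ s, wedge a (b i) := by simp [← wedgeLin_apply]

lemma wedge_comp (a : Form ι p) (b : Form ι q) (f : (κ → ℝ) →L[ℝ] (ι → ℝ)) :
    (wedge a b).compContinuousLinearMap f =
      wedge (a.compContinuousLinearMap f) (b.compContinuousLinearMap f) := by
  ext v
  simp [wedge_apply, Function.comp_def]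

/-- Transport of a form along an equality of degrees. -/
def castForm (h : p = q) (a : Form ι p) : Form ι q := h ▸ a

lemma castForm_apply (h : p = q) (a : Form ι p) (v : Fin q → ι → ℝ) :
    castForm h a v = a (fun i => v (Fin.cast h i)) := by
  subst h
  rfl

/-- A permutation of the first block of indices. -/
def permLeft (r : ℕ) (τ : Perm (Fin p)) : Perm (Fin (p + r)) :=
  finSumFinEquiv.permCongr (Equiv.Perm.sumCongr τ 1)

/-- A permutation of the last block of indices. -/
def permRight (p : ℕ) (τ : Perm (Fin r)) : Perm (Fin (p + r)) :=
  finSumFinEquiv.permCongr (Equiv.Perm.sumCongr 1 τ)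

lemma permLeft_castAdd (τ : Perm (Fin p)) (i : Fin p) :
    permLeft r τ (castAdd r i) = castAdd r (τ i) := by simp [permLeft]

lemma permLeft_natAdd (τ : Perm (Fin p)) (i : Fin r) : permLeft r τ (natAdd p i) = natAdd p i := by
  simp [permLeft]

lemma permRight_castAdd (τ : Perm (Fin r)) (i : Fin p) :
    permRight p τ (castAdd r i) = castAdd r i := by simp [permRight]

lemma permRight_natAdd (τ : Perm (Fin r)) (i : Fin r) :
    permRight p τ (natAdd p i) = natAdd p (τ i) := by simp [permRight]

lemma sign_permLeft (τ : Perm (Fin p)) : Equiv.Perm.sign (permLeft r τ) = Equiv.Perm.sign τ := by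
  simp [permLeft]

lemma sign_permRight (τ : Perm (Fin r)) : Equiv.Perm.sign (permRight p τ) = Equiv.Perm.sign τ := by
  simp [permRight]

lemma sign_mul_self_real {α : Type*} [Fintype α] [DecidableEq α] (σ : Perm α) :
    (((Equiv.Perm.sign σ : ℤˣ) : ℤ) : ℝ) * (((Equiv.Perm.sign σ : ℤˣ) : ℤ) : ℝ) = 1 := by
  rcases Int.units_eq_one_or (Equiv.Perm.sign σ) with h | h <;> simp [h]

lemma wedge_wedge_left_apply (a : Form ι p) (b : Form ι q) (c : Form ι r)
    (v : Fin (p + q + r) → ι → ℝ) :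
    wedge (wedge a b) c v = ((p.factorial : ℝ) * q.factorial * r.factorial)⁻¹ *
      ∑ σ : Perm (Fin (p + q + r)), ((Equiv.Perm.sign σ : ℤ) : ℝ) *
        (a (fun i => v (σ (castAdd r (castAdd q i)))) *
          b (fun j => v (σ (castAdd r (natAdd p j)))) * c (fun j => v (σ (natAdd (p + q) j)))) := by
  rw [wedge_apply]
  simp_rw [wedge_apply, mul_sum, sum_mul, mul_sum]
  rw [sum_comm]
  have key : ∀ τ : Perm (Fin (p + q)), ∑ σ : Perm (Fin (p + q + r)),
      (((p + q).factorial : ℝ) * r.factorial)⁻¹ * (((Equiv.Perm.sign σ : ℤ) : ℝ) *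
        (((p.factorial : ℝ) * q.factorial)⁻¹ * (((Equiv.Perm.sign τ : ℤ) : ℝ) *
          (a (fun i => v (σ (castAdd r (τ (castAdd q i))))) *
            b (fun j => v (σ (castAdd r (τ (natAdd p j))))))) *
              c (fun j => v (σ (natAdd (p + q) j))))) =
      ∑ σ : Perm (Fin (p + q + r)), ((p + q).factorial : ℝ)⁻¹ *
        (((p.factorial : ℝ) * q.factorial * r.factorial)⁻¹ * (((Equiv.Perm.sign σ : ℤ) : ℝ) *
        (a (fun i => v (σ (castAdd r (castAdd q i)))) *
          b (fun j => v (σ (castAdd r (natAdd p j)))) *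
          c (fun j => v (σ (natAdd (p + q) j)))))) := by
    intro τ
    refine Fintype.sum_equiv (Equiv.mulRight (permLeft r τ)) _ _ fun σ => ?_
    simp only [Equiv.coe_mulRight, Equiv.Perm.sign_mul, sign_permLeft, Equiv.Perm.coe_mul,
      Function.comp_apply, permLeft_castAdd, permLeft_natAdd]
    push_cast
    rw [mul_inv, mul_inv _ (r.factorial : ℝ)]
    ring
  rw [sum_congr rfl fun τ _ => key τ]
  rw [Finset.sum_const, Finset.card_univ, Fintype.card_perm, Fintype.card_fin, ← mul_sum,
    nsmul_eq_mul, mul_inv_cancel_left₀ (by positivity)]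

lemma wedge_wedge_right_apply (a : Form ι p) (b : Form ι q) (c : Form ι r)
    (v : Fin (p + (q + r)) → ι → ℝ) :
    wedge a (wedge b c) v = ((p.factorial : ℝ) * q.factorial * r.factorial)⁻¹ *
      ∑ σ : Perm (Fin (p + (q + r))), ((Equiv.Perm.sign σ : ℤ) : ℝ) *
        (a (fun i => v (σ (castAdd (q + r) i))) * b (fun j => v (σ (natAdd p (castAdd r j)))) *
          c (fun j => v (σ (natAdd p (natAdd q j))))) := by
  rw [wedge_apply]
  simp_rw [wedge_apply, mul_sum]
  rw [sum_comm]
  have key : ∀ τ : Perm (Fin (q + r)), ∑ σ : Perm (Fin (p + (q + r))),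
      ((p.factorial : ℝ) * (q + r).factorial)⁻¹ * (((Equiv.Perm.sign σ : ℤ) : ℝ) *
        (a (fun i => v (σ (castAdd (q + r) i))) *
        (((q.factorial : ℝ) * r.factorial)⁻¹ * (((Equiv.Perm.sign τ : ℤ) : ℝ) *
          (b (fun i => v (σ (natAdd p (τ (castAdd r i))))) *
            c (fun j => v (σ (natAdd p (τ (natAdd q j)))))))))) =
      ∑ σ : Perm (Fin (p + (q + r))), ((q + r).factorial : ℝ)⁻¹ *
        (((p.factorial : ℝ) * q.factorial * r.factorial)⁻¹ * (((Equiv.Perm.sign σ : ℤ) : ℝ) *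
        (a (fun i => v (σ (castAdd (q + r) i))) * b (fun j => v (σ (natAdd p (castAdd r j)))) *
          c (fun j => v (σ (natAdd p (natAdd q j))))))) := by
    intro τ
    refine Fintype.sum_equiv (Equiv.mulRight (permRight p τ)) _ _ fun σ => ?_
    simp only [Equiv.coe_mulRight, Equiv.Perm.sign_mul, sign_permRight, Equiv.Perm.coe_mul,
      Function.comp_apply, permRight_castAdd, permRight_natAdd]
    push_cast
    simp only [mul_inv]
    ring
  rw [sum_congr rfl fun τ _ => key τ]
  rw [Finset.sum_const, Finset.card_univ, Fintype.card_perm, Fintype.card_fin, ← mul_sum,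
    nsmul_eq_mul, mul_inv_cancel_left₀ (by positivity)]

lemma wedge_assoc (a : Form ι p) (b : Form ι q) (c : Form ι r) :
    wedge (wedge a b) c = castForm (Nat.add_assoc p q r).symm (wedge a (wedge b c)) := by
  ext v
  rw [castForm_apply, wedge_wedge_left_apply, wedge_wedge_right_apply]
  congr 1
  refine Fintype.sum_equiv ((finCongr (Nat.add_assoc p q r)).permCongr) _ _ fun σ => ?_
  have hv : ∀ k, v (Fin.cast (Nat.add_assoc p q r).symm
      ((finCongr (Nat.add_assoc p q r)).permCongr σ k)) =
        v (σ (Fin.cast (Nat.add_assoc p q r).symm k)) := fun k => rfl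
  have h1 : ∀ i : Fin p, Fin.cast (Nat.add_assoc p q r).symm (castAdd (q + r) i) =
      castAdd r (castAdd q i) := fun i => rfl
  have h2 : ∀ i : Fin q, Fin.cast (Nat.add_assoc p q r).symm (natAdd p (castAdd r i)) =
      castAdd r (natAdd p i) := fun i => rfl
  have h3 : ∀ i : Fin r, Fin.cast (Nat.add_assoc p q r).symm (natAdd p (natAdd q i)) =
      natAdd (p + q) i := fun i => Fin.ext (by simp [Nat.add_assoc])
  simp only [Equiv.Perm.sign_permCongr, hv, h1, h2, h3]

lemma finRotate_pow_val {n : ℕ} (k : ℕ) (i : Fin n) :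
    (((finRotate n) ^ k) i : ℕ) = (i + k) % n := by
  induction k with
  | zero => simp [Nat.mod_eq_of_lt i.2]
  | succ k ih =>
    have := i.neZero
    rw [pow_succ', Equiv.Perm.mul_apply, finRotate_apply, Fin.val_add, ih]
    rcases Nat.lt_or_ge 1 n with h | h
    · rw [Fin.val_one', Nat.mod_eq_of_lt h, Nat.mod_add_mod, Nat.add_assoc]
    · have : n = 1 := le_antisymm h (Nat.pos_of_ne_zero (NeZero.ne n))
      subst this
      simp [Nat.mod_one]

/-- The sign of the permutation exchanging two blocks of indices. -/
lemma sign_blockSwap (p q : ℕ) :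
    Equiv.Perm.sign ((finAddFlip (m := p) (n := q)).trans (finCongr (Nat.add_comm q p))) =
      (-1) ^ (p * q) := by
  have h : (finAddFlip (m := p) (n := q)).trans (finCongr (Nat.add_comm q p)) =
      finRotate (p + q) ^ q := by
    ext i
    rw [finRotate_pow_val]
    refine addCases (fun j => ?_) (fun j => ?_) i
    · simp
      rw [Nat.mod_eq_of_lt (by omega)]
    · simp
      rw [show p + (j : ℕ) + q = j + (p + q) by omega, Nat.add_mod_right,
        Nat.mod_eq_of_lt (by omega)]
  rw [h, map_pow, sign_finRotate, ← pow_mul]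
  rcases q with _ | q
  · simp
  · have : (p + (q + 1) - 1) * (q + 1) = p * (q + 1) + q * (q + 1) := by
      rw [show p + (q + 1) - 1 = p + q by omega]; ring
    rw [this, pow_add, (Nat.even_mul_succ_self q).neg_one_pow, mul_one]

lemma wedge_comm (a : Form ι p) (b : Form ι q) :
    wedge a b = (-1 : ℝ) ^ (p * q) • castForm (Nat.add_comm q p) (wedge b a) := by
  ext v
  rw [Form.smul_apply, castForm_apply, wedge_apply, wedge_apply, mul_left_comm,
    mul_comm (q.factorial : ℝ)]
  congr 1
  rw [mul_sum]
  let f : Fin (p + q) ≃ Fin (q + p) := finAddFlip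
  let c : Fin (q + p) ≃ Fin (p + q) := finCongr (Nat.add_comm q p)
  have hs : ∀ σ : Perm (Fin (q + p)), Equiv.Perm.sign ((f.trans σ).trans c) =
      Equiv.Perm.sign σ * (-1) ^ (p * q) := by
    intro σ
    have : (f.trans σ).trans c = c.permCongr σ * (f.trans c) := by
      ext i
      simp [c]
    rw [this, map_mul, Equiv.Perm.sign_permCongr, sign_blockSwap]
  symm
  refine Fintype.sum_equiv
    ⟨fun σ => (f.trans σ).trans c, fun τ => (f.symm.trans τ).trans c.symm,
      fun σ => by ext; simp, fun σ => by ext; simp⟩ _ _ fun σ => ?_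
  simp only [Equiv.coe_fn_mk, hs]
  have h1 : ∀ i, f (castAdd q i) = natAdd q i := fun i => by simp [f]
  have h2 : ∀ i, f (natAdd p i) = castAdd p i := fun i => by simp [f]
  simp only [Equiv.trans_apply, h1, h2]
  push_cast
  simp only [c, finCongr_apply]
  ring

/-- The components of a form. -/
def componentsLin (ι : Type) [Fintype ι] [DecidableEq ι] (p : ℕ) :
    Form ι p →ₗ[ℝ] ((Fin p → ι) → ℝ) where
  toFun a I := a (fun k => coordVec (I k))
  map_add' _ _ := rfl
  map_smul' _ _ := rfl

lemma componentsLin_injective : Function.Injective (componentsLin ι p) :=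
  fun _ _ h => form_ext_coord fun I => congrFun h I

instance : FiniteDimensional ℝ (Form ι p) :=
  FiniteDimensional.of_injective _ componentsLin_injective

/-- The wedge product as a continuous bilinear map. -/
def wedgeCLM (ι : Type) [Fintype ι] [DecidableEq ι] (p q : ℕ) :
    Form ι p →L[ℝ] Form ι q →L[ℝ] Form ι (p + q) :=
  let f : Form ι p →ₗ[ℝ] (Form ι q →L[ℝ] Form ι (p + q)) :=
    { toFun := fun a => LinearMap.toContinuousLinearMap (wedgeLin ι p q a)
      map_add' := fun a b => by ext; simp
      map_smul' := fun c b => by ext; simp }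
  ⟨f, LinearMap.continuous_of_finiteDimensional (𝕜 := ℝ) (E := Form ι p)
    (F' := Form ι q →L[ℝ] Form ι (p + q)) f⟩

lemma wedgeCLM_apply (a : Form ι p) (b : Form ι q) : wedgeCLM ι p q a b = wedge a b := rfl

end Forms

section Smooth

variable {E : Type*} [NormedAddCommGroup E] [NormedSpace ℝ E] {s : Set E} {n : WithTop ℕ∞}

lemma contDiffOn_form_iff {θ : E → Form ι p} : ContDiffOn ℝ n θ s ↔
      ∀ I : Fin p → ι, ContDiffOn ℝ n (fun z => θ z (fun k => coordVec (I k))) s := by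
  constructor
  · intro h I
    exact (ContinuousAlternatingMap.apply ℝ (ι → ℝ) ℝ
      (fun k => coordVec (I k))).contDiff.comp_contDiffOn h
  · intro h
    obtain ⟨g, hg⟩ := (componentsLin ι p).exists_leftInverse_of_injective
      (LinearMap.ker_eq_bot.2 componentsLin_injective)
    have h1 : ContDiffOn ℝ n (fun z => componentsLin ι p (θ z)) s := contDiffOn_pi.2 h
    have h2 := g.toContinuousLinearMap.contDiff.comp_contDiffOn h1
    refine h2.congr fun z _ => ?_
    exact (LinearMap.congr_fun hg (θ z)).symm

lemma ContDiffOn.form_apply {θ : E → Form ι p} (h : ContDiffOn ℝ n θ s) (v : Fin p → ι → ℝ) :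
    ContDiffOn ℝ n (fun z => θ z v) s :=
  (ContinuousAlternatingMap.apply ℝ (ι → ℝ) ℝ v).contDiff.comp_contDiffOn h

lemma ContDiffOn.wedge {a : E → Form ι p} {b : E → Form ι q} (ha : ContDiffOn ℝ n a s)
    (hb : ContDiffOn ℝ n b s) : ContDiffOn ℝ n (fun z => wedge (a z) (b z)) s := by
  rw [contDiffOn_form_iff]
  intro I
  simp only [wedge_apply]
  exact contDiffOn_const.mul (ContDiffOn.sum fun σ _ =>
    contDiffOn_const.mul ((ha.form_apply _).mul (hb.form_apply _)))

lemma DifferentiableAt.wedge {a : E → Form ι p} {b : E → Form ι q} {z : E}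
    (ha : Diff a z) (hb : Diff b z) : Diff (fun z => wedge (a z) (b z)) z := by
  exact ((wedgeCLM ι p q).hasFDerivAt_of_bilinear ha.hasFDerivAt hb.hasFDerivAt).differentiableAt

lemma fderiv_wedge {a : E → Form ι p} {b : E → Form ι q} {z : E}
    (ha : Diff a z) (hb : Diff b z) (v : E) : fderiv ℝ (fun z => wedge (a z) (b z)) z v =
      _root_.wedge (fderiv ℝ a z v) (b z) + _root_.wedge (a z) (fderiv ℝ b z v) := by
  have := (wedgeCLM ι p q).hasFDerivAt_of_bilinear ha.hasFDerivAt hb.hasFDerivAt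
  rw [show (fun z => _root_.wedge (a z) (b z)) = fun z => wedgeCLM ι p q (a z) (b z) from rfl,
    this.fderiv]
  simp [wedgeCLM_apply, add_comm]

end Smooth

section HodgeAlgebra

variable {p q r : ℕ}

/-- The full contraction `a_{i₁…i_p} b^{i₁…i_p}` of two forms. -/
def formInner (g : Matrix ι ι ℝ) (a b : Form ι p) : ℝ :=
  ∑ I : Fin p → ι, a (fun k => coordVec (I k)) * b (fun k => g⁻¹ (I k))

lemma normSq_eq_formInner (g : Matrix ι ι ℝ) (a : Form ι p) : normSq g a = formInner g a a := rfl

/-- The interior product. -/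
def interior1 (v : ι → ℝ) (a : Form ι (p + 1)) : Form ι p := toForm (a.toAlternatingMap.curryLeft v)

lemma interior1_apply (v : ι → ℝ) (a : Form ι (p + 1)) (w : Fin p → ι → ℝ) :
    interior1 v a w = a (Fin.cons v w) := rfl

lemma contract_eq_formInner (g : Matrix ι ι ℝ) (a : Form ι (p + 1)) (i j : ι) :
    contract g a i j = formInner g (interior1 (coordVec i) a) (interior1 (coordVec j) a) := rfl

lemma form_expand (a : Form ι p) (w : Fin p → ι → ℝ) :
    a w = ∑ I : Fin p → ι, (∏ k, w k (I k)) * a (fun k => coordVec (I k)) := by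
  have hv : w = fun k => ∑ i : ι, w k i • (coordVec i : ι → ℝ) := by
    funext k
    exact pi_eq_sum_univ' (w k)
  conv_lhs => rw [hv]
  change a.toAlternatingMap _ = _
  rw [← AlternatingMap.coe_multilinearMap, MultilinearMap.map_sum]
  refine sum_congr rfl fun I _ => ?_
  rw [MultilinearMap.map_smul_univ]
  rfl

/-- Moving a linear map across a full contraction. -/
lemma sum_contract_transpose (M : Matrix ι ι ℝ) (a b : Form ι p) :
    ∑ I : Fin p → ι, a (fun k => coordVec (I k)) * b (fun k => M (I k)) =
      ∑ I : Fin p → ι, a (fun k => M.transpose (I k)) * b (fun k => coordVec (I k)) := by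
  have h1 : ∀ I : Fin p → ι, b (fun k => M (I k)) =
      ∑ K : Fin p → ι, (∏ k, M (I k) (K k)) * b (fun k => coordVec (K k)) :=
    fun I => form_expand b _
  have h2 : ∀ K : Fin p → ι, a (fun k => M.transpose (K k)) =
      ∑ I : Fin p → ι, (∏ k, M (I k) (K k)) * a (fun k => coordVec (I k)) :=
    fun K => form_expand a _
  simp_rw [h1, h2, mul_sum, sum_mul]
  rw [sum_comm]
  exact sum_congr rfl fun _ _ => sum_congr rfl fun _ _ => by ring

lemma formInner_comm {g : Matrix ι ι ℝ} (hg : g.transpose = g) (a b : Form ι p) :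
    formInner g a b = formInner g b a := by
  unfold formInner
  rw [sum_contract_transpose, Matrix.transpose_nonsing_inv, hg]
  exact sum_congr rfl fun _ _ => mul_comm _ _

/-- The coordinate volume form attached to an ordering of the coordinates. -/
def coordVol {n : ℕ} (e : ι ≃ Fin n) : Form ι n := toForm ((Pi.basisFun ℝ ι).reindex e).det

lemma coordVol_self {n : ℕ} (e : ι ≃ Fin n) : coordVol e (fun k => coordVec (e.symm k)) = 1 := by
  rw [coordVol, toForm_apply]
  convert ((Pi.basisFun ℝ ι).reindex e).det_self using 2
  funext k
  simp

lemma coordVol_perm {n : ℕ} (e : ι ≃ Fin n) (σ : Perm (Fin n)) :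
    coordVol e (fun k => coordVec (e.symm (σ k))) = ((Equiv.Perm.sign σ : ℤ) : ℝ) := by
  have := (coordVol e).toAlternatingMap.map_perm (fun k => coordVec (e.symm k)) σ
  change coordVol e _ = _ • coordVol e _ at this
  rw [coordVol_self] at this
  rw [show (fun k => coordVec (e.symm (σ k)) : Fin n → ι → ℝ) =
    (fun k => coordVec (e.symm k)) ∘ σ from rfl, this]
  simp [Units.smul_def]

/-- A top-degree form is determined by its value on a coordinate basis. -/
lemma top_form_eq {n : ℕ} (e : ι ≃ Fin n) (a : Form ι n) :
    a = a (fun k => coordVec (e.symm k)) • coordVol e := by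
  ext v
  have := congrArg (fun f => f v)
    (a.toAlternatingMap.eq_smul_basis_det ((Pi.basisFun ℝ ι).reindex e))
  have hb : (⇑(Pi.basisFun ℝ ι) ∘ ⇑e.symm) = fun k => (coordVec (e.symm k) : ι → ℝ) := by
    funext k
    simp
  simpa [hb, coordVol, toForm_apply] using this

lemma top_form_ext {n : ℕ} (e : ι ≃ Fin n) {a b : Form ι n}
    (h : a (fun k => coordVec (e.symm k)) = b (fun k => coordVec (e.symm k))) : a = b := by
  rw [top_form_eq e a, top_form_eq e b, h]

lemma coordVol_ne_zero {n : ℕ} (e : ι ≃ Fin n) : coordVol e ≠ 0 := fun h => by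
  have := coordVol_self e
  rw [h] at this
  simp at this

lemma exists_equiv_extending (hc : Fintype.card ι = p + q) {I : Fin p → ι}
    (hI : Function.Injective I) : ∃ c : ι ≃ Fin (p + q), ∀ i, c.symm (castAdd q i) = I i := by
  classical
  have hcard : Fintype.card ((Set.range I)ᶜ : Set ι) = q := by
    rw [Fintype.card_compl_set, Set.card_range_of_injective hI, hc, Fintype.card_fin]
    omega
  let f : Fin q ≃ ((Set.range I)ᶜ : Set ι) := (Fintype.equivFinOfCardEq hcard).symm
  refine ⟨(finSumFinEquiv.symm.trans
    ((Equiv.sumCongr (Equiv.ofInjective I hI) f).trans (Equiv.Set.sumCompl _))).symm, fun i => ?_⟩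
  simp

lemma insertLeft_apply {E : Type} [AddCommGroup E] [Module ℝ E]
    (D : E [⋀^Fin (p + q)]→ₗ[ℝ] ℝ) (w : Fin p → E) (v : Fin q → E) :
    insertLeft D w v = D (append w v) := rfl

/-- Insert vectors into the last slots. -/
def insertRight (D : Form ι (p + q)) (w : Fin q → ι → ℝ) : Form ι p :=
  toForm (insertLeft (D.toAlternatingMap.domDomCongr finAddFlip) w)

lemma append_comp_finAddFlip {α : Type*} (w : Fin q → α) (v : Fin p → α) :
    (fun i => append w v (finAddFlip i)) = append v w := by
  funext i
  refine addCases (fun j => ?_) (fun j => ?_) i <;> simp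

lemma insertRight_apply (D : Form ι (p + q)) (w : Fin q → ι → ℝ) (v : Fin p → ι → ℝ) :
    insertRight D w v = D (append v w) := by
  change D (fun i => append w v (finAddFlip i)) = _
  rw [append_comp_finAddFlip]

lemma alternatingMap_sum_apply {S : Type*} (s : Finset S) (f : S → (ι → ℝ) [⋀^Fin p]→ₗ[ℝ] ℝ)
    (v : Fin p → ι → ℝ) : (∑ i ∈ s, f i) v = ∑ i ∈ s, f i v :=
  map_sum (⟨⟨fun f : (ι → ℝ) [⋀^Fin p]→ₗ[ℝ] ℝ => f v, rfl⟩, fun _ _ => rfl⟩ :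
    ((ι → ℝ) [⋀^Fin p]→ₗ[ℝ] ℝ) →+ ℝ) f s

lemma hodge_apply (e : ι ≃ Fin (p + q)) (g : Matrix ι ι ℝ) (a : Form ι p) (v : Fin q → ι → ℝ) :
    hodge e g a v = √|g.det| / (p.factorial : ℝ) * ∑ I : Fin p → ι,
      a (fun k => g⁻¹ (I k)) * coordVol e (append (fun k => coordVec (I k)) v) := by
  rw [hodge, toForm_apply, AlternatingMap.smul_apply, alternatingMap_sum_apply, smul_eq_mul]
  rfl

lemma hodge_eq_sum (e : ι ≃ Fin (p + q)) (g : Matrix ι ι ℝ) (a : Form ι p) :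
    hodge e g a = (√|g.det| / (p.factorial : ℝ)) • ∑ I : Fin p → ι, a (fun k => g⁻¹ (I k)) •
      toForm (insertLeft (coordVol e).toAlternatingMap (fun k => (coordVec (I k) : ι → ℝ))) := by
  ext v
  rw [hodge_apply, Form.smul_apply, Form.sum_apply]
  rfl

lemma hodge_add (e : ι ≃ Fin (p + q)) (g : Matrix ι ι ℝ) (a b : Form ι p) :
    hodge e g (a + b) = hodge e g a + hodge e g b := by
  ext v
  simp only [hodge_apply, Form.add_apply, add_mul, sum_add_distrib, mul_add]

lemma hodge_smul (e : ι ≃ Fin (p + q)) (g : Matrix ι ι ℝ) (c : ℝ) (a : Form ι p) :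
    hodge e g (c • a) = c • hodge e g a := by
  ext v
  simp only [hodge_apply, Form.smul_apply, mul_sum]
  exact sum_congr rfl fun _ _ => by ring

/-- The Hodge dual as a linear map. -/
def hodgeLin (e : ι ≃ Fin (p + q)) (g : Matrix ι ι ℝ) : Form ι p →ₗ[ℝ] Form ι q where
  toFun := hodge e g
  map_add' := hodge_add e g
  map_smul' := hodge_smul e g

lemma hodgeLin_apply (e : ι ≃ Fin (p + q)) (g : Matrix ι ι ℝ) (a : Form ι p) :
    hodgeLin e g a = hodge e g a := rfl

lemma hodge_zero (e : ι ≃ Fin (p + q)) (g : Matrix ι ι ℝ) : hodge e g (0 : Form ι p) = 0 := by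
  simp [← hodgeLin_apply]

lemma hodge_neg (e : ι ≃ Fin (p + q)) (g : Matrix ι ι ℝ) (a : Form ι p) :
    hodge e g (-a) = -hodge e g a := by simp [← hodgeLin_apply]

lemma hodge_sub (e : ι ≃ Fin (p + q)) (g : Matrix ι ι ℝ) (a b : Form ι p) :
    hodge e g (a - b) = hodge e g a - hodge e g b := by simp [← hodgeLin_apply]

lemma hodge_sum {S : Type*} (s : Finset S) (e : ι ≃ Fin (p + q)) (g : Matrix ι ι ℝ)
    (a : S → Form ι p) : hodge e g (∑ i ∈ s, a i) = ∑ i ∈ s, hodge e g (a i) := by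
  simp [← hodgeLin_apply]

lemma wedge_insertLeft_coordVol (e : ι ≃ Fin (p + q)) (a : Form ι p) (I : Fin p → ι) :
    wedge a (toForm (insertLeft (coordVol e).toAlternatingMap
      (fun k => (coordVec (I k) : ι → ℝ)))) = a (fun k => coordVec (I k)) • coordVol e := by
  by_cases hI : Function.Injective I
  · obtain ⟨c, hc⟩ := exists_equiv_extending (q := q) ((Fintype.card_congr e).trans (by simp)) hI
    apply top_form_ext c
    rw [wedge_apply_of_vanish]
    · simp only [hc]
      rw [Form.smul_apply, toForm_apply, insertLeft_apply]
      congr 1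
      change coordVol e _ = coordVol e _
      congr 1
      funext k
      refine addCases (fun i => ?_) (fun j => ?_) k <;> simp [hc]
    · rintro σ - ⟨i, j, hij⟩
      rw [toForm_apply, insertLeft_apply,
        AlternatingMap.map_eq_zero_of_eq _ _ (i := castAdd q i) (j := natAdd p j), mul_zero]
      · simp [hij, hc]
      · intro h
        have := congrArg Fin.val h
        simp at this
        omega
  · have hI' : ∃ i j, I i = I j ∧ i ≠ j := by
      simpa [Function.Injective] using hI
    obtain ⟨i, j, hij, hne⟩ := hI'
    have h1 : a (fun k => coordVec (I k)) = 0 :=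
      a.map_eq_zero_of_eq _ (i := i) (j := j) (by simp [hij]) hne
    have h2 : insertLeft (coordVol e).toAlternatingMap
        (fun k => (coordVec (I k) : ι → ℝ)) = 0 := by
      ext v
      rw [insertLeft_apply]
      refine AlternatingMap.map_eq_zero_of_eq _ _ (i := castAdd q i) (j := castAdd q j)
        ?_ ?_
      · simp [hij]
      · simpa using hne
    rw [h1, h2, zero_smul]
    exact wedge_zero_right a

/-- `a ∧ *b = ⟨a, b⟩ vol`. -/
lemma wedge_hodge (e : ι ≃ Fin (p + q)) (g : Matrix ι ι ℝ) (a b : Form ι p) :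
    wedge a (hodge e g b) = (√|g.det| / (p.factorial : ℝ) * formInner g a b) • coordVol e := by
  rw [hodge_eq_sum, wedge_smul_right, wedge_sum_right, mul_smul]
  congr 1
  simp_rw [wedge_smul_right, wedge_insertLeft_coordVol, formInner, sum_smul, smul_smul]
  exact sum_congr rfl fun _ _ => by rw [mul_comm]

lemma wedge_hodge_comm (e : ι ≃ Fin (p + q)) {g : Matrix ι ι ℝ} (hg : g.transpose = g)
    (a b : Form ι p) : wedge a (hodge e g b) = wedge b (hodge e g a) := by
  rw [wedge_hodge, wedge_hodge, formInner_comm hg]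

lemma sum_coordVol_mul {n : ℕ} (e : ι ≃ Fin n) (f : (Fin n → ι) → ℝ) :
    ∑ L : Fin n → ι, coordVol e (fun k => coordVec (L k)) * f L =
      ∑ σ : Perm (Fin n), ((Equiv.Perm.sign σ : ℤ) : ℝ) * f (fun k => e.symm (σ k)) := by
  symm
  refine Fintype.sum_of_injective (fun (σ : Perm (Fin n)) k => e.symm (σ k)) ?_ _ _ ?_ ?_
  · intro σ τ h
    ext k
    have := congrFun h k
    simp only [EmbeddingLike.apply_eq_iff_eq] at this
    rw [this]
  · intro L hL
    have : ¬Function.Injective L := by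
      intro hinj
      apply hL
      have hb : Function.Bijective (fun k => e (L k)) :=
        Finite.injective_iff_bijective.1 (e.injective.comp hinj)
      exact ⟨Equiv.ofBijective _ hb, by funext k; simp⟩
    have hI' : ∃ i j, L i = L j ∧ i ≠ j := by
      simpa [Function.Injective] using this
    obtain ⟨i, j, hij, hne⟩ := hI'
    rw [(coordVol e).map_eq_zero_of_eq _ (i := i) (j := j) (by simp [hij]) hne, zero_mul]
  · intro σ
    rw [coordVol_perm]

lemma coordVol_map (g : Matrix ι ι ℝ) {n : ℕ} (e : ι ≃ Fin n) (I : Fin n → ι) :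
    coordVol e (fun k => g (I k)) = g.det * coordVol e (fun k => coordVec (I k)) := by
  let f : (ι → ℝ) →ₗ[ℝ] (ι → ℝ) := Matrix.toLin' g.transpose
  have h2 := ((Pi.basisFun ℝ ι).reindex e).det_comp f (fun k => coordVec (I k))
  have h3 : (f ∘ fun k => coordVec (I k)) = fun k => g (I k) := by
    funext k
    simp [f, Matrix.toLin'_apply]
    rfl
  rw [h3] at h2
  simpa [f, coordVol, toForm_apply] using h2

lemma coordVol_append_comm (e : ι ≃ Fin (p + q)) (w : Fin p → ι → ℝ) (v : Fin q → ι → ℝ) :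
    coordVol (e.trans (finCongr (Nat.add_comm p q))) (append v w) =
      (-1) ^ (p * q) * coordVol e (append w v) := by
  have h1 : coordVol (e.trans (finCongr (Nat.add_comm p q))) =
      castForm (Nat.add_comm p q) (coordVol e) := by
    apply top_form_ext (e.trans (finCongr (Nat.add_comm p q)))
    rw [coordVol_self, castForm_apply]
    have := coordVol_self e
    exact this.symm
  rw [h1, castForm_apply]
  have := (coordVol e).toAlternatingMap.map_perm (append w v)
    ((finAddFlip (m := p) (n := q)).trans (finCongr (Nat.add_comm q p)))⁻¹
  rw [Equiv.Perm.sign_inv, sign_blockSwap] at this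
  change coordVol e _ = _ • coordVol e _ at this
  rw [Units.smul_def, zsmul_eq_mul] at this
  push_cast at this
  rw [← this]
  congr 1
  funext k
  obtain ⟨k', rfl⟩ := ((finAddFlip (m := p) (n := q)).trans (finCongr (Nat.add_comm q p))).surjective k
  simp only [Function.comp_apply, Equiv.Perm.inv_def, Equiv.symm_apply_apply]
  refine addCases (fun j => ?_) (fun j => ?_) k' <;> simp

lemma sum_coordVol_coordVol (e : ι ≃ Fin (p + q)) (a : Form ι p) (J : Fin p → ι) :
    ∑ I : Fin p → ι, ∑ K : Fin q → ι, a (fun k => coordVec (I k)) *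
      coordVol e (append (fun k => coordVec (I k)) (fun k => coordVec (K k))) *
      coordVol e (append (fun k => coordVec (J k)) (fun k => coordVec (K k))) =
    (p.factorial : ℝ) * q.factorial * a (fun k => coordVec (J k)) := by
  have h := congrArg (fun b => b (fun k => coordVec (e.symm k))) (wedge_insertLeft_coordVol e a J)
  simp only [Form.smul_apply, coordVol_self, mul_one] at h
  rw [← h, wedge_apply, mul_inv_cancel_left₀ (by positivity)]
  rw [← Fintype.sum_prod_type' (f := fun (I : Fin p → ι) (K : Fin q → ι) =>
    a (fun k => coordVec (I k)) *
      coordVol e (append (fun k => coordVec (I k)) (fun k => coordVec (K k))) *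
      coordVol e (append (fun k => coordVec (J k)) (fun k => coordVec (K k))))]
  have := sum_coordVol_mul e (fun L => a (fun i => coordVec (L (castAdd q i))) *
    coordVol e (append (fun k => coordVec (J k)) (fun k => coordVec (L (natAdd p k)))))
  refine Eq.trans ?_ this
  refine Fintype.sum_equiv (Fin.appendEquiv p q) _ _ fun x => ?_
  have happ : (fun k => coordVec (Fin.appendEquiv p q x k) : Fin (p + q) → ι → ℝ) =
      append (fun k => coordVec (x.1 k)) (fun k => coordVec (x.2 k)) := by
    funext k
    refine addCases (fun j => ?_) (fun j => ?_) k <;> simp [Fin.appendEquiv]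
  rw [happ]
  simp only [Fin.appendEquiv, Equiv.coe_fn_mk, Fin.append_left, Fin.append_right]
  ring

/-- The square of the Hodge dual. -/
lemma hodge_hodge (e : ι ≃ Fin (p + q)) {g : Matrix ι ι ℝ} (hg : g.transpose = g)
    (hdet : g.det ≠ 0) (a : Form ι p) :
    hodge (e.trans (finCongr (Nat.add_comm p q))) g (hodge e g a) =
      (|g.det| / g.det * (-1) ^ (p * q)) • a := by
  apply form_ext_coord
  intro J
  rw [hodge_apply, Form.smul_apply]
  have h1 : ∀ K : Fin q → ι, hodge e g a (fun k => g⁻¹ (K k)) =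
      √|g.det| / (p.factorial : ℝ) * (g.det⁻¹ * ∑ I : Fin p → ι, a (fun k => coordVec (I k)) *
        coordVol e (append (fun k => coordVec (I k)) (fun k => coordVec (K k)))) := by
    intro K
    rw [hodge_apply]
    congr 1
    have := sum_contract_transpose g⁻¹ (insertRight (coordVol e) (fun k => g⁻¹ (K k))) a
    rw [Matrix.transpose_nonsing_inv, hg] at this
    simp only [insertRight_apply] at this
    rw [sum_congr rfl fun I _ => mul_comm _ _, this, mul_sum]
    refine sum_congr rfl fun I _ => ?_
    have happ : append (fun k => g⁻¹ (I k)) (fun k => g⁻¹ (K k)) = fun k => g⁻¹ (append I K k) := by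
      funext k
      refine addCases (fun j => ?_) (fun j => ?_) k <;> simp
    have happ' : append (fun k => coordVec (I k)) (fun k => coordVec (K k)) =
        fun k => (coordVec (append I K k) : ι → ℝ) := by
      funext k
      refine addCases (fun j => ?_) (fun j => ?_) k <;> simp
    rw [happ, coordVol_map, happ', Matrix.det_nonsing_inv, Ring.inverse_eq_inv']
    ring
  simp_rw [h1, coordVol_append_comm]
  have h2 := sum_coordVol_coordVol e a J
  rw [sum_comm] at h2
  have h3 : (∑ K : Fin q → ι, √|g.det| / (p.factorial : ℝ) * (g.det⁻¹ * ∑ I : Fin p → ι,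
      a (fun k => coordVec (I k)) *
        coordVol e (append (fun k => coordVec (I k)) (fun k => coordVec (K k)))) *
      ((-1) ^ (p * q) * coordVol e (append (fun k => coordVec (J k))
        (fun k => coordVec (K k))))) = √|g.det| / (p.factorial : ℝ) * g.det⁻¹ * (-1) ^ (p * q) *
      ((p.factorial : ℝ) * q.factorial * a (fun k => coordVec (J k))) := by
    rw [← h2, mul_sum]
    refine sum_congr rfl fun K _ => ?_
    rw [← sum_mul]
    ring
  rw [h3]
  have hs : √|g.det| * √|g.det| = |g.det| := mul_self_sqrt (abs_nonneg _)
  have hp : (p.factorial : ℝ) ≠ 0 := by positivity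
  have hq : (q.factorial : ℝ) ≠ 0 := by positivity
  field_simp
  rw [sq, hs]
  ring

end HodgeAlgebra

section Derivation

variable {p q r : ℕ}

/-- The action of the rank-one endomorphism `u ↦ w(u) v` on forms, as a derivation. -/
def rankOneDeriv (v : ι → ℝ) (w : (ι → ℝ) →L[ℝ] ℝ) (a : Form ι (p + 1)) : Form ι (p + 1) :=
  ContinuousAlternatingMap.alternatizeUncurryFin (w.smulRight (interior1 v a))

lemma rankOneDeriv_apply (v : ι → ℝ) (w : (ι → ℝ) →L[ℝ] ℝ) (a : Form ι (p + 1))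
    (u : Fin (p + 1) → ι → ℝ) :
    rankOneDeriv v w a u = ∑ k, w (u k) * a (Function.update u k v) := by
  rw [rankOneDeriv, ContinuousAlternatingMap.alternatizeUncurryFin_apply]
  refine sum_congr rfl fun k _ => ?_
  have := a.map_insertNth k v (k.removeNth u)
  rw [Fin.insertNth_removeNth] at this
  rw [this, ContinuousLinearMap.smulRight_apply, Form.smul_apply, interior1_apply]
  simp only [zsmul_eq_mul]
  push_cast
  change _ * (_ * a (Fin.cons v _)) = _ * (_ * a (Fin.cons v _))
  ring

lemma rankOneDeriv_wedge (v : ι → ℝ) (w : (ι → ℝ) →L[ℝ] ℝ) (a : Form ι (p + 1))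
    (b : Form ι (q + 1)) : rankOneDeriv (p := p + 1 + q) v w (wedge (p := p + 1) (q := q + 1) a b) =
      wedge (rankOneDeriv v w a) b + wedge a (rankOneDeriv v w b) := by
  ext u
  rw [rankOneDeriv_apply, Form.add_apply, wedge_apply, wedge_apply, ← mul_add, ← sum_add_distrib]
  have h1 : ∀ k, w (u k) * wedge a b (Function.update u k v) =
      (((p + 1).factorial : ℝ) * (q + 1).factorial)⁻¹ *
        ∑ σ : Perm (Fin (p + 1 + (q + 1))), ((Equiv.Perm.sign σ : ℤ) : ℝ) * (w (u k) *
          (a (fun i => Function.update u k v (σ (castAdd (q + 1) i))) *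
            b (fun j => Function.update u k v (σ (natAdd (p + 1) j))))) := by
    intro k
    rw [wedge_apply, mul_left_comm, mul_sum]
    congr 1
    exact sum_congr rfl fun _ _ => by ring
  refine (sum_congr rfl fun k _ => h1 k).trans ?_
  rw [← mul_sum, sum_comm]
  congr 1
  refine sum_congr rfl fun σ _ => ?_
  rw [← mul_sum, ← mul_add]
  congr 1
  rw [rankOneDeriv_apply, rankOneDeriv_apply]
  change ∑ k : Fin (p + 1 + (q + 1)), _ = _
  rw [← Equiv.sum_comp σ, Fin.sum_univ_add, sum_mul, mul_sum]
  have hupd : ∀ k j, Function.update u (σ k) v (σ j) =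
      Function.update (fun l => u (σ l)) k v j := by
    intro k j
    rcases eq_or_ne j k with h | h
    · subst h; simp
    · rw [Function.update_of_ne h, Function.update_of_ne (by simpa using h)]
  congr 1
  · refine sum_congr rfl fun i _ => ?_
    have e1 : (fun i' => Function.update u (σ (castAdd (q + 1) i)) v
        (σ (castAdd (q + 1) i'))) =
        Function.update (fun i' => u (σ (castAdd (q + 1) i'))) i v := by
      funext i'
      rw [hupd]
      rcases eq_or_ne i' i with h | h
      · subst h; simp
      · rw [Function.update_of_ne h, Function.update_of_ne (by simpa using h)]
    have e2 : (fun j => Function.update u (σ (castAdd (q + 1) i)) v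
        (σ (natAdd (p + 1) j))) = fun j => u (σ (natAdd (p + 1) j)) := by
      funext j
      rw [hupd, Function.update_of_ne]
      intro h
      have := congrArg Fin.val h
      simp at this
      omega
    rw [e1, e2]
    ring
  · refine sum_congr rfl fun i _ => ?_
    have e1 : (fun i' => Function.update u (σ (natAdd (p + 1) i)) v
        (σ (natAdd (p + 1) i'))) =
        Function.update (fun i' => u (σ (natAdd (p + 1) i'))) i v := by
      funext i'
      rw [hupd]
      rcases eq_or_ne i' i with h | h
      · subst h; simp
      · rw [Function.update_of_ne h, Function.update_of_ne (by simpa using h)]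
    have e2 : (fun j => Function.update u (σ (natAdd (p + 1) i)) v
        (σ (castAdd (q + 1) j))) = fun j => u (σ (castAdd (q + 1) j)) := by
      funext j
      rw [hupd, Function.update_of_ne]
      intro h
      have := congrArg Fin.val h
      simp at this
      omega
    rw [e1, e2]
    ring

lemma rankOneDeriv_top (e : ι ≃ Fin (p + 1)) (v : ι → ℝ) (w : (ι → ℝ) →L[ℝ] ℝ)
    (a : Form ι (p + 1)) : rankOneDeriv v w a = w v • a := by
  apply top_form_ext e
  rw [rankOneDeriv_apply, Form.smul_apply]
  have h : ∀ k, a (Function.update (fun k => (coordVec (e.symm k) : ι → ℝ)) k v) =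
      v (e.symm k) * a (fun k => coordVec (e.symm k)) := by
    intro k
    conv_lhs => rw [pi_eq_sum_univ' v]
    change a.toAlternatingMap _ = _
    rw [AlternatingMap.map_update_sum, sum_eq_single (e.symm k)]
    · rw [AlternatingMap.map_update_smul, Function.update_eq_self_iff.2 rfl]
      rfl
    · intro i _ hi
      rw [AlternatingMap.map_update_smul, AlternatingMap.map_eq_zero_of_eq _ _ (i := k) (j := e i),
        smul_zero]
      · rw [Function.update_self, Function.update_of_ne]
        · simp
        · rintro rfl
          simp at hi
      · rintro rfl
        simp at hi
    · simp
  simp_rw [h]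
  have hw : w v = ∑ k, w (coordVec (e.symm k)) * v (e.symm k) := by
    rw [Equiv.sum_comp e.symm (fun i => w (coordVec i) * v i)]
    conv_lhs => rw [pi_eq_sum_univ' v]
    rw [map_sum]
    refine sum_congr rfl fun i _ => ?_
    rw [map_smul, smul_eq_mul, mul_comm]
  rw [hw, sum_mul]
  exact sum_congr rfl fun _ _ => by ring

lemma formInner_rankOneDeriv {g : Matrix ι ι ℝ} (v u : ι → ℝ) (w : (ι → ℝ) →L[ℝ] ℝ)
    (hw : ∑ i, w (coordVec i) • g⁻¹ i = u) (a b : Form ι (p + 1)) :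
    formInner g (rankOneDeriv v w a) b = (p + 1) * formInner g (interior1 v a) (interior1 u b) := by
  unfold formInner
  simp_rw [rankOneDeriv_apply, sum_mul]
  rw [sum_comm]
  have h : ∀ k : Fin (p + 1), ∑ I : Fin (p + 1) → ι, w (coordVec (I k)) *
      a (Function.update (fun k => coordVec (I k)) k v) * b (fun k => g⁻¹ (I k)) =
      ∑ I : Fin p → ι, interior1 v a (fun k => coordVec (I k)) *
        interior1 u b (fun k => g⁻¹ (I k)) := by
    intro k
    rw [← Equiv.sum_comp (Fin.insertNthEquiv (fun _ => ι) k), Fintype.sum_prod_type, sum_comm]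
    refine sum_congr rfl fun I _ => ?_
    have e1 : ∀ i, a (Function.update
        (fun l => (coordVec (Fin.insertNth (α := fun _ => ι) k i I l) : ι → ℝ)) k v) =
        (-1) ^ (k : ℕ) * interior1 v a (fun k => coordVec (I k)) := by
      intro i
      have : Function.update
          (fun l => (coordVec (Fin.insertNth (α := fun _ => ι) k i I l) : ι → ℝ)) k v =
          k.insertNth v (fun l => coordVec (I l)) := by
        rw [← Fin.insertNth_removeNth]
        congr 1
        funext l
        simp [Fin.removeNth]
      rw [this, ContinuousAlternatingMap.map_insertNth]
      simp
      rfl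
    have e2 : ∀ i, b (fun l => g⁻¹ (Fin.insertNth (α := fun _ => ι) k i I l)) =
        (-1) ^ (k : ℕ) * interior1 (g⁻¹ i) b (fun k => g⁻¹ (I k)) := by
      intro i
      have : (fun l => g⁻¹ (Fin.insertNth (α := fun _ => ι) k i I l)) =
          k.insertNth (α := fun _ => ι → ℝ) (g⁻¹ i) (fun l => g⁻¹ (I l)) := by
        rw [Fin.eq_insertNth_iff]
        constructor
        · simp
        · funext l
          simp [Fin.removeNth]
      rw [this, ContinuousAlternatingMap.map_insertNth]
      simp
      rfl
    have e3 : interior1 u b (fun k => g⁻¹ (I k)) =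
        ∑ i, w (coordVec i) * interior1 (g⁻¹ i) b (fun k => g⁻¹ (I k)) := by
      rw [← hw]
      change (b.toAlternatingMap.curryLeft _) _ = _
      rw [map_sum, alternatingMap_sum_apply]
      refine sum_congr rfl fun i _ => ?_
      rw [map_smul]
      rfl
    rw [e3, mul_sum]
    refine sum_congr rfl fun i _ => ?_
    have hi : ∀ l, (Fin.insertNthEquiv (fun _ => ι) k) (i, I) l =
        Fin.insertNth (α := fun _ => ι) k i I l := fun l => rfl
    simp only [hi, e1, e2, Fin.insertNth_apply_same]
    have hs : (-1 : ℝ) ^ (k : ℕ) * (-1) ^ (k : ℕ) = 1 := by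
      rw [← mul_pow]; simp
    linear_combination (w (coordVec i) * interior1 v a (fun k => coordVec (I k)) *
      interior1 (g⁻¹ i) b (fun k => g⁻¹ (I k))) * hs
  rw [sum_congr rfl fun k _ => h k, Finset.sum_const, Finset.card_univ, Fintype.card_fin,
    nsmul_eq_mul]
  push_cast
  rfl

end Derivation

section SixDim

lemma IsLorentzian.transpose_eq {g : Matrix ι ι ℝ} (h : IsLorentzian g) : g.transpose = g := by
  obtain ⟨t, P, hP, h⟩ := h
  have hT : P.transpose * g.transpose * P = P.transpose * g * P := by
    have := congrArg Matrix.transpose h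
    rw [Matrix.diagonal_transpose, ← h] at this
    simpa [Matrix.transpose_mul, Matrix.mul_assoc] using this
  have hP' : IsUnit P := (Matrix.isUnit_iff_isUnit_det P).2 hP
  have hPT : IsUnit P.transpose := (Matrix.isUnit_iff_isUnit_det _).2 (by simpa using hP)
  exact hPT.mul_left_cancel (hP'.mul_right_cancel hT)

lemma IsLorentzian.det_neg {g : Matrix ι ι ℝ} (h : IsLorentzian g) : g.det < 0 := by
  obtain ⟨t, P, hP, h⟩ := h
  have hd := congrArg Matrix.det h
  rw [Matrix.det_mul, Matrix.det_mul, Matrix.det_transpose, Matrix.det_diagonal,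
    Finset.prod_ite_eq', if_pos (mem_univ t)] at hd
  nlinarith [sq_nonneg P.det, hd]

/-- Lowering an index, as a one-form. -/
def lowerIndex {ι : Type} [Fintype ι] (g : Matrix ι ι ℝ) (j : ι) : (ι → ℝ) →L[ℝ] ℝ :=
  ∑ k, g j k • ContinuousLinearMap.proj (R := ℝ) (φ := fun _ : ι => ℝ) k

lemma lowerIndex_coordVec (g : Matrix ι ι ℝ) (j k : ι) : lowerIndex g j (coordVec k) = g j k := by
  simp [lowerIndex, Pi.single_apply]

lemma formInner_rankOneDeriv_lowerIndex
    {g : Matrix ι ι ℝ} (hdet : g.det ≠ 0) (i j : ι) (a b : Form ι (p + 1)) :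
    formInner g (rankOneDeriv (coordVec i) (lowerIndex g j) a) b =
      (p + 1) * formInner g (interior1 (coordVec i) a) (interior1 (coordVec j) b) := by
  apply formInner_rankOneDeriv
  funext l
  have := congrFun (congrFun (Matrix.mul_nonsing_inv g (isUnit_iff_ne_zero.2 hdet)) j) l
  rw [Matrix.mul_apply] at this
  simp only [lowerIndex_coordVec, Finset.sum_apply, Pi.smul_apply, smul_eq_mul, this,
    Matrix.one_apply, Pi.single_apply, eq_comm]

lemma wedge_three_three (a b : Λ⁶ 3) : wedge a b = -wedge b a := by
  have h := wedge_comm a b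
  have hc : castForm (Nat.add_comm 3 3) (wedge b a) = wedge b a := rfl
  rw [hc] at h
  rw [h]
  module

lemma wedge_three_self (a : Λ⁶ 3) : wedge a a = 0 := by
  have h := wedge_three_three a a
  have h2 : (2 : ℝ) • wedge a a = 0 := by
    rw [two_smul]
    nth_rewrite 1 [h]
    simp
  simpa using h2

lemma star6_star6 {g : Mat₆} (hg : IsLorentzian g) (a : Λ⁶ 3) : ⋆₃ g (⋆₃ g a) = a := by
  have h := hodge_hodge (p := 3) (q := 3) (finCongr rfl) hg.transpose_eq hg.det_neg.ne a
  rw [abs_of_neg hg.det_neg, neg_div, div_self hg.det_neg.ne] at h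
  norm_num at h
  exact h

/-- `(*H)_{μρλ} (*H)_ν^{ρλ} = H_{μρλ} H_ν^{ρλ} - ⅓ g_{μν} H²` in Lorentzian signature. -/
lemma contract_star6 {g : Mat₆} (hg : IsLorentzian g) (a : Λ⁶ 3)
    (i j : Fin 6) : contract g (⋆₃ g a) i j = contract g a i j - 1 / 3 * g i j * normSq g a := by
  let D : Λ⁶ 3 → Λ⁶ 3 := rankOneDeriv (p := 2) (coordVec i) (lowerIndex g j)
  have h1 : wedge (D a) (⋆₃ g a) + wedge a (D (⋆₃ g a)) = g i j • wedge a (⋆₃ g a) := by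
    rw [← rankOneDeriv_wedge (p := 2) (q := 2) (coordVec i) (lowerIndex g j) a,
      rankOneDeriv_top (p := 5) (finCongr rfl), lowerIndex_coordVec]
    have := congrFun (congrFun hg.transpose_eq i) j
    rw [transpose_apply] at this
    rw [this]
  have h2 : wedge a (D (⋆₃ g a)) = -wedge (D (⋆₃ g a)) (⋆₃ g (⋆₃ g a)) := by
    rw [star6_star6 hg, wedge_three_three]
  rw [h2] at h1
  have hw : ∀ a b : Λ⁶ 3, wedge a (⋆₃ g b) =
      (√|g.det| / (Nat.factorial 3 : ℝ) * formInner g a b) • coordVol (finCongr rfl) :=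
    fun a b => wedge_hodge (p := 3) (q := 3) (finCongr rfl) g a b
  rw [hw, hw, hw, formInner_rankOneDeriv_lowerIndex hg.det_neg.ne,
    formInner_rankOneDeriv_lowerIndex hg.det_neg.ne, ← contract_eq_formInner,
    ← contract_eq_formInner, ← normSq_eq_formInner] at h1
  have h3 := congrArg (fun f : Λ⁶ (3 + 3) =>
    f (fun k => coordVec ((finCongr rfl : Fin 6 ≃ Fin (3 + 3)).symm k))) h1
  simp only [Form.smul_apply, Form.neg_apply, Form.add_apply, coordVol_self] at h3
  have hs : √|g.det| ≠ 0 := by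
    rw [Real.sqrt_ne_zero']
    exact abs_pos.2 hg.det_neg.ne
  have h4 : √|g.det| * (3 * contract g a i j - 3 * contract g (⋆₃ g a) i j -
      g i j * normSq g a) = 0 := by
    simp only [Nat.factorial] at h3
    push_cast at h3
    linear_combination 6 * h3
  have h5 := (mul_eq_zero.1 h4).resolve_left hs
  linarith

end SixDim

section ExteriorDerivative

variable {ι κ : Type} [Fintype ι] [DecidableEq ι] [Fintype κ] [DecidableEq κ] {p q r : ℕ}

lemma castForm_add (h : p = q) (a b : Form ι p) :
    castForm h (a + b) = castForm h a + castForm h b := by subst h; rfl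

lemma castForm_smul (h : p = q) (c : ℝ) (a : Form ι p) :
    castForm h (c • a) = c • castForm h a := by subst h; rfl

lemma castForm_sum {S : Type*} (s : Finset S) (h : p = q) (a : S → Form ι p) :
    castForm h (∑ i ∈ s, a i) = ∑ i ∈ s, castForm h (a i) := by subst h; rfl

lemma castForm_castForm (h : p = q) (h' : q = r) (a : Form ι p) :
    castForm h' (castForm h a) = castForm (h.trans h') a := by subst h; subst h'; rfl

lemma wedge_castForm_left {p' : ℕ} (h : p = p') (a : Form ι p) (b : Form ι q) :
    wedge (castForm h a) b = castForm (congrArg (· + q) h) (wedge a b) := by subst h; rfl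

lemma wedge_castForm_right {q' : ℕ} (h : q = q') (a : Form ι p) (b : Form ι q) :
    wedge a (castForm h b) = castForm (congrArg (p + ·) h) (wedge a b) := by subst h; rfl

/-- A linear functional as a one-form. -/
def oneForm (w : (ι → ℝ) →L[ℝ] ℝ) : Form ι 1 :=
  ContinuousAlternatingMap.ofSubsingleton ℝ (ι → ℝ) ℝ (0 : Fin 1) w

lemma oneForm_apply (w : (ι → ℝ) →L[ℝ] ℝ) (v : Fin 1 → ι → ℝ) : oneForm w v = w (v 0) := rfl

lemma dScalar_apply (f : (ι → ℝ) → ℝ) (x : ι → ℝ) (v : Fin 1 → ι → ℝ) :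
    dScalar f x v = fderiv ℝ f x (v 0) := rfl

lemma dCoord_apply (i : ι) (v : Fin 1 → ι → ℝ) : dCoord i v = v 0 i := rfl

/-- Permutations of `n + 1` letters, sorted by the image of `0`. -/
def permOfCycle {n : ℕ} (x : Fin (n + 1) × Perm (Fin n)) : Perm (Fin (n + 1)) :=
  x.1.cycleRange.symm * Equiv.Perm.decomposeFin.symm (0, x.2)

lemma permOfCycle_zero {n : ℕ} (x : Fin (n + 1) × Perm (Fin n)) : permOfCycle x 0 = x.1 := by
  simp [permOfCycle]

lemma permOfCycle_succ {n : ℕ} (x : Fin (n + 1) × Perm (Fin n)) (j : Fin n) :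
    permOfCycle x j.succ = x.1.succAbove (x.2 j) := by simp [permOfCycle]

lemma sign_permOfCycle {n : ℕ} (x : Fin (n + 1) × Perm (Fin n)) :
    Equiv.Perm.sign (permOfCycle x) = (-1) ^ (x.1 : ℕ) * Equiv.Perm.sign x.2 := by
  simp [permOfCycle]

lemma permOfCycle_bijective {n : ℕ} : Function.Bijective (permOfCycle (n := n)) := by
  rw [Fintype.bijective_iff_injective_and_card]
  constructor
  · rintro ⟨k, τ⟩ ⟨k', τ'⟩ h
    have h0 : k = k' := by
      have := congrArg (fun σ => σ 0) h
      simpa [permOfCycle_zero] using this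
    subst h0
    congr 1
    ext j
    have := congrArg (fun σ => σ j.succ) h
    simp only [permOfCycle_succ] at this
    rw [Fin.succAbove_right_injective this]
  · simp [Fintype.card_perm, Nat.factorial_succ]

lemma alternatizeUncurryFin_smulRight (w : (ι → ℝ) →L[ℝ] ℝ) (b : Form ι p) :
    ContinuousAlternatingMap.alternatizeUncurryFin (w.smulRight b) =
      castForm (Nat.add_comm 1 p) (wedge (oneForm w) b) := by
  ext v
  rw [castForm_apply, wedge_apply, ContinuousAlternatingMap.alternatizeUncurryFin_apply]
  have h1 : ∑ σ : Perm (Fin (1 + p)), ((Equiv.Perm.sign σ : ℤ) : ℝ) *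
      (oneForm w (fun i => v (Fin.cast (Nat.add_comm 1 p) (σ (castAdd p i)))) *
        b (fun j => v (Fin.cast (Nat.add_comm 1 p) (σ (natAdd 1 j))))) =
      ∑ σ : Perm (Fin (p + 1)), ((Equiv.Perm.sign σ : ℤ) : ℝ) *
        (w (v (σ 0)) * b (fun j => v (σ j.succ))) := by
    refine Fintype.sum_equiv ((finCongr (Nat.add_comm 1 p)).permCongr) _ _ fun σ => ?_
    rw [Equiv.Perm.sign_permCongr, oneForm_apply]
    have e0 : (finCongr (Nat.add_comm 1 p)).symm 0 = castAdd p (0 : Fin 1) := Fin.ext (by simp)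
    have e1 : ∀ j : Fin p, (finCongr (Nat.add_comm 1 p)).symm j.succ = natAdd 1 j :=
      fun j => Fin.ext (by simp [Nat.add_comm])
    simp only [Equiv.permCongr_apply, e0, e1, finCongr_apply]
  rw [h1, ← Equiv.sum_comp (Equiv.ofBijective _ (permOfCycle_bijective (n := p))),
    Fintype.sum_prod_type, mul_sum]
  refine sum_congr rfl fun k _ => ?_
  have h2 : ∀ τ : Perm (Fin p),
      ((Equiv.Perm.sign (Equiv.ofBijective _ (permOfCycle_bijective (n := p)) (k, τ)) : ℤ) : ℝ) *
        (w (v (Equiv.ofBijective _ (permOfCycle_bijective (n := p)) (k, τ) 0)) *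
          b (fun j => v (Equiv.ofBijective _ (permOfCycle_bijective (n := p)) (k, τ) j.succ))) =
      (-1) ^ (k : ℕ) * (w (v k) * b (k.removeNth v)) := by
    intro τ
    simp only [Equiv.ofBijective_apply, permOfCycle_zero, permOfCycle_succ, sign_permOfCycle]
    have hb := b.toAlternatingMap.map_perm (k.removeNth v) τ
    change b (fun j => v (k.succAbove (τ j))) = _ • b (k.removeNth v) at hb
    rw [hb, Units.smul_def, zsmul_eq_mul]
    push_cast
    linear_combination ((-1) ^ (k : ℕ) * (w (v k) * b (k.removeNth v))) * sign_mul_self_real τ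
  rw [sum_congr rfl fun τ _ => h2 τ, Finset.sum_const, Finset.card_univ, Fintype.card_perm,
    Fintype.card_fin, nsmul_eq_mul]
  simp only [ContinuousLinearMap.smulRight_apply, Form.smul_apply, zsmul_eq_mul, Nat.factorial_one]
  push_cast
  rw [one_mul, inv_mul_cancel_left₀ (by positivity)]

/-- `dω = dx^i ∧ ∂_i ω`. -/
lemma extDeriv_eq_sum (a : (ι → ℝ) → Form ι p) (x : ι → ℝ) :
    extDeriv a x = ∑ i, castForm (Nat.add_comm 1 p)
      (wedge (dCoord i) (fderiv ℝ a x (coordVec i))) := by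
  have h : fderiv ℝ a x = ∑ i, (ContinuousLinearMap.proj (R := ℝ) (φ := fun _ : ι => ℝ) i).smulRight
      (fderiv ℝ a x (coordVec i)) := by
    ext1 v
    conv_lhs => rw [pi_eq_sum_univ' v]
    simp
  rw [extDeriv, h]
  change ContinuousAlternatingMap.alternatizeUncurryFinCLM ℝ (ι → ℝ) ℝ _ = _
  rw [map_sum]
  refine sum_congr rfl fun i _ => ?_
  refine (alternatizeUncurryFin_smulRight _ _).trans ?_
  rw [← h]
  rfl

/-- The Leibniz rule. -/
lemma extDeriv_wedge {a : (ι → ℝ) → Form ι p} {b : (ι → ℝ) → Form ι q} {x : ι → ℝ}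
    (ha : Diff a x) (hb : Diff b x) : extDeriv (fun z => wedge (a z) (b z)) x =
      castForm (Nat.add_right_comm p 1 q) (wedge (extDeriv a x) (b x)) +
        (-1 : ℝ) ^ p • wedge (a x) (extDeriv b x) := by
  rw [extDeriv_eq_sum, extDeriv_eq_sum a, extDeriv_eq_sum b, wedge_sum_left, wedge_sum_right,
    castForm_sum, smul_sum, ← sum_add_distrib]
  refine sum_congr rfl fun i _ => ?_
  rw [fderiv_wedge ha hb, wedge_add_right, castForm_add, wedge_castForm_left, wedge_castForm_right,
    castForm_castForm]
  have h1 : wedge (dCoord i) (wedge (fderiv ℝ a x (coordVec i)) (b x)) =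
      castForm (Nat.add_assoc 1 p q)
        (wedge (wedge (dCoord i) (fderiv ℝ a x (coordVec i))) (b x)) := by
    rw [wedge_assoc, castForm_castForm]
    rfl
  have h2 : wedge (dCoord i) (wedge (a x) (fderiv ℝ b x (coordVec i))) =
      castForm (Nat.add_assoc 1 p q)
        (wedge (wedge (dCoord i) (a x)) (fderiv ℝ b x (coordVec i))) := by
    rw [wedge_assoc, castForm_castForm]
    rfl
  rw [h1, h2, wedge_comm (dCoord i) (a x), wedge_smul_left, wedge_castForm_left,
    wedge_assoc (a x) (dCoord i)]
  simp only [castForm_castForm, castForm_smul, one_mul]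

lemma extDeriv_smul_fun {f : (ι → ℝ) → ℝ} {a : (ι → ℝ) → Form ι p} {x : ι → ℝ}
    (hf : Diff f x) (ha : Diff a x) : extDeriv (fun z => f z • a z) x =
      f x • extDeriv a x + castForm (Nat.add_comm 1 p) (wedge (dScalar f x) (a x)) := by
  have h : fderiv ℝ (fun z => f z • a z) x = f x • fderiv ℝ a x + (fderiv ℝ f x).smulRight (a x) :=
    fderiv_fun_smul hf ha
  rw [extDeriv, h, ContinuousAlternatingMap.alternatizeUncurryFin_add,
    ContinuousAlternatingMap.alternatizeUncurryFin_smul, alternatizeUncurryFin_smulRight]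
  rfl

lemma extDeriv_sum {S : Type*} (s : Finset S) {a : S → (ι → ℝ) → Form ι p} {x : ι → ℝ}
    (ha : ∀ i ∈ s, Diff (a i) x) :
    extDeriv (fun z => ∑ i ∈ s, a i z) x = ∑ i ∈ s, extDeriv (a i) x := by
  rw [extDeriv, fderiv_fun_sum ha]
  change ContinuousAlternatingMap.alternatizeUncurryFinCLM ℝ (ι → ℝ) ℝ _ = _
  rw [map_sum]
  rfl

lemma extDeriv_const_smul (c : ℝ) (a : (ι → ℝ) → Form ι p) (x : ι → ℝ) :
    extDeriv (fun z => c • a z) x = c • extDeriv a x :=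
  extDeriv_smul c a

lemma extDeriv_neg (a : (ι → ℝ) → Form ι p) (x : ι → ℝ) :
    extDeriv (fun z => -a z) x = -extDeriv a x := by
  have h : (fun z => -a z) = fun z => (-1 : ℝ) • a z := by
    funext z
    ext v
    simp
  rw [h, extDeriv_const_smul, neg_one_smul]

lemma extDeriv_const (a : Form ι p) (x : ι → ℝ) : extDeriv (fun _ => a) x = 0 := by
  rw [extDeriv_eq_sum]
  refine sum_eq_zero fun i _ => ?_
  ext v
  simp [castForm_apply, wedge_zero_right]

lemma two_le_smooth : minSmoothness ℝ 2 ≤ (∞ : WithTop ℕ∞) := by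
  rw [minSmoothness_of_isRCLikeNormedField]
  exact WithTop.coe_le_coe.2 (le_top : (2 : ℕ∞) ≤ ⊤)

lemma extDeriv_dScalar {f : (ι → ℝ) → ℝ} {x : ι → ℝ} (hf : ContDiffAt ℝ ∞ f x) :
    extDeriv (dScalar f) x = 0 := by
  have h : dScalar f = extDeriv (fun x => ContinuousAlternatingMap.constOfIsEmpty ℝ (ι → ℝ)
      (Fin 0) (f x)) := by
    funext z
    rw [extDeriv_constOfIsEmpty]
    rfl
  rw [h]
  refine extDeriv_extDeriv_apply (r := ∞) ?_ two_le_smooth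
  exact (ContinuousAlternatingMap.constOfIsEmptyLIE ℝ (ι → ℝ) ℝ
    (Fin 0)).toContinuousLinearEquiv.contDiff.contDiffAt.comp x hf

lemma extDeriv_comp_linear (f : (κ → ℝ) →L[ℝ] (ι → ℝ)) {a : (ι → ℝ) → Form ι p} {x : κ → ℝ}
    (ha : Diff a (f x)) : extDeriv (fun z => (a (f z)).compContinuousLinearMap f) x =
      (extDeriv a (f x)).compContinuousLinearMap f := by
  have := extDeriv_pullback (r := ∞) (f := f) ha f.contDiff.contDiffAt two_le_smooth
  simpa using this

end ExteriorDerivative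

section Blocks

variable {p q a b n : ℕ}

lemma append_append_middle {α : Type*} (X : Fin p → α) (Y : Fin q → α) (U : Fin a → α)
    (W : Fin b → α) (h : p + (q + a) + b = p + q + (a + b))
    (h' : p + (q + a) + b = p + a + (q + b)) (k : Fin (p + (q + a) + b)) :
    append (append X U) (append Y W) (Fin.cast h' (permLeft b (permRight p
      ((finAddFlip (m := q) (n := a)).trans (finCongr (Nat.add_comm a q)))) k)) =
    append (append X Y) (append U W) (Fin.cast h k) := by
  refine addCases (fun k => ?_) (fun l => ?_) k
  · refine addCases (fun i => ?_) (fun k => ?_) k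
    · rw [permLeft_castAdd, permRight_castAdd]
      have e1 : Fin.cast h' (castAdd b (castAdd (q + a) i)) = castAdd (q + b) (castAdd a i) := rfl
      have e2 : Fin.cast h (castAdd b (castAdd (q + a) i)) = castAdd (a + b) (castAdd q i) := rfl
      rw [e1, e2]
      simp
    · refine addCases (fun j => ?_) (fun i => ?_) k
      · rw [permLeft_castAdd, permRight_natAdd]
        have e1 : Fin.cast h' (castAdd b (natAdd p
            (((finAddFlip (m := q) (n := a)).trans (finCongr (Nat.add_comm a q)))
              (castAdd a j)))) = natAdd (p + a) (castAdd b j) :=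
          Fin.ext (by simp; omega)
        have e2 : Fin.cast h (castAdd b (natAdd p (castAdd a j))) =
            castAdd (a + b) (natAdd p j) := rfl
        rw [e1, e2]
        simp
      · rw [permLeft_castAdd, permRight_natAdd]
        have e1 : Fin.cast h' (castAdd b (natAdd p
            (((finAddFlip (m := q) (n := a)).trans (finCongr (Nat.add_comm a q)))
              (natAdd q i)))) = castAdd (q + b) (natAdd p i) :=
          Fin.ext (by simp)
        have e2 : Fin.cast h (castAdd b (natAdd p (natAdd q i))) =
            natAdd (p + q) (castAdd b i) := Fin.ext (by simp [Nat.add_assoc])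
        rw [e1, e2]
        simp
  · rw [permLeft_natAdd]
    have e1 : Fin.cast h' (natAdd (p + (q + a)) l) = natAdd (p + a) (natAdd q l) :=
      Fin.ext (by simp; omega)
    have e2 : Fin.cast h (natAdd (p + (q + a)) l) = natAdd (p + q) (natAdd a l) :=
      Fin.ext (by simp; omega)
    rw [e1, e2]
    simp

lemma form_swap_blocks (D : Form ι n) (h : n = p + q + (a + b)) (h' : n = p + a + (q + b))
    (X : Fin p → ι → ℝ) (Y : Fin q → ι → ℝ) (U : Fin a → ι → ℝ) (W : Fin b → ι → ℝ) :
    castForm h D (append (append X Y) (append U W)) =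
      (-1) ^ (q * a) * castForm h' D (append (append X U) (append Y W)) := by
  have hn : p + (q + a) + b = n := by omega
  subst hn
  rw [castForm_apply, castForm_apply]
  have := D.toAlternatingMap.map_perm
    (fun i => append (append X U) (append Y W) (Fin.cast h' i))
    (permLeft b (permRight p ((finAddFlip (m := q) (n := a)).trans (finCongr (Nat.add_comm a q)))))
  rw [sign_permLeft, sign_permRight, sign_blockSwap] at this
  change D _ = _ • D _ at this
  rw [Units.smul_def, zsmul_eq_mul] at this
  push_cast at this
  rw [← this]
  congr 1
  funext k
  exact (append_append_middle X Y U W h h' k).symm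

lemma form_eq_zero_of_card_lt (h : Fintype.card ι < p) (a : Form ι p) : a = 0 := by
  apply form_ext_coord
  intro I
  have hI : ¬Function.Injective I := fun hinj => by
    have := Fintype.card_le_of_injective I hinj
    simp at this
    omega
  have hI' : ∃ i j, I i = I j ∧ i ≠ j := by simpa [Function.Injective] using hI
  obtain ⟨i, j, hij, hne⟩ := hI'
  rw [a.map_eq_zero_of_eq _ (i := i) (j := j) (by simp [hij]) hne]
  rfl

end Blocks

section Product

variable {p q p' q' a b n : ℕ}

/-- The exterior product of a form along `x` with a form along `y`. -/
def bi (α : Λ⁶ p) (β : Λ⁴ q) : Form Ten (p + q) := wedge (pullX α) (pullY β)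

/-- A vector along `x`. -/
def inlVec (u : ℝ⁶) : ℝ¹⁰ := Sum.elim u 0

/-- A vector along `y`. -/
def inrVec (w : ℝ⁴) : ℝ¹⁰ := Sum.elim 0 w

lemma projX_inlVec (u : ℝ⁶) : projX (inlVec u) = u := rfl
lemma projY_inrVec (w : ℝ⁴) : projY (inrVec w) = w := rfl
lemma projX_inrVec (w : ℝ⁴) : projX (inrVec w) = 0 := rfl
lemma projY_inlVec (u : ℝ⁶) : projY (inlVec u) = 0 := rfl

lemma inlVec_coordVec (i : Fin 6) : inlVec (coordVec i) = coordVec (inl i) := by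
  funext k
  rcases k with k | k <;> simp [inlVec, Pi.single_apply]

lemma inrVec_coordVec (i : Fin 4) : inrVec (coordVec i) = coordVec (inr i) := by
  funext k
  rcases k with k | k <;> simp [inrVec, Pi.single_apply]

lemma pullX_apply (α : Λ⁶ p) (v : Fin p → ℝ¹⁰) : pullX α v = α (fun k => projX (v k)) := rfl

lemma pullY_apply (β : Λ⁴ q) (v : Fin q → ℝ¹⁰) : pullY β v = β (fun k => projY (v k)) := rfl

/-- Vectors along `x` followed by vectors along `y`. -/
def splitVec (u : Fin a → ℝ⁶) (w : Fin b → ℝ⁴) : Fin (a + b) → ℝ¹⁰ :=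
  append (fun i => inlVec (u i)) (fun j => inrVec (w j))

lemma splitVec_castAdd (u : Fin a → ℝ⁶) (w : Fin b → ℝ⁴) (i : Fin a) :
    splitVec u w (castAdd b i) = inlVec (u i) := by simp [splitVec]

lemma splitVec_natAdd (u : Fin a → ℝ⁶) (w : Fin b → ℝ⁴) (i : Fin b) :
    splitVec u w (natAdd a i) = inrVec (w i) := by simp [splitVec]

lemma bi_splitVec (α : Λ⁶ p) (β : Λ⁴ q) (u : Fin p → ℝ⁶)
    (w : Fin q → ℝ⁴) : bi α β (splitVec u w) = α u * β w := by
  rw [bi, wedge_apply_of_vanish]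
  · simp only [pullX_apply, pullY_apply, splitVec_castAdd, splitVec_natAdd, projX_inlVec,
      projY_inrVec]
  · rintro σ ⟨i, j, hij⟩ -
    rw [pullX_apply, α.map_coord_zero i, zero_mul]
    rw [hij, splitVec_natAdd, projX_inrVec]

lemma bi_splitVec_of_ne (α : Λ⁶ p) (β : Λ⁴ q) (h : p + q = a + b)
    (hne : a ≠ p) (u : Fin a → ℝ⁶) (w : Fin b → ℝ⁴) : castForm h (bi α β) (splitVec u w) = 0 := by
  rw [castForm_apply, bi, wedge_apply]
  rw [sum_eq_zero, mul_zero]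
  intro σ _
  rcases lt_or_gt_of_ne hne with hlt | hlt
  · have : ∃ i : Fin p, a ≤ (σ (castAdd q i) : ℕ) := by
      by_contra hc
      push Not at hc
      have hinj : Function.Injective (fun i : Fin p => (⟨σ (castAdd q i), hc i⟩ : Fin a)) := by
        intro i j hij
        have h1 := congrArg Fin.val hij
        simp only at h1
        have h2 := σ.injective (Fin.ext h1)
        exact Fin.castAdd_injective _ _ h2
      have := Fintype.card_le_of_injective _ hinj
      simp at this
      omega
    obtain ⟨i, hi⟩ := this
    rw [pullX_apply, α.map_coord_zero i, zero_mul, mul_zero]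
    have hlt' := (σ (castAdd q i)).2
    have : Fin.cast h (σ (castAdd q i)) = natAdd a (⟨σ (castAdd q i) - a, by omega⟩ : Fin b) :=
      Fin.ext (by simp; omega)
    rw [this, splitVec_natAdd, projX_inrVec]
  · have : ∃ j : Fin q, (σ (natAdd p j) : ℕ) < a := by
      by_contra hc
      push Not at hc
      have hinj : Function.Injective (fun j : Fin q =>
          (⟨σ (natAdd p j) - a, by
            have := (σ (natAdd p j)).2
            have := hc j
            omega⟩ : Fin b)) := by
        intro i j hij
        have h1 := congrArg Fin.val hij
        simp only at h1
        have hi := hc i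
        have hj := hc j
        have h2 := σ.injective (Fin.ext (by omega : (σ (natAdd p i) : ℕ) = σ (natAdd p j)))
        exact Fin.natAdd_injective _ _ h2
      have := Fintype.card_le_of_injective _ hinj
      simp at this
      omega
    obtain ⟨j, hj⟩ := this
    rw [pullY_apply, β.map_coord_zero j, mul_zero, mul_zero]
    have : Fin.cast h (σ (natAdd p j)) = castAdd b (⟨σ (natAdd p j), hj⟩ : Fin a) :=
      Fin.ext (by simp)
    rw [this, splitVec_castAdd, projY_inlVec]

lemma exists_split_perm (I : Fin n → Ten) :
    ∃ (a b : ℕ) (h : a + b = n) (σ : Perm (Fin n)) (K : Fin a → Fin 6) (L : Fin b → Fin 4),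
      ∀ k, I (σ (Fin.cast h k)) = append (fun i => inl (K i)) (fun j => inr (L j)) k := by
  classical
  let P : Fin n → Prop := fun k => (I k).isLeft = true
  have hcard : Fintype.card {k // P k} + Fintype.card {k // ¬P k} = n := by
    rw [← Fintype.card_sum, Fintype.card_congr (Equiv.sumCompl P), Fintype.card_fin]
  let eL := Fintype.equivFin {k // P k}
  let eR := Fintype.equivFin {k // ¬P k}
  let f : Fin (Fintype.card {k // P k} + Fintype.card {k // ¬P k}) ≃ Fin n :=
    finSumFinEquiv.symm.trans ((Equiv.sumCongr eL.symm eR.symm).trans (Equiv.sumCompl P))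
  refine ⟨_, _, hcard, (finCongr hcard).symm.trans f,
    fun i => (I (eL.symm i).1).getLeft (eL.symm i).2,
    fun j => (I (eR.symm j).1).getRight (by simpa [P] using (eR.symm j).2), fun k => ?_⟩
  refine addCases (fun i => ?_) (fun j => ?_) k
  · simp [f]
  · simp [f]

/-- A form is determined by its values on split families of vectors. -/
lemma form_ext_split {θ θ' : Form Ten n}
    (h : ∀ (a b : ℕ) (h : n = a + b) (u : Fin a → ℝ⁶) (w : Fin b → ℝ⁴),
      castForm h θ (splitVec u w) = castForm h θ' (splitVec u w)) : θ = θ' := by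
  apply form_ext_coord
  intro I
  obtain ⟨a, b, hab, σ, K, L, hI⟩ := exists_split_perm I
  have h1 := h a b hab.symm (fun i => coordVec (K i)) (fun j => coordVec (L j))
  have hv : (fun i => splitVec (fun i => coordVec (K i)) (fun j => coordVec (L j))
      (Fin.cast hab.symm i)) = (fun k => (coordVec (I k) : ℝ¹⁰)) ∘ σ := by
    funext k
    obtain ⟨k', rfl⟩ : ∃ k', Fin.cast hab k' = k := ⟨Fin.cast hab.symm k, by simp⟩
    simp only [Function.comp_apply, hI]
    refine addCases (fun i => ?_) (fun j => ?_) k'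
    · simp [splitVec_castAdd, inlVec_coordVec]
    · simp [splitVec_natAdd, inrVec_coordVec]
  rw [castForm_apply, castForm_apply, hv] at h1
  have e1 := θ.toAlternatingMap.map_perm (fun k => (coordVec (I k) : ℝ¹⁰)) σ
  have e2 := θ'.toAlternatingMap.map_perm (fun k => (coordVec (I k) : ℝ¹⁰)) σ
  change θ _ = _ • θ _ at e1
  change θ' _ = _ • θ' _ at e2
  rw [e1, e2] at h1
  exact smul_left_cancel _ h1

end Product

section Product

variable {p q p' q' a b n : ℕ}

lemma sum_bi_mul (α : Λ⁶ p) (β : Λ⁴ q) (θ : Form Ten (p + q)) (M : Matrix Ten Ten ℝ) :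
    ∑ I : Fin (p + q) → Ten, bi α β (fun k => coordVec (I k)) * θ (fun k => M (I k)) =
      ((p + q).factorial : ℝ) / (p.factorial * q.factorial) *
        ∑ K : Fin p → Fin 6, ∑ L : Fin q → Fin 4, α (fun k => coordVec (K k)) *
          β (fun k => coordVec (L k)) *
          θ (append (fun k => M (inl (K k))) (fun k => M (inr (L k)))) := by
  simp_rw [bi, wedge_apply, mul_sum, sum_mul]
  rw [sum_comm]
  have key : ∀ σ : Perm (Fin (p + q)), ∑ I : Fin (p + q) → Ten,
      ((p.factorial : ℝ) * q.factorial)⁻¹ * (((Equiv.Perm.sign σ : ℤ) : ℝ) *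
        (pullX α (fun i => coordVec (I (σ (castAdd q i)))) *
          pullY β (fun j => coordVec (I (σ (natAdd p j)))))) * θ (fun k => M (I k)) =
      ((p.factorial : ℝ) * q.factorial)⁻¹ * ∑ I : Fin (p + q) → Ten,
        pullX α (fun i => coordVec (I (castAdd q i))) *
          pullY β (fun j => coordVec (I (natAdd p j))) * θ (fun k => M (I k)) := by
    intro σ
    rw [mul_sum]
    refine Fintype.sum_equiv (Equiv.arrowCongr σ.symm (Equiv.refl _)) _ _ fun I => ?_
    have hθ := θ.toAlternatingMap.map_perm (fun k => M (I k)) σ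
    change θ (fun k => M (I (σ k))) = _ • θ (fun k => M (I k)) at hθ
    have hI : (Equiv.arrowCongr σ.symm (Equiv.refl Ten)) I = fun k => I (σ k) := rfl
    rw [hI]
    simp only
    rw [hθ, Units.smul_def, zsmul_eq_mul]
    ring
  rw [sum_congr rfl fun σ _ => key σ, Finset.sum_const, Finset.card_univ, Fintype.card_perm,
    Fintype.card_fin, nsmul_eq_mul, ← mul_assoc, ← div_eq_mul_inv]
  simp_rw [← mul_sum]
  congr 1
  rw [← Equiv.sum_comp (Fin.appendEquiv p q), Fintype.sum_prod_type]
  symm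
  have hX : ∀ K' : Fin p → Ten, (K' ∉ Set.range (fun (K : Fin p → Fin 6) k => (inl (K k) : Ten))) →
      pullX α (fun i => coordVec (K' i)) = 0 := by
    intro K' hK'
    have : ∃ i j, K' i = inr j := by
      by_contra hc
      push Not at hc
      apply hK'
      have : ∀ i, ∃ k, K' i = inl k := fun i => by
        rcases hh : K' i with k | k
        · exact ⟨k, rfl⟩
        · exact absurd hh (hc i k)
      choose K hK using this
      exact ⟨K, by funext i; rw [hK]⟩
    obtain ⟨i, j, hij⟩ := this
    rw [pullX_apply, α.map_coord_zero i]
    rw [hij, ← inrVec_coordVec, projX_inrVec]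
  have hY : ∀ L' : Fin q → Ten, (L' ∉ Set.range (fun (L : Fin q → Fin 4) k => (inr (L k) : Ten))) →
      pullY β (fun i => coordVec (L' i)) = 0 := by
    intro L' hL'
    have : ∃ i j, L' i = inl j := by
      by_contra hc
      push Not at hc
      apply hL'
      have : ∀ i, ∃ k, L' i = inr k := fun i => by
        rcases hh : L' i with k | k
        · exact absurd hh (hc i k)
        · exact ⟨k, rfl⟩
      choose L hL using this
      exact ⟨L, by funext i; rw [hL]⟩
    obtain ⟨i, j, hij⟩ := this
    rw [pullY_apply, β.map_coord_zero i]
    rw [hij, ← inlVec_coordVec, projY_inlVec]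
  have hl : ∀ (K' : Fin p → Ten) (L' : Fin q → Ten) i,
      Fin.appendEquiv p q (K', L') (castAdd q i) = K' i := by
    intro K' L' i
    simp [Fin.appendEquiv]
  have hr : ∀ (K' : Fin p → Ten) (L' : Fin q → Ten) i,
      Fin.appendEquiv p q (K', L') (natAdd p i) = L' i := by
    intro K' L' i
    simp [Fin.appendEquiv]
  have hM : ∀ (K' : Fin p → Ten) (L' : Fin q → Ten),
      (fun k => M (Fin.appendEquiv p q (K', L') k)) =
        append (fun k => M (K' k)) (fun k => M (L' k)) := by
    intro K' L'
    funext k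
    refine addCases (fun i => ?_) (fun j => ?_) k <;> simp [Fin.appendEquiv]
  simp only [hl, hr, hM]
  refine Fintype.sum_of_injective (fun (K : Fin p → Fin 6) k => (inl (K k) : Ten)) ?_ _ _ ?_ ?_
  · intro K K' h
    funext k
    exact Sum.inl_injective (congrFun h k)
  · intro K' hK'
    simp [hX K' hK']
  · intro K
    refine Fintype.sum_of_injective (fun (L : Fin q → Fin 4) k => (inr (L k) : Ten)) ?_ _ _ ?_ ?_
    · intro L L' h
      funext k
      exact Sum.inr_injective (congrFun h k)
    · intro L' hL'
      simp [hY L' hL']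
    · intro L
      simp only [pullX_apply, pullY_apply, ← inlVec_coordVec, ← inrVec_coordVec, projX_inlVec,
        projY_inrVec]

/-- The warped product metric `A g ⊕ B δ`. -/
def warp (A : ℝ) (g : Mat₆) (B : ℝ) : Matrix Ten Ten ℝ := fromBlocks (A • g) 0 0 (B • 1)

lemma warp_inv {A B : ℝ} (hA : A ≠ 0) (hB : B ≠ 0) {g : Mat₆}
    (hg : g.det ≠ 0) : (warp A g B)⁻¹ = fromBlocks (A⁻¹ • g⁻¹) 0 0 (B⁻¹ • 1) := by
  apply Matrix.inv_eq_right_inv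
  rw [warp, Matrix.fromBlocks_multiply]
  have h := Matrix.mul_nonsing_inv g (isUnit_iff_ne_zero.2 hg)
  simp [h, smul_smul, hA, hB]

lemma warp_inv_inl {A B : ℝ} (hA : A ≠ 0) (hB : B ≠ 0) {g : Mat₆}
    (hg : g.det ≠ 0) (μ : Fin 6) : (warp A g B)⁻¹ (inl μ) = A⁻¹ • inlVec (g⁻¹ μ) := by
  rw [warp_inv hA hB hg]
  funext k
  rcases k with k | k <;> simp [fromBlocks, inlVec]

lemma warp_inv_inr {A B : ℝ} (hA : A ≠ 0) (hB : B ≠ 0) {g : Mat₆}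
    (hg : g.det ≠ 0) (m : Fin 4) : (warp A g B)⁻¹ (inr m) = B⁻¹ • inrVec (coordVec m) := by
  rw [warp_inv hA hB hg]
  funext k
  rcases k with k | k <;>
    simp [fromBlocks, inrVec, Matrix.one_apply, Pi.single_apply, eq_comm]

lemma sqrt_abs_det_warp {A B : ℝ} (hA : 0 < A) (hB : 0 < B) (g : Mat₆) :
    √|(warp A g B).det| = A ^ 3 * B ^ 2 * √|g.det| := by
  have : |(warp A g B).det| = (A ^ 3 * B ^ 2) ^ 2 * |g.det| := by
    rw [warp, Matrix.det_fromBlocks_zero₂₁, Matrix.det_smul, Matrix.det_smul]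
    simp only [Fintype.card_fin, det_one, mul_one, abs_mul, abs_pow, abs_of_pos hA, abs_of_pos hB]
    ring
  rw [this, Real.sqrt_mul (by positivity), Real.sqrt_sq (by positivity)]

lemma form_append_smul (θ : Form Ten (p + q)) (c d : ℝ) (u : Fin p → ℝ¹⁰) (w : Fin q → ℝ¹⁰) :
    θ (append (fun k => c • u k) (fun k => d • w k)) = c ^ p * d ^ q * θ (append u w) := by
  have h := θ.toAlternatingMap.toMultilinearMap.map_smul_univ
    (append (fun _ : Fin p => c) (fun _ : Fin q => d)) (append u w)
  have h2 : (fun i => append (fun _ : Fin p => c) (fun _ : Fin q => d) i • append u w i) =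
      append (fun k => c • u k) (fun k => d • w k) := by
    funext k
    refine addCases (fun i => ?_) (fun j => ?_) k <;> simp
  rw [h2, Fin.prod_univ_add] at h
  simp only [Fin.append_left, Fin.append_right, Finset.prod_const, Finset.card_univ,
    Fintype.card_fin] at h
  exact h

lemma formInner_bi {A B : ℝ} (hA : A ≠ 0) (hB : B ≠ 0) {g : Mat₆}
    (hg : g.det ≠ 0) (α : Λ⁶ p) (β : Λ⁴ q) (θ : Form Ten (p + q)) :
    formInner (warp A g B) (bi α β) θ =
      ((p + q).factorial : ℝ) / (p.factorial * q.factorial) * (A⁻¹ ^ p * B⁻¹ ^ q) *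
        ∑ K : Fin p → Fin 6, ∑ L : Fin q → Fin 4, α (fun k => coordVec (K k)) *
          β (fun k => coordVec (L k)) *
          θ (splitVec (fun k => g⁻¹ (K k)) (fun k => coordVec (L k))) := by
  rw [formInner, sum_bi_mul, mul_assoc]
  congr 1
  rw [mul_sum]
  refine sum_congr rfl fun K _ => ?_
  rw [mul_sum]
  refine sum_congr rfl fun L _ => ?_
  simp only [warp_inv_inl hA hB hg, warp_inv_inr hA hB hg]
  rw [form_append_smul, splitVec]
  ring

lemma formInner_bi_bi {A B : ℝ} (hA : A ≠ 0) (hB : B ≠ 0) {g : Mat₆}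
    (hg : g.det ≠ 0) (α α' : Λ⁶ p) (β β' : Λ⁴ q) : formInner (warp A g B) (bi α β) (bi α' β') =
      ((p + q).factorial : ℝ) / (p.factorial * q.factorial) * (A⁻¹ ^ p * B⁻¹ ^ q) *
        (formInner g α α' * formInner 1 β β') := by
  rw [formInner_bi hA hB hg]
  congr 1
  simp only [bi_splitVec, formInner, Finset.sum_mul_sum]
  refine sum_congr rfl fun K _ => sum_congr rfl fun L _ => ?_
  have : ∀ k, (1 : Matrix (Fin 4) (Fin 4) ℝ)⁻¹ (L k) = coordVec (L k) := by
    intro k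
    rw [inv_one]
    funext j
    simp [Matrix.one_apply, Pi.single_apply, eq_comm]
  simp only [this]
  ring

lemma formInner_bi_of_ne {A B : ℝ} (hA : A ≠ 0) (hB : B ≠ 0) {g : Mat₆}
    (hg : g.det ≠ 0) (h : p' + q' = p + q) (hne : p ≠ p') (α : Λ⁶ p)
    (β : Λ⁴ q) (α' : Λ⁶ p') (β' : Λ⁴ q') :
    formInner (warp A g B) (bi α β) (castForm h (bi α' β')) = 0 := by
  rw [formInner_bi hA hB hg]
  simp only [bi_splitVec_of_ne α' β' h hne, mul_zero, sum_const_zero]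

lemma bi_wedge_bi (α : Λ⁶ p) (β : Λ⁴ q) (α' : Λ⁶ p') (β' : Λ⁴ q') :
    wedge (bi α β) (bi α' β') = (-1 : ℝ) ^ (q * p') •
      castForm (by omega : p + p' + (q + q') = p + q + (p' + q'))
        (bi (wedge α α') (wedge β β')) := by
  have hX : pullX (wedge α α') = wedge (pullX α) (pullX α') := wedge_comp _ _ _
  have hY : pullY (wedge β β') = wedge (pullY β) (pullY β') := wedge_comp _ _ _
  simp only [bi, hX, hY]
  have h1 : wedge (pullY β) (wedge (pullX α') (pullY β')) =
      castForm (Nat.add_assoc q p' q') (wedge (wedge (pullY β) (pullX α')) (pullY β')) := by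
    rw [wedge_assoc, castForm_castForm]
    rfl
  rw [wedge_assoc (pullX α), h1, wedge_comm (pullY β) (pullX α'), wedge_smul_left,
    wedge_castForm_left, wedge_assoc (pullX α') (pullY β), wedge_assoc (pullX α) (pullX α')]
  simp only [castForm_castForm, castForm_smul, wedge_smul_right, wedge_castForm_right]

lemma bi_add_left (α α' : Λ⁶ p) (β : Λ⁴ q) : bi (α + α') β = bi α β + bi α' β := by
  rw [bi, bi, bi, ← wedge_add_left]; rfl

lemma bi_smul_left (c : ℝ) (α : Λ⁶ p) (β : Λ⁴ q) : bi (c • α) β = c • bi α β := by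
  rw [bi, bi, ← wedge_smul_left]; rfl

lemma bi_smul_right (c : ℝ) (α : Λ⁶ p) (β : Λ⁴ q) : bi α (c • β) = c • bi α β := by
  rw [bi, bi, ← wedge_smul_right]; rfl

lemma bi_zero_left (β : Λ⁴ q) : bi (0 : Λ⁶ p) β = 0 := by
  have := bi_smul_left 0 (0 : Λ⁶ p) β
  simpa using this

lemma bi_zero_right (α : Λ⁶ p) : bi α (0 : Λ⁴ q) = 0 := by
  have := bi_smul_right 0 α (0 : Λ⁴ q)
  simpa using this

lemma bi_neg_left (α : Λ⁶ p) (β : Λ⁴ q) : bi (-α) β = -bi α β := by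
  rw [bi, bi, ← wedge_neg_left]; rfl

lemma bi_neg_right (α : Λ⁶ p) (β : Λ⁴ q) : bi α (-β) = -bi α β := by
  rw [bi, bi, ← wedge_neg_right]; rfl

lemma DifferentiableAt.pullX {α : ℝ⁶ → Λ⁶ p} {z : ℝ¹⁰} (hα : Diff α ♯z) :
    Diff (fun z => pullX (α ♯z)) z :=
  (ContinuousLinearMap.differentiableAt (E := Λ⁶ p) (F := Form Ten p)
    (ContinuousAlternatingMap.compContinuousLinearMapCLM projX)).comp z
      (hα.comp z projX.differentiableAt)

lemma DifferentiableAt.pullY {β : ℝ⁴ → Λ⁴ q} {z : ℝ¹⁰} (hβ : Diff β ♭z) :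
    Diff (fun z => pullY (β ♭z)) z :=
  (ContinuousLinearMap.differentiableAt (E := Λ⁴ q) (F := Form Ten q)
    (ContinuousAlternatingMap.compContinuousLinearMapCLM projY)).comp z
      (hβ.comp z projY.differentiableAt)

lemma extDeriv_bi {α : ℝ⁶ → Λ⁶ p} {β : ℝ⁴ → Λ⁴ q} {z : ℝ¹⁰} (hα : Diff α ♯z) (hβ : Diff β ♭z) :
    extDeriv (fun z => bi (α ♯z) (β ♭z)) z =
      castForm (Nat.add_right_comm p 1 q) (bi (extDeriv α ♯z) (β ♭z)) +
        (-1 : ℝ) ^ p • bi (α ♯z) (extDeriv β ♭z) := by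
  have dX := hα.pullX
  have dY := hβ.pullY
  have eX : extDeriv (fun z => pullX (α ♯z)) z = pullX (extDeriv α ♯z) :=
    extDeriv_comp_linear projX hα
  have eY : extDeriv (fun z => pullY (β ♭z)) z = pullY (extDeriv β ♭z) :=
    extDeriv_comp_linear projY hβ
  have := extDeriv_wedge dX dY
  rw [eX, eY] at this
  exact this

lemma DifferentiableAt.bi {α : ℝ⁶ → Λ⁶ p} {β : ℝ⁴ → Λ⁴ q}
    {z : ℝ¹⁰} (hα : Diff α ♯z) (hβ : Diff β ♭z) : Diff (fun z => bi (α ♯z) (β ♭z)) z := by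
  have dX := hα.pullX
  have dY := hβ.pullY
  exact dX.wedge dY

end Product

section Product

variable {p q p' q' a b n : ℕ}

lemma castForm_coordVol_ten (hp : 6 = p + p') (hq : 4 = q + q')
    (h : 6 + 4 = p + q + (p' + q')) (h' : p + q + (p' + q') = p + p' + (q + q')) :
    castForm h' (coordVol ((finSumFinEquiv (m := 6) (n := 4)).trans (finCongr h))) =
      bi (coordVol (finCongr hp)) (coordVol (finCongr hq)) := by
  let e : Ten ≃ Fin (p + p' + (q + q')) :=
    (finSumFinEquiv (m := 6) (n := 4)).trans (finCongr (h.trans h'))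
  apply top_form_ext e
  rw [castForm_apply]
  have h1 := coordVol_self ((finSumFinEquiv (m := 6) (n := 4)).trans (finCongr h))
  have h2 : (fun k => (coordVec (e.symm k) : ℝ¹⁰)) =
      splitVec (fun i => coordVec ((finCongr hp).symm i))
        (fun i => coordVec ((finCongr hq).symm i)) := by
    funext k
    refine addCases (fun i => ?_) (fun j => ?_) k
    · rw [splitVec_castAdd, inlVec_coordVec]
      congr 1
      rw [Equiv.symm_apply_eq]
      exact Fin.ext rfl
    · rw [splitVec_natAdd, inrVec_coordVec]
      congr 1
      rw [Equiv.symm_apply_eq]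
      refine Fin.ext ?_
      change p + p' + (j : ℕ) = 6 + j
      omega
  have h3 : (fun k => (coordVec (e.symm (Fin.cast h' k)) : ℝ¹⁰)) =
      fun k => coordVec (((finSumFinEquiv (m := 6) (n := 4)).trans (finCongr h)).symm k) := rfl
  rw [h3, h1, h2, bi_splitVec, coordVol_self, coordVol_self, mul_one]

lemma warp_transpose {g : Mat₆} (hg : g.transpose = g) (A B : ℝ) :
    (warp A g B).transpose = warp A g B := by simp [warp, Matrix.fromBlocks_transpose, hg]

lemma sum_form_mul_coordVol {g : Matrix ι ι ℝ}
    (hg : g.transpose = g) (e : ι ≃ Fin (p + q)) (α : Form ι p) (v : Fin q → ι → ℝ) :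
    ∑ I : Fin p → ι, α (fun k => coordVec (I k)) * coordVol e (append (fun k => g⁻¹ (I k)) v) =
      ∑ I : Fin p → ι, α (fun k => g⁻¹ (I k)) *
        coordVol e (append (fun k => coordVec (I k)) v) := by
  have := sum_contract_transpose g⁻¹ α (insertRight (coordVol e) v)
  simpa only [insertRight_apply, Matrix.transpose_nonsing_inv, hg] using this

/-- The Hodge dual of a product form for a warped product metric. -/
lemma star10_bi {A B : ℝ} (hA : 0 < A) (hB : 0 < B) {g : Mat₆}
    (hgT : g.transpose = g) (hg : g.det ≠ 0) (hp : 6 = p + p') (hq : 4 = q + q')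
    (h : 6 + 4 = p + q + (p' + q')) (α : Λ⁶ p) (β : Λ⁴ q) :
    star10 (p + q) (p' + q') h (warp A g B) (bi α β) =
      ((-1) ^ (q * p') * (A ^ 3 * B ^ 2 * (A⁻¹ ^ p * B⁻¹ ^ q))) •
        bi (star6 p p' hp g α) (starDelta q q' hq β) := by
  apply form_ext_split
  intro a b hab u w
  rw [castForm_apply, castForm_smul, Form.smul_apply, star10, hodge_apply,
    ← sum_form_mul_coordVol (warp_transpose hgT A B)]
  have h1 := formInner_bi hA.ne' hB.ne' hg α β
    (insertRight (coordVol ((finSumFinEquiv (m := 6) (n := 4)).trans (finCongr h)))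
      (fun i => splitVec u w (Fin.cast hab i)))
  simp only [formInner, insertRight_apply] at h1
  rw [h1, sqrt_abs_det_warp hA hB]
  have h2 : ∀ (x : Fin p → ℝ⁶) (y : Fin q → ℝ⁴),
      coordVol ((finSumFinEquiv (m := 6) (n := 4)).trans (finCongr h))
        (append (splitVec x y) (fun i => splitVec u w (Fin.cast hab i))) =
      (-1) ^ (q * a) * castForm (by omega : p + p' + (q + q') = p + a + (q + b))
        (bi (coordVol (finCongr hp)) (coordVol (finCongr hq)))
        (splitVec (append x u) (append y w)) := by
    intro x y
    have hs : splitVec (append x u) (append y w) =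
        append (append (fun i => inlVec (x i)) (fun i => inlVec (u i)))
          (append (fun i => inrVec (y i)) (fun i => inrVec (w i))) := by
      funext k
      refine addCases (fun i => ?_) (fun j => ?_) k
      · rw [splitVec_castAdd, Fin.append_left]
        refine addCases (fun i => ?_) (fun j => ?_) i <;> simp
      · rw [splitVec_natAdd, Fin.append_right]
        refine addCases (fun i => ?_) (fun j => ?_) j <;> simp
    rw [hs, ← castForm_coordVol_ten hp hq h (by omega), castForm_castForm,
      ← form_swap_blocks _ (by omega), castForm_apply]
    congr 1
    funext k
    refine addCases (fun i => ?_) (fun j => ?_) k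
    · have e1 : Fin.cast (by omega : p + q + (p' + q') = p + q + (a + b))
          (castAdd (p' + q') i) = castAdd (a + b) i := rfl
      rw [e1, Fin.append_left, Fin.append_left]
      rfl
    · have e1 : Fin.cast (by omega : p + q + (p' + q') = p + q + (a + b))
          (natAdd (p + q) j) = natAdd (p + q) (Fin.cast hab j) := rfl
      rw [e1, Fin.append_right, Fin.append_right]
      rfl
  simp only [h2]
  by_cases hap : a = p'
  · subst hap
    obtain rfl : b = q' := by omega
    have hc : castForm hab (bi (star6 p a hp g α) (starDelta q b hq β)) =
      bi (star6 p a hp g α) (starDelta q b hq β) := rfl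
    have hc' : castForm (by omega : p + a + (q + b) = p + a + (q + b))
        (bi (coordVol (finCongr hp)) (coordVol (finCongr hq))) =
      bi (coordVol (finCongr hp)) (coordVol (finCongr hq)) := rfl
    rw [hc, hc', bi_splitVec, star6, starDelta, hodge_apply, hodge_apply,
      ← sum_form_mul_coordVol hgT, ← sum_form_mul_coordVol (Matrix.transpose_one)]
    simp only [bi_splitVec]
    have h4 : ∀ i : Fin 4, (1 : Matrix (Fin 4) (Fin 4) ℝ)⁻¹ i = coordVec i := by
      intro i
      rw [inv_one]
      funext j
      simp [Matrix.one_apply, Pi.single_apply, eq_comm]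
    simp only [h4]
    have h5 : ∑ K : Fin p → Fin 6, ∑ L : Fin q → Fin 4, α (fun k => coordVec (K k)) *
        β (fun k => coordVec (L k)) * ((-1) ^ (q * a) *
          (coordVol (finCongr hp) (append (fun k => g⁻¹ (K k)) u) *
            coordVol (finCongr hq) (append (fun k => coordVec (L k)) w))) =
        (-1) ^ (q * a) * ((∑ K : Fin p → Fin 6, α (fun k => coordVec (K k)) *
          coordVol (finCongr hp) (append (fun k => g⁻¹ (K k)) u)) *
          ∑ L : Fin q → Fin 4, β (fun k => coordVec (L k)) *
            coordVol (finCongr hq) (append (fun k => coordVec (L k)) w)) := by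
      rw [Finset.sum_mul_sum, mul_sum]
      refine sum_congr rfl fun K _ => ?_
      rw [mul_sum]
      exact sum_congr rfl fun L _ => by ring
    rw [h5]
    simp only [det_one, abs_one, Real.sqrt_one]
    have f1 : ((p + q).factorial : ℝ) ≠ 0 := by positivity
    field_simp
  · rw [bi_splitVec_of_ne _ _ hab hap]
    simp [bi_splitVec_of_ne _ _ (by omega : p + p' + (q + q') = p + a + (q + b)) (by omega)]

lemma interior1_inl_splitVec (θ : Form Ten (n + 1)) (h : n = a + b) (h' : n + 1 = a + 1 + b)
    (u : ℝ⁶) (U : Fin a → ℝ⁶) (W : Fin b → ℝ⁴) :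
    castForm h (interior1 (inlVec u) θ) (splitVec U W) =
      castForm h' θ (splitVec (Fin.cons u U : Fin (a + 1) → ℝ⁶) W) := by
  rw [castForm_apply, castForm_apply, interior1_apply]
  congr 1
  funext k
  refine Fin.cases ?_ (fun k => ?_) k
  · have e : Fin.cast h' 0 = castAdd b (0 : Fin (a + 1)) := Fin.ext (by simp)
    rw [e, splitVec_castAdd]
    rfl
  · rw [Fin.cons_succ]
    obtain ⟨k', rfl⟩ : ∃ k', Fin.cast h.symm k' = k := ⟨Fin.cast h k, by simp⟩
    refine addCases (fun i => ?_) (fun j => ?_) k'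
    · have e : Fin.cast h' (Fin.cast h.symm (castAdd b i)).succ = castAdd b i.succ :=
        Fin.ext (by simp)
      rw [e, splitVec_castAdd, Fin.cons_succ]
      simp [splitVec_castAdd]
    · have e : Fin.cast h' (Fin.cast h.symm (natAdd a j)).succ = natAdd (a + 1) j :=
        Fin.ext (by simp; omega)
      rw [e, splitVec_natAdd]
      simp [splitVec_natAdd]

lemma interior1_inr_splitVec (θ : Form Ten (n + 1)) (h : n = a + b) (h' : n + 1 = a + (b + 1))
    (w : ℝ⁴) (U : Fin a → ℝ⁶) (W : Fin b → ℝ⁴) :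
    castForm h (interior1 (inrVec w) θ) (splitVec U W) =
      (-1) ^ a * castForm h' θ (splitVec U (Fin.cons w W : Fin (b + 1) → ℝ⁴)) := by
  subst h
  have hk : a < a + b + 1 := by omega
  have h1 := θ.map_insertNth ⟨a, hk⟩ (inrVec w) (splitVec U W)
  have h2 : Fin.insertNth (α := fun _ => ℝ¹⁰) ⟨a, hk⟩ (inrVec w) (splitVec U W) =
      splitVec (a := a) (b := b + 1) U (Fin.cons w W) := by
    rw [Fin.insertNth_eq_iff]
    constructor
    · have e : (⟨a, hk⟩ : Fin (a + b + 1)) = natAdd a (0 : Fin (b + 1)) := Fin.ext (by simp)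
      rw [e]
      exact (splitVec_natAdd U (Fin.cons w W : Fin (b + 1) → ℝ⁴) 0).symm
    · funext k
      refine addCases (fun i => ?_) (fun j => ?_) k
      · have e : (⟨a, hk⟩ : Fin (a + b + 1)).succAbove (castAdd b i) = castAdd (b + 1) i := by
          rw [Fin.succAbove_of_castSucc_lt]
          · rfl
          · exact Fin.lt_def.2 (by simp)
        rw [Fin.removeNth, e, splitVec_castAdd]
        exact (splitVec_castAdd U (Fin.cons w W : Fin (b + 1) → ℝ⁴) i).symm
      · have e : (⟨a, hk⟩ : Fin (a + b + 1)).succAbove (natAdd a j) = natAdd a j.succ := by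
          rw [Fin.succAbove_of_le_castSucc]
          · rfl
          · exact Fin.le_def.2 (by simp)
        rw [Fin.removeNth, e, splitVec_natAdd]
        exact (splitVec_natAdd U (Fin.cons w W : Fin (b + 1) → ℝ⁴) j.succ).symm
  rw [h2] at h1
  have hc : castForm h' θ (splitVec U (Fin.cons w W : Fin (b + 1) → ℝ⁴)) =
    θ (splitVec (a := a) (b := b + 1) U (Fin.cons w W)) := rfl
  have hc' : castForm rfl (interior1 (inrVec w) θ) (splitVec U W) =
    θ (Matrix.vecCons (inrVec w) (splitVec U W)) := rfl
  rw [hc, hc', h1]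
  have hs : (-1 : ℝ) ^ a * (-1) ^ a = 1 := by rw [← mul_pow]; simp
  simp only [zsmul_eq_mul]
  push_cast
  rw [← mul_assoc, hs, one_mul]

lemma interior1_inl_bi (u : ℝ⁶) (α : Λ⁶ (p + 1)) (β : Λ⁴ q) :
    interior1 (inlVec u) (castForm (Nat.add_right_comm p 1 q) (bi α β)) = bi (interior1 u α) β := by
  apply form_ext_split
  intro a b h U W
  rw [interior1_inl_splitVec _ h (by omega), castForm_castForm]
  by_cases ha : a = p
  · subst ha
    obtain rfl : b = q := by omega
    refine (bi_splitVec α β (Fin.cons u U) W).trans ?_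
    exact (bi_splitVec (interior1 u α) β U W).symm
  · rw [bi_splitVec_of_ne _ _ _ (by omega), bi_splitVec_of_ne _ _ h ha]

lemma interior1_inl_bi_zero (u : ℝ⁶) (α : Λ⁶ 0) (β : Λ⁴ q)
    (h : 0 + q = n + 1) : interior1 (inlVec u) (castForm h (bi α β)) = 0 := by
  apply form_ext_split
  intro a b h' U W
  rw [interior1_inl_splitVec _ h' (by omega), castForm_castForm,
    bi_splitVec_of_ne _ _ _ (by omega), castForm_apply]
  rfl

lemma interior1_inr_bi (w : ℝ⁴) (α : Λ⁶ p) (β : Λ⁴ (q + 1)) :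
    interior1 (p := p + q) (inrVec w) (bi (p := p) (q := q + 1) α β) = (-1 : ℝ) ^ p • bi α (interior1 w β) := by
  apply form_ext_split
  intro a b h U W
  rw [interior1_inr_splitVec _ h (by omega), castForm_smul, Form.smul_apply]
  by_cases ha : a = p
  · subst ha
    obtain rfl : b = q := by omega
    congr 1
    refine (bi_splitVec α β U (Fin.cons w W)).trans ?_
    exact (bi_splitVec α (interior1 w β) U W).symm
  · rw [bi_splitVec_of_ne α β _ ha, bi_splitVec_of_ne _ _ h ha, mul_zero, mul_zero]

lemma interior1_inr_bi_zero (w : ℝ⁴) (α : Λ⁶ p) (β : Λ⁴ 0)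
    (h : p + 0 = n + 1) : interior1 (inrVec w) (castForm h (bi α β)) = 0 := by
  apply form_ext_split
  intro a b h' U W
  rw [interior1_inr_splitVec _ h' (by omega), castForm_castForm,
    bi_splitVec_of_ne _ _ _ (by omega), castForm_apply, mul_zero]
  rfl

end Product

section SmoothMetric

variable {s : Set (ι → ℝ)}

lemma contDiffOn_matrix_det {g : (ι → ℝ) → Matrix ι ι ℝ} {n : WithTop ℕ∞}
    (hg : ∀ i j, ContDiffOn ℝ n (fun x => g x i j) s) : ContDiffOn ℝ n (fun x => (g x).det) s := by
  simp only [Matrix.det_apply']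
  exact ContDiffOn.sum fun σ _ => contDiffOn_const.mul (contDiffOn_prod fun i _ => hg _ _)

lemma contDiffOn_matrix_inv {g : (ι → ℝ) → Matrix ι ι ℝ} {n : WithTop ℕ∞}
    (hg : ∀ i j, ContDiffOn ℝ n (fun x => g x i j) s) (hd : ∀ x ∈ s, (g x).det ≠ 0) (i j : ι) :
    ContDiffOn ℝ n (fun x => (g x)⁻¹ i j) s := by
  have h : ∀ x, (g x)⁻¹ i j = ((g x).det)⁻¹ * ((g x).updateRow j (Pi.single i 1)).det := by
    intro x
    rw [Matrix.inv_def, Ring.inverse_eq_inv', Matrix.smul_apply, Matrix.adjugate_apply, smul_eq_mul]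
  simp only [h]
  refine ((contDiffOn_matrix_det hg).inv hd).mul (contDiffOn_matrix_det fun k l => ?_)
  simp only [Matrix.updateRow_apply]
  by_cases hk : k = j
  · simp only [hk, if_true]
    exact contDiffOn_const
  · simp only [hk, if_false]
    exact hg k l

lemma contDiffOn_sqrt_abs_det {g : (ι → ℝ) → Matrix ι ι ℝ} {n : WithTop ℕ∞}
    (hg : ∀ i j, ContDiffOn ℝ n (fun x => g x i j) s) (hd : ∀ x ∈ s, (g x).det < 0) :
    ContDiffOn ℝ n (fun x => √|(g x).det|) s := by
  have h : ContDiffOn ℝ n (fun x => √(-(g x).det)) s :=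
    (contDiffOn_matrix_det hg).neg.sqrt fun x hx => by
      have := hd x hx
      simp only [ne_eq, neg_eq_zero]
      exact this.ne
  exact h.congr fun x hx => by rw [abs_of_neg (hd x hx)]

lemma ContDiffOn.hodge (e : ι ≃ Fin (p + q)) {g : (ι → ℝ) → Matrix ι ι ℝ}
    (hg : IsLorentzianMetricOn g s) {θ : (ι → ℝ) → Form ι p} (hθ : ContDiffOn ℝ ∞ θ s) :
    ContDiffOn ℝ ∞ (fun x => hodge e (g x) (θ x)) s := by
  rw [contDiffOn_form_iff]
  intro J
  simp only [hodge_apply]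
  refine ((contDiffOn_sqrt_abs_det hg.1 fun x hx => (hg.2 x hx).det_neg).div_const _).mul
    (ContDiffOn.sum fun I _ => ContDiffOn.mul ?_ contDiffOn_const)
  have h : ∀ x, θ x (fun k => (g x)⁻¹ (I k)) =
      ∑ K : Fin p → ι, (∏ k, (g x)⁻¹ (I k) (K k)) * θ x (fun k => coordVec (K k)) :=
    fun x => form_expand _ _
  simp only [h]
  exact ContDiffOn.sum fun K _ => (contDiffOn_prod fun k _ =>
    contDiffOn_matrix_inv hg.1 (fun x hx => (hg.2 x hx).det_neg.ne) _ _).mul (hθ.form_apply _)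

lemma ContDiffOn.dScalar {f : (ι → ℝ) → ℝ} (hs : IsOpen s) (hf : ContDiffOn ℝ ∞ f s) :
    ContDiffOn ℝ ∞ (dScalar f) s := by
  rw [contDiffOn_form_iff]
  intro J
  simp only [dScalar_apply]
  exact (hf.fderiv_of_isOpen hs (by simp)).clm_apply contDiffOn_const

lemma ContDiffOn.pd {f : (ι → ℝ) → ℝ} (hs : IsOpen s) (hf : ContDiffOn ℝ ∞ f s) (i : ι) :
    ContDiffOn ℝ ∞ (pd i f) s :=
  (hf.fderiv_of_isOpen hs (by simp)).clm_apply contDiffOn_const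

lemma ContDiffOn.differentiableAt_of_isOpen {E F : Type*} [NormedAddCommGroup E]
    [NormedSpace ℝ E] [NormedAddCommGroup F] [NormedSpace ℝ F] {f : E → F} {s : Set E}
    (hf : ContDiffOn ℝ ∞ f s) (hs : IsOpen s) {x : E} (hx : x ∈ s) : Diff f x :=
  (hf.contDiffAt (hs.mem_nhds hx)).differentiableAt (by simp)

end SmoothMetric

section FourDim

variable {p q : ℕ}

/-- The constant zero-form `1`. -/
def unitForm (ι : Type) [Fintype ι] : Form ι 0 :=
  ContinuousAlternatingMap.constOfIsEmpty ℝ (ι → ℝ) (Fin 0) 1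

lemma unitForm_apply {ι : Type} [Fintype ι] (v : Fin 0 → ι → ℝ) : unitForm ι v = 1 := rfl

/-- The flat volume form of the transverse space. -/
def vol4 : Λ⁴ 4 := coordVol (finCongr rfl)

lemma one_inv_row (i : ι) : (1 : Matrix ι ι ℝ)⁻¹ i = coordVec i := by
  rw [inv_one]
  funext j
  simp [Matrix.one_apply, Pi.single_apply, eq_comm]

lemma vol4_self : vol4 (fun k => coordVec k) = 1 := coordVol_self (finCongr rfl : Fin 4 ≃ Fin 4)

lemma starDelta_unit : starDelta 0 4 rfl (unitForm (Fin 4)) = vol4 := by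
  ext v
  rw [starDelta, hodge_apply]
  simp only [det_one, abs_one, Real.sqrt_one, Nat.factorial_zero, Nat.cast_one, div_one, one_mul,
    Finset.univ_unique, Finset.sum_singleton, unitForm_apply]
  change coordVol (finCongr rfl) _ = coordVol (finCongr rfl) v
  congr 1
  funext k
  have hk : (k : Fin (0 + 4)) = natAdd 0 k := Fin.ext (by simp)
  exact (congrArg _ hk).trans (Fin.append_right (m := 0) (n := 4) _ v k)

lemma starDelta_starDelta (β : Λ⁴ 1) : starDelta 3 1 rfl (starDelta 1 3 rfl β) = -β := by
  have h := hodge_hodge (p := 1) (q := 3) (finCongr rfl : Fin 4 ≃ Fin (1 + 3))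
    (Matrix.transpose_one (n := Fin 4) (α := ℝ)) (by simp) β
  refine h.trans ?_
  ext v
  simp only [det_one, Form.smul_apply, Form.neg_apply]
  norm_num

lemma wedge_starDelta (a b : Λ⁴ 1) : wedge a (starDelta 1 3 rfl b) =
      (∑ i, a (fun _ => coordVec i) * b (fun _ => coordVec i)) • vol4 := by
  have h := wedge_hodge (p := 1) (q := 3) (finCongr rfl : Fin 4 ≃ Fin (1 + 3)) 1 a b
  refine h.trans ?_
  have h2 : formInner 1 a b = ∑ i, a (fun _ => coordVec i) * b (fun _ => coordVec i) := by
    rw [formInner]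
    simp only [one_inv_row]
    exact Fintype.sum_equiv (Equiv.funUnique (Fin 1) (Fin 4)) _ _ fun I => by
      congr 2 <;>
      · funext k
        rw [Subsingleton.elim k 0]
        rfl
  rw [h2]
  simp only [det_one, abs_one, Real.sqrt_one, Nat.factorial_one, Nat.cast_one, div_one, one_mul]
  rfl

lemma wedge_one_comm (a b : Form ι 1) : wedge a b = -wedge b a := by
  have h := wedge_comm a b
  have hc : castForm (Nat.add_comm 1 1) (wedge b a) = wedge b a := rfl
  rw [hc] at h
  rw [h]
  module

lemma wedge_one_self (a : Form ι 1) : wedge a a = 0 := by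
  have h := wedge_one_comm a a
  ext v
  have := congrArg (fun f => f v) h
  simp only [Form.neg_apply] at this
  change wedge a a v = 0
  linarith

lemma starDelta_wedge (a b : Λ⁴ 1) : wedge (starDelta 1 3 rfl b) a =
      -((∑ i, a (fun _ => coordVec i) * b (fun _ => coordVec i)) • vol4) := by
  rw [← wedge_starDelta]
  have h := wedge_comm (starDelta 1 3 rfl b) a
  have hc : castForm (Nat.add_comm 1 3) (wedge a (starDelta 1 3 rfl b)) =
    wedge a (starDelta 1 3 rfl b) := rfl
  rw [hc] at h
  rw [h]
  module

/-- The flat dual of `dy^m`. -/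
def sDelta (m : Fin 4) : Λ⁴ 3 := starDelta 1 3 rfl (dCoord m)

lemma pd_mul {f h : (ι → ℝ) → ℝ} {x : ι → ℝ} (hf : Diff f x) (hh : Diff h x) {i : ι} :
    pd i (fun x => f x * h x) x = pd i f x * h x + f x * pd i h x := by
  rw [pd, fderiv_fun_mul hf hh]
  simp only [add_apply, smul_apply, smul_eq_mul]
  rw [add_comm, mul_comm]
  rfl

lemma dScalar_coordVec (f : (ι → ℝ) → ℝ) (x : ι → ℝ)
    (i : ι) : dScalar f x (fun _ => coordVec i) = pd i f x := rfl

lemma dCoord_coordVec (m i : ι) : dCoord m (fun _ => coordVec i) = if i = m then 1 else 0 := by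
  rw [dCoord_apply]
  simp [Pi.single_apply, eq_comm]

lemma wedge_dScalar_sDelta (f : ℝ⁴ → ℝ) (y : ℝ⁴) (m : Fin 4) :
    wedge (dScalar f y) (sDelta m) = pd m f y • vol4 := by
  rw [sDelta, wedge_starDelta]
  simp [dScalar_coordVec, dCoord_coordVec]

lemma wedge_dCoord_sDelta (n m : Fin 4) : wedge (dCoord n) (sDelta m) = δ[m,n] • vol4 := by
  rw [sDelta, wedge_starDelta]
  simp [dCoord_coordVec]

lemma starDelta_dScalar (f : ℝ⁴ → ℝ) (y : ℝ⁴) :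
    starDelta 1 3 rfl (dScalar f y) = ∑ m, pd m f y • sDelta m := by
  have h : dScalar f y = ∑ m, pd m f y • dCoord m := by
    apply form_ext_coord
    intro I
    have hI : (fun k => (coordVec (I k) : ℝ⁴)) = fun _ => coordVec (I 0) := by
      funext k
      rw [Subsingleton.elim k 0]
    rw [hI, dScalar_coordVec, Form.sum_apply]
    simp [dCoord_coordVec]
  conv_lhs => rw [h]
  rw [starDelta, hodge_sum]
  simp only [hodge_smul]
  rfl

lemma extDeriv_smul_sDelta {f : ℝ⁴ → ℝ} {y : ℝ⁴} (hf : Diff f y)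
    (m : Fin 4) : extDeriv (fun y => f y • sDelta m) y = pd m f y • vol4 := by
  rw [extDeriv_smul_fun hf (differentiableAt_const _), extDeriv_const, smul_zero, zero_add,
    wedge_dScalar_sDelta]
  rfl

lemma extDeriv_smul_starDelta {f H : ℝ⁴ → ℝ} {y : ℝ⁴} {Ω : Set ℝ⁴}
    (hΩ : IsOpen Ω) (hy : y ∈ Ω) (hf : Diff f y) (hH : ContDiffOn ℝ ∞ H Ω) :
    extDeriv (fun y => f y • starDelta 1 3 rfl (dScalar H y)) y =
      (∑ m, (pd m f y * pd m H y + f y * pd m (pd m H) y)) • vol4 := by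
  have hd : ∀ m, Diff (pd m H) y := fun m =>
    (hH.pd hΩ m).differentiableAt_of_isOpen hΩ hy
  have h : (fun y => f y • starDelta 1 3 rfl (dScalar H y)) =
      fun y => ∑ m, (f y * pd m H y) • sDelta m := by
    funext y
    rw [starDelta_dScalar, smul_sum]
    simp only [smul_smul]
  have hfm : ∀ m, Diff (fun y => f y * pd m H y) y := fun m => hf.mul (hd m)
  rw [h, extDeriv_sum _ fun m _ => (hfm m).smul_const _, sum_smul]
  refine sum_congr rfl fun m _ => ?_
  rw [extDeriv_smul_sDelta (hfm m)]
  congr 1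
  exact pd_mul hf (hd m)

end FourDim

section BiForms

variable {p q n p' q' n' : ℕ}

/-- The product form `α ∧ β` of total degree `n`. -/
def bic (h : p + q = n) (α : Λ⁶ p) (β : Λ⁴ q) : Form Ten n := castForm h (bi α β)

lemma bic_add_left (h : p + q = n) (α α' : Λ⁶ p) (β : Λ⁴ q) :
    bic h (α + α') β = bic h α β + bic h α' β := by subst h; exact bi_add_left _ _ _

lemma bic_smul_left (h : p + q = n) (c : ℝ) (α : Λ⁶ p) (β : Λ⁴ q) :
    bic h (c • α) β = c • bic h α β := by subst h; exact bi_smul_left _ _ _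

lemma bic_smul_right (h : p + q = n) (c : ℝ) (α : Λ⁶ p) (β : Λ⁴ q) :
    bic h α (c • β) = c • bic h α β := by subst h; exact bi_smul_right _ _ _

lemma bic_neg_left (h : p + q = n) (α : Λ⁶ p) (β : Λ⁴ q) : bic h (-α) β = -bic h α β := by
  subst h; exact bi_neg_left _ _

lemma bic_neg_right (h : p + q = n) (α : Λ⁶ p) (β : Λ⁴ q) : bic h α (-β) = -bic h α β := by
  subst h; exact bi_neg_right _ _

lemma bic_sub_left (h : p + q = n) (α α' : Λ⁶ p) (β : Λ⁴ q) :
    bic h (α - α') β = bic h α β - bic h α' β := by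
  rw [sub_eq_add_neg, bic_add_left, bic_neg_left, ← sub_eq_add_neg]

lemma bic_zero_left (h : p + q = n) (β : Λ⁴ q) : bic h (0 : Λ⁶ p) β = 0 := by
  subst h; exact bi_zero_left _

lemma bic_zero_right (h : p + q = n) (α : Λ⁶ p) : bic h α (0 : Λ⁴ q) = 0 := by
  subst h; exact bi_zero_right _

lemma bic_sum_left (h : p + q = n) {S : Type*} (s : Finset S) (α : S → Λ⁶ p)
    (β : Λ⁴ q) : bic h (∑ i ∈ s, α i) β = ∑ i ∈ s, bic h (α i) β := by
  classical
  induction s using Finset.induction_on with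
  | empty => simp [bic_zero_left]
  | insert i s hi ih => rw [Finset.sum_insert hi, Finset.sum_insert hi, bic_add_left, ih]

lemma bic_wedge_bic (h : p + q = n) (h' : p' + q' = n') (α : Λ⁶ p)
    (β : Λ⁴ q) (α' : Λ⁶ p') (β' : Λ⁴ q') : wedge (bic h α β) (bic h' α' β') = (-1 : ℝ) ^ (q * p') •
      bic (by omega : p + p' + (q + q') = n + n') (wedge α α') (wedge β β') := by
  subst h; subst h'; exact bi_wedge_bi _ _ _ _

lemma bic_eq_zero_of_six_lt (h : p + q = n) (hp : 6 < p) (α : Λ⁶ p) (β : Λ⁴ q) : bic h α β = 0 := by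
  rw [form_eq_zero_of_card_lt (by simpa using hp) α, bic_zero_left]

lemma bic_eq_zero_of_four_lt (h : p + q = n) (hq : 4 < q) (α : Λ⁶ p)
    (β : Λ⁴ q) : bic h α β = 0 := by
  rw [form_eq_zero_of_card_lt (by simpa using hq) β, bic_zero_right]

lemma unitForm_wedge (β : Form ι q) : wedge (unitForm ι) β = castForm (Nat.zero_add q).symm β := by
  ext v
  rw [wedge_apply_of_vanish, castForm_apply, unitForm_apply, one_mul]
  · congr 1
    funext k
    congr 1
    exact Fin.ext (by simp)
  · rintro σ ⟨i, _⟩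
    exact i.elim0

lemma wedge_unitForm (β : Form ι q) : wedge β (unitForm ι) = β := by
  ext v
  rw [wedge_apply_of_vanish, unitForm_apply, mul_one]
  · rfl
  · rintro σ - ⟨_, i, _⟩
    exact i.elim0

lemma bic_castForm_left (h : p' + q = n) (e : p = p') (α : Λ⁶ p)
    (β : Λ⁴ q) : bic h (castForm e α) β = bic (by omega) α β := by subst e; rfl

lemma bic_castForm_right (h : p + q' = n) (e : q = q') (α : Λ⁶ p)
    (β : Λ⁴ q) : bic h α (castForm e β) = bic (by omega) α β := by subst e; rfl

lemma bic_unit_wedge_left (h : 0 + p + q = n) (α : Λ⁶ p) (β : Λ⁴ q) :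
    bic h (wedge (unitForm _) α) β = bic (by omega) α β := by rw [unitForm_wedge, bic_castForm_left]

lemma bic_unit_wedge_right (h : p + (0 + q) = n) (α : Λ⁶ p) (β : Λ⁴ q) :
    bic h α (wedge (unitForm _) β) = bic (by omega) α β := by
  rw [unitForm_wedge, bic_castForm_right]

lemma bic_wedge_unit_left (h : p + 0 + q = n) (α : Λ⁶ p) (β : Λ⁴ q) :
    bic h (wedge α (unitForm _)) β = bic (p := p) h α β := by rw [wedge_unitForm]

lemma bic_wedge_unit_right (h : p + (q + 0) = n) (α : Λ⁶ p) (β : Λ⁴ q) :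
    bic h α (wedge β (unitForm _)) = bic (q := q) h α β := by rw [wedge_unitForm]

lemma pullX_eq_bic (α : Λ⁶ p) : pullX α = bic (Nat.add_zero p) α (unitForm _) := by
  have h : pullY (unitForm (Fin 4)) = unitForm Ten := rfl
  change _ = wedge (pullX α) (pullY (unitForm (Fin 4)))
  rw [h, wedge_unitForm]

lemma pullY_eq_bic (β : Λ⁴ q) : pullY β = bic (Nat.zero_add q) (unitForm _) β := by
  have h : pullX (unitForm (Fin 6)) = unitForm Ten := rfl
  change _ = castForm _ (wedge (pullX (unitForm (Fin 6))) (pullY β))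
  rw [h, unitForm_wedge, castForm_castForm]
  rfl

lemma extDeriv_bic (h : p + q = n) {α : ℝ⁶ → Λ⁶ p} {β : ℝ⁴ → Λ⁴ q} {z : ℝ¹⁰} (hα : Diff α ♯z)
    (hβ : Diff β ♭z) : extDeriv (fun z => bic h (α ♯z) (β ♭z)) z =
      bic (by omega) (extDeriv α ♯z) (β ♭z) +
        (-1 : ℝ) ^ p • bic (by omega) (α ♯z) (extDeriv β ♭z) := by subst h; exact extDeriv_bi hα hβ

lemma DifferentiableAt.bic (h : p + q = n) {α : ℝ⁶ → Λ⁶ p}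
    {β : ℝ⁴ → Λ⁴ q} {z : ℝ¹⁰} (hα : Diff α ♯z) (hβ : Diff β ♭z) :
    Diff (fun z => bic h (α ♯z) (β ♭z)) z := by subst h; exact hα.bi hβ

lemma star10_bic {A B : ℝ} (hA : 0 < A) (hB : 0 < B) {g : Mat₆}
    (hgT : g.transpose = g) (hg : g.det ≠ 0) (hp : 6 = p + p') (hq : 4 = q + q')
    (h : p + q = n) (h' : p' + q' = n') (hn : 6 + 4 = n + n') (α : Λ⁶ p) (β : Λ⁴ q) :
    star10 n n' hn (warp A g B) (bic h α β) =
      ((-1) ^ (q * p') * (A ^ 3 * B ^ 2 * (A⁻¹ ^ p * B⁻¹ ^ q))) •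
        bic h' (star6 p p' hp g α) (starDelta q q' hq β) := by
  subst h; subst h'; exact star10_bi hA hB hgT hg hp hq hn α β

lemma star10_add (h : 6 + 4 = p + q) (g : Matrix Ten Ten ℝ) (a b : Form Ten p) :
    star10 p q h g (a + b) = star10 p q h g a + star10 p q h g b := hodge_add _ _ _ _

lemma star10_smul (h : 6 + 4 = p + q) (g : Matrix Ten Ten ℝ) (c : ℝ) (a : Form Ten p) :
    star10 p q h g (c • a) = c • star10 p q h g a := hodge_smul _ _ _ _

lemma star10_sum {S : Type*} (s : Finset S) (h : 6 + 4 = p + q) (g : Matrix Ten Ten ℝ)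
    (a : S → Form Ten p) :
    star10 p q h g (∑ i ∈ s, a i) = ∑ i ∈ s, star10 p q h g (a i) := hodge_sum _ _ _ _

/-- The component of bidegree `(a, b)` of a form in ten dimensions. -/
def comp (a b : ℕ) (h : n = a + b) (θ : Form Ten n) (u : Fin a → ℝ⁶) (w : Fin b → ℝ⁴) : ℝ :=
  castForm h θ (splitVec u w)

lemma comp_bic (h : p + q = n) (h' : n = p + q) (α : Λ⁶ p) (β : Λ⁴ q)
    (u : Fin p → ℝ⁶) (w : Fin q → ℝ⁴) : comp p q h' (bic h α β) u w = α u * β w := by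
  subst h; exact bi_splitVec _ _ _ _

lemma comp_bic_of_ne {a b : ℕ} (h : p + q = n) (h' : n = a + b) (hne : a ≠ p)
    (α : Λ⁶ p) (β : Λ⁴ q) (u : Fin a → ℝ⁶) (w : Fin b → ℝ⁴) : comp a b h' (bic h α β) u w = 0 := by
  subst h; exact bi_splitVec_of_ne _ _ _ hne _ _

lemma comp_add {a b : ℕ} (h : n = a + b) (θ θ' : Form Ten n) (u : Fin a → ℝ⁶)
    (w : Fin b → ℝ⁴) : comp a b h (θ + θ') u w = comp a b h θ u w + comp a b h θ' u w := by
  subst h; rfl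

lemma comp_smul {a b : ℕ} (h : n = a + b) (c : ℝ) (θ : Form Ten n) (u : Fin a → ℝ⁶)
    (w : Fin b → ℝ⁴) : comp a b h (c • θ) u w = c * comp a b h θ u w := by subst h; rfl

lemma comp_zero {a b : ℕ} (h : n = a + b) (u : Fin a → ℝ⁶)
    (w : Fin b → ℝ⁴) : comp a b h (0 : Form Ten n) u w = 0 := by subst h; rfl

lemma comp_sum {a b : ℕ} {S : Type*} (s : Finset S) (h : n = a + b) (θ : S → Form Ten n)
    (u : Fin a → ℝ⁶) (w : Fin b → ℝ⁴) :
    comp a b h (∑ i ∈ s, θ i) u w = ∑ i ∈ s, comp a b h (θ i) u w := by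
  subst h
  exact Form.sum_apply _ _ _

lemma form_eq_zero_of_sum_smul_dCoord {c : ℝ⁴}
    (h : ∀ w, ∑ m, c m * dCoord m w = 0) (m : Fin 4) : c m = 0 := by
  have := h fun _ => coordVec m
  simpa [dCoord_coordVec] using this

lemma form_eq_zero_of_sum_smul_sDelta {c : ℝ⁴}
    (h : ∀ w, ∑ m, c m * sDelta m w = 0) (m : Fin 4) : c m = 0 := by
  have h0 : ∑ m, c m • sDelta m = 0 := by
    ext w
    rw [Form.sum_apply]
    exact h w
  have h1 := congrArg (fun θ => wedge (dCoord m) θ (fun k => coordVec k)) h0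
  simp only [wedge_sum_right, wedge_smul_right, wedge_dCoord_sDelta, wedge_zero_right] at h1
  rw [Form.sum_apply] at h1
  have h2 : ∀ n, (c n • δ[n,m] • vol4 : Λ⁴ (1 + 3))
      (fun k => coordVec k) = if n = m then c n else 0 := by
    intro n
    change c n * (δ[n,m] * vol4 (fun k => coordVec k)) = _
    rw [vol4_self]
    split_ifs <;> simp
  simp only [h2, sum_ite_eq', mem_univ, if_true] at h1
  exact h1

end BiForms

variable {U : Set ℝ⁶} {Ω : Set ℝ⁴} {H : ℝ⁴ → ℝ} {F : SixFields} {z : ℝ¹⁰} {x : ℝ⁶} {y : ℝ⁴}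

/-- The ten-dimensional metric, dilaton and field strengths of the ansatz. -/
local notation "𝐠" => IIAFields.metric (uplift H F)
local notation "𝚽" => IIAFields.Phi (uplift H F)
local notation "𝐇" => IIAFields.H3 (uplift H F)
local notation "𝐅₂" => IIAFields.F2 (uplift H F)
local notation "𝐅₄" => IIAFields.F4 (uplift H F)

/-- The differentials of the axions. -/
local notation:max "dφ" m:max => dScalar (SixFields.phi F m)

section UpliftForms

lemma one_div_sqrt_two : 1 / √2 = 2 * (1 / (2 * √2)) := by field_simp

lemma sqrt_two_eq : √2 = 4 * (1 / (2 * √2)) := by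
  have h : √2 * √2 = 2 := mul_self_sqrt (by norm_num)
  field_simp
  nlinarith

lemma uplift_metric_eq_warp (H : ℝ⁴ → ℝ) (F : SixFields) (z : ℝ¹⁰) : (uplift H F).metric z =
      warp (H ♭z ^ (-(1 / 4) : ℝ) * exp (-(1 / (2 * √2) * F.sigma ♯z))) (F.metric ♯z)
        (H ♭z ^ (3 / 4 : ℝ) * exp (1 / (2 * √2) * F.sigma ♯z)) := rfl

lemma uplift_Phi_eq (F : SixFields) (hH : 0 < H ♭z) :
    (uplift H F).Phi z = 1 / 2 * log (H ♭z) - 1 / √2 * F.sigma ♯z := by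
  change log _ = _
  rw [Real.log_mul (Real.rpow_pos_of_pos hH _).ne' (exp_pos _).ne', Real.log_exp, Real.log_rpow hH]
  ring

lemma uplift_H3_eq (H : ℝ⁴ → ℝ) (F : SixFields) (z : ℝ¹⁰) : (uplift H F).H3 z =
      bic rfl (unitForm _) (-starDelta 1 3 rfl (dScalar H ♭z)) +
        bic rfl (F.H0 ♯z) (unitForm _) := by
  rw [bic_neg_right]
  change -pullY _ + pullX _ = _
  rw [pullX_eq_bic, pullY_eq_bic]

lemma uplift_F2_eq (H : ℝ⁴ → ℝ) (F : SixFields) (z : ℝ¹⁰) : (uplift H F).F2 z =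
      (1 / √2) • ∑ m, bic rfl (dScalar (F.phi m) ♯z) (dCoord m) := rfl

lemma uplift_F4_eq (H : ℝ⁴ → ℝ) (F : SixFields) (z : ℝ¹⁰) : (uplift H F).F4 z =
      ∑ m, bic rfl (F.Hm m ♯z) (dCoord m) +
        (1 / √2) • ∑ m, bic rfl (dScalar (F.phi m) ♯z) (H ♭z • sDelta m) := by
  simp only [bic_smul_right]
  rw [← smul_sum, smul_smul]
  rfl

lemma starDelta_neg_starDelta (β : Λ⁴ 1) : starDelta 3 1 rfl (-starDelta 1 3 rfl β) = β := by
  have h := starDelta_starDelta (-β)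
  rw [neg_neg] at h
  refine Eq.trans (congrArg (starDelta 3 1 rfl) ?_) h
  exact (hodge_neg (finCongr rfl : Fin 4 ≃ Fin (1 + 3)) 1 β).symm

lemma starDelta_sDelta (m : Fin 4) : starDelta 3 1 rfl (sDelta m) = -dCoord m :=
  starDelta_starDelta _

lemma warp_coefficient (a b : ℝ) {p q : ℕ} :
    exp a ^ 3 * exp b ^ 2 * ((exp a)⁻¹ ^ p * (exp b)⁻¹ ^ q) = exp ((3 - p) * a + (2 - q) * b) := by
  simp only [← exp_neg, ← exp_nat_mul, ← exp_add]
  congr 1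
  push_cast
  ring

lemma uplift_scale_x (hH : 0 < H ♭z) (F : SixFields) :
    H ♭z ^ (-(1 / 4) : ℝ) * exp (-(1 / (2 * √2) * F.sigma ♯z)) =
      exp (-(1 / 4) * log (H ♭z) - 1 / (2 * √2) * F.sigma ♯z) := by
  rw [Real.rpow_def_of_pos hH, ← exp_add]
  congr 1
  ring

lemma uplift_scale_y (hH : 0 < H ♭z) (F : SixFields) :
    H ♭z ^ (3 / 4 : ℝ) * exp (1 / (2 * √2) * F.sigma ♯z) =
      exp (3 / 4 * log (H ♭z) + 1 / (2 * √2) * F.sigma ♯z) := by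
  rw [Real.rpow_def_of_pos hH, ← exp_add]
  congr 1
  ring

lemma uplift_star_bic {p q n p' q' n' : ℕ} (hH : 0 < H ♭z)
    (hg : IsLorentzian (F.metric ♯z)) (hp : 6 = p + p') (hq : 4 = q + q')
    (h : p + q = n) (h' : p' + q' = n') (hn : 6 + 4 = n + n') (r : ℝ) {X Y : ℝ}
    (hX : X = exp ((-2 * r - 1 + p - q) * (1 / (2 * √2)) * F.sigma ♯z))
    (hY : Y = exp ((r / 2 + (3 + p - 3 * q) / 4) * log (H ♭z))) (α : Λ⁶ p) (β : Λ⁴ q) :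
    exp (r * 𝚽 z) • star10 n n' hn (𝐠 z) (bic h α β) =
      (-1 : ℝ) ^ (q * p') • bic h' (X • star6 p p' hp (F.metric ♯z) α)
        (Y • starDelta q q' hq β) := by
  rw [uplift_metric_eq_warp, uplift_scale_x hH, uplift_scale_y hH,
    star10_bic (exp_pos _) (exp_pos _) hg.transpose_eq hg.det_neg.ne hp hq h h' hn, bic_smul_left,
    bic_smul_right, smul_smul, smul_smul, smul_smul, warp_coefficient, hX, hY, uplift_Phi_eq F hH,
    one_div_sqrt_two]
  congr 1
  rw [mul_left_comm, ← exp_add, mul_assoc ((-1 : ℝ) ^ (q * p')), ← exp_add]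
  congr 2
  ring

lemma uplift_star_F2 (hH : 0 < H ♭z) (hg : IsLorentzian (F.metric ♯z)) : exp (3 / 2 * 𝚽 z) •
        star10 2 8 rfl (𝐠 z) (𝐅₂ z) =
      (-(1 / √2)) • ∑ m, bic rfl (exp (-(√2 * F.sigma ♯z)) • ⋆₁ (F.metric ♯z) (dφ m ♯z))
          (H ♭z • sDelta m) := by
  have key := fun m => uplift_star_bic (n' := 8) hH hg (p := 1) (q := 1) (p' := 5) (q' := 3)
    rfl rfl rfl rfl rfl (3 / 2) (X := exp (-(√2 * F.sigma ♯z))) (Y := H ♭z)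
    (by congr 1; nth_rewrite 1 [sqrt_two_eq]; push_cast; ring)
    (by norm_num [exp_log hH]) (dφ m ♯z) (dCoord m)
  rw [uplift_F2_eq, star10_smul, star10_sum, smul_comm, smul_sum]
  simp only [key]
  ext v
  simp only [Form.smul_apply, Form.sum_apply, mul_sum]
  refine sum_congr rfl fun m _ => ?_
  norm_num [sDelta]

lemma uplift_star_F4 (hH : 0 < H ♭z) (hg : IsLorentzian (F.metric ♯z)) : exp (1 / 2 * 𝚽 z) •
        star10 4 6 rfl (𝐠 z) (𝐅₄ z) =
      -∑ m, bic rfl (⋆₃ (F.metric ♯z) (F.Hm m ♯z)) (H ♭z • sDelta m) +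
        (1 / √2) • ∑ m, bic rfl (exp (-(√2 * F.sigma ♯z)) •
          ⋆₁ (F.metric ♯z) (dφ m ♯z)) (dCoord m) := by
  have key1 := fun m => uplift_star_bic (n' := 6) hH hg (p := 3) (q := 1) (p' := 3) (q' := 3)
    rfl rfl rfl rfl rfl (1 / 2) (X := 1) (Y := H ♭z)
    (by rw [eq_comm, Real.exp_eq_one_iff]; push_cast; ring)
    (by norm_num [exp_log hH]) (F.Hm m ♯z) (dCoord m)
  have key2 := fun m => uplift_star_bic (n' := 6) hH hg (p := 1) (q := 3) (p' := 5) (q' := 1)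
    rfl rfl rfl rfl rfl (1 / 2) (X := exp (-(√2 * F.sigma ♯z))) (Y := (H ♭z)⁻¹)
    (by congr 1; nth_rewrite 1 [sqrt_two_eq]; push_cast; ring)
    (by
      rw [← exp_log (inv_pos.2 hH), Real.log_inv]
      congr 1
      push_cast
      ring)
    (dφ m ♯z) (sDelta m)
  rw [uplift_F4_eq, star10_add, star10_smul, star10_sum, star10_sum, smul_add, smul_sum]
  simp only [key1]
  rw [smul_comm, smul_sum]
  simp only [bic_smul_right, star10_smul] at key2 ⊢
  simp only [smul_comm _ (H ♭z), key2, starDelta_sDelta, bic_neg_right]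
  have h1 : ∀ θ : Form Ten 6, H ♭z • (-1 : ℝ) ^ (3 * 5) • (H ♭z)⁻¹ • -θ = θ := by
    intro θ
    ext v
    simp only [Form.smul_apply, Form.neg_apply]
    field_simp
    norm_num
  simp only [h1]
  congr 1
  ext v
  simp only [Form.smul_apply, Form.neg_apply, Form.sum_apply, bic_smul_left, ← sum_neg_distrib]
  refine sum_congr rfl fun m _ => ?_
  norm_num [sDelta]

lemma uplift_star_H3 (hH : 0 < H ♭z) (hg : IsLorentzian (F.metric ♯z)) : exp (-𝚽 z) •
        star10 3 7 rfl (𝐠 z) (𝐇 z) =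
      bic rfl (exp (-(1 / √2 * F.sigma ♯z)) • star6 0 6 rfl (F.metric ♯z) (unitForm _))
          ((H ♭z ^ 2)⁻¹ • dScalar H ♭z) +
        bic rfl (exp (√2 * F.sigma ♯z) • ⋆₃ (F.metric ♯z) (F.H0 ♯z)) (H ♭z • vol4) := by
  have key1 := uplift_star_bic (n' := 7) hH hg (p := 0) (q := 3) (p' := 6) (q' := 1)
    rfl rfl rfl rfl rfl (-1) (X := exp (-(1 / √2 * F.sigma ♯z)))
    (Y := (H ♭z ^ 2)⁻¹)
    (by congr 1; rw [one_div_sqrt_two]; push_cast; ring)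
    (by
      rw [← exp_log (inv_pos.2 (pow_pos hH 2)), Real.log_inv, Real.log_pow]
      congr 1
      push_cast
      ring)
    (unitForm _) (-starDelta 1 3 rfl (dScalar H ♭z))
  have key2 := uplift_star_bic (n' := 7) hH hg (p := 3) (q := 0) (p' := 3) (q' := 4)
    rfl rfl rfl rfl rfl (-1) (X := exp (√2 * F.sigma ♯z))
    (Y := H ♭z)
    (by congr 1; nth_rewrite 1 [sqrt_two_eq]; push_cast; ring)
    (by norm_num [exp_log hH])
    (F.H0 ♯z) (unitForm _)
  rw [← neg_one_mul (𝚽 z), uplift_H3_eq, star10_add, smul_add, key1, key2, starDelta_neg_starDelta,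
    starDelta_unit]
  module

end UpliftForms

/-- The hypotheses under which the truncation ansatz is considered. -/
structure UpliftData (U : Set ℝ⁶) (Ω : Set ℝ⁴) (H : ℝ⁴ → ℝ) (F : SixFields) : Prop where
  isOpenU : IsOpen U
  isOpenΩ : IsOpen Ω
  smooth : ContDiffOn ℝ ∞ H Ω
  pos : ∀ y ∈ Ω, 0 < H y
  harm : ∀ y ∈ Ω, ∑ m, pd m (pd m H) y = 0
  reg : F.Regular U

lemma bic_wedge_comm_left {p q p' n : ℕ} (h : p + p' + q = n) (α : Λ⁶ p) (α' : Λ⁶ p') (β : Λ⁴ q) :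
    bic h (wedge α α') β = (-1 : ℝ) ^ (p * p') • bic (by omega) (wedge α' α) β := by
  rw [wedge_comm, bic_smul_left, bic_castForm_left]

lemma extDeriv_sum_add_smul_sum {ι S : Type} [Fintype ι] [DecidableEq ι] {p : ℕ} (s : Finset S)
    {a b : S → (ι → ℝ) → Form ι p} {x : ι → ℝ} (c : ℝ) (ha : ∀ i, Diff (a i) x)
    (hb : ∀ i, Diff (b i) x) : extDeriv (fun z => ∑ i ∈ s, a i z + c • ∑ i ∈ s, b i z) x =
      ∑ i ∈ s, extDeriv (a i) x + c • ∑ i ∈ s, extDeriv (b i) x := by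
  have hb' : Diff (fun z => ∑ i ∈ s, b i z) x := DifferentiableAt.fun_sum fun i _ => hb i
  rw [extDeriv_fun_add (DifferentiableAt.fun_sum fun i _ => ha i) (hb'.fun_const_smul c),
    extDeriv_const_smul, extDeriv_sum _ fun i _ => ha i, extDeriv_sum _ fun i _ => hb i]

lemma bic_sum_dCoord_eq_zero {p n : ℕ} (h : p + 1 = n) {α : Fin 4 → Λ⁶ p}
    (h0 : ∑ m, bic h (α m) (dCoord m) = 0) (m : Fin 4) : α m = 0 := by
  ext u
  refine form_eq_zero_of_sum_smul_dCoord (c := fun m => α m u) (fun w => ?_) m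
  have := congrArg (fun θ => comp p 1 h.symm θ u w) h0
  simpa only [comp_sum, comp_bic, comp_zero] using this

lemma bic_sum_sDelta_eq_zero {p n : ℕ} (h : p + 3 = n) {α : Fin 4 → Λ⁶ p}
    (h0 : ∑ m, bic h (α m) (sDelta m) = 0) (m : Fin 4) : α m = 0 := by
  ext u
  refine form_eq_zero_of_sum_smul_sDelta (c := fun m => α m u) (fun w => ?_) m
  have := congrArg (fun θ => comp p 3 h.symm θ u w) h0
  simpa only [comp_sum, comp_bic, comp_zero] using this

lemma bic_vol4_eq_zero {p n : ℕ} (h : p + 4 = n) {α : Λ⁶ p} (h0 : bic h α vol4 = 0) : α = 0 := by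
  ext u
  have := congrArg (fun θ => comp p 4 h.symm θ u (fun k => coordVec k)) h0
  change α u = 0
  simpa only [comp_bic, comp_zero, vol4_self, mul_one] using this

lemma ContDiffOn.star6 {p q : ℕ} (h : 6 = p + q) {U : Set ℝ⁶}
    {g : ℝ⁶ → Mat₆} (hg : IsLorentzianMetricOn g U) {θ : ℝ⁶ → Λ⁶ p} (hθ : ContDiffOn ℝ ∞ θ U) :
    ContDiffOn ℝ ∞ (fun x => star6 p q h (g x) (θ x)) U :=
  ContDiffOn.hodge _ hg hθ

/-- The hypotheses on the data of the ansatz. -/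
local notation "Uplift" => UpliftData U Ω H F

namespace UpliftData

lemma isOpen_region (S : Uplift) : IsOpen (region U Ω) :=
  (S.isOpenU.preimage projX.continuous).inter (S.isOpenΩ.preimage projY.continuous)

lemma eventually_region (S : Uplift) (hz : z ∈ region U Ω) :
    ∀ᶠ w in nhds z, w ∈ region U Ω := S.isOpen_region.mem_nhds hz

lemma lorentzian (S : Uplift) (hx : x ∈ U) : IsLorentzian (F.metric x) := S.reg.metric.2 x hx

lemma diff_H (S : Uplift) (hy : y ∈ Ω) : Diff H y :=
  S.smooth.differentiableAt_of_isOpen S.isOpenΩ hy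

lemma diff_dphi (S : Uplift) (hx : x ∈ U) (m : Fin 4) : Diff (dφ m) x :=
  ((S.reg.phi m).dScalar S.isOpenU).differentiableAt_of_isOpen S.isOpenU hx

lemma diff_H0 (S : Uplift) (hx : x ∈ U) : Diff F.H0 x :=
  S.reg.H0.differentiableAt_of_isOpen S.isOpenU hx

lemma diff_Hm (S : Uplift) (hx : x ∈ U) (m : Fin 4) : Diff (F.Hm m) x :=
  (S.reg.Hm m).differentiableAt_of_isOpen S.isOpenU hx

lemma diff_star_Hm (S : Uplift) (hx : x ∈ U) (m : Fin 4) :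
    Diff (fun x => ⋆₃ (F.metric x) (F.Hm m x)) x :=
  (ContDiffOn.star6 rfl S.reg.metric (S.reg.Hm m)).differentiableAt_of_isOpen S.isOpenU hx

lemma diff_star_H0 (S : Uplift) (hx : x ∈ U) : Diff (fun x => exp (√2 * F.sigma x) •
      ⋆₃ (F.metric x) (F.H0 x)) x :=
  ((contDiffOn_const.mul S.reg.sigma).exp.smul
    (ContDiffOn.star6 rfl S.reg.metric S.reg.H0)).differentiableAt_of_isOpen S.isOpenU hx

lemma diff_star_dphi (S : Uplift) (hx : x ∈ U) (m : Fin 4) :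
    Diff (fun x => exp (-(√2 * F.sigma x)) • ⋆₁ (F.metric x) (dφ m x)) x :=
  ((contDiffOn_const.mul S.reg.sigma).neg.exp.smul
    (ContDiffOn.star6 rfl S.reg.metric
      ((S.reg.phi m).dScalar S.isOpenU))).differentiableAt_of_isOpen S.isOpenU hx

lemma diff_star_dsigma (S : Uplift) (hx : x ∈ U) :
    Diff (fun x => ⋆₁ (F.metric x) (dScalar F.sigma x)) x :=
  (ContDiffOn.star6 rfl S.reg.metric
      (S.reg.sigma.dScalar S.isOpenU)).differentiableAt_of_isOpen S.isOpenU hx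

lemma diff_star_unit (S : Uplift) (hx : x ∈ U) (c : ℝ) : Diff (fun x => exp (-(c * F.sigma x)) •
      star6 0 6 rfl (F.metric x) (unitForm _)) x :=
  ((contDiffOn_const.mul S.reg.sigma).neg.exp.smul
    (ContDiffOn.star6 rfl S.reg.metric contDiffOn_const)).differentiableAt_of_isOpen S.isOpenU hx

lemma diff_starDelta_dH (S : Uplift) (hy : y ∈ Ω) :
    Diff (fun y => starDelta 1 3 rfl (dScalar H y)) y := by
  simp only [starDelta_dScalar]
  refine DifferentiableAt.fun_sum fun m _ => ?_
  exact ((S.smooth.pd S.isOpenΩ m).differentiableAt_of_isOpen S.isOpenΩ hy).smul_const _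

lemma extDeriv_starDelta_dH (S : Uplift) (hy : y ∈ Ω) :
    extDeriv (fun y => starDelta 1 3 rfl (dScalar H y)) y = 0 := by
  have h := extDeriv_smul_starDelta (f := fun _ => 1) S.isOpenΩ hy (differentiableAt_const _)
    S.smooth
  simp only [one_smul, one_mul, sum_add_distrib, S.harm y hy, add_zero] at h
  rw [h]
  simp [pd]

lemma extDeriv_H_smul_sDelta (S : Uplift) (hy : y ∈ Ω) (m : Fin 4) :
    extDeriv (fun y => H y • sDelta m) y = pd m H y • vol4 :=
  extDeriv_smul_sDelta (S.diff_H hy) m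

lemma diff_H_smul {q : ℕ} (S : Uplift) (hy : y ∈ Ω) (β : Λ⁴ q) :
    Diff (fun y => H y • β) y := (S.diff_H hy).smul_const _

lemma extDeriv_H3 (S : Uplift) (hz : z ∈ region U Ω) :
    extDeriv 𝐇 z = bic rfl (extDeriv F.H0 ♯z) (unitForm _) := by
  have hd := S.diff_starDelta_dH hz.2
  rw [show 𝐇 = _ from funext fun z => uplift_H3_eq H F z, extDeriv_fun_add
    (DifferentiableAt.bic (α := fun _ => unitForm _) rfl (differentiableAt_const _) hd.fun_neg)
    (DifferentiableAt.bic (β := fun _ => unitForm _) rfl (S.diff_H0 hz.1)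
      (differentiableAt_const _)),
    extDeriv_bic (α := fun _ => unitForm _) rfl (differentiableAt_const _) hd.fun_neg,
    extDeriv_bic (β := fun _ => unitForm _) rfl (S.diff_H0 hz.1) (differentiableAt_const _),
    extDeriv_const, extDeriv_const, extDeriv_neg, S.extDeriv_starDelta_dH hz.2, bic_zero_left,
    bic_zero_right, neg_zero, bic_zero_right, smul_zero, smul_zero, add_zero, zero_add, add_zero]

lemma bianchi_H3_iff (S : Uplift) (hz : z ∈ region U Ω) :
    extDeriv 𝐇 z = 0 ↔ extDeriv F.H0 ♯z = 0 := by
  rw [S.extDeriv_H3 hz]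
  constructor
  · intro h
    ext u
    have := congrArg (fun θ => comp 4 0 rfl θ u Fin.elim0) h
    simpa [comp_bic, comp_zero, unitForm_apply] using this
  · intro h
    rw [h, bic_zero_left]

lemma bianchi_F2 (S : Uplift) (hz : z ∈ region U Ω) : extDeriv 𝐅₂ z = 0 := by
  have h1 : ∀ m, extDeriv (fun z => bic (n := 2) rfl (dφ m ♯z) (dCoord m)) z = 0 := by
    intro m
    rw [extDeriv_bic (β := fun _ => dCoord m) rfl (S.diff_dphi hz.1 m) (differentiableAt_const _),
      extDeriv_const, extDeriv_dScalar ((S.reg.phi m).contDiffAt (S.isOpenU.mem_nhds hz.1)),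
      bic_zero_left, bic_zero_right, smul_zero, add_zero]
  rw [show 𝐅₂ = _ from funext fun z => uplift_F2_eq H F z, extDeriv_const_smul,
    extDeriv_sum _ fun m _ => DifferentiableAt.bic (β := fun _ => dCoord m) rfl
      (S.diff_dphi hz.1 m) (differentiableAt_const _)]
  simp only [h1, sum_const_zero, smul_zero]

lemma extDeriv_F4 (S : Uplift) (hz : z ∈ region U Ω) : extDeriv 𝐅₄ z =
      ∑ m, bic (n := 4 + 1) (by rfl) (extDeriv (F.Hm m) ♯z) (dCoord m) - (1 / √2) • ∑ m, pd m H ♭z •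
          bic (n := 4 + 1) (by rfl) (dφ m ♯z) vol4 := by
  have d1 : ∀ m, Diff
      (fun z => bic (n := 4) rfl (F.Hm m ♯z) (dCoord m)) z := fun m =>
    DifferentiableAt.bic (β := fun _ => dCoord m) rfl (S.diff_Hm hz.1 m) (differentiableAt_const _)
  have d2 : ∀ m, Diff (fun z => bic (n := 4) rfl (dφ m ♯z)
      (H ♭z • sDelta m)) z := fun m =>
    DifferentiableAt.bic (β := fun y => H y • sDelta m) rfl (S.diff_dphi hz.1 m) (S.diff_H_smul hz.2 _)
  have h1 : ∀ m, extDeriv (fun z => bic (n := 4) rfl (F.Hm m ♯z) (dCoord m)) z =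
      bic rfl (extDeriv (F.Hm m) ♯z) (dCoord m) := by
    intro m
    rw [extDeriv_bic (β := fun _ => dCoord m) rfl (S.diff_Hm hz.1 m) (differentiableAt_const _),
      extDeriv_const, bic_zero_right, smul_zero, add_zero]
  have h2 : ∀ m, extDeriv (fun z => bic (n := 4) rfl (dφ m ♯z)
      (H ♭z • sDelta m)) z =
      -(pd m H ♭z • bic rfl (dφ m ♯z) vol4) := by
    intro m
    rw [extDeriv_bic (β := fun y => H y • sDelta m) rfl (S.diff_dphi hz.1 m) (S.diff_H_smul hz.2 _),
      S.extDeriv_H_smul_sDelta hz.2,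
      extDeriv_dScalar ((S.reg.phi m).contDiffAt (S.isOpenU.mem_nhds hz.1)), bic_zero_left,
      zero_add, bic_smul_right]
    module
  rw [show 𝐅₄ = _ from funext fun z => uplift_F4_eq H F z, extDeriv_sum_add_smul_sum _ _ d1 d2,
    sum_congr rfl fun m _ => h1 m, sum_congr rfl fun m _ => h2 m, sum_neg_distrib]
  module

lemma wedge_F2_H3 (z : ℝ¹⁰) : wedge (𝐅₂ z) (𝐇 z) =
      (1 / √2) • (∑ m, bic rfl (wedge (F.H0 ♯z) (dφ m ♯z)) (dCoord m) -
        ∑ m, pd m H ♭z • bic rfl (dφ m ♯z) vol4) := by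
  have h1 : ∀ m, wedge (bic (n := 2) rfl (dφ m ♯z) (dCoord m))
      (𝐇 z) =
      bic rfl (wedge (F.H0 ♯z) (dφ m ♯z)) (dCoord m) - pd m H ♭z • bic rfl (dφ m ♯z) vol4 := by
    intro m
    rw [uplift_H3_eq, wedge_add_right, bic_wedge_bic, bic_wedge_bic, bic_wedge_unit_left,
      bic_wedge_unit_right, wedge_neg_right, wedge_starDelta, bic_neg_right, bic_smul_right,
      bic_wedge_comm_left]
    simp only [dScalar_coordVec, dCoord_coordVec]
    ext v
    simp only [Form.smul_apply, Form.neg_apply, Form.sub_apply, Form.add_apply]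
    simp
    ring
  rw [uplift_F2_eq, wedge_smul_left, wedge_sum_left]
  simp only [h1, sum_sub_distrib]

lemma bianchi_F4_sub (S : Uplift) (hz : z ∈ region U Ω) : extDeriv 𝐅₄ z - wedge (𝐅₂ z) (𝐇 z) =
      ∑ m, bic (n := 4 + 1) (by rfl) (extDeriv (F.Hm m) ♯z -
        (1 / √2) • wedge (F.H0 ♯z) (dφ m ♯z)) (dCoord m) := by
  rw [S.extDeriv_F4 hz, wedge_F2_H3, smul_sub]
  simp only [bic_sub_left, bic_smul_left, sum_sub_distrib, ← smul_sum]
  exact sub_sub_sub_cancel_right _ _ _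

lemma H3_wedge_bic {p q n : ℕ} (h : p + q = n) (α : Λ⁶ p) (β : Λ⁴ q) (z : ℝ¹⁰) :
    wedge (𝐇 z) (bic h α β) = -((-1 : ℝ) ^ (3 * p) •
        bic (by omega) α (wedge (starDelta 1 3 rfl (dScalar H ♭z)) β)) +
      bic (by omega) (wedge (F.H0 ♯z) α) β := by
  rw [uplift_H3_eq, wedge_add_left, bic_wedge_bic, bic_wedge_bic, bic_unit_wedge_left,
    bic_unit_wedge_right, wedge_neg_left, bic_neg_right, smul_neg, Nat.zero_mul, pow_zero, one_smul]

lemma H3_wedge_bic_dCoord {p n : ℕ} (h : p + 1 = n) (α : Λ⁶ p) (m : Fin 4) (z : ℝ¹⁰) :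
    wedge (𝐇 z) (bic h α (dCoord m)) = ((-1 : ℝ) ^ p * pd m H ♭z) • bic (by omega) α vol4 +
      bic (by omega) (wedge (F.H0 ♯z) α) (dCoord m) := by
  rw [H3_wedge_bic, starDelta_wedge, bic_neg_right, bic_smul_right]
  congr 1
  have : ((-1 : ℝ) ^ (3 * p)) = (-1) ^ p := by rw [pow_mul]; norm_num
  rw [this, smul_neg, neg_neg, smul_smul]
  simp [dScalar_coordVec, dCoord_coordVec]

lemma H3_wedge_bic_three {p n : ℕ} (h : p + 3 = n) (α : Λ⁶ p) (β : Λ⁴ 3) (z : ℝ¹⁰) :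
    wedge (𝐇 z) (bic h α β) = bic (by omega) (wedge (F.H0 ♯z) α) β := by
  rw [H3_wedge_bic, bic_eq_zero_of_four_lt _ (by norm_num), smul_zero, neg_zero, zero_add]

end UpliftData

namespace UpliftData

lemma eventually_star_F2 (S : Uplift) (hz : z ∈ region U Ω) : (fun w => exp (3 / 2 * 𝚽 w) •
        star10 2 8 rfl (𝐠 w) (𝐅₂ w)) =ᶠ[nhds z]
      fun w => (-(1 / √2)) • ∑ m, bic rfl (exp (-(√2 * F.sigma ♯w)) • ⋆₁ (F.metric ♯w) (dφ m ♯w))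
          (H ♭w • sDelta m) :=
  (S.eventually_region hz).mono fun _ hw => uplift_star_F2 (S.pos _ hw.2) (S.lorentzian hw.1)

lemma extDeriv_star_F2 (S : Uplift) (hz : z ∈ region U Ω) : extDeriv (fun w => exp (3 / 2 * 𝚽 w) •
        star10 2 8 rfl (𝐠 w) (𝐅₂ w)) z =
      (-(1 / √2)) • ∑ m, (H ♭z • bic (n := 8 + 1) (by rfl)
          (extDeriv (fun x => exp (-(√2 * F.sigma x)) • ⋆₁ (F.metric x) (dφ m x)) ♯z) (sDelta m) -
        pd m H ♭z • bic (n := 8 + 1) (by rfl) (exp (-(√2 * F.sigma ♯z)) •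
          ⋆₁ (F.metric ♯z) (dφ m ♯z)) vol4) := by
  rw [(S.eventually_star_F2 hz).extDeriv_eq, extDeriv_const_smul, extDeriv_sum _ fun m _ =>
    DifferentiableAt.bic (α := fun x => exp (-(√2 * F.sigma x)) •
      ⋆₁ (F.metric x) (dφ m x)) (β := fun y => H y • sDelta m) rfl
      (S.diff_star_dphi hz.1 m) (S.diff_H_smul hz.2 _)]
  congr 1
  refine sum_congr rfl fun m _ => ?_
  rw [extDeriv_bic (α := fun x => exp (-(√2 * F.sigma x)) •
      ⋆₁ (F.metric x) (dφ m x)) (β := fun y => H y • sDelta m) rfl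
      (S.diff_star_dphi hz.1 m) (S.diff_H_smul hz.2 _), S.extDeriv_H_smul_sDelta hz.2,
      bic_smul_right, bic_smul_right]
  module

lemma eom_F2_sub (S : Uplift) (hz : z ∈ region U Ω) : extDeriv (fun w => exp (3 / 2 * 𝚽 w) •
        star10 2 8 rfl (𝐠 w) (𝐅₂ w)) z -
      -(exp (1 / 2 * 𝚽 z) • wedge (𝐇 z) (star10 4 6 rfl (𝐠 z) (𝐅₄ z))) =
      (-(1 / √2) * H ♭z) • ∑ m, bic (n := 8 + 1) (by rfl)
          (extDeriv (fun x => exp (-(√2 * F.sigma x)) • ⋆₁ (F.metric x) (dφ m x)) ♯z +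
          √2 • wedge (F.H0 ♯z) (⋆₃ (F.metric ♯z) (F.Hm m ♯z)))
        (sDelta m) := by
  rw [S.extDeriv_star_F2 hz, ← wedge_smul_right, uplift_star_F4 (S.pos _ hz.2) (S.lorentzian hz.1),
    wedge_add_right, wedge_neg_right, wedge_smul_right, wedge_sum_right, wedge_sum_right]
  simp only [H3_wedge_bic_dCoord, H3_wedge_bic_three]
  have h0 : ∀ m, bic (n := 3 + 6) (by rfl) (wedge (F.H0 ♯z)
      (exp (-(√2 * F.sigma ♯z)) • ⋆₁ (F.metric ♯z) (dφ m ♯z))) (dCoord m) = 0 :=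
    fun m => bic_eq_zero_of_six_lt _ (by norm_num) _ _
  ext v
  simp only [h0, add_zero, Form.smul_apply, Form.neg_apply, Form.sub_apply, Form.add_apply,
    Form.sum_apply, bic_add_left, bic_smul_left, bic_smul_right, mul_sum, ← sum_neg_distrib,
    ← sum_add_distrib, ← sum_sub_distrib]
  refine sum_congr rfl fun m _ => ?_
  field_simp
  ring

lemma eventually_star_F4 (S : Uplift) (hz : z ∈ region U Ω) : (fun w => exp (1 / 2 * 𝚽 w) •
        star10 4 6 rfl (𝐠 w) (𝐅₄ w)) =ᶠ[nhds z]
      fun w => ∑ m, -bic rfl (⋆₃ (F.metric ♯w) (F.Hm m ♯w)) (H ♭w • sDelta m) +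
        (1 / √2) • ∑ m, bic rfl (exp (-(√2 * F.sigma ♯w)) •
          ⋆₁ (F.metric ♯w) (dφ m ♯w)) (dCoord m) :=
  (S.eventually_region hz).mono fun _ hw => by
    simp only [uplift_star_F4 (S.pos _ hw.2) (S.lorentzian hw.1), sum_neg_distrib]

lemma extDeriv_star_F4 (S : Uplift) (hz : z ∈ region U Ω) : extDeriv (fun w => exp (1 / 2 * 𝚽 w) •
        star10 4 6 rfl (𝐠 w) (𝐅₄ w)) z =
      ∑ m, (pd m H ♭z • bic (n := 6 + 1) (by rfl)
            (⋆₃ (F.metric ♯z) (F.Hm m ♯z)) vol4 -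
          H ♭z • bic (n := 6 + 1) (by rfl)
            (extDeriv (fun x => ⋆₃ (F.metric x) (F.Hm m x)) ♯z) (sDelta m)) +
        (1 / √2) • ∑ m, bic (n := 6 + 1) (by rfl)
          (extDeriv (fun x => exp (-(√2 * F.sigma x)) •
            ⋆₁ (F.metric x) (dφ m x)) ♯z) (dCoord m) := by
  have d1 : ∀ m, Diff (fun w => bic (n := 6) rfl
      (⋆₃ (F.metric ♯w) (F.Hm m ♯w)) (H ♭w • sDelta m)) z :=
    fun m => DifferentiableAt.bic (α := fun x => ⋆₃ (F.metric x) (F.Hm m x))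
      (β := fun y => H y • sDelta m) rfl (S.diff_star_Hm hz.1 m) (S.diff_H_smul hz.2 _)
  have d2 : ∀ m, Diff (fun w => bic (n := 6) rfl
      (exp (-(√2 * F.sigma ♯w)) • ⋆₁ (F.metric ♯w) (dφ m ♯w)) (dCoord m)) z :=
    fun m => DifferentiableAt.bic (α := fun x => exp (-(√2 * F.sigma x)) •
      ⋆₁ (F.metric x) (dφ m x)) (β := fun _ => dCoord m) rfl
      (S.diff_star_dphi hz.1 m) (differentiableAt_const _)
  rw [(S.eventually_star_F4 hz).extDeriv_eq,
    extDeriv_sum_add_smul_sum _ _ (fun m => (d1 m).fun_neg) d2]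
  have h1 : ∀ m, extDeriv (fun w => -bic (n := 6) rfl
      (⋆₃ (F.metric ♯w) (F.Hm m ♯w)) (H ♭w • sDelta m)) z =
      pd m H ♭z • bic (n := 6 + 1) (by rfl)
            (⋆₃ (F.metric ♯z) (F.Hm m ♯z)) vol4 -
          H ♭z • bic (n := 6 + 1) (by rfl)
            (extDeriv (fun x => ⋆₃ (F.metric x) (F.Hm m x)) ♯z) (sDelta m) := by
    intro m
    rw [extDeriv_neg, extDeriv_bic (α := fun x => ⋆₃ (F.metric x) (F.Hm m x))
      (β := fun y => H y • sDelta m) rfl (S.diff_star_Hm hz.1 m) (S.diff_H_smul hz.2 _),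
      S.extDeriv_H_smul_sDelta hz.2, bic_smul_right, bic_smul_right]
    module
  have h2 : ∀ m, extDeriv (fun w => bic (n := 6) rfl (exp (-(√2 * F.sigma ♯w)) •
          ⋆₁ (F.metric ♯w) (dφ m ♯w)) (dCoord m)) z =
      bic (n := 6 + 1) (by rfl) (extDeriv (fun x => exp (-(√2 * F.sigma x)) •
            ⋆₁ (F.metric x) (dφ m x)) ♯z) (dCoord m) := by
    intro m
    rw [extDeriv_bic (α := fun x => exp (-(√2 * F.sigma x)) •
      ⋆₁ (F.metric x) (dφ m x)) (β := fun _ => dCoord m) rfl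
      (S.diff_star_dphi hz.1 m) (differentiableAt_const _), extDeriv_const, bic_zero_right,
      smul_zero, add_zero]
  rw [sum_congr rfl fun m _ => h1 m, sum_congr rfl fun m _ => h2 m]

lemma eom_F4_sub (S : Uplift) (hz : z ∈ region U Ω) : extDeriv (fun w => exp (1 / 2 * 𝚽 w) •
        star10 4 6 rfl (𝐠 w) (𝐅₄ w)) z -
      -wedge (𝐇 z) (𝐅₄ z) = ∑ m, pd m H ♭z • bic (n := 6 + 1) (by rfl)
            (⋆₃ (F.metric ♯z) (F.Hm m ♯z) - F.Hm m ♯z) vol4 +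
        (-H ♭z) • ∑ m, bic (n := 6 + 1) (by rfl)
            (extDeriv (fun x => ⋆₃ (F.metric x) (F.Hm m x)) ♯z -
              (1 / √2) • wedge (F.H0 ♯z) (dφ m ♯z)) (sDelta m) +
        (1 / √2) • ∑ m, bic (n := 6 + 1) (by rfl)
          (extDeriv (fun x => exp (-(√2 * F.sigma x)) • ⋆₁ (F.metric x) (dφ m x)) ♯z +
            √2 • wedge (F.H0 ♯z) (F.Hm m ♯z)) (dCoord m) := by
  rw [S.extDeriv_star_F4 hz, uplift_F4_eq, wedge_add_right, wedge_smul_right, wedge_sum_right,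
    wedge_sum_right]
  simp only [H3_wedge_bic_dCoord, H3_wedge_bic_three]
  ext v
  simp only [Form.smul_apply, Form.neg_apply, Form.sub_apply, Form.add_apply, Form.sum_apply,
    bic_add_left, bic_sub_left, bic_smul_left, bic_smul_right, mul_sum, ← sum_neg_distrib,
    ← sum_add_distrib, ← sum_sub_distrib]
  refine sum_congr rfl fun m _ => ?_
  field_simp
  ring

lemma extDeriv_smul_dScalar_self (S : Uplift) (hy : y ∈ Ω) :
    extDeriv (fun y => (H y ^ 2)⁻¹ • dScalar H y) y = 0 := by
  have hH : Diff (fun y => (H y ^ 2)⁻¹) y :=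
    ((S.diff_H hy).pow 2).fun_inv (pow_pos (S.pos y hy) 2).ne'
  have hd : Diff (dScalar H) y :=
    (S.smooth.dScalar S.isOpenΩ).differentiableAt_of_isOpen S.isOpenΩ hy
  have h1 : dScalar (fun y => (H y ^ 2)⁻¹) y = (-2 * (H y ^ 3)⁻¹) • dScalar H y := by
    have h2 : HasFDerivAt (fun y => (H y ^ 2)⁻¹) ((-2 * (H y ^ 3)⁻¹) • fderiv ℝ H y) y := by
      have h3 : HasDerivAt (fun t : ℝ => (t ^ 2)⁻¹) (-2 * (H y ^ 3)⁻¹) (H y) := by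
        have h4 := (hasDerivAt_pow 2 (H y)).fun_inv (pow_pos (S.pos y hy) 2).ne'
        refine h4.congr_deriv ?_
        have := (S.pos y hy).ne'
        norm_num
        field_simp
      exact h3.comp_hasFDerivAt y (S.diff_H hy).hasFDerivAt
    ext v
    rw [dScalar_apply, h2.fderiv]
    rfl
  rw [extDeriv_smul_fun hH hd, extDeriv_dScalar (S.smooth.contDiffAt (S.isOpenΩ.mem_nhds hy)), h1,
    wedge_smul_left, wedge_one_self, smul_zero, smul_zero, zero_add]
  rfl

lemma eventually_star_H3 (S : Uplift) (hz : z ∈ region U Ω) : (fun w => exp (-𝚽 w) •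
        star10 3 7 rfl (𝐠 w) (𝐇 w)) =ᶠ[nhds z]
      fun w => bic rfl (exp (-(1 / √2 * F.sigma ♯w)) • star6 0 6 rfl (F.metric ♯w) (unitForm _))
          ((H ♭w ^ 2)⁻¹ • dScalar H ♭w) +
        bic rfl (exp (√2 * F.sigma ♯w) • ⋆₃ (F.metric ♯w) (F.H0 ♯w)) (H ♭w • vol4) :=
  (S.eventually_region hz).mono fun _ hw => uplift_star_H3 (S.pos _ hw.2) (S.lorentzian hw.1)

lemma extDeriv_star_H3 (S : Uplift) (hz : z ∈ region U Ω) : extDeriv (fun w => exp (-𝚽 w) •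
        star10 3 7 rfl (𝐠 w) (𝐇 w)) z =
      H ♭z • bic (n := 7 + 1) (by rfl) (extDeriv (fun x => exp (√2 * F.sigma x) •
          ⋆₃ (F.metric x) (F.H0 x)) ♯z) vol4 := by
  have hH : Diff (fun y => (H y ^ 2)⁻¹ • dScalar H y) ♭z :=
    (((S.diff_H hz.2).pow 2).fun_inv (pow_pos (S.pos _ hz.2) 2).ne').fun_smul
      ((S.smooth.dScalar S.isOpenΩ).differentiableAt_of_isOpen S.isOpenΩ hz.2)
  have e1 := extDeriv_bic (n := 7) (α := fun x => exp (-(1 / √2 * F.sigma x)) •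
    star6 0 6 rfl (F.metric x) (unitForm _)) (β := fun y => (H y ^ 2)⁻¹ • dScalar H y) rfl
    (S.diff_star_unit hz.1 _) hH
  have e2 := extDeriv_bic (n := 7) (α := fun x => exp (√2 * F.sigma x) •
    ⋆₃ (F.metric x) (F.H0 x)) (β := fun y => H y • vol4) rfl
    (S.diff_star_H0 hz.1) (S.diff_H_smul hz.2 _)
  have z1 := form_eq_zero_of_card_lt (by simp) (extDeriv (fun x =>
    exp (-(1 / √2 * F.sigma x)) • star6 0 6 rfl (F.metric x) (unitForm _)) ♯z)
  have z2 := form_eq_zero_of_card_lt (by simp) (extDeriv (fun y => H y • vol4) ♭z)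
  rw [(S.eventually_star_H3 hz).extDeriv_eq, extDeriv_fun_add
    (DifferentiableAt.bic (α := fun x => exp (-(1 / √2 * F.sigma x)) •
      star6 0 6 rfl (F.metric x) (unitForm _)) (β := fun y => (H y ^ 2)⁻¹ • dScalar H y) rfl
      (S.diff_star_unit hz.1 _) hH)
    (DifferentiableAt.bic (α := fun x => exp (√2 * F.sigma x) •
      ⋆₃ (F.metric x) (F.H0 x)) (β := fun y => H y • vol4) rfl
      (S.diff_star_H0 hz.1) (S.diff_H_smul hz.2 _)), e1, e2, z1, z2, S.extDeriv_smul_dScalar_self hz.2,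
    bic_zero_left, bic_zero_right, bic_zero_right, bic_smul_right, smul_zero, smul_zero, add_zero,
    zero_add, add_zero]

end UpliftData

section Products

variable {p n p' n' : ℕ}

lemma wedge_bic_dCoord_sDelta (h : p + 1 = n) (h' : p' + 3 = n') (α : Λ⁶ p)
    (α' : Λ⁶ p') (i j : Fin 4) : wedge (bic h α (dCoord i)) (bic h' α' (sDelta j)) =
      ((-1 : ℝ) ^ p' * if j = i then 1 else 0) • bic (by omega) (wedge α α') vol4 := by
  rw [bic_wedge_bic, wedge_dCoord_sDelta, bic_smul_right, smul_smul, Nat.one_mul]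

lemma wedge_bic_sDelta_dCoord (h : p + 3 = n) (h' : p' + 1 = n') (α : Λ⁶ p)
    (α' : Λ⁶ p') (i j : Fin 4) : wedge (bic h α (sDelta i)) (bic h' α' (dCoord j)) =
      (-(-1 : ℝ) ^ p' * if j = i then 1 else 0) • bic (by omega) (wedge α α') vol4 := by
  have h3 : (-1 : ℝ) ^ (3 * p') = (-1) ^ p' := by rw [pow_mul]; norm_num
  rw [bic_wedge_bic, sDelta, starDelta_wedge, bic_neg_right, bic_smul_right, h3]
  have hij : ∑ k, dCoord j (fun _ => coordVec k) * dCoord i (fun _ => coordVec k) =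
      if j = i then (1 : ℝ) else 0 := by
    simp [dCoord_coordVec, eq_comm]
  rw [hij]
  module

lemma wedge_bic_three_three (h : p + 3 = n) (h' : p' + 3 = n') (α : Λ⁶ p)
    (α' : Λ⁶ p') (β β' : Λ⁴ 3) : wedge (bic h α β) (bic h' α' β') = 0 := by
  rw [bic_wedge_bic, form_eq_zero_of_card_lt (by simp) (wedge β β'), bic_zero_right, smul_zero]

lemma wedge_bic_one_one (h : p + 1 = n) (h' : p' + 1 = n') (α : Λ⁶ p) (α' : Λ⁶ p') (β β' : Λ⁴ 1) :
    wedge (bic h α β) (bic h' α' β') =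
      (-1 : ℝ) ^ p' • bic (by omega) (wedge α α') (wedge β β') := by rw [bic_wedge_bic, Nat.one_mul]

lemma sum_bic_symm_eq_zero (h : p + 2 = n) {X : Fin 4 → Fin 4 → Λ⁶ p} (hX : ∀ i j, X i j = X j i) :
    ∑ i, ∑ j, bic h (X i j) (wedge (dCoord i) (dCoord j)) = 0 := by
  have h1 : ∑ i, ∑ j, bic h (X i j) (wedge (dCoord i) (dCoord j)) =
      -∑ i, ∑ j, bic h (X i j) (wedge (dCoord i) (dCoord j)) := by
    conv_lhs => rw [sum_comm]
    rw [← sum_neg_distrib]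
    refine sum_congr rfl fun i _ => ?_
    rw [← sum_neg_distrib]
    refine sum_congr rfl fun j _ => ?_
    rw [hX j i, wedge_one_comm, bic_neg_right]
  ext v
  have h2 := congrArg (fun θ => θ v) h1
  simp only [Form.neg_apply] at h2
  exact self_eq_neg.1 h2

lemma star6_one_symm {g : Mat₆} (hg : IsLorentzian g) (a b : Λ⁶ p) (h : 6 = p + p') :
    wedge a (star6 p p' h g b) = wedge b (star6 p p' h g a) :=
  wedge_hodge_comm _ hg.transpose_eq _ _

end Products

namespace UpliftData

lemma F2_wedge_star_F4 (S : Uplift) (hz : z ∈ region U Ω) : exp (1 / 2 * 𝚽 z) • wedge (𝐅₂ z)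
        (star10 4 6 rfl (𝐠 z) (𝐅₄ z)) =
      (-(1 / √2 * H ♭z)) • ∑ m, bic (n := 2 + 6) (by rfl)
        (wedge (⋆₃ (F.metric ♯z) (F.Hm m ♯z))
          (dφ m ♯z)) vol4 := by
  rw [← wedge_smul_right, uplift_star_F4 (S.pos _ hz.2) (S.lorentzian hz.1), uplift_F2_eq,
    wedge_smul_left, wedge_add_right, wedge_neg_right, wedge_smul_right]
  have h1 : wedge (∑ m, bic (n := 2) rfl (dφ m ♯z) (dCoord m))
      (∑ m, bic (n := 6) rfl (⋆₃ (F.metric ♯z) (F.Hm m ♯z))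
        (H ♭z • sDelta m)) = H ♭z • ∑ m, bic (n := 2 + 6) (by rfl)
        (wedge (⋆₃ (F.metric ♯z) (F.Hm m ♯z))
          (dφ m ♯z)) vol4 := by
    rw [wedge_sum_left]
    simp only [wedge_sum_right, bic_smul_right, wedge_smul_right, wedge_bic_dCoord_sDelta]
    rw [smul_sum]
    refine sum_congr rfl fun m _ => ?_
    rw [sum_eq_single m (fun k _ hk => by simp [hk]) (by simp), bic_wedge_comm_left]
    ext v
    simp only [Form.smul_apply]
    norm_num
  have h2 : wedge (∑ m, bic (n := 2) rfl (dφ m ♯z) (dCoord m))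
      (∑ m, bic (n := 6) rfl (exp (-(√2 * F.sigma ♯z)) •
          ⋆₁ (F.metric ♯z) (dφ m ♯z)) (dCoord m)) = 0 := by
    rw [wedge_sum_left]
    simp only [wedge_sum_right, bic_smul_left, wedge_smul_right, wedge_bic_one_one]
    simp only [← smul_sum]
    rw [sum_bic_symm_eq_zero _ fun i j => star6_one_symm (S.lorentzian hz.1) _ _ _, smul_zero,
      smul_zero]
  rw [h1, h2]
  module

lemma F4_wedge_F4 (z : ℝ¹⁰) : wedge (𝐅₄ z) (𝐅₄ z) =
      -(∑ i, ∑ j, bic (n := 4 + 4) (by rfl) (wedge (F.Hm i ♯z) (F.Hm j ♯z))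
          (wedge (dCoord i) (dCoord j))) -
        (2 * (1 / √2 * H ♭z)) • ∑ m, bic (n := 4 + 4) (by rfl)
          (wedge (F.Hm m ♯z) (dφ m ♯z)) vol4 := by
  have h1 : wedge (∑ m, bic (n := 4) rfl (F.Hm m ♯z) (dCoord m))
      (∑ m, bic (n := 4) rfl (F.Hm m ♯z) (dCoord m)) =
      -(∑ i, ∑ j, bic (n := 4 + 4) (by rfl) (wedge (F.Hm i ♯z) (F.Hm j ♯z))
          (wedge (dCoord i) (dCoord j))) := by
    rw [wedge_sum_left]
    simp only [wedge_sum_right, wedge_bic_one_one, ← smul_sum]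
    module
  have h2 : wedge (∑ m, bic (n := 4) rfl (F.Hm m ♯z) (dCoord m))
      (∑ m, bic (n := 4) rfl (dφ m ♯z) (H ♭z • sDelta m)) =
      (-H ♭z) • ∑ m, bic (n := 4 + 4) (by rfl)
          (wedge (F.Hm m ♯z) (dφ m ♯z)) vol4 := by
    rw [wedge_sum_left]
    simp only [wedge_sum_right, bic_smul_right, wedge_smul_right, wedge_bic_dCoord_sDelta]
    rw [smul_sum]
    refine sum_congr rfl fun m _ => ?_
    rw [sum_eq_single m (fun k _ hk => by simp [hk]) (by simp)]
    ext v
    simp only [Form.smul_apply]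
    norm_num
  have h3 : wedge (∑ m, bic (n := 4) rfl (dφ m ♯z) (H ♭z • sDelta m))
      (∑ m, bic (n := 4) rfl (F.Hm m ♯z) (dCoord m)) =
      (-H ♭z) • ∑ m, bic (n := 4 + 4) (by rfl)
          (wedge (F.Hm m ♯z) (dφ m ♯z)) vol4 := by
    rw [wedge_sum_left]
    simp only [wedge_sum_right, bic_smul_right, wedge_smul_left, wedge_bic_sDelta_dCoord]
    rw [smul_sum]
    refine sum_congr rfl fun m _ => ?_
    rw [sum_eq_single m (fun k _ hk => by simp [hk]) (by simp), bic_wedge_comm_left]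
    ext v
    simp only [Form.smul_apply]
    norm_num
  have h4 : wedge (∑ m, bic (n := 4) rfl (dφ m ♯z) (H ♭z • sDelta m))
      (∑ m, bic (n := 4) rfl (dφ m ♯z) (H ♭z • sDelta m)) = 0 := by
    rw [wedge_sum_left]
    simp only [wedge_sum_right, wedge_bic_three_three, sum_const_zero]
  rw [uplift_F4_eq, wedge_add_left, wedge_add_right, wedge_add_right, wedge_smul_left,
    wedge_smul_left, wedge_smul_right, wedge_smul_right, h1, h2, h3, h4]
  module

lemma eom_H3_sub (S : Uplift) (hz : z ∈ region U Ω) : extDeriv (fun w => exp (-𝚽 w) •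
        star10 3 7 rfl (𝐠 w) (𝐇 w)) z -
      (exp (1 / 2 * 𝚽 z) • wedge (𝐅₂ z) (star10 4 6 rfl (𝐠 z) (𝐅₄ z)) +
        (1 / 2 : ℝ) • wedge (𝐅₄ z) (𝐅₄ z)) =
      H ♭z • bic (n := 7 + 1) (by rfl) (extDeriv (fun x => exp (√2 * F.sigma x) •
          ⋆₃ (F.metric x) (F.H0 x)) ♯z +
          (1 / √2) • ∑ m, (wedge (⋆₃ (F.metric ♯z) (F.Hm m ♯z))
            (dφ m ♯z) +
            wedge (F.Hm m ♯z) (dφ m ♯z))) vol4 +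
        (1 / 2 : ℝ) • ∑ i, ∑ j, bic (n := 7 + 1) (by rfl)
          (wedge (F.Hm i ♯z) (F.Hm j ♯z)) (wedge (dCoord i) (dCoord j)) := by
  rw [S.extDeriv_star_H3 hz, S.F2_wedge_star_F4 hz, F4_wedge_F4, bic_add_left, bic_smul_left,
    bic_sum_left]
  simp only [bic_add_left, sum_add_distrib]
  module

lemma dScalar_Phi (S : Uplift) (hz : z ∈ region U Ω) : dScalar 𝚽 z =
      bic (n := 1) (by rfl) (unitForm _) ((2 * H ♭z)⁻¹ • dScalar H ♭z) +
        bic (n := 1) (by rfl) ((-(1 / √2)) • dScalar F.sigma ♯z) (unitForm _) := by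
  have hev : 𝚽 =ᶠ[nhds z] fun w =>
      1 / 2 * log (H ♭w) - 1 / √2 * F.sigma ♯w :=
    (S.eventually_region hz).mono fun w hw => uplift_Phi_eq F (S.pos _ hw.2)
  have hσ : Diff F.sigma ♯z := S.reg.sigma.differentiableAt_of_isOpen S.isOpenU hz.1
  have h1 : HasFDerivAt (fun w => 1 / 2 * log (H ♭w) - 1 / √2 * F.sigma ♯w)
      ((1 / 2 : ℝ) • ((H ♭z)⁻¹ • (fderiv ℝ H ♭z).comp projY) -
        (1 / √2) • (fderiv ℝ F.sigma ♯z).comp projX) z := by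
    have a1 : HasFDerivAt (fun w => H ♭w) ((fderiv ℝ H ♭z).comp projY) z :=
      (S.diff_H hz.2).hasFDerivAt.comp z projY.hasFDerivAt
    have a2 : HasFDerivAt (fun w => F.sigma ♯w) ((fderiv ℝ F.sigma ♯z).comp projX) z :=
      hσ.hasFDerivAt.comp z projX.hasFDerivAt
    exact ((a1.log (S.pos _ hz.2).ne').const_mul (1 / 2)).sub (a2.const_mul (1 / √2))
  have e1 : bic (n := 1) (by rfl) (unitForm _) (dScalar H ♭z) =
      pullY (dScalar H ♭z) := (pullY_eq_bic _).symm
  have e2 : bic (n := 1) (by rfl) (dScalar F.sigma ♯z) (unitForm _) =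
      pullX (dScalar F.sigma ♯z) := (pullX_eq_bic _).symm
  rw [bic_smul_right, bic_smul_left, e1, e2]
  ext v
  rw [dScalar_apply, hev.fderiv_eq, h1.fderiv]
  change (1 / 2 : ℝ) * ((H ♭z)⁻¹ * fderiv ℝ H ♭z (projY (v 0))) -
    1 / √2 * fderiv ℝ F.sigma ♯z (projX (v 0)) =
    (2 * H ♭z)⁻¹ * fderiv ℝ H ♭z (projY (v 0)) +
    -(1 / √2) * fderiv ℝ F.sigma ♯z (projX (v 0))
  rw [mul_inv]
  ring

end UpliftData

namespace UpliftData

lemma star_dPhi (S : Uplift) (hz : z ∈ region U Ω) : star10 1 9 rfl (𝐠 z) (dScalar 𝚽 z) =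
      bic (n := 9) (by rfl) (exp (-(1 / √2 * F.sigma ♯z)) •
          star6 0 6 rfl (F.metric ♯z) (unitForm _))
          ((2 * H ♭z)⁻¹ • starDelta 1 3 rfl (dScalar H ♭z)) +
        (-(1 / √2)) • bic (n := 9) (by rfl)
          (⋆₁ (F.metric ♯z) (dScalar F.sigma ♯z))
            (H ♭z • vol4) := by
  have hH := S.pos _ hz.2
  have key1 := uplift_star_bic (n' := 9) hH (S.lorentzian hz.1) (p := 0) (q := 1) (p' := 6)
    (q' := 3) rfl rfl rfl rfl rfl 0 (X := exp (-(1 / √2 * F.sigma ♯z))) (Y := 1)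
    (by congr 1; rw [one_div_sqrt_two]; push_cast; ring)
    (by norm_num) (unitForm _) (dScalar H ♭z)
  have key2 := uplift_star_bic (n' := 9) hH (S.lorentzian hz.1) (p := 1) (q := 0) (p' := 5)
    (q' := 4) rfl rfl rfl rfl rfl 0 (X := 1) (Y := H ♭z)
    (by rw [eq_comm, Real.exp_eq_one_iff]; push_cast; ring)
    (by norm_num [exp_log hH]) (dScalar F.sigma ♯z) (unitForm _)
  simp only [zero_mul, Real.exp_zero, one_smul, pow_zero, Nat.one_mul] at key1 key2
  rw [S.dScalar_Phi hz, star10_add, bic_smul_left, bic_smul_right, star10_smul, star10_smul, key1,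
    key2, starDelta_unit, bic_smul_right _ (2 * H ♭z)⁻¹]
  module

lemma pd_inv_two_mul (S : Uplift) (hy : y ∈ Ω) (m : Fin 4) :
    pd m (fun y => (2 * H y)⁻¹) y = -(2 * H y ^ 2)⁻¹ * pd m H y := by
  have hp := (S.pos y hy).ne'
  have h2 : HasFDerivAt (fun y => (2 * H y)⁻¹) ((-(2 * H y ^ 2)⁻¹) • fderiv ℝ H y) y := by
    have h3 : HasDerivAt (fun t : ℝ => (2 * t)⁻¹) (-(2 * H y ^ 2)⁻¹) (H y) := by
      have h4 := ((hasDerivAt_id (H y)).const_mul 2).fun_inv (mul_ne_zero two_ne_zero hp)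
      refine h4.congr_deriv ?_
      simp only [id]
      field_simp
    exact h3.comp_hasFDerivAt y (S.diff_H hy).hasFDerivAt
  rw [pd, h2.fderiv]
  rfl

lemma extDeriv_star_dPhi (S : Uplift) (hz : z ∈ region U Ω) :
    extDeriv (fun w => star10 1 9 rfl (𝐠 w) (dScalar 𝚽 w)) z =
      (-((2 * H ♭z ^ 2)⁻¹ * ∑ m, pd m H ♭z ^ 2)) • bic (n := 9 + 1) (by rfl)
        (exp (-(1 / √2 * F.sigma ♯z)) • star6 0 6 rfl (F.metric ♯z) (unitForm _)) vol4 +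
        (-(1 / √2) * H ♭z) • bic (n := 9 + 1) (by rfl)
          (extDeriv (fun x => ⋆₁ (F.metric x) (dScalar F.sigma x)) ♯z) vol4 := by
  have hH : Diff (fun y => (2 * H y)⁻¹) ♭z :=
    ((S.diff_H hz.2).const_mul 2).fun_inv (mul_pos two_pos (S.pos _ hz.2)).ne'
  have d1 : Diff (fun w => bic (n := 9) (by rfl)
      (exp (-(1 / √2 * F.sigma ♯w)) • star6 0 6 rfl (F.metric ♯w) (unitForm _))
        ((2 * H ♭w)⁻¹ • starDelta 1 3 rfl (dScalar H ♭w))) z :=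
    DifferentiableAt.bic (α := fun x => exp (-(1 / √2 * F.sigma x)) •
      star6 0 6 rfl (F.metric x) (unitForm _))
      (β := fun y => (2 * H y)⁻¹ • starDelta 1 3 rfl (dScalar H y)) rfl
      (S.diff_star_unit hz.1 _) (hH.fun_smul (S.diff_starDelta_dH hz.2))
  have d2 : Diff (fun w => bic (n := 9) (by rfl)
      (⋆₁ (F.metric ♯w) (dScalar F.sigma ♯w)) (H ♭w • vol4)) z :=
    DifferentiableAt.bic (α := fun x => ⋆₁ (F.metric x) (dScalar F.sigma x))
      (β := fun y => H y • vol4) rfl (S.diff_star_dsigma hz.1) (S.diff_H_smul hz.2 _)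
  have e1 := extDeriv_bic (n := 9) (α := fun x => exp (-(1 / √2 * F.sigma x)) •
      star6 0 6 rfl (F.metric x) (unitForm _))
      (β := fun y => (2 * H y)⁻¹ • starDelta 1 3 rfl (dScalar H y)) rfl
      (S.diff_star_unit hz.1 _) (hH.fun_smul (S.diff_starDelta_dH hz.2))
  have e2 := extDeriv_bic (n := 9) (α := fun x => ⋆₁ (F.metric x) (dScalar F.sigma x))
      (β := fun y => H y • vol4) rfl (S.diff_star_dsigma hz.1) (S.diff_H_smul hz.2 _)
  have z1 := form_eq_zero_of_card_lt (by simp) (extDeriv (fun x =>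
    exp (-(1 / √2 * F.sigma x)) • star6 0 6 rfl (F.metric x) (unitForm _)) ♯z)
  have z2 := form_eq_zero_of_card_lt (by simp) (extDeriv (fun y => H y • vol4) ♭z)
  have hsum : ∑ m, (pd m (fun y => (2 * H y)⁻¹) ♭z * pd m H ♭z + (2 * H ♭z)⁻¹ * pd m (pd m H) ♭z) =
      -((2 * H ♭z ^ 2)⁻¹ * ∑ m, pd m H ♭z ^ 2) := by
    rw [sum_add_distrib, ← mul_sum, S.harm _ hz.2, mul_zero, add_zero, mul_sum, ← sum_neg_distrib]
    refine sum_congr rfl fun m _ => ?_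
    rw [S.pd_inv_two_mul hz.2]
    ring
  have hev := (S.eventually_region hz).mono fun w hw => S.star_dPhi hw
  rw [Filter.EventuallyEq.extDeriv_eq hev, extDeriv_fun_add d1 (d2.fun_const_smul _),
    extDeriv_const_smul, e1, e2, z1, z2, extDeriv_smul_starDelta S.isOpenΩ hz.2 hH S.smooth, hsum,
    bic_zero_left, bic_zero_right, bic_smul_right _ (-((2 * H ♭z ^ 2)⁻¹ * _)),
    bic_smul_right _ (H ♭z), smul_zero, add_zero, zero_add]
  module

lemma H3_wedge_star_H3 (S : Uplift) (hz : z ∈ region U Ω) : exp (-𝚽 z) • wedge (𝐇 z)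
        (star10 3 7 rfl (𝐠 z) (𝐇 z)) =
      ((H ♭z ^ 2)⁻¹ * ∑ m, pd m H ♭z ^ 2) • bic (n := 3 + 7) (by rfl)
        (exp (-(1 / √2 * F.sigma ♯z)) • star6 0 6 rfl (F.metric ♯z) (unitForm _)) vol4 +
        (H ♭z * exp (√2 * F.sigma ♯z)) • bic (n := 3 + 7) (by rfl)
          (wedge (F.H0 ♯z) (⋆₃ (F.metric ♯z) (F.H0 ♯z))) vol4 := by
  have z1 := form_eq_zero_of_card_lt (by simp) (wedge (F.H0 ♯z)
    (exp (-(1 / √2 * F.sigma ♯z)) • star6 0 6 rfl (F.metric ♯z) (unitForm _)))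
  have z2 := form_eq_zero_of_card_lt (by simp) (wedge (starDelta 1 3 rfl (dScalar H ♭z))
    (H ♭z • vol4))
  rw [← wedge_smul_right, uplift_star_H3 (S.pos _ hz.2) (S.lorentzian hz.1), wedge_add_right,
    H3_wedge_bic, H3_wedge_bic, z1, z2, wedge_smul_right, wedge_smul_right, starDelta_wedge,
    bic_zero_left, bic_zero_right, smul_zero, add_zero, neg_zero, zero_add]
  simp only [dScalar_coordVec, ← sq, bic_smul_right, bic_smul_left, bic_neg_right]
  module

lemma F2_wedge_star_F2 (S : Uplift) (hz : z ∈ region U Ω) : exp (3 / 2 * 𝚽 z) • wedge (𝐅₂ z)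
        (star10 2 8 rfl (𝐠 z) (𝐅₂ z)) =
      (1 / 2 * H ♭z * exp (-(√2 * F.sigma ♯z))) • ∑ m, bic (n := 2 + 8) (by rfl)
          (wedge (dφ m ♯z)
            (⋆₁ (F.metric ♯z) (dφ m ♯z))) vol4 := by
  rw [← wedge_smul_right, uplift_star_F2 (S.pos _ hz.2) (S.lorentzian hz.1), uplift_F2_eq,
    wedge_smul_left, wedge_smul_right, wedge_sum_left, smul_sum, smul_sum, smul_sum]
  refine sum_congr rfl fun m _ => ?_
  rw [wedge_sum_right]
  simp only [bic_smul_right, bic_smul_left, wedge_smul_right, wedge_bic_dCoord_sDelta]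
  rw [sum_eq_single m (fun k _ hk => by simp [hk]) (by simp)]
  have hs : √2 * √2 = 2 := mul_self_sqrt (by norm_num)
  ext v
  simp only [Form.smul_apply, if_true]
  field_simp
  rw [sq, hs]
  ring

lemma F4_wedge_star_F4 (S : Uplift) (hz : z ∈ region U Ω) : exp (1 / 2 * 𝚽 z) • wedge (𝐅₄ z)
        (star10 4 6 rfl (𝐠 z) (𝐅₄ z)) =
      H ♭z • ∑ m, bic (n := 4 + 6) (by rfl) (wedge (F.Hm m ♯z)
            (⋆₃ (F.metric ♯z) (F.Hm m ♯z))) vol4 +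
      (1 / 2 * H ♭z * exp (-(√2 * F.sigma ♯z))) • ∑ m, bic (n := 4 + 6) (by rfl)
          (wedge (dφ m ♯z)
            (⋆₁ (F.metric ♯z) (dφ m ♯z))) vol4 := by
  have h1 : wedge (∑ m, bic (n := 4) rfl (F.Hm m ♯z) (dCoord m))
      (∑ m, bic (n := 6) rfl (⋆₃ (F.metric ♯z) (F.Hm m ♯z))
        (H ♭z • sDelta m)) = (-H ♭z) • ∑ m, bic (n := 4 + 6) (by rfl)
          (wedge (F.Hm m ♯z) (⋆₃ (F.metric ♯z) (F.Hm m ♯z))) vol4 := by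
    rw [wedge_sum_left]
    simp only [wedge_sum_right, bic_smul_right, wedge_smul_right, wedge_bic_dCoord_sDelta]
    rw [smul_sum]
    refine sum_congr rfl fun m _ => ?_
    rw [sum_eq_single m (fun k _ hk => by simp [hk]) (by simp)]
    ext v
    simp only [Form.smul_apply]
    norm_num
  have h2 : wedge (∑ m, bic (n := 4) rfl (F.Hm m ♯z) (dCoord m))
      (∑ m, bic (n := 6) rfl (exp (-(√2 * F.sigma ♯z)) •
          ⋆₁ (F.metric ♯z) (dφ m ♯z)) (dCoord m)) = 0 := by
    rw [wedge_sum_left]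
    simp only [wedge_sum_right, bic_smul_left, wedge_smul_right, wedge_bic_one_one]
    refine sum_eq_zero fun i _ => sum_eq_zero fun j _ => ?_
    rw [bic_eq_zero_of_six_lt _ (by norm_num), smul_zero, smul_zero]
  have h3 : wedge (∑ m, bic (n := 4) rfl (dφ m ♯z) (H ♭z • sDelta m))
      (∑ m, bic (n := 6) rfl (⋆₃ (F.metric ♯z) (F.Hm m ♯z))
        (H ♭z • sDelta m)) = 0 := by
    rw [wedge_sum_left]
    simp only [wedge_sum_right, wedge_bic_three_three, sum_const_zero]
  have h4 : wedge (∑ m, bic (n := 4) rfl (dφ m ♯z) (H ♭z • sDelta m))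
      (∑ m, bic (n := 6) rfl (exp (-(√2 * F.sigma ♯z)) • ⋆₁ (F.metric ♯z) (dφ m ♯z)) (dCoord m)) =
      (H ♭z * exp (-(√2 * F.sigma ♯z))) • ∑ m, bic (n := 4 + 6) (by rfl)
          (wedge (dφ m ♯z)
            (⋆₁ (F.metric ♯z) (dφ m ♯z))) vol4 := by
    rw [wedge_sum_left]
    simp only [wedge_sum_right, bic_smul_left, bic_smul_right, wedge_smul_left, wedge_smul_right,
      wedge_bic_sDelta_dCoord]
    rw [smul_sum]
    refine sum_congr rfl fun m _ => ?_
    rw [sum_eq_single m (fun k _ hk => by simp [hk]) (by simp)]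
    ext v
    simp only [Form.smul_apply]
    norm_num
    ring
  rw [← wedge_smul_right, uplift_star_F4 (S.pos _ hz.2) (S.lorentzian hz.1), uplift_F4_eq,
    wedge_add_left, wedge_add_right, wedge_add_right, wedge_neg_right, wedge_neg_right,
    wedge_smul_left, wedge_smul_left, wedge_smul_right, wedge_smul_right, h1, h2, h3, h4]
  have hs : √2 * √2 = 2 := mul_self_sqrt (by norm_num)
  ext v
  simp only [Form.smul_apply, Form.add_apply, Form.neg_apply, smul_zero, neg_zero, add_zero,
    zero_add]
  field_simp
  rw [sq, hs]
  ring

lemma eom_Phi_sub (S : Uplift) (hz : z ∈ region U Ω) :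
    extDeriv (fun w => star10 1 9 rfl (𝐠 w) (dScalar 𝚽 w)) z - (-((1 / 2 * exp (-𝚽 z)) •
          wedge (𝐇 z) (star10 3 7 rfl (𝐠 z) (𝐇 z))) +
        (3 / 4 * exp (3 / 2 * 𝚽 z)) • wedge (𝐅₂ z) (star10 2 8 rfl (𝐠 z) (𝐅₂ z)) +
        (1 / 4 * exp (1 / 2 * 𝚽 z)) • wedge (𝐅₄ z) (star10 4 6 rfl (𝐠 z) (𝐅₄ z))) =
      (-(1 / √2) * H ♭z) • bic (n := 9 + 1) (by rfl)
        ((extDeriv (fun x => ⋆₁ (F.metric x) (dScalar F.sigma x)) ♯z +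
      (1 / √2 * exp (-(√2 * F.sigma ♯z))) • ∑ m, wedge (dφ m ♯z)
          (⋆₁ (F.metric ♯z) (dφ m ♯z)) -
      (1 / √2 * exp (√2 * F.sigma ♯z)) • wedge (F.H0 ♯z) (⋆₃ (F.metric ♯z) (F.H0 ♯z))) +
      (√2 / 4) • ∑ m, wedge (F.Hm m ♯z)
            (⋆₃ (F.metric ♯z) (F.Hm m ♯z))) vol4 := by
  have e1 := S.H3_wedge_star_H3 hz
  have e2 := S.F2_wedge_star_F2 hz
  have e3 := S.F4_wedge_star_F4 hz
  have hs : √2 ^ 2 = 2 := sq_sqrt (by norm_num)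
  rw [S.extDeriv_star_dPhi hz, mul_smul (1 / 2 : ℝ), mul_smul (3 / 4 : ℝ), mul_smul (1 / 4 : ℝ), e1,
    e2, e3, bic_add_left, bic_sub_left, bic_add_left, bic_smul_left _ (√2 / 4),
    bic_smul_left _ (1 / √2 * _), bic_smul_left _ (1 / √2 * _), bic_sum_left, bic_sum_left]
  ext v
  simp only [Form.smul_apply, Form.add_apply, Form.neg_apply, Form.sub_apply]
  have hH := (S.pos _ hz.2).ne'
  field_simp
  ring_nf
  simp only [hs]
  ring

end UpliftData

lemma star6_smul {p q : ℕ} (h : 6 = p + q) (g : Mat₆) (c : ℝ)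
    (a : Λ⁶ p) : star6 p q h g (c • a) = c • star6 p q h g a := hodge_smul _ _ _ _

namespace UpliftData

lemma bianchi_F4_iff (S : Uplift) (hz : z ∈ region U Ω) : extDeriv 𝐅₄ z = wedge (𝐅₂ z) (𝐇 z) ↔
      ∀ m, extDeriv (F.Hm m) ♯z = (1 / √2) • wedge (F.H0 ♯z) (dφ m ♯z) := by
  rw [← sub_eq_zero, S.bianchi_F4_sub hz]
  constructor
  · intro h m
    exact sub_eq_zero.1 (bic_sum_dCoord_eq_zero _ h m)
  · intro h
    refine sum_eq_zero fun m _ => ?_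
    rw [h m, sub_self, bic_zero_left]

lemma eom_F2_iff (S : Uplift) (hSD : F.SelfDual U) (hz : z ∈ region U Ω) :
    extDeriv (fun w => exp (3 / 2 * 𝚽 w) • star10 2 8 rfl (𝐠 w) (𝐅₂ w)) z =
      -(exp (1 / 2 * 𝚽 z) • wedge (𝐇 z) (star10 4 6 rfl (𝐠 z) (𝐅₄ z))) ↔
      ∀ m, extDeriv (fun x => exp (-(√2 * F.sigma x)) • ⋆₁ (F.metric x) (dφ m x)) ♯z +
          √2 • wedge (F.H0 ♯z) (F.Hm m ♯z) = 0 := by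
  rw [← sub_eq_zero, S.eom_F2_sub hz]
  simp only [← hSD _ _ hz.1]
  have hH := (S.pos _ hz.2).ne'
  constructor
  · intro h m
    have hc : -(1 / √2) * H ♭z ≠ 0 := by
      have : √2 ≠ 0 := by positivity
      simp [hH]
    exact bic_sum_sDelta_eq_zero _ ((smul_eq_zero.1 h).resolve_left hc) m
  · intro h
    rw [sum_eq_zero fun m _ => ?_, smul_zero]
    rw [h m, bic_zero_left]

lemma eom_F4_of (S : Uplift) (hSD : F.SelfDual U) (hz : z ∈ region U Ω)
    (hB : ∀ m, extDeriv (F.Hm m) ♯z = (1 / √2) • wedge (F.H0 ♯z) (dφ m ♯z))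
    (hφ : ∀ m, extDeriv (fun x => exp (-(√2 * F.sigma x)) • ⋆₁ (F.metric x) (dφ m x)) ♯z +
          √2 • wedge (F.H0 ♯z) (F.Hm m ♯z) = 0) :
    extDeriv (fun w => exp (1 / 2 * 𝚽 w) • star10 4 6 rfl (𝐠 w) (𝐅₄ w)) z =
      -wedge (𝐇 z) (𝐅₄ z) := by
  rw [← sub_eq_zero, S.eom_F4_sub hz]
  have hd : ∀ m, extDeriv (fun x => ⋆₃ (F.metric x) (F.Hm m x)) ♯z =
      extDeriv (F.Hm m) ♯z := fun m => Filter.EventuallyEq.extDeriv_eq <|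
    Filter.eventually_of_mem (S.isOpenU.mem_nhds hz.1) fun w hw => (hSD m w hw).symm
  have h1 : ∀ m, ⋆₃ (F.metric ♯z) (F.Hm m ♯z) - F.Hm m ♯z = 0 :=
    fun m => sub_eq_zero.2 (hSD m _ hz.1).symm
  simp only [hd, hB, hφ, h1, sub_self, bic_zero_left, smul_zero, sum_const_zero, add_zero]

lemma selfDual_of_eom_F4 (S : Uplift) (hiso : ∀ c : ℝ⁴, (∀ y ∈ Ω, ∑ m, c m * pd m H y = 0) → c = 0)
    (h : ∀ z ∈ region U Ω, extDeriv (fun w => exp (1 / 2 * 𝚽 w) • star10 4 6 rfl (𝐠 w) (𝐅₄ w)) z =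
      -wedge (𝐇 z) (𝐅₄ z)) : F.SelfDual U := by
  intro m x hx
  ext u
  have key := hiso (fun m => (⋆₃ (F.metric x) (F.Hm m x) - F.Hm m x) u) fun y hy => by
    have hz : Sum.elim x y ∈ region U Ω := ⟨hx, hy⟩
    have h1 := h _ hz
    have hX : projX (Sum.elim x y) = x := rfl
    have hY : projY (Sum.elim x y) = y := rfl
    rw [← sub_eq_zero, S.eom_F4_sub hz, hX, hY] at h1
    have h2 := congrArg (fun θ => comp 3 4 rfl θ u fun k => coordVec k) h1
    simp only [comp_add, comp_smul, comp_sum, comp_zero, comp_bic, vol4_self, mul_one] at h2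
    have h3 : ∀ (α : Λ⁶ (3 + 1)) (β : Λ⁴ 3),
        comp 3 4 rfl (bic (n := 6 + 1) (by rfl) α β) u (fun k => coordVec k) = 0 :=
      fun α β => comp_bic_of_ne _ _ (by norm_num) α β _ _
    have h4 : ∀ (α : Λ⁶ (5 + 1)) (β : Λ⁴ 1),
        comp 3 4 rfl (bic (n := 6 + 1) (by rfl) α β) u (fun k => coordVec k) = 0 :=
      fun α β => comp_bic_of_ne _ _ (by norm_num) α β _ _
    simp only [h3, h4] at h2
    simp only [sum_const_zero, mul_zero, add_zero] at h2
    simpa only [mul_comm] using h2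
  have := congrFun key m
  simp only [Form.sub_apply, Pi.zero_apply] at this
  linarith

lemma wedge_selfDual (hSD : F.SelfDual U) (S : Uplift) (hx : x ∈ U) (i j : Fin 4) :
    wedge (F.Hm i x) (F.Hm j x) = 0 := by
  have h1 : wedge (F.Hm i x) (F.Hm j x) = wedge (F.Hm j x) (F.Hm i x) := by
    conv_lhs => rw [hSD j x hx]
    rw [star6_one_symm (S.lorentzian hx), ← hSD i x hx]
  have h2 := wedge_three_three (F.Hm i x) (F.Hm j x)
  rw [← h1] at h2
  ext v
  have h3 := congrArg (fun θ => θ v) h2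
  simp only [Form.neg_apply] at h3
  exact self_eq_neg.1 h3

lemma eom_H3_iff (S : Uplift) (hSD : F.SelfDual U) (hz : z ∈ region U Ω) :
    extDeriv (fun w => exp (-𝚽 w) • star10 3 7 rfl (𝐠 w) (𝐇 w)) z = exp (1 / 2 * 𝚽 z) • wedge (𝐅₂ z)
        (star10 4 6 rfl (𝐠 z) (𝐅₄ z)) + (1 / 2 : ℝ) • wedge (𝐅₄ z) (𝐅₄ z) ↔
      extDeriv (fun x => exp (√2 * F.sigma x) • ⋆₃ (F.metric x) (F.H0 x)) ♯z +
        √2 • ∑ m, wedge (F.Hm m ♯z) (dφ m ♯z) = 0 := by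
  rw [← sub_eq_zero, S.eom_H3_sub hz]
  have hH := (S.pos _ hz.2).ne'
  have h1 : (1 / √2) • ∑ m, (wedge (F.Hm m ♯z) (dφ m ♯z) + wedge (F.Hm m ♯z) (dφ m ♯z)) =
      √2 • ∑ m, wedge (F.Hm m ♯z) (dφ m ♯z) := by
    rw [sum_add_distrib]
    have hs : √2 ^ 2 = 2 := sq_sqrt (by norm_num)
    ext v
    simp only [Form.smul_apply, Form.add_apply]
    field_simp
    rw [hs]
    ring
  simp only [wedge_selfDual hSD S hz.1, bic_zero_left, sum_const_zero, smul_zero, add_zero,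
    ← hSD _ _ hz.1, h1]
  constructor
  · intro h
    exact bic_vol4_eq_zero _ ((smul_eq_zero.1 h).resolve_left hH)
  · intro h
    rw [h, bic_zero_left, smul_zero]

lemma eom_Phi_iff (S : Uplift) (hSD : F.SelfDual U) (hz : z ∈ region U Ω) :
    extDeriv (fun w => star10 1 9 rfl (𝐠 w) (dScalar 𝚽 w)) z = -((1 / 2 * exp (-𝚽 z)) •
          wedge (𝐇 z) (star10 3 7 rfl (𝐠 z) (𝐇 z))) +
        (3 / 4 * exp (3 / 2 * 𝚽 z)) • wedge (𝐅₂ z) (star10 2 8 rfl (𝐠 z) (𝐅₂ z)) +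
        (1 / 4 * exp (1 / 2 * 𝚽 z)) • wedge (𝐅₄ z) (star10 4 6 rfl (𝐠 z) (𝐅₄ z)) ↔
      extDeriv (fun x => ⋆₁ (F.metric x) (dScalar F.sigma x)) ♯z +
      (1 / √2 * exp (-(√2 * F.sigma ♯z))) • ∑ m, wedge (dφ m ♯z) (⋆₁ (F.metric ♯z) (dφ m ♯z)) -
      (1 / √2 * exp (√2 * F.sigma ♯z)) • wedge (F.H0 ♯z) (⋆₃ (F.metric ♯z) (F.H0 ♯z)) = 0 := by
  rw [← sub_eq_zero, S.eom_Phi_sub hz]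
  have hH := (S.pos _ hz.2).ne'
  have hc : -(1 / √2) * H ♭z ≠ 0 := by
    have : √2 ≠ 0 := by positivity
    simp [hH]
  have h1 : ∀ m, wedge (F.Hm m ♯z)
      (⋆₃ (F.metric ♯z) (F.Hm m ♯z)) = 0 := fun m => by
    rw [← hSD m _ hz.1, wedge_selfDual hSD S hz.1]
  simp only [h1, sum_const_zero, smul_zero, add_zero]
  constructor
  · intro h
    exact bic_vol4_eq_zero _ ((smul_eq_zero.1 h).resolve_left hc)
  · intro h
    rw [h, bic_zero_left, smul_zero]

end UpliftData

section PartialDerivatives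

lemma pd_comp_projX_inl {f : ℝ⁶ → ℝ} {z : ℝ¹⁰} (μ : Fin 6) (hf : Diff f ♯z) :
    pd (inl μ) (fun z => f ♯z) z = pd μ f ♯z := by
  have h := (hf.hasFDerivAt.comp z projX.hasFDerivAt).fderiv
  change fderiv ℝ (f ∘ projX) z _ = _
  rw [h, ← inlVec_coordVec]
  rfl

lemma pd_comp_projX_inr {f : ℝ⁶ → ℝ} {z : ℝ¹⁰} (m : Fin 4) (hf : Diff f ♯z) :
    pd (inr m) (fun z => f ♯z) z = 0 := by
  have h := (hf.hasFDerivAt.comp z projX.hasFDerivAt).fderiv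
  change fderiv ℝ (f ∘ projX) z _ = _
  rw [h, ← inrVec_coordVec]
  exact map_zero (fderiv ℝ f ♯z)

lemma pd_comp_projY_inl {f : ℝ⁴ → ℝ} {z : ℝ¹⁰} (μ : Fin 6) (hf : Diff f ♭z) :
    pd (inl μ) (fun z => f ♭z) z = 0 := by
  have h := (hf.hasFDerivAt.comp z projY.hasFDerivAt).fderiv
  change fderiv ℝ (f ∘ projY) z _ = _
  rw [h, ← inlVec_coordVec]
  exact map_zero (fderiv ℝ f ♭z)

lemma pd_comp_projY_inr {f : ℝ⁴ → ℝ} {z : ℝ¹⁰} (m : Fin 4) (hf : Diff f ♭z) :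
    pd (inr m) (fun z => f ♭z) z = pd m f ♭z := by
  have h := (hf.hasFDerivAt.comp z projY.hasFDerivAt).fderiv
  change fderiv ℝ (f ∘ projY) z _ = _
  rw [h, ← inrVec_coordVec]
  rfl

variable {f : ℝ⁶ → ℝ} {k : ℝ⁴ → ℝ}

lemma pd_mul_inl (hf : Diff f ♯z) (hk : Diff k ♭z)
    (μ : Fin 6) : pd (inl μ) (fun z => f ♯z * k ♭z) z = pd μ f ♯z * k ♭z := by
  have hf' : Diff (fun z => f ♯z) z := hf.comp z projX.differentiableAt
  have hk' : Diff (fun z => k ♭z) z := hk.comp z projY.differentiableAt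
  rw [pd_mul hf' hk']
  rw [pd_comp_projX_inl μ hf, pd_comp_projY_inl μ hk, mul_zero, add_zero]

lemma pd_mul_inr (hf : Diff f ♯z) (hk : Diff k ♭z)
    (m : Fin 4) : pd (inr m) (fun z => f ♯z * k ♭z) z = f ♯z * pd m k ♭z := by
  have hf' : Diff (fun z => f ♯z) z := hf.comp z projX.differentiableAt
  have hk' : Diff (fun z => k ♭z) z := hk.comp z projY.differentiableAt
  rw [pd_mul hf' hk']
  rw [pd_comp_projX_inr m hf, pd_comp_projY_inr m hk, zero_mul, zero_add]

lemma pd_const (i : ι) (c : ℝ) (x : ι → ℝ) : pd i (fun _ => c) x = 0 := by simp [pd]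

lemma pd_congr {f f' : (ι → ℝ) → ℝ} {x : ι → ℝ}
    (h : f =ᶠ[nhds x] f') (i : ι) : pd i f x = pd i f' x := by rw [pd, pd, h.fderiv_eq]

lemma pd_exp_mul {f : (ι → ℝ) → ℝ} {x : ι → ℝ} (hf : Diff f x) (c : ℝ) (i : ι) :
    pd i (fun x => exp (c * f x)) x = c * pd i f x * exp (c * f x) := by
  have h := ((hf.hasFDerivAt.const_mul c).exp).fderiv
  rw [pd, h]
  change exp (c * f x) * (c * pd i f x) = _
  ring

lemma pd_rpow {f : (ι → ℝ) → ℝ} {x : ι → ℝ} (hf : Diff f x) (hx : 0 < f x) (r : ℝ) (i : ι) :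
    pd i (fun x => f x ^ r) x = r * (pd i f x / f x) * f x ^ r := by
  have h := (hf.hasFDerivAt.rpow_const (p := r) (Or.inl hx.ne')).fderiv
  rw [pd, h]
  change (r * f x ^ (r - 1)) * pd i f x = _
  rw [Real.rpow_sub_one hx.ne']
  ring

end PartialDerivatives

/-- `∂_μ s` for `s = σ / (4 √2)`. -/
def sDown (F : SixFields) (μ : Fin 6) (x : ℝ⁶) : ℝ := 1 / (2 * √2) / 2 * pd μ F.sigma x

/-- `∂^μ s` for `s = σ / (4 √2)`. -/
def sUp (F : SixFields) (μ : Fin 6) (x : ℝ⁶) : ℝ := ∑ ρ, (F.metric x)⁻¹ μ ρ * sDown F ρ x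

/-- `∂_m h` for `h = (log H) / 8`. -/
def hDown (H : ℝ⁴ → ℝ) (m : Fin 4) (y : ℝ⁴) : ℝ := pd m H y / (8 * H y)

namespace UpliftData

lemma diff_sigma (S : Uplift) (hx : x ∈ U) : Diff F.sigma x :=
  S.reg.sigma.differentiableAt_of_isOpen S.isOpenU hx

lemma diff_metric (S : Uplift) (hx : x ∈ U) (μ ν : Fin 6) : Diff (fun x => F.metric x μ ν) x :=
  (S.reg.metric.1 μ ν).differentiableAt_of_isOpen S.isOpenU hx

lemma metric_symm (S : Uplift) (hx : x ∈ U) (μ ν : Fin 6) : F.metric x μ ν = F.metric x ν μ :=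
  congrFun (congrFun (S.lorentzian hx).transpose_eq ν) μ

lemma sum_inv_mul (S : Uplift) (hx : x ∈ U) (μ ν : Fin 6) :
    ∑ ρ, (F.metric x)⁻¹ μ ρ * F.metric x ρ ν = if μ = ν then 1 else 0 := by
  have h := Matrix.nonsing_inv_mul (F.metric x)
    (isUnit_iff_ne_zero.2 (S.lorentzian hx).det_neg.ne)
  have := congrFun (congrFun h μ) ν
  rwa [Matrix.mul_apply, Matrix.one_apply] at this

lemma sum_inv_mul' (S : Uplift) (hx : x ∈ U) (μ ν : Fin 6) :
    ∑ ρ, (F.metric x)⁻¹ μ ρ * F.metric x ν ρ = if μ = ν then 1 else 0 := by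
  simp only [S.metric_symm hx ν]
  exact S.sum_inv_mul hx μ ν

lemma diff_rpow (S : Uplift) (hy : y ∈ Ω) (r : ℝ) : Diff (fun y => H y ^ r) y :=
  (S.diff_H hy).rpow_const (Or.inl (S.pos y hy).ne')

lemma pd_metric_inl_inl_inl (S : Uplift) (hz : z ∈ region U Ω) (ρ μ ν : Fin 6) :
    pd (inl ρ) (fun z => 𝐠 z (inl μ) (inl ν)) z =
      (H ♭z ^ (-(1 / 4) : ℝ) * exp (-(1 / (2 * √2) * F.sigma ♯z))) *
        (pd ρ (fun x => F.metric x μ ν) ♯z - 2 * sDown F ρ ♯z * F.metric ♯z μ ν) := by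
  have h : (fun z => 𝐠 z (inl μ) (inl ν)) = fun z =>
      (fun x => exp ((-(1 / (2 * √2))) * F.sigma x) * F.metric x μ ν) ♯z *
        (fun y => H y ^ (-(1 / 4) : ℝ)) ♭z := by
    funext z
    change H ♭z ^ (-(1 / 4) : ℝ) * exp (-(1 / (2 * √2) * F.sigma ♯z)) * F.metric ♯z μ ν = _
    rw [← neg_mul]
    ring
  have hd : Diff (fun x => exp ((-(1 / (2 * √2))) * F.sigma x)) ♯z :=
    ((S.diff_sigma hz.1).const_mul _).exp
  rw [h, pd_mul_inl (hd.fun_mul (S.diff_metric hz.1 μ ν)) (S.diff_rpow hz.2 _),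
    pd_mul hd (S.diff_metric hz.1 μ ν), pd_exp_mul (S.diff_sigma hz.1), sDown, ← neg_mul]
  ring

lemma pd_metric_inr_inl_inl (S : Uplift) (hz : z ∈ region U Ω) (m : Fin 4) (μ ν : Fin 6) :
    pd (inr m) (fun z => 𝐠 z (inl μ) (inl ν)) z =
      (H ♭z ^ (-(1 / 4) : ℝ) * exp (-(1 / (2 * √2) * F.sigma ♯z))) *
        (-2 * hDown H m ♭z * F.metric ♯z μ ν) := by
  have h : (fun z => 𝐠 z (inl μ) (inl ν)) = fun z =>
      (fun x => exp ((-(1 / (2 * √2))) * F.sigma x) * F.metric x μ ν) ♯z *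
        (fun y => H y ^ (-(1 / 4) : ℝ)) ♭z := by
    funext z
    change H ♭z ^ (-(1 / 4) : ℝ) * exp (-(1 / (2 * √2) * F.sigma ♯z)) * F.metric ♯z μ ν = _
    rw [← neg_mul]
    ring
  have hd : Diff (fun x => exp ((-(1 / (2 * √2))) * F.sigma x)) ♯z :=
    ((S.diff_sigma hz.1).const_mul _).exp
  rw [h, pd_mul_inr (hd.fun_mul (S.diff_metric hz.1 μ ν)) (S.diff_rpow hz.2 _),
    pd_rpow (S.diff_H hz.2) (S.pos _ hz.2), hDown, ← neg_mul]
  have := (S.pos _ hz.2).ne'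
  field_simp
  ring

lemma metric_inr_inr (z : ℝ¹⁰) (m n : Fin 4) : 𝐠 z (inr m) (inr n) =
      (fun x => δ[m,n] * exp ((1 / (2 * √2)) * F.sigma x)) ♯z *
        (fun y => H y ^ (3 / 4 : ℝ)) ♭z := by
  change (H ♭z ^ (3 / 4 : ℝ) * exp (1 / (2 * √2) * F.sigma ♯z)) *
    (1 : Matrix (Fin 4) (Fin 4) ℝ) m n = _
  rw [Matrix.one_apply]
  ring

lemma pd_metric_inl_inr_inr (S : Uplift) (hz : z ∈ region U Ω) (ρ : Fin 6) (m n : Fin 4) :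
    pd (inl ρ) (fun z => 𝐠 z (inr m) (inr n)) z =
      (H ♭z ^ (3 / 4 : ℝ) * exp (1 / (2 * √2) * F.sigma ♯z)) *
        (2 * sDown F ρ ♯z * if m = n then 1 else 0) := by
  have hd : Diff (fun x => exp ((1 / (2 * √2)) * F.sigma x)) ♯z :=
    ((S.diff_sigma hz.1).const_mul _).exp
  rw [show (fun z => 𝐠 z (inr m) (inr n)) = _ from funext fun z => metric_inr_inr z m n,
    pd_mul_inl (hd.const_mul _) (S.diff_rpow hz.2 _), pd_mul (differentiableAt_const _) hd,
    pd_exp_mul (S.diff_sigma hz.1), pd_const, sDown]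
  ring

lemma pd_metric_inr_inr_inr (S : Uplift) (hz : z ∈ region U Ω) (p m n : Fin 4) :
    pd (inr p) (fun z => 𝐠 z (inr m) (inr n)) z =
      (H ♭z ^ (3 / 4 : ℝ) * exp (1 / (2 * √2) * F.sigma ♯z)) *
        (6 * hDown H p ♭z * if m = n then 1 else 0) := by
  have hd : Diff (fun x => exp ((1 / (2 * √2)) * F.sigma x)) ♯z :=
    ((S.diff_sigma hz.1).const_mul _).exp
  rw [show (fun z => 𝐠 z (inr m) (inr n)) = _ from funext fun z => metric_inr_inr z m n,
    pd_mul_inr (hd.const_mul _) (S.diff_rpow hz.2 _), pd_rpow (S.diff_H hz.2) (S.pos _ hz.2), hDown]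
  have := (S.pos _ hz.2).ne'
  field_simp
  ring

lemma pd_metric_inl_inr (K : Ten) (z : ℝ¹⁰) (μ : Fin 6) (m : Fin 4) :
    pd K (fun z => 𝐠 z (inl μ) (inr m)) z = 0 := pd_const K 0 z

lemma pd_metric_inr_inl (K : Ten) (z : ℝ¹⁰) (μ : Fin 6) (m : Fin 4) :
    pd K (fun z => 𝐠 z (inr m) (inl μ)) z = 0 := pd_const K 0 z

lemma scale_x_pos (S : Uplift) (hz : z ∈ region U Ω) :
    0 < H ♭z ^ (-(1 / 4) : ℝ) * exp (-(1 / (2 * √2) * F.sigma ♯z)) :=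
  mul_pos (Real.rpow_pos_of_pos (S.pos _ hz.2) _) (exp_pos _)

lemma scale_y_pos (S : Uplift) (hz : z ∈ region U Ω) :
    0 < H ♭z ^ (3 / 4 : ℝ) * exp (1 / (2 * √2) * F.sigma ♯z) :=
  mul_pos (Real.rpow_pos_of_pos (S.pos _ hz.2) _) (exp_pos _)

lemma metric_inv (S : Uplift) (hz : z ∈ region U Ω) : (𝐠 z)⁻¹ = fromBlocks
      ((H ♭z ^ (-(1 / 4) : ℝ) * exp (-(1 / (2 * √2) * F.sigma ♯z)))⁻¹ • (F.metric ♯z)⁻¹) 0 0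
      ((H ♭z ^ (3 / 4 : ℝ) * exp (1 / (2 * √2) * F.sigma ♯z))⁻¹ • 1) := by
  rw [uplift_metric_eq_warp,
    warp_inv (S.scale_x_pos hz).ne' (S.scale_y_pos hz).ne' (S.lorentzian hz.1).det_neg.ne]

lemma scale_ratio (S : Uplift) (hz : z ∈ region U Ω) :
    (H ♭z ^ (3 / 4 : ℝ) * exp (1 / (2 * √2) * F.sigma ♯z))⁻¹ *
      (H ♭z ^ (-(1 / 4) : ℝ) * exp (-(1 / (2 * √2) * F.sigma ♯z))) =
      exp (-(1 / √2) * F.sigma ♯z) * (H ♭z)⁻¹ := by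
  rw [uplift_scale_x (S.pos _ hz.2), uplift_scale_y (S.pos _ hz.2), ← exp_neg, ← exp_add]
  nth_rewrite 3 [← exp_log (S.pos _ hz.2)]
  rw [← exp_neg, ← exp_add, one_div_sqrt_two]
  congr 1
  ring

lemma christoffel_lll (S : Uplift) (hz : z ∈ region U Ω) (l μ ν : Fin 6) :
    christoffel 𝐠 (inl l) (inl μ) (inl ν) z =
      christoffel F.metric l μ ν ♯z - δ[l,ν] * sDown F μ ♯z - δ[l,μ] * sDown F ν ♯z +
        F.metric ♯z μ ν * sUp F l ♯z := by
  rw [christoffel, S.metric_inv hz]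
  simp only [Fintype.sum_sum_type, fromBlocks_apply₁₁, fromBlocks_apply₁₂, Matrix.zero_apply,
    zero_mul, sum_const_zero, add_zero, S.pd_metric_inl_inl_inl hz, Matrix.smul_apply, smul_eq_mul]
  rw [← S.sum_inv_mul' hz.1 l ν, ← S.sum_inv_mul' hz.1 l μ, christoffel, sUp]
  simp only [mul_sum, sum_mul, ← sum_sub_distrib, ← sum_add_distrib]
  refine sum_congr rfl fun ρ _ => ?_
  have := (S.scale_x_pos hz).ne'
  generalize H ♭z ^ (-(1 / 4) : ℝ) * exp (-(1 / (2 * √2) * F.sigma ♯z)) = A at this ⊢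
  field_simp
  ring

lemma christoffel_rll (S : Uplift) (hz : z ∈ region U Ω) (m : Fin 4) (μ ν : Fin 6) :
    christoffel 𝐠 (inr m) (inl μ) (inl ν) z = (exp (-(1 / √2) * F.sigma ♯z) * F.metric ♯z μ ν) *
        (hDown H m ♭z * (H ♭z)⁻¹) := by
  rw [christoffel, S.metric_inv hz]
  simp only [Fintype.sum_sum_type, fromBlocks_apply₂₁, fromBlocks_apply₂₂, Matrix.zero_apply,
    zero_mul, sum_const_zero, zero_add, S.pd_metric_inr_inl_inl hz, pd_metric_inl_inr,
    Matrix.smul_apply, Matrix.one_apply, smul_eq_mul, mul_ite, mul_one, mul_zero, ite_mul,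
    sum_ite_eq, mem_univ, if_true]
  linear_combination (hDown H m ♭z * F.metric ♯z μ ν) * S.scale_ratio hz

lemma christoffel_llr (S : Uplift) (hz : z ∈ region U Ω) (l μ : Fin 6) (m : Fin 4) :
    christoffel 𝐠 (inl l) (inl μ) (inr m) z = -(δ[l,μ] * hDown H m ♭z) := by
  rw [christoffel, S.metric_inv hz]
  simp only [Fintype.sum_sum_type, fromBlocks_apply₁₁, fromBlocks_apply₁₂, Matrix.zero_apply,
    zero_mul, sum_const_zero, add_zero, S.pd_metric_inr_inl_inl hz, pd_metric_inl_inr,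
    pd_metric_inr_inl, sub_zero, zero_add, Matrix.smul_apply, smul_eq_mul]
  rw [← S.sum_inv_mul' hz.1 l μ]
  simp only [mul_sum, sum_mul, ← sum_neg_distrib]
  refine sum_congr rfl fun ρ _ => ?_
  have := (S.scale_x_pos hz).ne'
  generalize H ♭z ^ (-(1 / 4) : ℝ) * exp (-(1 / (2 * √2) * F.sigma ♯z)) = A at this ⊢
  field_simp

lemma christoffel_lrl (S : Uplift) (hz : z ∈ region U Ω) (l μ : Fin 6) (m : Fin 4) :
    christoffel 𝐠 (inl l) (inr m) (inl μ) z = -(δ[l,μ] * hDown H m ♭z) := by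
  rw [← S.christoffel_llr hz, christoffel, christoffel]
  congr 1
  refine sum_congr rfl fun ρ _ => ?_
  rw [pd_metric_inl_inr, pd_metric_inr_inl]
  ring

lemma christoffel_rlr (S : Uplift) (hz : z ∈ region U Ω) (μ : Fin 6) (p m : Fin 4) :
    christoffel 𝐠 (inr p) (inl μ) (inr m) z = δ[p,m] * sDown F μ ♯z := by
  rw [christoffel, S.metric_inv hz]
  simp only [Fintype.sum_sum_type, fromBlocks_apply₂₁, fromBlocks_apply₂₂, Matrix.zero_apply,
    zero_mul, sum_const_zero, zero_add, S.pd_metric_inl_inr_inr hz, pd_metric_inl_inr,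
    Matrix.smul_apply, Matrix.one_apply, smul_eq_mul, add_zero, sub_zero]
  have := (S.scale_y_pos hz).ne'
  rw [sum_eq_single p (fun q _ hq => by simp [hq.symm]) (by simp)]
  simp only [if_true, eq_comm (a := m) (b := p)]
  generalize H ♭z ^ (3 / 4 : ℝ) * exp (1 / (2 * √2) * F.sigma ♯z) = B at this ⊢
  field_simp

lemma christoffel_rrl (S : Uplift) (hz : z ∈ region U Ω) (μ : Fin 6) (p m : Fin 4) :
    christoffel 𝐠 (inr p) (inr m) (inl μ) z = δ[p,m] * sDown F μ ♯z := by
  rw [← S.christoffel_rlr hz, christoffel, christoffel]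
  congr 1
  refine sum_congr rfl fun ρ _ => ?_
  rw [pd_metric_inl_inr, pd_metric_inr_inl]
  ring

lemma christoffel_lrr (S : Uplift) (hz : z ∈ region U Ω) (l : Fin 6) (m n : Fin 4) :
    christoffel 𝐠 (inl l) (inr m) (inr n) z = (-δ[m,n] * (exp (1 / √2 * F.sigma ♯z) * sUp F l ♯z)) *
        H ♭z := by
  have hr : (H ♭z ^ (-(1 / 4) : ℝ) * exp (-(1 / (2 * √2) * F.sigma ♯z)))⁻¹ *
      (H ♭z ^ (3 / 4 : ℝ) * exp (1 / (2 * √2) * F.sigma ♯z)) =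
      exp (1 / √2 * F.sigma ♯z) * H ♭z := by
    have h := congrArg (·⁻¹) (S.scale_ratio hz)
    simp only [mul_inv, inv_inv] at h ⊢
    rw [mul_comm, h, neg_mul, exp_neg, inv_inv]
  rw [christoffel, S.metric_inv hz]
  simp only [Fintype.sum_sum_type, fromBlocks_apply₁₁, fromBlocks_apply₁₂, Matrix.zero_apply,
    zero_mul, sum_const_zero, add_zero, S.pd_metric_inl_inr_inr hz, pd_metric_inr_inl,
    Matrix.smul_apply, smul_eq_mul]
  rw [sUp]
  simp only [mul_sum, sum_mul]
  refine sum_congr rfl fun ρ _ => ?_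
  linear_combination (-(F.metric ♯z)⁻¹ l ρ * sDown F ρ ♯z * δ[m,n]) * hr

lemma christoffel_rrr (S : Uplift) (hz : z ∈ region U Ω) (p m n : Fin 4) :
    christoffel 𝐠 (inr p) (inr m) (inr n) z = 3 * (δ[p,n] * hDown H m ♭z + δ[p,m] * hDown H n ♭z -
        δ[m,n] * hDown H p ♭z) := by
  rw [christoffel, S.metric_inv hz]
  simp only [Fintype.sum_sum_type, fromBlocks_apply₂₁, fromBlocks_apply₂₂, Matrix.zero_apply,
    zero_mul, sum_const_zero, zero_add, S.pd_metric_inr_inr_inr hz, Matrix.smul_apply,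
    Matrix.one_apply, smul_eq_mul]
  have := (S.scale_y_pos hz).ne'
  rw [sum_eq_single p (fun q _ hq => by simp [hq.symm]) (by simp)]
  simp only [if_true, eq_comm (a := n) (b := p), eq_comm (a := m) (b := p)]
  generalize H ♭z ^ (3 / 4 : ℝ) * exp (1 / (2 * √2) * F.sigma ♯z) = B at this ⊢
  field_simp
  ring

end UpliftData

section ConformalAlgebra

variable (G : Fin 6 → Fin 6 → ℝ⁶) (g : Fin 6 → ℝ⁶) (s su : ℝ⁶)

/-- The Christoffel symbols of a conformally rescaled metric. -/
def confGamma (l μ ν : Fin 6) : ℝ := G l μ ν - δ[l,ν] * s μ - δ[l,μ] * s ν + g μ ν * su l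

variable {G g s su}

lemma sum_confGamma_mul (l ν : Fin 6) (X : ℝ⁶) : ∑ r, confGamma G g s su l ν r * X r =
      ∑ r, G l ν r * X r - s ν * X l - δ[l,ν] * ∑ r, s r * X r + (∑ r, g ν r * X r) * su l := by
  simp only [confGamma, add_mul, sub_mul, sum_add_distrib, sum_sub_distrib]
  congr 1
  · congr 1
    · congr 1
      simp
    · rw [mul_sum]
      exact sum_congr rfl fun r _ => by ring
  · rw [sum_mul]
    exact sum_congr rfl fun r _ => by ring

lemma sum_mul_confGamma (μ ν : Fin 6) (X : ℝ⁶) : ∑ r, X r * confGamma G g s su r μ ν =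
      ∑ r, X r * G r μ ν - X ν * s μ - X μ * s ν + g μ ν * ∑ r, X r * su r := by
  simp only [confGamma, mul_add, mul_sub, sum_add_distrib, sum_sub_distrib]
  congr 1
  · congr 1
    · congr 1
      simp
    · simp
  · rw [mul_sum]
    exact sum_congr rfl fun r _ => by ring

lemma sum_confGamma_trace (hs : ∀ μ, ∑ l, g μ l * su l = s μ) (μ : Fin 6) :
    ∑ l, confGamma G g s su l μ l = ∑ l, G l μ l - 6 * s μ := by
  simp only [confGamma, sum_add_distrib, sum_sub_distrib, hs]
  simp

lemma sum_confGamma_trace' (hg : ∀ μ ν, g μ ν = g ν μ) (hs : ∀ μ, ∑ l, g μ l * su l = s μ)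
    (μ : Fin 6) : ∑ l, confGamma G g s su l l μ = ∑ l, G l l μ - 6 * s μ := by
  simp only [confGamma, sum_add_distrib, sum_sub_distrib, hg _ μ, hs]
  simp
  ring

lemma sum_confGamma_confGamma (hg : ∀ μ ν, g μ ν = g ν μ)
    (hG : ∀ l μ ν, G l μ ν = G l ν μ) (hs : ∀ μ, ∑ l, g μ l * su l = s μ) (μ ν : Fin 6) :
    ∑ l, ∑ r, confGamma G g s su l ν r * confGamma G g s su r μ l =
      ∑ l, ∑ r, G l ν r * G r μ l - (∑ l, G l ν l) * s μ - (∑ l, G l μ l) * s ν -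
        2 * ∑ r, s r * G r μ ν +
        (∑ l, ∑ r, G l ν r * g μ l * su r + ∑ l, ∑ r, G r μ l * g ν r * su l) +
        8 * (s μ * s ν) - 2 * (g μ ν * ∑ r, s r * su r) := by
  simp only [sum_confGamma_mul]
  rw [sum_add_distrib, sum_sub_distrib, sum_sub_distrib]
  have a : ∑ l, ∑ r, G l ν r * confGamma G g s su r μ l =
      ∑ l, ∑ r, G l ν r * G r μ l - (∑ l, G l ν l) * s μ - ∑ r, s r * G r μ ν +
        ∑ l, ∑ r, G l ν r * g μ l * su r := by
    simp only [sum_mul_confGamma]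
    rw [sum_add_distrib, sum_sub_distrib, sum_sub_distrib, sum_mul]
    congr 1
    · congr 1
      exact sum_congr rfl fun r _ => by rw [hG r ν μ]; ring
    · refine sum_congr rfl fun l _ => ?_
      rw [mul_sum]
      exact sum_congr rfl fun r _ => by ring
  have c : ∑ r, s r * confGamma G g s su r μ ν =
      ∑ r, s r * G r μ ν - 2 * (s μ * s ν) + g μ ν * ∑ r, s r * su r := by
    rw [sum_mul_confGamma]
    ring
  have d : ∑ l, (∑ r, g ν r * confGamma G g s su r μ l) * su l =
      ∑ l, ∑ r, G r μ l * g ν r * su l - g μ ν * ∑ r, s r * su r := by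
    simp only [sum_mul_confGamma, hs]
    have e : ∀ l, (∑ r, g ν r * G r μ l - g ν l * s μ - g ν μ * s l + g μ l * s ν) * su l =
        ∑ r, G r μ l * g ν r * su l - s μ * (g ν l * su l) - g ν μ * (s l * su l) +
          s ν * (g μ l * su l) := by
      intro l
      have : (∑ r, g ν r * G r μ l) * su l = ∑ r, G r μ l * g ν r * su l := by
        rw [sum_mul]
        exact sum_congr rfl fun r _ => by ring
      rw [← this]
      ring
    simp only [e]
    rw [sum_add_distrib, sum_sub_distrib, sum_sub_distrib, ← mul_sum, ← mul_sum, ← mul_sum, hs, hs,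
      hg ν μ]
    ring
  have b : ∑ l, s ν * confGamma G g s su l μ l = (∑ l, G l μ l) * s ν - 6 * (s μ * s ν) := by
    rw [← mul_sum, sum_confGamma_trace hs]
    ring
  have c' : ∑ l, δ[l,ν] * ∑ r, s r * confGamma G g s su r μ l =
      ∑ r, s r * G r μ ν - 2 * (s μ * s ν) + g μ ν * ∑ r, s r * su r := by
    rw [← c]
    simp
  rw [a, b, c', d]
  ring

end ConformalAlgebra

section Compatibility

variable {g : (ι → ℝ) → Matrix ι ι ℝ} {x : ι → ℝ}

lemma christoffel_comm (hg : ∀ᶠ x in nhds x, (g x).transpose = g x) (k i j : ι) :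
    christoffel g k i j x = christoffel g k j i x := by
  rw [christoffel, christoffel]
  congr 1
  refine sum_congr rfl fun l _ => ?_
  have h : pd l (fun z => g z i j) x = pd l (fun z => g z j i) x :=
    pd_congr (hg.mono fun w hw => congrFun (congrFun hw j) i) l
  rw [h]
  ring

lemma sum_mul_christoffel (hg : (g x).transpose = g x) (hd : (g x).det ≠ 0) (n i j : ι) :
    ∑ k, g x k n * christoffel g k i j x =
      1 / 2 * (pd i (fun z => g z j n) x + pd j (fun z => g z i n) x -
        pd n (fun z => g z i j) x) := by
  simp only [christoffel, mul_sum]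
  rw [sum_comm]
  have h := Matrix.mul_nonsing_inv (g x) (isUnit_iff_ne_zero.2 hd)
  have h1 : ∀ l, ∑ k, g x k n * (g x)⁻¹ k l = if n = l then 1 else 0 := by
    intro l
    have := congrFun (congrFun h n) l
    rw [Matrix.mul_apply, Matrix.one_apply] at this
    rw [← this]
    refine sum_congr rfl fun k _ => ?_
    congr 1
    exact congrFun (congrFun hg n) k
  have h2 : ∀ l, ∑ k, g x k n * (1 / 2 * ((g x)⁻¹ k l * (pd i (fun z => g z j l) x +
      pd j (fun z => g z i l) x - pd l (fun z => g z i j) x))) =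
      δ[n,l] * (1 / 2 * (pd i (fun z => g z j l) x +
        pd j (fun z => g z i l) x - pd l (fun z => g z i j) x)) := by
    intro l
    rw [← h1, sum_mul]
    exact sum_congr rfl fun k _ => by ring
  simp only [h2]
  simp

lemma pd_metric_eq (hg : ∀ᶠ x in nhds x, (g x).transpose = g x) (hd : (g x).det ≠ 0)
    (l i j : ι) : pd l (fun z => g z i j) x =
      ∑ k, g x k j * christoffel g k l i x + ∑ k, g x k i * christoffel g k l j x := by
  have h : ∀ a b c, pd a (fun z => g z b c) x = pd a (fun z => g z c b) x := fun a b c =>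
    pd_congr (hg.mono fun w hw => congrFun (congrFun hw c) b) a
  rw [sum_mul_christoffel hg.self_of_nhds hd, sum_mul_christoffel hg.self_of_nhds hd, h l j i,
    h i l j, h j l i]
  ring

end Compatibility

section SmoothChristoffel

variable {g : (ι → ℝ) → Matrix ι ι ℝ} {s : Set (ι → ℝ)}

lemma ContDiffOn.christoffel (hs : IsOpen s) (hg : IsLorentzianMetricOn g s) (k i j : ι) :
    ContDiffOn ℝ ∞ (christoffel g k i j) s :=
  contDiffOn_const.mul (ContDiffOn.sum fun l _ =>
    (contDiffOn_matrix_inv hg.1 (fun x hx => (hg.2 x hx).det_neg.ne) k l).mul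
      ((((hg.1 j l).pd hs i).add ((hg.1 i l).pd hs j)).sub ((hg.1 i j).pd hs l)))

lemma pd_add {f h : (ι → ℝ) → ℝ} {x : ι → ℝ} (hf : Diff f x) (hh : Diff h x) (i : ι) :
    pd i (fun x => f x + h x) x = pd i f x + pd i h x := by rw [pd, fderiv_fun_add hf hh]; rfl

lemma pd_sub {f h : (ι → ℝ) → ℝ} {x : ι → ℝ} (hf : Diff f x) (hh : Diff h x) (i : ι) :
    pd i (fun x => f x - h x) x = pd i f x - pd i h x := by rw [pd, fderiv_fun_sub hf hh]; rfl

lemma pd_const_mul {f : (ι → ℝ) → ℝ} {x : ι → ℝ} (hf : Diff f x) (c : ℝ) (i : ι) :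
    pd i (fun x => c * f x) x = c * pd i f x := by
  rw [pd_mul (differentiableAt_const c) hf, pd_const, zero_mul, zero_add]

lemma pd_sum {S : Type*} (t : Finset S) {f : S → (ι → ℝ) → ℝ} {x : ι → ℝ}
    (hf : ∀ a ∈ t, Diff (f a) x) (i : ι) :
    pd i (fun x => ∑ a ∈ t, f a x) x = ∑ a ∈ t, pd i (f a) x := by
  rw [pd, fderiv_fun_sum hf, sum_apply]
  rfl

lemma ricci_eq (g : (ι → ℝ) → Matrix ι ι ℝ) (i j : ι) (x : ι → ℝ) :
    ricci g i j x = ∑ k, pd k (christoffel g k i j) x - ∑ k, pd j (christoffel g k i k) x +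
      ∑ l, (∑ k, christoffel g k k l x) * christoffel g l i j x -
      ∑ k, ∑ l, christoffel g k j l x * christoffel g l i k x := by
  have h : ∑ k, ∑ l, christoffel g k k l x * christoffel g l i j x =
      ∑ l, (∑ k, christoffel g k k l x) * christoffel g l i j x := by
    rw [sum_comm]
    exact sum_congr rfl fun l _ => (sum_mul _ _ _).symm
  simp only [ricci, sum_sub_distrib, h]
  ring

lemma pd_pd_comm {f : (ι → ℝ) → ℝ} {x : ι → ℝ} (hs : IsOpen s) (hf : ContDiffOn ℝ ∞ f s)
    (hx : x ∈ s) (i j : ι) : pd i (pd j f) x = pd j (pd i f) x := by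
  have h2 : ContDiffAt ℝ ∞ f x := hf.contDiffAt (hs.mem_nhds hx)
  have hd : Diff (fderiv ℝ f) x :=
    ((hf.fderiv_of_isOpen (m := ∞) hs (by simp)).differentiableOn (by simp)).differentiableAt
      (hs.mem_nhds hx)
  have key : ∀ a b, pd a (pd b f) x = fderiv ℝ (fderiv ℝ f) x (coordVec a) (coordVec b) := by
    intro a b
    have h3 := (hd.hasFDerivAt.clm_apply (hasFDerivAt_const (coordVec b) x)).fderiv
    change fderiv ℝ (fun x => fderiv ℝ f x (coordVec b)) x (coordVec a) = _
    rw [h3]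
    simp
  rw [key, key]
  exact (h2.isSymmSndFDerivAt (by simpa using two_le_smooth)).eq _ _

end SmoothChristoffel

/-- The wave operator acting on `s = σ / (4 √2)`. -/
def boxS (F : SixFields) (x : ℝ⁶) : ℝ :=
  ∑ l, pd l (sUp F l) x + ∑ l, (∑ k, christoffel F.metric k k l x) * sUp F l x

namespace UpliftData

lemma diff_christoffel (S : Uplift) (hx : x ∈ U) (k i j : Fin 6) :
    Diff (christoffel F.metric k i j) x :=
  (ContDiffOn.christoffel S.isOpenU S.reg.metric k i j).differentiableAt_of_isOpen S.isOpenU hx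

lemma smooth_sDown (S : Uplift) (μ : Fin 6) : ContDiffOn ℝ ∞ (sDown F μ) U :=
  contDiffOn_const.mul (S.reg.sigma.pd S.isOpenU μ)

lemma diff_sDown (S : Uplift) (hx : x ∈ U) (μ : Fin 6) : Diff (sDown F μ) x :=
  (S.smooth_sDown μ).differentiableAt_of_isOpen S.isOpenU hx

lemma diff_sUp (S : Uplift) (hx : x ∈ U) (μ : Fin 6) : Diff (sUp F μ) x :=
  (ContDiffOn.sum fun ρ _ => (contDiffOn_matrix_inv S.reg.metric.1
    (fun _ hx => (S.lorentzian hx).det_neg.ne) μ ρ).mul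
      (S.smooth_sDown ρ)).differentiableAt_of_isOpen S.isOpenU hx

lemma diff_hDown (S : Uplift) (hy : y ∈ Ω) (m : Fin 4) : Diff (hDown H m) y :=
  ((S.smooth.pd S.isOpenΩ m).div (contDiffOn_const.mul S.smooth) fun y hy =>
    (mul_pos (by norm_num) (S.pos y hy)).ne').differentiableAt_of_isOpen S.isOpenΩ hy

lemma pd_sDown_comm (S : Uplift) (hx : x ∈ U) (μ ν : Fin 6) :
    pd μ (sDown F ν) x = pd ν (sDown F μ) x := by
  have hd : ∀ ν, Diff (pd ν F.sigma) x := fun ν =>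
    (S.reg.sigma.pd S.isOpenU ν).differentiableAt_of_isOpen S.isOpenU hx
  change pd μ (fun x => 1 / (2 * √2) / 2 * pd ν F.sigma x) x =
    pd ν (fun x => 1 / (2 * √2) / 2 * pd μ F.sigma x) x
  rw [pd_const_mul (hd ν), pd_const_mul (hd μ), pd_pd_comm S.isOpenU S.reg.sigma hx]

lemma pd_hDown (S : Uplift) (hy : y ∈ Ω) (m n : Fin 4) :
    pd n (hDown H m) y = pd n (pd m H) y / (8 * H y) - 8 * (hDown H n y * hDown H m y) := by
  have hp := (S.pos y hy).ne'
  have hd : Diff (pd m H) y := (S.smooth.pd S.isOpenΩ m).differentiableAt_of_isOpen S.isOpenΩ hy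
  have hi : Diff (fun y => (2 * H y)⁻¹) y :=
    ((S.diff_H hy).const_mul 2).fun_inv (mul_ne_zero two_ne_zero hp)
  have h : hDown H m = fun y => 1 / 4 * (pd m H y * (2 * H y)⁻¹) := by
    funext y
    rw [hDown]
    ring
  rw [h, pd_const_mul (hd.fun_mul hi), pd_mul hd hi, S.pd_inv_two_mul hy, hDown]
  field_simp
  ring

lemma pd_of_eq_inl (S : Uplift) (hz : z ∈ region U Ω) {Q : ℝ¹⁰ → ℝ} {f : ℝ⁶ → ℝ} {k : ℝ⁴ → ℝ}
    (h : ∀ w ∈ region U Ω, Q w = f ♯w * k ♭w) (hf : Diff f ♯z) (hk : Diff k ♭z) (μ : Fin 6) :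
    pd (inl μ) Q z = pd μ f ♯z * k ♭z := by
  rw [pd_congr ((S.eventually_region hz).mono h), pd_mul_inl hf hk]

lemma pd_of_eq_inr (S : Uplift) (hz : z ∈ region U Ω) {Q : ℝ¹⁰ → ℝ} {f : ℝ⁶ → ℝ} {k : ℝ⁴ → ℝ}
    (h : ∀ w ∈ region U Ω, Q w = f ♯w * k ♭w) (hf : Diff f ♯z) (hk : Diff k ♭z) (m : Fin 4) :
    pd (inr m) Q z = f ♯z * pd m k ♭z := by
  rw [pd_congr ((S.eventually_region hz).mono h), pd_mul_inr hf hk]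

/-- The conformal Christoffel symbols on the six-dimensional space. -/
def confGammaField (F : SixFields) (l μ ν : Fin 6) (x : ℝ⁶) : ℝ :=
  confGamma (fun l μ ν => christoffel F.metric l μ ν x) (fun μ ν => F.metric x μ ν)
    (fun μ => sDown F μ x) (fun μ => sUp F μ x) l μ ν

lemma christoffel_lll' (S : Uplift) (hz : z ∈ region U Ω) (l μ ν : Fin 6) :
    christoffel 𝐠 (inl l) (inl μ) (inl ν) z = confGammaField F l μ ν ♯z :=
  S.christoffel_lll hz l μ ν

lemma diff_confGammaField (S : Uplift) (hx : x ∈ U) (l μ ν : Fin 6) :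
    Diff (confGammaField F l μ ν) x :=
  (((S.diff_christoffel hx l μ ν).fun_sub ((S.diff_sDown hx μ).const_mul _)).fun_sub
    ((S.diff_sDown hx ν).const_mul _)).fun_add ((S.diff_metric hx μ ν).fun_mul (S.diff_sUp hx l))

lemma pd_confGammaField (S : Uplift) (hx : x ∈ U) (κ l μ ν : Fin 6) :
    pd κ (confGammaField F l μ ν) x = pd κ (christoffel F.metric l μ ν) x -
      δ[l,ν] * pd κ (sDown F μ) x - δ[l,μ] * pd κ (sDown F ν) x +
      (pd κ (fun x => F.metric x μ ν) x * sUp F l x + F.metric x μ ν * pd κ (sUp F l) x) := by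
  have h1 := S.diff_christoffel hx l μ ν
  have h2 := (S.diff_sDown hx μ).const_mul δ[l,ν]
  have h3 := (S.diff_sDown hx ν).const_mul δ[l,μ]
  have h4 := (S.diff_metric hx μ ν).fun_mul (S.diff_sUp hx l)
  change pd κ (fun x => christoffel F.metric l μ ν x - δ[l,ν] * sDown F μ x -
    δ[l,μ] * sDown F ν x + F.metric x μ ν * sUp F l x) x = _
  rw [pd_add ((h1.fun_sub h2).fun_sub h3) h4, pd_sub (h1.fun_sub h2) h3, pd_sub h1 h2,
    pd_const_mul (S.diff_sDown hx μ), pd_const_mul (S.diff_sDown hx ν),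
    pd_mul (S.diff_metric hx μ ν) (S.diff_sUp hx l)]

lemma eventually_symm (S : Uplift) (hx : x ∈ U) :
    ∀ᶠ w in nhds x, (F.metric w).transpose = F.metric w :=
  Filter.eventually_of_mem (S.isOpenU.mem_nhds hx) fun _ hw => (S.lorentzian hw).transpose_eq

lemma sum_metric_sUp (S : Uplift) (hx : x ∈ U) (μ : Fin 6) :
    ∑ l, F.metric x μ l * sUp F l x = sDown F μ x := by
  simp only [sUp, mul_sum]
  rw [sum_comm]
  have h := Matrix.mul_nonsing_inv (F.metric x)
    (isUnit_iff_ne_zero.2 (S.lorentzian hx).det_neg.ne)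
  have h2 : ∀ ρ, ∑ l, F.metric x μ l * ((F.metric x)⁻¹ l ρ * sDown F ρ x) =
      δ[μ,ρ] * sDown F ρ x := by
    intro ρ
    have := congrFun (congrFun h μ) ρ
    rw [Matrix.mul_apply, Matrix.one_apply] at this
    rw [← this, sum_mul]
    exact sum_congr rfl fun l _ => by ring
  simp only [h2]
  simp

lemma christoffel_trace_l (S : Uplift) (hz : z ∈ region U Ω) (μ : Fin 6) :
    ∑ k, christoffel 𝐠 k k (inl μ) z = ∑ l, christoffel F.metric l l μ ♯z - 2 * sDown F μ ♯z := by
  have tr := sum_confGamma_trace' (G := fun l μ ν => christoffel F.metric l μ ν ♯z)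
    (g := fun μ ν => F.metric ♯z μ ν) (s := fun μ => sDown F μ ♯z)
    (su := fun μ => sUp F μ ♯z) (S.metric_symm hz.1) (S.sum_metric_sUp hz.1) μ
  rw [Fintype.sum_sum_type]
  simp only [S.christoffel_lll' hz, S.christoffel_rrl hz, if_true, one_mul, confGammaField]
  rw [tr]
  simp
  ring

lemma christoffel_trace_r (S : Uplift) (hz : z ∈ region U Ω) (m : Fin 4) :
    ∑ k, christoffel 𝐠 k k (inr m) z = 6 * hDown H m ♭z := by
  rw [Fintype.sum_sum_type]
  simp only [S.christoffel_llr hz, S.christoffel_rrr hz, if_true, one_mul, ← mul_sum,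
    sum_sub_distrib, sum_add_distrib]
  simp
  ring

lemma ricci_ll (S : Uplift) (hz : z ∈ region U Ω) (μ ν : Fin 6) : ricci 𝐠 (inl μ) (inl ν) z =
      ricci F.metric μ ν ♯z - 8 * (sDown F μ ♯z * sDown F ν ♯z) + F.metric ♯z μ ν * boxS F ♯z -
        8 * (exp (-(1 / √2) * F.sigma ♯z) * F.metric ♯z μ ν *
          (H ♭z)⁻¹ * ∑ m, hDown H m ♭z ^ 2) := by
  have hx := hz.1
  have hy := hz.2
  have hp := (S.pos _ hy).ne'
  have hg : ∀ μ ν, F.metric ♯z μ ν = F.metric ♯z ν μ := S.metric_symm hx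
  have hG : ∀ l μ ν, christoffel F.metric l μ ν ♯z = christoffel F.metric l ν μ ♯z :=
    christoffel_comm (S.eventually_symm hx)
  have hs := S.sum_metric_sUp hx
  have c1 : Diff (fun _ : ℝ⁴ => (1 : ℝ)) ♭z := differentiableAt_const _
  have hE : Diff (fun x => exp (-(1 / √2) * F.sigma x) * F.metric x μ ν)
      ♯z := ((S.diff_sigma hx).const_mul _).exp.fun_mul (S.diff_metric hx μ ν)
  have hK : ∀ m, Diff (fun y => hDown H m y * (H y)⁻¹) ♭z := fun m =>
    (S.diff_hDown hy m).fun_mul ((S.diff_H hy).fun_inv hp)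
  have D1 : ∀ κ l μ ν, pd (inl κ)
      (christoffel 𝐠 (inl l) (inl μ) (inl ν)) z =
      pd κ (confGammaField F l μ ν) ♯z := fun κ l μ ν => by
    rw [S.pd_of_eq_inl hz (k := fun _ => 1) (fun w hw => by rw [S.christoffel_lll' hw, mul_one])
      (S.diff_confGammaField hx l μ ν) c1, mul_one]
  have D2 : ∀ m, pd (inr m)
      (christoffel 𝐠 (inr m) (inl μ) (inl ν)) z =
      exp (-(1 / √2) * F.sigma ♯z) * F.metric ♯z μ ν *
        pd m (fun y => hDown H m y * (H y)⁻¹) ♭z := fun m =>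
    S.pd_of_eq_inr hz (f := fun x => exp (-(1 / √2) * F.sigma x) * F.metric x μ ν)
      (k := fun y => hDown H m y * (H y)⁻¹) (fun w hw => S.christoffel_rll hw m μ ν) hE (hK m) m
  have D2' : ∑ m, pd m (fun y => hDown H m y * (H y)⁻¹) ♭z =
      -(16 * (H ♭z)⁻¹ * ∑ m, hDown H m ♭z ^ 2) := by
    have h1 : ∀ m, pd m (fun y => hDown H m y * (H y)⁻¹) ♭z = pd m (pd m H) ♭z / (8 * H ♭z ^ 2) -
          16 * (H ♭z)⁻¹ * hDown H m ♭z ^ 2 := by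
      intro m
      have h2 : pd m (fun y => (H y)⁻¹) ♭z = -(H ♭z ^ 2)⁻¹ * pd m H ♭z := by
        have h3 := S.pd_inv_two_mul hy m
        have h4 : (fun y => (H y)⁻¹) = fun y => 2 * (2 * H y)⁻¹ := by
          funext y
          rw [mul_inv]
          ring
        rw [h4, pd_const_mul (((S.diff_H hy).const_mul 2).fun_inv (mul_ne_zero two_ne_zero hp)), h3]
        rw [mul_inv]
        ring
      rw [pd_mul (S.diff_hDown hy m) ((S.diff_H hy).fun_inv hp), S.pd_hDown hy, h2, hDown]
      field_simp
      ring
    simp only [h1]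
    rw [sum_sub_distrib, ← Finset.sum_div, S.harm _ hy, zero_div, zero_sub, mul_sum]
  have D3 : ∀ m, pd (inl ν)
      (christoffel 𝐠 (inr m) (inl μ) (inr m)) z =
      pd ν (sDown F μ) ♯z := fun m => by
    rw [S.pd_of_eq_inl hz (k := fun _ => 1) (fun w hw => by
      rw [S.christoffel_rlr hw, if_pos rfl, one_mul, mul_one]) (S.diff_sDown hx μ) c1, mul_one]
  have E1 : ∑ l, pd l (confGammaField F l μ ν) ♯z =
      ∑ l, pd l (christoffel F.metric l μ ν) ♯z - 2 * pd ν (sDown F μ) ♯z +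
        (∑ l, pd l (fun x => F.metric x μ ν) ♯z * sUp F l ♯z +
          F.metric ♯z μ ν * ∑ l, pd l (sUp F l) ♯z) := by
    simp only [S.pd_confGammaField hx]
    rw [sum_add_distrib, sum_sub_distrib, sum_sub_distrib, sum_add_distrib, ← mul_sum]
    simp only [ite_mul, one_mul, zero_mul, sum_ite_eq', mem_univ, if_true]
    rw [S.pd_sDown_comm hx μ ν]
    ring
  have E2 : ∑ l, pd ν (confGammaField F l μ l) ♯z =
      ∑ l, pd ν (christoffel F.metric l μ l) ♯z - 6 * pd ν (sDown F μ) ♯z := by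
    rw [← pd_sum _ fun l _ => S.diff_confGammaField hx l μ l,
      ← pd_sum _ fun l _ => S.diff_christoffel hx l μ l, ← pd_const_mul (S.diff_sDown hx μ),
      ← pd_sub (DifferentiableAt.fun_sum fun l _ => S.diff_christoffel hx l μ l)
        ((S.diff_sDown hx μ).const_mul 6)]
    refine pd_congr (Filter.eventually_of_mem (S.isOpenU.mem_nhds hx) fun w hw => ?_) ν
    exact sum_confGamma_trace (G := fun l μ ν => christoffel F.metric l μ ν w)
      (g := fun μ ν => F.metric w μ ν) (s := fun μ => sDown F μ w) (su := fun μ => sUp F μ w)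
      (S.sum_metric_sUp hw) μ
  have E3 : ∑ l, pd l (fun x => F.metric x μ ν) ♯z * sUp F l ♯z =
      ∑ l, ∑ r, christoffel F.metric l ν r ♯z * F.metric ♯z μ l * sUp F r ♯z +
      ∑ l, ∑ r, christoffel F.metric r μ l ♯z * F.metric ♯z ν r * sUp F l ♯z := by
    simp only [pd_metric_eq (S.eventually_symm hx) (S.lorentzian hx).det_neg.ne, add_mul, sum_mul]
    rw [sum_add_distrib, add_comm]
    congr 1
    · rw [sum_comm]
      refine sum_congr rfl fun l _ => sum_congr rfl fun r _ => ?_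
      rw [hG l r ν, hg l μ]
      ring
    · refine sum_congr rfl fun l _ => sum_congr rfl fun r _ => ?_
      rw [hG r l μ, hg r ν]
      ring
  have key := sum_confGamma_confGamma (G := fun l μ ν => christoffel F.metric l μ ν ♯z)
    (g := fun μ ν => F.metric ♯z μ ν) (s := fun μ => sDown F μ ♯z)
    (su := fun μ => sUp F μ ♯z) hg hG hs μ ν
  have P1 : ∑ k, pd k (christoffel 𝐠 k (inl μ) (inl ν)) z =
      ∑ l, pd l (christoffel F.metric l μ ν) ♯z - 2 * pd ν (sDown F μ) ♯z +
        (∑ l, pd l (fun x => F.metric x μ ν) ♯z * sUp F l ♯z +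
          F.metric ♯z μ ν * ∑ l, pd l (sUp F l) ♯z) +
        exp (-(1 / √2) * F.sigma ♯z) * F.metric ♯z μ ν *
          -(16 * (H ♭z)⁻¹ * ∑ m, hDown H m ♭z ^ 2) := by
    rw [Fintype.sum_sum_type]
    simp only [D1, D2, E1]
    rw [← mul_sum, D2']
  have P2 : ∑ k, pd (inl ν) (christoffel 𝐠 k (inl μ) k) z =
      ∑ l, pd ν (christoffel F.metric l μ l) ♯z - 2 * pd ν (sDown F μ) ♯z := by
    rw [Fintype.sum_sum_type]
    simp only [D1, D3, E2]
    simp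
    ring
  have P3 : ∑ l, (∑ k, christoffel 𝐠 k k l z) * christoffel 𝐠 l (inl μ) (inl ν) z =
      ∑ l, (∑ k, christoffel F.metric k k l ♯z) * christoffel F.metric l μ ν ♯z -
      2 * ∑ r, sDown F r ♯z * christoffel F.metric r μ ν ♯z -
      (∑ l, christoffel F.metric l l ν ♯z) * sDown F μ ♯z -
      (∑ l, christoffel F.metric l l μ ♯z) * sDown F ν ♯z +
      4 * (sDown F μ ♯z * sDown F ν ♯z) +
      F.metric ♯z μ ν * (∑ l, (∑ k, christoffel F.metric k k l ♯z) * sUp F l ♯z -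
        2 * ∑ r, sDown F r ♯z * sUp F r ♯z) +
      exp (-(1 / √2) * F.sigma ♯z) * F.metric ♯z μ ν * (6 * (H ♭z)⁻¹ * ∑ m, hDown H m ♭z ^ 2) := by
    have T3 := sum_mul_confGamma (G := fun l μ ν => christoffel F.metric l μ ν ♯z)
      (g := fun μ ν => F.metric ♯z μ ν) (s := fun μ => sDown F μ ♯z)
      (su := fun μ => sUp F μ ♯z) μ ν
      (fun r => ∑ l, christoffel F.metric l l r ♯z - 2 * sDown F r ♯z)
    rw [Fintype.sum_sum_type]
    simp only [S.christoffel_trace_l hz, S.christoffel_trace_r hz, S.christoffel_lll' hz,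
      S.christoffel_rll hz, confGammaField]
    rw [T3]
    simp only [sub_mul, sum_sub_distrib, mul_assoc (2 : ℝ), ← mul_sum]
    have e : ∑ m, 6 * hDown H m ♭z * (exp (-(1 / √2) * F.sigma ♯z) *
        F.metric ♯z μ ν * (hDown H m ♭z * (H ♭z)⁻¹)) =
        exp (-(1 / √2) * F.sigma ♯z) * F.metric ♯z μ ν *
          (6 * (H ♭z)⁻¹ * ∑ m, hDown H m ♭z ^ 2) := by
      simp only [mul_sum]
      exact sum_congr rfl fun m _ => by ring
    rw [e]
    ring
  have P4 : ∑ k, ∑ l, christoffel 𝐠 k (inl ν) l z * christoffel 𝐠 l (inl μ) k z =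
      ∑ l, ∑ r, confGammaField F l ν r ♯z * confGammaField F r μ l ♯z +
      4 * (sDown F μ ♯z * sDown F ν ♯z) -
      exp (-(1 / √2) * F.sigma ♯z) * F.metric ♯z μ ν * (2 * (H ♭z)⁻¹ * ∑ m, hDown H m ♭z ^ 2) := by
    simp only [Fintype.sum_sum_type, S.christoffel_lll' hz, S.christoffel_rll hz,
      S.christoffel_llr hz, S.christoffel_rlr hz, sum_add_distrib]
    have e1 : ∑ l, ∑ m, -(δ[l,ν] * hDown H m ♭z) * (exp (-(1 / √2) * F.sigma ♯z) * F.metric ♯z μ l *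
          (hDown H m ♭z * (H ♭z)⁻¹)) =
        -(exp (-(1 / √2) * F.sigma ♯z) * F.metric ♯z μ ν * ((H ♭z)⁻¹ * ∑ m, hDown H m ♭z ^ 2)) := by
      rw [sum_eq_single ν (fun l _ hl => by simp [hl]) (by simp), if_pos rfl]
      simp only [mul_sum, ← sum_neg_distrib]
      exact sum_congr rfl fun m _ => by ring
    have e2 : ∑ m, ∑ l, exp (-(1 / √2) * F.sigma ♯z) * F.metric ♯z ν l * (hDown H m ♭z * (H ♭z)⁻¹) *
            -(δ[l,μ] * hDown H m ♭z) =
        -(exp (-(1 / √2) * F.sigma ♯z) * F.metric ♯z μ ν * ((H ♭z)⁻¹ * ∑ m, hDown H m ♭z ^ 2)) := by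
      rw [sum_comm, sum_eq_single μ (fun l _ hl => by simp [hl]) (by simp),
        if_pos rfl, hg ν μ]
      simp only [mul_sum, ← sum_neg_distrib]
      exact sum_congr rfl fun m _ => by ring
    have e3 : ∑ m : Fin 4, ∑ n : Fin 4, δ[m,n] * sDown F ν ♯z * (δ[n,m] * sDown F μ ♯z) =
        4 * (sDown F μ ♯z * sDown F ν ♯z) := by
      simp
      ring
    rw [e1, e2, e3]
    ring
  have tG : ∀ r, ∑ l, christoffel F.metric l l r ♯z =
      ∑ l, christoffel F.metric l r l ♯z := fun r => sum_congr rfl fun l _ => hG l l r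
  rw [tG μ, tG ν] at P3
  simp only [confGammaField] at P4
  rw [ricci_eq, ricci_eq, P1, P2, P3, P4, key, E3, boxS]
  ring

end UpliftData

lemma ricci_comm_of_trace {g : (ι → ℝ) → Matrix ι ι ℝ}
    {x : ι → ℝ} (hg : ∀ᶠ x in nhds x, (g x).transpose = g x) {i j : ι}
    (h : ∑ k, pd j (christoffel g k i k) x = ∑ k, pd i (christoffel g k j k) x) :
    ricci g i j x = ricci g j i x := by
  have h1 : ∀ k, pd k (christoffel g k i j) x = pd k (christoffel g k j i) x := fun k =>
    pd_congr (hg.eventually_nhds.mono fun _ hw => christoffel_comm hw k i j) k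
  rw [ricci_eq, ricci_eq, h, sum_comm (f := fun k l => christoffel g k j l x * _)]
  simp only [h1, christoffel_comm hg _ i j, mul_comm (christoffel g _ j _ x)]

namespace UpliftData

lemma pd_inr_of_eq_comp_projX (S : Uplift) (hz : z ∈ region U Ω) {Q : ℝ¹⁰ → ℝ}
    {f : ℝ⁶ → ℝ} (h : ∀ w ∈ region U Ω, Q w = f ♯w)
    (hf : Diff f ♯z) (m : Fin 4) : pd (inr m) Q z = 0 := by
  rw [S.pd_of_eq_inr hz (k := fun _ => 1) (fun w hw => (h w hw).trans (mul_one _).symm) hf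
    (differentiableAt_const _), pd_const, mul_zero]

lemma pd_inl_of_eq_comp_projY (S : Uplift) (hz : z ∈ region U Ω) {Q : ℝ¹⁰ → ℝ}
    {k : ℝ⁴ → ℝ} (h : ∀ w ∈ region U Ω, Q w = k ♭w)
    (hk : Diff k ♭z) (μ : Fin 6) : pd (inl μ) Q z = 0 := by
  rw [S.pd_of_eq_inl hz (f := fun _ => 1) (fun w hw => (h w hw).trans (one_mul _).symm)
    (differentiableAt_const _) hk, pd_const, zero_mul]

lemma diff_christoffel_rrr (S : Uplift) (hy : y ∈ Ω) (p m n : Fin 4) :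
    Diff (fun y => 3 * (δ[p,n] * hDown H m y + δ[p,m] * hDown H n y - δ[m,n] * hDown H p y)) y :=
  ((((S.diff_hDown hy m).const_mul _).fun_add ((S.diff_hDown hy n).const_mul _)).fun_sub
    ((S.diff_hDown hy p).const_mul _)).const_mul 3

lemma pd_trace_lr (S : Uplift) (hz : z ∈ region U Ω) (μ : Fin 6) (m : Fin 4) :
    ∑ k, pd (inr m) (christoffel 𝐠 k (inl μ) k) z = 0 := by
  rw [Fintype.sum_sum_type]
  simp only [fun l => S.pd_inr_of_eq_comp_projX hz (fun w hw => S.christoffel_lll' hw l μ l)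
      (S.diff_confGammaField hz.1 l μ l) m,
    fun p => S.pd_inr_of_eq_comp_projX hz (fun w hw => S.christoffel_rlr hw μ p p)
      ((S.diff_sDown hz.1 μ).const_mul _) m]
  simp

lemma pd_trace_rl (S : Uplift) (hz : z ∈ region U Ω) (μ : Fin 6) (m : Fin 4) :
    ∑ k, pd (inl μ) (christoffel 𝐠 k (inr m) k) z = 0 := by
  rw [Fintype.sum_sum_type]
  simp only [fun l => S.pd_inl_of_eq_comp_projY hz (fun w hw => S.christoffel_lrl hw l l m)
      ((S.diff_hDown hz.2 m).const_mul _).fun_neg μ,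
    fun p => S.pd_inl_of_eq_comp_projY hz (fun w hw => S.christoffel_rrr hw p m p)
      (S.diff_christoffel_rrr hz.2 p m p) μ]
  simp

lemma exp_mul_exp_neg (c s : ℝ) : exp (c * s) * exp (-c * s) = 1 := by
  rw [← exp_add]
  simp

lemma ricci_lr (S : Uplift) (hz : z ∈ region U Ω) (μ : Fin 6) (m : Fin 4) :
    ricci 𝐠 (inl μ) (inr m) z = -(8 * (sDown F μ ♯z * hDown H m ♭z)) := by
  have hx := hz.1
  have hp := (S.pos _ hz.2).ne'
  have P1 : ∑ k, pd k (christoffel 𝐠 k (inl μ) (inr m)) z = 0 := by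
    rw [Fintype.sum_sum_type]
    simp only [fun l => S.pd_inl_of_eq_comp_projY hz (fun w hw => S.christoffel_llr hw l μ m)
        ((S.diff_hDown hz.2 m).const_mul _).fun_neg l,
      fun p => S.pd_inr_of_eq_comp_projX hz (fun w hw => S.christoffel_rlr hw μ p m)
        ((S.diff_sDown hx μ).const_mul _) p]
    simp
  have P3 : ∑ l, (∑ k, christoffel 𝐠 k k l z) * christoffel 𝐠 l (inl μ) (inr m) z =
      -((∑ l, christoffel F.metric l l μ ♯z - 2 * sDown F μ ♯z) *
        hDown H m ♭z) + 6 * hDown H m ♭z * sDown F μ ♯z := by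
    rw [Fintype.sum_sum_type]
    simp only [S.christoffel_trace_l hz, S.christoffel_trace_r hz, S.christoffel_llr hz,
      S.christoffel_rlr hz]
    simp
  have tr := sum_confGamma_trace (G := fun l μ ν => christoffel F.metric l μ ν ♯z)
    (g := fun μ ν => F.metric ♯z μ ν) (s := fun μ => sDown F μ ♯z)
    (su := fun μ => sUp F μ ♯z) (S.sum_metric_sUp hx) μ
  have P4 : ∑ k, ∑ l, christoffel 𝐠 k (inr m) l z * christoffel 𝐠 l (inl μ) k z =
      -(hDown H m ♭z * (∑ l, christoffel F.metric l μ l ♯z -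
        6 * sDown F μ ♯z)) + 10 * (hDown H m ♭z * sDown F μ ♯z) := by
    simp only [Fintype.sum_sum_type, S.christoffel_lrl hz, S.christoffel_lll' hz,
      S.christoffel_lrr hz, S.christoffel_rll hz, S.christoffel_rrl hz, S.christoffel_llr hz,
      S.christoffel_rrr hz, S.christoffel_rlr hz, sum_add_distrib]
    have e1 : ∑ k, ∑ l, -(δ[k,l] * hDown H m ♭z) * confGammaField F l μ k ♯z = -(hDown H m ♭z *
          (∑ l, christoffel F.metric l μ l ♯z - 6 * sDown F μ ♯z)) := by
      rw [← tr]
      simp [confGammaField, mul_sum]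
    have e2 : ∑ k, ∑ p, -δ[m,p] * (exp (1 / √2 * F.sigma ♯z) *
        sUp F k ♯z) * H ♭z * (exp (-(1 / √2) * F.sigma ♯z) *
          F.metric ♯z μ k * (hDown H p ♭z * (H ♭z)⁻¹)) =
        -(hDown H m ♭z * sDown F μ ♯z) := by
      rw [← S.sum_metric_sUp hx μ, mul_sum, ← sum_neg_distrib]
      refine sum_congr rfl fun k _ => ?_
      rw [sum_eq_single m (fun p _ h => by simp [h.symm]) (by simp), if_pos rfl]
      have := exp_mul_exp_neg (1 / √2) (F.sigma ♯z)
      have h2 := mul_inv_cancel₀ hp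
      linear_combination (-(hDown H m ♭z * F.metric ♯z μ k * sUp F k ♯z) * H ♭z * (H ♭z)⁻¹) * this -
        (hDown H m ♭z * F.metric ♯z μ k * sUp F k ♯z) * h2
    have e3 : ∑ p : Fin 4, ∑ l : Fin 6, δ[p,m] * sDown F l ♯z * -(δ[l,μ] * hDown H p ♭z) =
        -(hDown H m ♭z * sDown F μ ♯z) := by
      rw [sum_eq_single m (fun p _ h => by simp [h]) (by simp),
        sum_eq_single μ (fun p _ h => by simp [h]) (by simp)]
      simp
      ring
    have e4 : ∑ p : Fin 4, ∑ q : Fin 4, 3 * (δ[p,q] * hDown H m ♭z + δ[p,m] * hDown H q ♭z -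
        δ[m,q] * hDown H p ♭z) * (δ[q,p] * sDown F μ ♯z) =
        12 * (hDown H m ♭z * sDown F μ ♯z) := by
      have : ∀ p : Fin 4, ∑ q : Fin 4, 3 * (δ[p,q] * hDown H m ♭z + δ[p,m] * hDown H q ♭z -
        δ[m,q] * hDown H p ♭z) * (δ[q,p] * sDown F μ ♯z) = 3 * (hDown H m ♭z * sDown F μ ♯z) := by
        intro p
        rw [sum_eq_single p (fun q _ h => by simp [h]) (by simp)]
        simp only [if_true, eq_comm (a := m) (b := p)]
        ring
      rw [sum_congr rfl fun p _ => this p]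
      simp
      ring
    rw [e1, e2, e3, e4]
    ring
  have tG : ∑ l, christoffel F.metric l l μ ♯z = ∑ l, christoffel F.metric l μ l ♯z :=
    sum_congr rfl fun l _ => christoffel_comm (S.eventually_symm hx) l l μ
  rw [ricci_eq, P1, S.pd_trace_lr hz, P3, P4, tG]
  ring

lemma uplift_metric_symm (S : Uplift) (hz : z ∈ region U Ω) : (𝐠 z).transpose = 𝐠 z := by
  change (fromBlocks _ _ _ _).transpose = fromBlocks _ _ _ _
  rw [Matrix.fromBlocks_transpose, Matrix.transpose_smul, (S.lorentzian hz.1).transpose_eq]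
  simp

lemma ricci_rl (S : Uplift) (hz : z ∈ region U Ω) (μ : Fin 6) (m : Fin 4) :
    ricci 𝐠 (inr m) (inl μ) z = -(8 * (sDown F μ ♯z * hDown H m ♭z)) := by
  rw [← S.ricci_lr hz]
  exact ricci_comm_of_trace ((S.eventually_region hz).mono fun _ => S.uplift_metric_symm)
    ((S.pd_trace_rl hz μ m).trans (S.pd_trace_lr hz μ m).symm)

lemma ricci_rr (S : Uplift) (hz : z ∈ region U Ω) (m n : Fin 4) : ricci 𝐠 (inr m) (inr n) z =
      -(δ[m,n] * (H ♭z * exp (1 / √2 * F.sigma ♯z) *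
        boxS F ♯z)) - 24 * (hDown H m ♭z * hDown H n ♭z) +
      24 * (δ[m,n] * ∑ p, hDown H p ♭z ^ 2) := by
  have hx := hz.1
  have hy := hz.2
  have hp := (S.pos _ hz.2).ne'
  have hhc : pd m (hDown H n) ♭z = pd n (hDown H m) ♭z := by
    rw [S.pd_hDown hy, S.pd_hDown hy, pd_pd_comm S.isOpenΩ S.smooth hy]
    ring
  have hdiv : ∑ p, pd p (hDown H p) ♭z = -8 * ∑ p, hDown H p ♭z ^ 2 := by
    simp only [S.pd_hDown hy]
    rw [sum_sub_distrib, ← Finset.sum_div, S.harm _ hy, zero_div, mul_sum, zero_sub,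
      ← sum_neg_distrib]
    exact sum_congr rfl fun p _ => by ring
  have hEs : ∀ l, Diff (fun x => exp (1 / √2 * F.sigma x) * sUp F l x)
      ♯z := fun l => ((S.diff_sigma hx).const_mul _).exp.fun_mul (S.diff_sUp hx l)
  have D1 : ∀ l, pd (inl l)
      (christoffel 𝐠 (inl l) (inr m) (inr n)) z =
      -(δ[m,n] * H ♭z) * (exp (1 / √2 * F.sigma ♯z) *
        (4 * (sDown F l ♯z * sUp F l ♯z) + pd l (sUp F l) ♯z)) := by
    intro l
    rw [S.pd_of_eq_inl hz (f := fun x => -δ[m,n] * (exp (1 / √2 * F.sigma x) * sUp F l x)) (k := H)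
      (fun w hw => S.christoffel_lrr hw l m n) ((hEs l).const_mul _) (S.diff_H hy),
      pd_const_mul (hEs l), pd_mul ((S.diff_sigma hx).const_mul _).exp (S.diff_sUp hx l),
      pd_exp_mul (S.diff_sigma hx), one_div_sqrt_two, sDown]
    ring
  have D2 : ∀ p, pd (inr p)
      (christoffel 𝐠 (inr p) (inr m) (inr n)) z =
      3 * (δ[p,n] * pd p (hDown H m) ♭z + δ[p,m] * pd p (hDown H n) ♭z -
        δ[m,n] * pd p (hDown H p) ♭z) := by
    intro p
    have a1 := (S.diff_hDown hy m).const_mul δ[p,n]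
    have a2 := (S.diff_hDown hy n).const_mul δ[p,m]
    have a3 := (S.diff_hDown hy p).const_mul δ[m,n]
    rw [S.pd_of_eq_inr hz (f := fun _ => 1) (fun w hw =>
      (S.christoffel_rrr hw p m n).trans (one_mul _).symm) (differentiableAt_const _)
      (S.diff_christoffel_rrr hy p m n), one_mul, pd_const_mul ((a1.fun_add a2).fun_sub a3),
      pd_sub (a1.fun_add a2) a3, pd_add a1 a2, pd_const_mul (S.diff_hDown hy m),
      pd_const_mul (S.diff_hDown hy n), pd_const_mul (S.diff_hDown hy p)]
  have P1 : ∑ k, pd k (christoffel 𝐠 k (inr m) (inr n)) z =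
      -(δ[m,n] * H ♭z) * (exp (1 / √2 * F.sigma ♯z) *
        (4 * ∑ l, sDown F l ♯z * sUp F l ♯z + ∑ l, pd l (sUp F l) ♯z)) +
      3 * (2 * pd n (hDown H m) ♭z + δ[m,n] * (8 * ∑ p, hDown H p ♭z ^ 2)) := by
    rw [Fintype.sum_sum_type]
    simp only [D1, D2, ← mul_sum, sum_add_distrib, sum_sub_distrib, hdiv]
    simp only [ite_mul, one_mul, zero_mul, sum_ite_eq', mem_univ, if_true, hhc]
    split_ifs <;> ring
  have P2 : ∑ k, pd (inr n) (christoffel 𝐠 k (inr m) k) z = 6 * pd n (hDown H m) ♭z := by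
    have a : ∀ l, pd (inr n)
        (christoffel 𝐠 (inl l) (inr m) (inl l)) z =
        -1 * pd n (hDown H m) ♭z := by
      intro l
      rw [S.pd_of_eq_inr hz (f := fun _ => -1) (k := hDown H m) (fun w hw => by
        rw [S.christoffel_lrl hw, if_pos rfl]; ring) (differentiableAt_const _)
        (S.diff_hDown hy m)]
    have b : ∀ p, pd (inr n)
        (christoffel 𝐠 (inr p) (inr m) (inr p)) z =
        3 * pd n (hDown H m) ♭z := by
      intro p
      rw [S.pd_of_eq_inr hz (f := fun _ => 3) (k := hDown H m) (fun w hw => by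
        simp only [S.christoffel_rrr hw, eq_comm (a := m) (b := p)]; simp)
        (differentiableAt_const _) (S.diff_hDown hy m)]
    rw [Fintype.sum_sum_type]
    simp only [a, b]
    simp
    ring
  have P3 : ∑ l, (∑ k, christoffel 𝐠 k k l z) * christoffel 𝐠 l (inr m) (inr n) z =
      -(δ[m,n] * H ♭z) * (exp (1 / √2 * F.sigma ♯z) *
        (∑ l, (∑ k, christoffel F.metric k k l ♯z) * sUp F l ♯z -
          2 * ∑ l, sDown F l ♯z * sUp F l ♯z)) +
      36 * (hDown H m ♭z * hDown H n ♭z) -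
      18 * (δ[m,n] * ∑ p, hDown H p ♭z ^ 2) := by
    rw [Fintype.sum_sum_type]
    simp only [S.christoffel_trace_l hz, S.christoffel_trace_r hz, S.christoffel_lrr hz,
      S.christoffel_rrr hz]
    have e1 : ∑ l, (∑ k, christoffel F.metric k k l ♯z - 2 * sDown F l ♯z) *
        (-δ[m,n] * (exp (1 / √2 * F.sigma ♯z) * sUp F l ♯z) * H ♭z) = -(δ[m,n] * H ♭z) *
        (exp (1 / √2 * F.sigma ♯z) * (∑ l, (∑ k, christoffel F.metric k k l ♯z) * sUp F l ♯z -
          2 * ∑ l, sDown F l ♯z * sUp F l ♯z)) := by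
      rw [mul_sum (a := (2 : ℝ)), ← sum_sub_distrib, mul_sum, mul_sum]
      exact sum_congr rfl fun l _ => by ring
    have e2 : ∑ p, 6 * hDown H p ♭z * (3 * (δ[p,n] * hDown H m ♭z + δ[p,m] * hDown H n ♭z -
        δ[m,n] * hDown H p ♭z)) =
        ∑ p, (δ[p,n] * (18 * (hDown H p ♭z * hDown H m ♭z)) +
          δ[p,m] * (18 * (hDown H p ♭z * hDown H n ♭z)) -
          18 * (δ[m,n] * hDown H p ♭z ^ 2)) :=
      sum_congr rfl fun p _ => by ring
    rw [e1, e2]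
    simp only [sum_add_distrib, sum_sub_distrib, ← mul_sum]
    simp only [ite_mul, one_mul, zero_mul, sum_ite_eq', mem_univ, if_true]
    ring
  have P4 : ∑ k, ∑ l, christoffel 𝐠 k (inr n) l z * christoffel 𝐠 l (inr m) k z =
      60 * (hDown H m ♭z * hDown H n ♭z) -
      18 * (δ[m,n] * ∑ p, hDown H p ♭z ^ 2) -
      2 * (δ[m,n] * (H ♭z * (exp (1 / √2 * F.sigma ♯z) * ∑ l, sDown F l ♯z * sUp F l ♯z))) := by
    simp only [Fintype.sum_sum_type, S.christoffel_lrl hz, S.christoffel_lrr hz,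
      S.christoffel_rrl hz, S.christoffel_rrr hz, sum_add_distrib]
    have e1 : ∑ k : Fin 6, ∑ l : Fin 6, -(δ[k,l] * hDown H n ♭z) * -(δ[l,k] * hDown H m ♭z) =
        6 * (hDown H m ♭z * hDown H n ♭z) := by
      simp
      ring
    have e2 : ∑ k, ∑ p, -δ[n,p] * (exp (1 / √2 * F.sigma ♯z) *
        sUp F k ♯z) * H ♭z * (δ[p,m] * sDown F k ♯z) =
        -(δ[m,n] * (H ♭z * (exp (1 / √2 * F.sigma ♯z) *
        ∑ l, sDown F l ♯z * sUp F l ♯z))) := by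
      simp only [mul_sum, ← sum_neg_distrib]
      refine sum_congr rfl fun k _ => ?_
      rw [sum_eq_single n (fun p _ h => by simp [h.symm]) (by simp)]
      simp only [if_true, eq_comm (a := n) (b := m)]
      ring
    have e3 : ∑ p, ∑ l, δ[p,n] * sDown F l ♯z * (-δ[m,p] * (exp (1 / √2 * F.sigma ♯z) *
        sUp F l ♯z) * H ♭z) =
        -(δ[m,n] * (H ♭z * (exp (1 / √2 * F.sigma ♯z) *
        ∑ l, sDown F l ♯z * sUp F l ♯z))) := by
      rw [sum_eq_single n (fun p _ h => by simp [h]) (by simp)]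
      simp only [mul_sum, ← sum_neg_distrib]
      refine sum_congr rfl fun k _ => ?_
      simp only [if_true]
      ring
    have e4 : ∀ h : ℝ⁴, ∑ p, ∑ q, 3 * (δ[p,q] * h n + δ[p,n] * h q -
        δ[n,q] * h p) * (3 * (δ[q,p] * h m + δ[q,m] * h p - δ[m,p] * h q)) =
        54 * (h m * h n) - 18 * (δ[m,n] * ∑ p, h p ^ 2) := by
      intro h
      fin_cases m <;> fin_cases n <;> simp [Fin.sum_univ_four] <;> ring
    rw [e1, e2, e3, e4 fun p => hDown H p ♭z]
    ring
  rw [ricci_eq, P1, P2, P3, P4, boxS]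
  ring

end UpliftData

lemma det_updateRow_eq_sum {n : ℕ} {A : Matrix (Fin n) (Fin n) ℝ} (h : A.det ≠ 0) (j : Fin n)
    (b : Fin n → ℝ) : (A.updateRow j b).det = A.det * ∑ k, A⁻¹ k j * b k := by
  rw [← Matrix.cramer_transpose_apply, Matrix.cramer_eq_adjugate_mulVec,
    ← Matrix.adjugate_transpose, Matrix.mulVec, dotProduct, mul_sum]
  refine sum_congr rfl fun k _ => ?_
  simp only [transpose_apply, Matrix.inv_def, Ring.inverse_eq_inv', Matrix.smul_apply, smul_eq_mul]
  field_simp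

section Jacobi

variable {n : ℕ} {g : (Fin n → ℝ) → Matrix (Fin n) (Fin n) ℝ} {x : Fin n → ℝ}

lemma pd_det (hg : ∀ i j, Diff (fun x => g x i j) x) (h0 : (g x).det ≠ 0) (i : Fin n) :
    Diff (fun x => (g x).det) x ∧ pd i (fun x => (g x).det) x =
      (g x).det * ∑ j, ∑ k, (g x)⁻¹ k j * pd i (fun x => g x j k) x := by
  let D := (toForm (Matrix.detRowAlternating :
    (Fin n → ℝ) [⋀^Fin n]→ₗ[ℝ] ℝ)).toContinuousMultilinearMap
  let G : (Fin n → ℝ) → Fin n → Fin n → ℝ := fun x i j => g x i j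
  have hG : HasFDerivAt G (ContinuousLinearMap.pi fun i => ContinuousLinearMap.pi fun j =>
      fderiv ℝ (fun x => g x i j) x) x :=
    hasFDerivAt_pi.2 fun i => hasFDerivAt_pi.2 fun j => (hg i j).hasFDerivAt
  have hD := (D.hasFDerivAt (G x)).comp x hG
  have hD' : HasFDerivAt (fun x => (g x).det) _ x := hD
  refine ⟨hD'.differentiableAt, ?_⟩
  rw [pd, hD'.fderiv, ContinuousLinearMap.comp_apply, ContinuousMultilinearMap.linearDeriv_apply,
    mul_sum]
  refine sum_congr rfl fun j _ => ?_
  exact det_updateRow_eq_sum h0 j _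

lemma sum_christoffel_trace (hg : ∀ᶠ x in nhds x, (g x).transpose = g x) (i : Fin n) :
    ∑ k, christoffel g k k i x = 1 / 2 * ∑ j, ∑ k, (g x)⁻¹ k j * pd i (fun x => g x j k) x := by
  have hs : ∀ l a b, pd l (fun z => g z a b) x = pd l (fun z => g z b a) x := fun l a b =>
    pd_congr (hg.mono fun w hw => congrFun (congrFun hw b) a) l
  have hi : ∀ a b, (g x)⁻¹ a b = (g x)⁻¹ b a := fun a b => by
    conv_lhs => rw [← hg.self_of_nhds, ← Matrix.transpose_nonsing_inv]
    rfl
  have h1 : ∑ k, ∑ l, (g x)⁻¹ k l * pd k (fun z => g z i l) x =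
      ∑ k, ∑ l, (g x)⁻¹ k l * pd l (fun z => g z k i) x := by
    rw [sum_comm]
    refine sum_congr rfl fun k _ => sum_congr rfl fun l _ => ?_
    rw [hi, hs l i k]
  have h2 : ∑ j, ∑ k, (g x)⁻¹ k j * pd i (fun x => g x j k) x =
      ∑ k, ∑ l, (g x)⁻¹ k l * pd i (fun z => g z k l) x :=
    sum_congr rfl fun k _ => sum_congr rfl fun l _ => by rw [hi]
  simp only [christoffel, mul_add, mul_sub, sum_add_distrib, sum_sub_distrib, ← mul_sum]
  rw [h1, h2]
  ring

lemma pd_sqrt_abs_det (hs : ∀ᶠ x in nhds x, (g x).transpose = g x)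
    (hg : ∀ i j, Diff (fun x => g x i j) x) (h0 : ∀ᶠ x in nhds x, (g x).det < 0) (i : Fin n) :
    Diff (fun x => √|(g x).det|) x ∧
    pd i (fun x => √|(g x).det|) x = √|(g x).det| * ∑ k, christoffel g k k i x := by
  have hd := pd_det hg h0.self_of_nhds.ne i
  have hn : 0 < -(g x).det := neg_pos.2 h0.self_of_nhds
  have he : (fun x => √|(g x).det|) =ᶠ[nhds x] fun x => √(-(g x).det) := h0.mono fun w hw => by
      change √|(g w).det| = √(-(g w).det)
      rw [abs_of_neg hw]
  have h1 := hd.1.hasFDerivAt.fun_neg.sqrt hn.ne'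
  refine ⟨h1.differentiableAt.congr_of_eventuallyEq he, ?_⟩
  rw [pd_congr he, pd, h1.fderiv]
  have h2 : fderiv ℝ (fun x => (g x).det) x (coordVec i) = _ := hd.2
  simp only [smul_apply, neg_apply, smul_eq_mul, h2, abs_of_neg h0.self_of_nhds]
  rw [sum_christoffel_trace hs]
  have h3 := Real.sqrt_pos.2 hn
  have h4 := mul_self_sqrt hn.le
  field_simp
  rw [sq_sqrt hn.le]
  ring

end Jacobi

section Laplacian

variable {g : ℝ⁶ → Mat₆} {x : ℝ⁶} {U : Set ℝ⁶}

lemma dScalar_vec (f : ℝ⁶ → ℝ) (x v : ℝ⁶) : dScalar f x (fun _ => v) = ∑ ρ, v ρ * pd ρ f x := by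
  change fderiv ℝ f x v = _
  conv_lhs => rw [pi_eq_sum_univ' v, map_sum]
  simp only [map_smul, smul_eq_mul]
  rfl

lemma star6_one_eq_sum (g : Mat₆) (θ : Λ⁶ 1) : ⋆₁ g θ =
      ∑ i, (√|g.det| * θ (fun _ => g⁻¹ i)) • ⋆₁ 1 (dCoord i) := by
  have hsum : ∀ f : (Fin 1 → Fin 6) → ℝ, ∑ I, f I = ∑ i, f (fun _ => i) := fun f =>
    ((Equiv.funUnique (Fin 1) (Fin 6)).symm.sum_comp f).symm
  ext v
  rw [Form.sum_apply]
  simp only [star6, Form.smul_apply, hodge_apply, hsum, one_inv_row, dCoord_coordVec, det_one]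
  simp [mul_sum, mul_assoc]

lemma extDeriv_star6_dScalar (hU : IsOpen U) (hg : IsLorentzianMetricOn g U)
    {f : ℝ⁶ → ℝ} (hf : ContDiffOn ℝ ∞ f U) (hx : x ∈ U) :
    extDeriv (fun w => ⋆₁ (g w) (dScalar f w)) x =
      (√|(g x).det| * (∑ μ, pd μ (fun w => ∑ ρ, (g w)⁻¹ μ ρ * pd ρ f w) x +
        ∑ μ, (∑ k, christoffel g k k μ x) * ∑ ρ, (g x)⁻¹ μ ρ * pd ρ f x)) •
          coordVol (finCongr rfl : Fin 6 ≃ Fin (5 + 1)) := by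
  have hv : ∀ μ, Diff (fun w => ∑ ρ, (g w)⁻¹ μ ρ * pd ρ f w) x := fun μ =>
    (ContDiffOn.sum fun ρ _ => (contDiffOn_matrix_inv hg.1
      (fun _ hx => (hg.2 _ hx).det_neg.ne) μ ρ).mul (hf.pd hU ρ)).differentiableAt_of_isOpen hU hx
  have hd := pd_sqrt_abs_det (g := g) (x := x)
    (Filter.eventually_of_mem (hU.mem_nhds hx) fun _ hw => (hg.2 _ hw).transpose_eq)
    (fun i j => (hg.1 i j).differentiableAt_of_isOpen hU hx)
    (Filter.eventually_of_mem (hU.mem_nhds hx) fun _ hw => (hg.2 _ hw).det_neg)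
  have h1 : (fun w => ⋆₁ (g w) (dScalar f w)) = fun w => ∑ i,
      (√|(g w).det| * ∑ ρ, (g w)⁻¹ i ρ * pd ρ f w) • ⋆₁ 1 (dCoord i) := by
    funext w
    rw [star6_one_eq_sum]
    simp only [dScalar_vec]
  have hp : ∀ i, Diff (fun w => √|(g w).det| * ∑ ρ, (g w)⁻¹ i ρ * pd ρ f w) x :=
    fun i => (hd i).1.fun_mul (hv i)
  have hw : ∀ (u : ℝ⁶ → ℝ) (i : Fin 6), castForm (Nat.add_comm 1 5)
      (wedge (dScalar u x) (⋆₁ 1 (dCoord i))) =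
      pd i u x • coordVol (finCongr rfl : Fin 6 ≃ Fin (5 + 1)) := by
    intro u i
    have hsum : ∀ f : (Fin 1 → Fin 6) → ℝ, ∑ I, f I = ∑ i, f (fun _ => i) := fun f =>
      ((Equiv.funUnique (Fin 1) (Fin 6)).symm.sum_comp f).symm
    rw [star6, wedge_hodge, formInner, hsum]
    simp only [one_inv_row, dCoord_coordVec, dScalar_coordVec, det_one]
    simp
    rfl
  rw [h1, extDeriv_sum _ fun i _ => (hp i).smul_const _, mul_add, mul_sum, mul_sum,
    ← sum_add_distrib, sum_smul]
  refine sum_congr rfl fun i _ => ?_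
  rw [extDeriv_smul_fun (hp i) (differentiableAt_const _), extDeriv_const, smul_zero, zero_add, hw,
    pd_mul (hd i).1 (hv i), (hd i).2]
  congr 1
  ring

end Laplacian

namespace UpliftData

lemma extDeriv_star6_sigma (S : Uplift) (hx : x ∈ U) :
    extDeriv (fun w => ⋆₁ (F.metric w) (dScalar F.sigma w)) x =
      (√|(F.metric x).det| * (4 * √2 * boxS F x)) •
          coordVol (finCongr rfl : Fin 6 ≃ Fin (5 + 1)) := by
  have hv : ∀ μ, Diff (fun w => ∑ ρ, (F.metric w)⁻¹ μ ρ * pd ρ F.sigma w) x := fun μ =>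
    (ContDiffOn.sum fun ρ _ => (contDiffOn_matrix_inv S.reg.metric.1
      (fun _ hx => (S.lorentzian hx).det_neg.ne) μ ρ).mul
        (S.reg.sigma.pd S.isOpenU ρ)).differentiableAt_of_isOpen S.isOpenU hx
  have hs : ∀ μ, sUp F μ = fun w => 1 / (2 * √2) / 2 * ∑ ρ, (F.metric w)⁻¹ μ ρ * pd ρ F.sigma w := by
    intro μ
    funext w
    rw [sUp, mul_sum]
    exact sum_congr rfl fun ρ _ => by rw [sDown]; ring
  rw [extDeriv_star6_dScalar S.isOpenU S.reg.metric S.reg.sigma hx, boxS]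
  simp only [hs, fun μ => pd_const_mul (hv μ) (1 / (2 * √2) / 2)]
  simp only [mul_left_comm _ (1 / (2 * √2) / 2), ← mul_sum]
  congr 2
  have h : √2 ≠ 0 := by positivity
  rw [← mul_add, ← mul_assoc]
  field_simp
  norm_num

lemma eom_sigma_iff (S : Uplift) (hx : x ∈ U) :
    extDeriv (fun w => ⋆₁ (F.metric w) (dScalar F.sigma w)) x + (1 / √2 * exp (-(√2 * F.sigma x))) •
        ∑ m, wedge (dφ m x) (⋆₁ (F.metric x) (dφ m x)) -
      (1 / √2 * exp (√2 * F.sigma x)) • wedge (F.H0 x) (⋆₃ (F.metric x) (F.H0 x)) = 0 ↔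
    boxS F x = -(1 / 8 * exp (-(√2 * F.sigma x)) * ∑ m, formInner (F.metric x) (dφ m x) (dφ m x)) +
      1 / 48 * exp (√2 * F.sigma x) * normSq (F.metric x) (F.H0 x) := by
  have hd : 0 < √|(F.metric x).det| := Real.sqrt_pos.2 (abs_pos.2 (S.lorentzian hx).det_neg.ne)
  have h2 : √2 ≠ 0 := by positivity
  have hs : √2 * √2 = 2 := mul_self_sqrt (by norm_num)
  have hn : coordVol (finCongr rfl : Fin 6 ≃ Fin (5 + 1)) ≠ 0 := fun h => by
    have := coordVol_self (finCongr rfl : Fin 6 ≃ Fin (5 + 1))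
    rw [h] at this
    exact zero_ne_one this
  have e : extDeriv (fun w => ⋆₁ (F.metric w) (dScalar F.sigma w)) x +
      (1 / √2 * exp (-(√2 * F.sigma x))) • ∑ m, wedge (dφ m x) (⋆₁ (F.metric x) (dφ m x)) -
      (1 / √2 * exp (√2 * F.sigma x)) • wedge (F.H0 x) (⋆₃ (F.metric x) (F.H0 x)) =
      (√|(F.metric x).det| * (4 * √2) * (boxS F x - (-(1 / 8 * exp (-(√2 * F.sigma x)) *
        ∑ m, formInner (F.metric x) (dφ m x) (dφ m x)) +
      1 / 48 * exp (√2 * F.sigma x) * normSq (F.metric x) (F.H0 x)))) •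
        coordVol (finCongr rfl : Fin 6 ≃ Fin (5 + 1)) := by
    rw [S.extDeriv_star6_sigma hx]
    simp only [star6, wedge_hodge, ← sum_smul, ← mul_sum]
    rw [normSq_eq_formInner]
    have hf : ((Nat.factorial 3 : ℕ) : ℝ) = 6 := by norm_num [Nat.factorial]
    ext v
    simp only [Form.sub_apply, Form.add_apply, Form.smul_apply, hf, Nat.factorial_one, Nat.cast_one]
    change _ + _ * (_ * coordVol (finCongr rfl : Fin 6 ≃ Fin (5 + 1)) v) -
      _ * (_ * coordVol (finCongr rfl : Fin 6 ≃ Fin (5 + 1)) v) = _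
    have hi : 1 / √2 = √2 / 2 := by rw [div_eq_div_iff h2 two_ne_zero, hs, one_mul]
    rw [hi]
    ring
  rw [e, smul_eq_zero, or_iff_left hn, mul_eq_zero, or_iff_right (by positivity), sub_eq_zero]

end UpliftData

section Bilinear

variable (g : Matrix ι ι ℝ)

lemma formInner_add_left (a a' b : Form ι p) :
    formInner g (a + a') b = formInner g a b + formInner g a' b := by
  simp only [formInner, Form.add_apply, add_mul, sum_add_distrib]

lemma formInner_add_right (a b b' : Form ι p) :
    formInner g a (b + b') = formInner g a b + formInner g a b' := by
  simp only [formInner, Form.add_apply, mul_add, sum_add_distrib]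

lemma formInner_smul_left (c : ℝ) (a b : Form ι p) :
    formInner g (c • a) b = c * formInner g a b := by
  simp only [formInner, Form.smul_apply, mul_assoc, mul_sum]

lemma formInner_smul_right (c : ℝ) (a b : Form ι p) :
    formInner g a (c • b) = c * formInner g a b := by
  simp only [formInner, Form.smul_apply, mul_left_comm _ c, mul_sum]

lemma formInner_zero_left (b : Form ι p) : formInner g 0 b = 0 := by
  rw [← zero_smul ℝ (0 : Form ι p), formInner_smul_left, zero_mul]

lemma formInner_sum_left {S : Type*} (s : Finset S) (a : S → Form ι p) (b : Form ι p) :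
    formInner g (∑ i ∈ s, a i) b = ∑ i ∈ s, formInner g (a i) b :=
  map_sum (AddMonoidHom.mk' (fun a => formInner g a b) fun a a' => formInner_add_left g a a' b) a s

lemma formInner_sum_right {S : Type*} (s : Finset S) (a : Form ι p) (b : S → Form ι p) :
    formInner g a (∑ i ∈ s, b i) = ∑ i ∈ s, formInner g a (b i) :=
  map_sum (AddMonoidHom.mk' (fun b => formInner g a b) fun b b' => formInner_add_right g a b b') b s

lemma interior1_add (v : ι → ℝ) (a a' : Form ι (p + 1)) :
    interior1 v (a + a') = interior1 v a + interior1 v a' := rfl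

lemma interior1_smul (v : ι → ℝ) (c : ℝ) (a : Form ι (p + 1)) :
    interior1 v (c • a) = c • interior1 v a := rfl

lemma interior1_sum {S : Type*} (s : Finset S) (v : ι → ℝ) (a : S → Form ι (p + 1)) :
    interior1 v (∑ i ∈ s, a i) = ∑ i ∈ s, interior1 v (a i) :=
  map_sum (AddMonoidHom.mk' (interior1 v) fun a a' => interior1_add v a a') a s

lemma interior1_one (v : ι → ℝ) (a : Form ι 1) : interior1 v a = a (fun _ => v) • unitForm ι := by
  ext u
  rw [interior1_apply, Form.smul_apply, unitForm_apply, mul_one]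
  congr 1
  funext k
  obtain rfl : k = 0 := Subsingleton.elim (α := Fin 1) k 0
  rfl

lemma formInner_unitForm : formInner g (unitForm ι) (unitForm ι) = 1 := by
  simp [formInner, unitForm_apply]

lemma contract_eq_zero_of_eq_zero {a : Form ι (p + 1)} (h : a = 0) (i j : ι) :
    contract g a i j = 0 := by
  rw [contract_eq_formInner, h]
  exact formInner_zero_left g _

end Bilinear

section Mixed

variable {p q p' q' n : ℕ}

lemma formInner_bic_bic (h : p + q = n) {A B : ℝ} (hA : A ≠ 0) (hB : B ≠ 0)
    {g : Mat₆} (hg : g.det ≠ 0) (α α' : Λ⁶ p) (β β' : Λ⁴ q) :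
    formInner (warp A g B) (bic h α β) (bic h α' β') =
      (n.factorial : ℝ) / (p.factorial * q.factorial) * (A⁻¹ ^ p * B⁻¹ ^ q) *
        (formInner g α α' * formInner 1 β β') := by
  subst h
  exact formInner_bi_bi hA hB hg α α' β β'

lemma formInner_bic_of_ne (h : p + q = n) (h' : p' + q' = n) {A B : ℝ} (hA : A ≠ 0) (hB : B ≠ 0)
    {g : Mat₆} (hg : g.det ≠ 0) (hne : p ≠ p') (α : Λ⁶ p) (β : Λ⁴ q) (α' : Λ⁶ p') (β' : Λ⁴ q') :
    formInner (warp A g B) (bic h α β) (bic h' α' β') = 0 := by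
  subst h
  exact formInner_bi_of_ne hA hB hg h' hne α β α' β'

lemma interior1_inl_bic (h : p + 1 + q = n + 1) (μ : Fin 6) (α : Λ⁶ (p + 1))
    (β : Λ⁴ q) : interior1 (coordVec (inl μ)) (bic h α β) =
      bic (by omega) (interior1 (coordVec μ) α) β := by
  obtain rfl : n = p + q := by omega
  rw [← inlVec_coordVec]
  exact interior1_inl_bi _ α β

lemma interior1_inl_bic_zero (h : 0 + q = n + 1) (μ : Fin 6) (α : Λ⁶ 0)
    (β : Λ⁴ q) : interior1 (coordVec (inl μ)) (bic h α β) = 0 := by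
  rw [← inlVec_coordVec]
  exact interior1_inl_bi_zero _ α β h

lemma interior1_inr_bic (h : p + (q + 1) = n + 1) (m : Fin 4) (α : Λ⁶ p)
    (β : Λ⁴ (q + 1)) : interior1 (coordVec (inr m)) (bic h α β) =
      (-1 : ℝ) ^ p • bic (by omega) α (interior1 (coordVec m) β) := by
  obtain rfl : n = p + q := by omega
  rw [← inrVec_coordVec]
  exact interior1_inr_bi _ α β

lemma interior1_inr_bic_zero (h : p + 0 = n + 1) (m : Fin 4) (α : Λ⁶ p)
    (β : Λ⁴ 0) : interior1 (coordVec (inr m)) (bic h α β) = 0 := by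
  rw [← inrVec_coordVec]
  exact interior1_inr_bi_zero _ α β h

end Mixed

section FlatContraction

lemma formInner_dCoord (m n : Fin 4) :
    formInner 1 (dCoord m) (dCoord n) = if m = n then 1 else 0 := by
  have hsum : ∀ f : (Fin 1 → Fin 4) → ℝ, ∑ I, f I = ∑ i, f (fun _ => i) := fun f =>
    ((Equiv.funUnique (Fin 1) (Fin 4)).symm.sum_comp f).symm
  rw [formInner, hsum]
  simp [one_inv_row, dCoord_coordVec, eq_comm]

lemma sqrt_det_one : √|(1 : Matrix (Fin 4) (Fin 4) ℝ).det| = 1 := by simp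

lemma vol4_ne_zero : vol4 ≠ 0 := fun h => by
  have := vol4_self
  rw [h] at this
  exact zero_ne_one this

lemma sDelta_wedge_dCoord (m n : Fin 4) : wedge (sDelta m) (dCoord n) = -(δ[m,n] • vol4) := by
  rw [sDelta, starDelta_wedge]
  simp [dCoord_coordVec]

lemma wedge_starDelta_three (a b : Λ⁴ 3) :
    wedge a (starDelta 3 1 rfl b) = (1 / 6 * formInner 1 a b) • vol4 := by
  have h := wedge_hodge (p := 3) (q := 1) (finCongr rfl : Fin 4 ≃ Fin (3 + 1)) 1 a b
  rw [sqrt_det_one] at h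
  refine h.trans ?_
  norm_num [Nat.factorial]
  rfl

lemma formInner_sDelta (m n : Fin 4) :
    formInner 1 (sDelta m) (sDelta n) = if m = n then 6 else 0 := by
  have h := wedge_starDelta_three (sDelta m) (sDelta n)
  rw [starDelta_sDelta, wedge_neg_right, sDelta_wedge_dCoord, neg_neg] at h
  have h' := smul_left_injective ℝ vol4_ne_zero h
  have h'' : δ[m,n] = 1 / 6 * formInner 1 (sDelta m) (sDelta n) := h'
  split_ifs at h'' ⊢ <;> linarith

lemma formInner_interior1_sDelta (m n p q : Fin 4) :
    formInner 1 (interior1 (coordVec m) (sDelta p)) (interior1 (coordVec n) (sDelta q)) =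
      2 * (δ[m,n] * δ[p,q] - δ[m,q] * δ[p,n]) := by
  have h1 := formInner_rankOneDeriv_lowerIndex (g := (1 : Matrix (Fin 4) (Fin 4) ℝ)) (p := 2)
    (by simp) m n (sDelta p) (sDelta q)
  have h2 := rankOneDeriv_wedge (p := 2) (q := 0) (coordVec m)
    (lowerIndex (1 : Matrix (Fin 4) (Fin 4) ℝ) n) (sDelta p) (dCoord q)
  rw [rankOneDeriv_top (p := 3) (finCongr rfl : Fin 4 ≃ Fin (3 + 1)), lowerIndex_coordVec] at h2
  have h3 : rankOneDeriv (p := 0) (coordVec m) (lowerIndex (1 : Matrix (Fin 4) (Fin 4) ℝ) n)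
      (dCoord q) = δ[m,q] • dCoord n := by
    apply form_ext_coord
    intro I
    have hI : (fun k => (coordVec (I k) : ℝ⁴)) = fun _ => coordVec (I 0) := by
      funext k
      obtain rfl : k = 0 := Subsingleton.elim (α := Fin 1) k 0
      rfl
    have hu : Function.update (fun _ : Fin 1 => (coordVec (I 0) : ℝ⁴)) 0 (coordVec m) =
        fun _ => coordVec m := by
      funext k
      rw [Subsingleton.elim k 0]
      simp
    rw [hI, rankOneDeriv_apply, Form.smul_apply]
    refine (Fin.sum_univ_one (fun k : Fin 1 => _)).trans ?_
    rw [hu]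
    have hq : dCoord q (fun _ : Fin (0 + 1) => coordVec m) = if m = q then 1 else 0 :=
      dCoord_coordVec q m
    have hn : dCoord n (fun _ : Fin (0 + 1) => coordVec (I 0)) = if I 0 = n then 1 else 0 :=
      dCoord_coordVec n (I 0)
    rw [hq, hn]
    simp only [lowerIndex_coordVec, Matrix.one_apply, eq_comm (a := n)]
    ring
  have h4 := wedge_starDelta_three (rankOneDeriv (p := 2) (coordVec m)
    (lowerIndex (1 : Matrix (Fin 4) (Fin 4) ℝ) n) (sDelta p)) (sDelta q)
  rw [starDelta_sDelta, wedge_neg_right] at h4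
  rw [h3, wedge_smul_right, sDelta_wedge_dCoord, sDelta_wedge_dCoord] at h2
  rw [h1] at h4
  have h5 : (1 / 6 * (((2 : ℕ) + 1 : ℝ) * formInner 1 (interior1 (coordVec m) (sDelta p))
      (interior1 (coordVec n) (sDelta q)))) • vol4 =
      (δ[m,n] * δ[p,q] - δ[m,q] * δ[p,n]) • vol4 := by
    rw [← h4]
    ext v
    have := congrArg (fun θ => θ v) h2
    simp only [Form.add_apply, Form.neg_apply, Form.smul_apply, Matrix.one_apply,
      eq_comm (a := n) (b := m)]
      at this ⊢
    linear_combination this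
  have h6 := smul_left_injective ℝ vol4_ne_zero h5
  simp only [Nat.cast_ofNat] at h6
  linear_combination 2 * h6

end FlatContraction

section Flux

variable {A B : ℝ} {g : Mat₆} {c h : ℝ}

/-- A three-form with components of type `(0, 3)` and `(3, 0)`. -/
def fluxThree (α : Λ⁶ 3) (β : Λ⁴ 3) : Form Ten (2 + 1) :=
  bic rfl (unitForm _) β + bic rfl α (unitForm _)

/-- A two-form of type `(1, 1)`. -/
def fluxTwo (c : ℝ) (α : Fin 4 → Λ⁶ 1) : Form Ten (1 + 1) := c • ∑ m, bic rfl (α m) (dCoord m)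

/-- A four-form with components of type `(3, 1)` and `(1, 3)`. -/
def fluxFour (c h : ℝ) (α : Fin 4 → Λ⁶ 1) (η : Fin 4 → Λ⁶ 3) : Form Ten (3 + 1) :=
  ∑ m, bic rfl (η m) (dCoord m) + c • ∑ m, bic rfl (α m) (h • sDelta m)

lemma interior1_inl_fluxThree (μ : Fin 6) (α : Λ⁶ 3) (β : Λ⁴ 3) :
    interior1 (coordVec (inl μ)) (fluxThree α β) =
      bic rfl (interior1 (p := 2) (coordVec μ) α) (unitForm _) := by
  rw [fluxThree, interior1_add, interior1_inl_bic_zero, zero_add]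
  exact interior1_inl_bic (p := 2) (q := 0) (n := 2) rfl μ α _

lemma interior1_inr_fluxThree (m : Fin 4) (α : Λ⁶ 3) (β : Λ⁴ 3) :
    interior1 (coordVec (inr m)) (fluxThree α β) =
      bic rfl (unitForm _) (interior1 (p := 2) (coordVec m) β) := by
  rw [fluxThree, interior1_add, interior1_inr_bic_zero (p := 3) (n := 2) rfl, add_zero]
  exact (interior1_inr_bic (p := 0) (q := 2) (n := 2) rfl m _ β).trans (by rw [pow_zero, one_smul])

lemma interior1_inl_fluxTwo (μ : Fin 6) (α : Fin 4 → Λ⁶ 1) :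
    interior1 (coordVec (inl μ)) (fluxTwo c α) =
      c • ∑ m, α m (fun _ => coordVec μ) • bic rfl (unitForm _) (dCoord m) := by
  rw [fluxTwo, interior1_smul, interior1_sum]
  simp only [fun m => interior1_inl_bic (p := 0) (q := 1) (n := 1) rfl μ (α m) (dCoord m),
    interior1_one, bic_smul_left]

lemma interior1_inr_fluxTwo (m : Fin 4) (α : Fin 4 → Λ⁶ 1) :
    interior1 (coordVec (inr m)) (fluxTwo c α) = (-c) • bic rfl (α m) (unitForm _) := by
  rw [fluxTwo, interior1_smul, interior1_sum]
  simp only [fun p => interior1_inr_bic (p := 1) (q := 0) (n := 1) rfl m (α p) (dCoord p),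
    interior1_one, bic_smul_right, dCoord_coordVec]
  simp only [ite_smul, one_smul, zero_smul, smul_ite, smul_zero, sum_ite_eq, mem_univ, if_true,
    pow_one, smul_smul]
  congr 1
  ring

lemma interior1_inl_fluxFour (μ : Fin 6) (α : Fin 4 → Λ⁶ 1)
    (η : Fin 4 → Λ⁶ 3) : interior1 (coordVec (inl μ)) (fluxFour c h α η) =
      ∑ m, bic rfl (interior1 (p := 2) (coordVec μ) (η m)) (dCoord m) +
      (c * h) • ∑ m, α m (fun _ => coordVec μ) • bic rfl (unitForm _) (sDelta m) := by
  rw [fluxFour, interior1_add, interior1_smul, interior1_sum, interior1_sum]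
  simp only [fun m => interior1_inl_bic (p := 2) (q := 1) (n := 3) rfl μ (η m) (dCoord m),
    bic_smul_right, interior1_smul,
    fun m => interior1_inl_bic (p := 0) (q := 3) (n := 3) rfl μ (α m) (sDelta m), interior1_one,
    bic_smul_left]
  rw [← smul_sum, smul_smul]

lemma interior1_inr_fluxFour (m : Fin 4) (α : Fin 4 → Λ⁶ 1)
    (η : Fin 4 → Λ⁶ 3) : interior1 (coordVec (inr m)) (fluxFour c h α η) =
      (-1 : ℝ) • bic rfl (η m) (unitForm _) +
      (-(c * h)) • ∑ p, bic rfl (α p) (interior1 (p := 2) (coordVec m) (sDelta p)) := by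
  rw [fluxFour, interior1_add, interior1_smul, interior1_sum, interior1_sum]
  simp only [fun p => interior1_inr_bic (p := 3) (q := 0) (n := 3) rfl m (η p) (dCoord p),
    fun p => interior1_inr_bic (p := 1) (q := 2) (n := 3) rfl m (α p) (sDelta p), interior1_one,
    bic_smul_right, dCoord_coordVec, interior1_smul, pow_one]
  congr 1
  · simp only [ite_smul, one_smul, zero_smul, smul_ite, smul_zero, sum_ite_eq, mem_univ, if_true]
    norm_num
  · rw [← smul_sum, ← smul_sum, smul_smul, smul_smul]
    congr 1
    ring

lemma normSq_fluxThree (hA : A ≠ 0) (hB : B ≠ 0) (hg : g.det ≠ 0) (α : Λ⁶ 3)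
    (β : Λ⁴ 3) : normSq (warp A g B) (fluxThree α β) =
      A⁻¹ ^ 3 * normSq g α + B⁻¹ ^ 3 * formInner 1 β β := by
  rw [normSq_eq_formInner, normSq_eq_formInner, fluxThree]
  simp only [formInner_add_left, formInner_add_right, formInner_bic_bic _ hA hB hg,
    formInner_bic_of_ne (p := 0) (p' := 3) _ _ hA hB hg (by norm_num),
    formInner_bic_of_ne (p := 3) (p' := 0) _ _ hA hB hg (by norm_num), formInner_unitForm]
  norm_num [Nat.factorial]
  ring

lemma contract_fluxThree_ll (hA : A ≠ 0) (hB : B ≠ 0) (hg : g.det ≠ 0) (α : Λ⁶ 3)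
    (β : Λ⁴ 3) (μ ν : Fin 6) : contract (warp A g B) (fluxThree α β) (inl μ) (inl ν) =
      A⁻¹ ^ 2 * contract (p := 2) g α μ ν := by
  rw [contract_eq_formInner, contract_eq_formInner, interior1_inl_fluxThree,
    interior1_inl_fluxThree, formInner_bic_bic _ hA hB hg, formInner_unitForm]
  norm_num [Nat.factorial]

lemma contract_fluxThree_rr (hA : A ≠ 0) (hB : B ≠ 0) (hg : g.det ≠ 0) (α : Λ⁶ 3)
    (β : Λ⁴ 3) (m n : Fin 4) : contract (warp A g B) (fluxThree α β) (inr m) (inr n) =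
      B⁻¹ ^ 2 * contract (p := 2) 1 β m n := by
  rw [contract_eq_formInner, contract_eq_formInner, interior1_inr_fluxThree,
    interior1_inr_fluxThree, formInner_bic_bic _ hA hB hg, formInner_unitForm]
  norm_num [Nat.factorial]

lemma contract_fluxThree_mixed (hA : A ≠ 0) (hB : B ≠ 0) (hg : g.det ≠ 0) (α : Λ⁶ 3)
    (β : Λ⁴ 3) (μ : Fin 6) (m : Fin 4) : contract (warp A g B) (fluxThree α β) (inl μ) (inr m) = 0 ∧
    contract (warp A g B) (fluxThree α β) (inr m) (inl μ) = 0 := by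
  rw [contract_eq_formInner, contract_eq_formInner, interior1_inr_fluxThree,
    interior1_inl_fluxThree]
  exact ⟨formInner_bic_of_ne (p := 2) (p' := 0) _ _ hA hB hg (by norm_num) _ _ _ _,
    formInner_bic_of_ne (p := 0) (p' := 2) _ _ hA hB hg (by norm_num) _ _ _ _⟩

lemma normSq_fluxTwo (hA : A ≠ 0) (hB : B ≠ 0) (hg : g.det ≠ 0) (α : Fin 4 → Λ⁶ 1) :
    normSq (warp A g B) (fluxTwo c α) = 2 * c ^ 2 * (A⁻¹ * B⁻¹) * ∑ m, formInner g (α m) (α m) := by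
  rw [normSq_eq_formInner, fluxTwo]
  simp only [formInner_smul_left, formInner_smul_right, formInner_sum_left, formInner_sum_right,
    formInner_bic_bic _ hA hB hg, formInner_dCoord, mul_ite, mul_one, mul_zero, sum_ite_eq',
    mem_univ, if_true, ← mul_sum]
  norm_num [Nat.factorial]
  ring

lemma contract_fluxTwo_ll (hA : A ≠ 0) (hB : B ≠ 0) (hg : g.det ≠ 0)
    (α : Fin 4 → Λ⁶ 1) (μ ν : Fin 6) : contract (warp A g B) (fluxTwo c α) (inl μ) (inl ν) =
      c ^ 2 * B⁻¹ * ∑ m, α m (fun _ => coordVec μ) * α m (fun _ => coordVec ν) := by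
  rw [contract_eq_formInner, interior1_inl_fluxTwo, interior1_inl_fluxTwo]
  simp only [formInner_smul_left, formInner_smul_right, formInner_sum_left, formInner_sum_right,
    formInner_bic_bic _ hA hB hg, formInner_dCoord, mul_ite, mul_one, mul_zero, sum_ite_eq',
    mem_univ, if_true, formInner_unitForm]
  simp only [mul_sum]
  refine sum_congr rfl fun m _ => ?_
  norm_num [Nat.factorial]
  ring

lemma contract_fluxTwo_rr (hA : A ≠ 0) (hB : B ≠ 0) (hg : g.det ≠ 0)
    (α : Fin 4 → Λ⁶ 1) (m n : Fin 4) : contract (warp A g B) (fluxTwo c α) (inr m) (inr n) =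
      c ^ 2 * A⁻¹ * formInner g (α m) (α n) := by
  rw [contract_eq_formInner, interior1_inr_fluxTwo, interior1_inr_fluxTwo]
  simp only [formInner_smul_left, formInner_smul_right, formInner_bic_bic _ hA hB hg,
    formInner_unitForm]
  norm_num [Nat.factorial]
  ring

lemma contract_fluxTwo_mixed (hA : A ≠ 0) (hB : B ≠ 0) (hg : g.det ≠ 0)
    (α : Fin 4 → Λ⁶ 1) (μ : Fin 6) (m : Fin 4) :
    contract (warp A g B) (fluxTwo c α) (inl μ) (inr m) = 0 ∧
    contract (warp A g B) (fluxTwo c α) (inr m) (inl μ) = 0 := by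
  rw [contract_eq_formInner, contract_eq_formInner, interior1_inr_fluxTwo, interior1_inl_fluxTwo]
  simp only [formInner_smul_left, formInner_smul_right, formInner_sum_left, formInner_sum_right,
    formInner_bic_of_ne (p := 1) (p' := 0) _ _ hA hB hg (by norm_num),
    formInner_bic_of_ne (p := 0) (p' := 1) _ _ hA hB hg (by norm_num)]
  simp

lemma normSq_fluxFour (hA : A ≠ 0) (hB : B ≠ 0) (hg : g.det ≠ 0) (α : Fin 4 → Λ⁶ 1)
    (η : Fin 4 → Λ⁶ 3) : normSq (warp A g B) (fluxFour c h α η) =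
      4 * (A⁻¹ ^ 3 * B⁻¹) * ∑ m, normSq g (η m) +
      24 * (c * h) ^ 2 * (A⁻¹ * B⁻¹ ^ 3) * ∑ m, formInner g (α m) (α m) := by
  rw [normSq_eq_formInner, fluxFour]
  simp only [formInner_add_left, formInner_add_right, formInner_smul_left, formInner_smul_right,
    formInner_sum_left, formInner_sum_right, formInner_bic_bic _ hA hB hg, formInner_dCoord,
    formInner_bic_of_ne (p := 1) (p' := 3) _ _ hA hB hg (by norm_num),
    formInner_bic_of_ne (p := 3) (p' := 1) _ _ hA hB hg (by norm_num), formInner_sDelta,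
    mul_ite, mul_one, mul_zero, sum_ite_eq', mem_univ, if_true,
    sum_const_zero, add_zero, zero_add]
  simp only [mul_sum, ← sum_add_distrib]
  refine sum_congr rfl fun m _ => ?_
  rw [normSq_eq_formInner]
  norm_num [Nat.factorial]
  ring

lemma contract_fluxFour_ll (hA : A ≠ 0) (hB : B ≠ 0) (hg : g.det ≠ 0)
    (α : Fin 4 → Λ⁶ 1) (η : Fin 4 → Λ⁶ 3) (μ ν : Fin 6) :
    contract (warp A g B) (fluxFour c h α η) (inl μ) (inl ν) =
      3 * (A⁻¹ ^ 2 * B⁻¹) * ∑ m, contract (p := 2) g (η m) μ ν +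
      6 * (c * h) ^ 2 * B⁻¹ ^ 3 * ∑ m, α m (fun _ => coordVec μ) * α m (fun _ => coordVec ν) := by
  rw [contract_eq_formInner, interior1_inl_fluxFour, interior1_inl_fluxFour]
  simp only [formInner_add_left, formInner_add_right, formInner_smul_left, formInner_smul_right,
    formInner_sum_left, formInner_sum_right, formInner_bic_bic _ hA hB hg, formInner_dCoord,
    formInner_bic_of_ne (p := 0) (p' := 2) _ _ hA hB hg (by norm_num),
    formInner_bic_of_ne (p := 2) (p' := 0) _ _ hA hB hg (by norm_num), formInner_sDelta,
    mul_ite, mul_one, mul_zero, sum_ite_eq', mem_univ, if_true,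
    sum_const_zero, add_zero, zero_add, formInner_unitForm]
  simp only [mul_sum, ← sum_add_distrib]
  refine sum_congr rfl fun m _ => ?_
  rw [contract_eq_formInner]
  norm_num [Nat.factorial]
  ring

lemma contract_fluxFour_rr (hA : A ≠ 0) (hB : B ≠ 0) (hg : g.det ≠ 0)
    (α : Fin 4 → Λ⁶ 1) (η : Fin 4 → Λ⁶ 3) (m n : Fin 4) :
    contract (warp A g B) (fluxFour c h α η) (inr m) (inr n) = A⁻¹ ^ 3 * formInner g (η m) (η n) +
      6 * (c * h) ^ 2 * (A⁻¹ * B⁻¹ ^ 2) *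
        (δ[m,n] * ∑ p, formInner g (α p) (α p) - formInner g (α n) (α m)) := by
  rw [contract_eq_formInner, interior1_inr_fluxFour, interior1_inr_fluxFour]
  simp only [formInner_add_left, formInner_add_right, formInner_smul_left, formInner_smul_right,
    formInner_sum_left, formInner_sum_right, formInner_bic_bic _ hA hB hg,
    formInner_bic_of_ne (p := 1) (p' := 3) _ _ hA hB hg (by norm_num),
    formInner_bic_of_ne (p := 3) (p' := 1) _ _ hA hB hg (by norm_num), formInner_unitForm,
    sum_const_zero, add_zero, zero_add, mul_zero]
  have e : ∑ q, ∑ p, formInner g (α p) (α q) * formInner 1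
      (interior1 (p := 2) (coordVec m) (sDelta p)) (interior1 (p := 2) (coordVec n) (sDelta q)) =
      2 * (δ[m,n] * ∑ p, formInner g (α p) (α p) - formInner g (α n) (α m)) := by
    simp only [formInner_interior1_sDelta]
    have e1 : ∀ p q, formInner g (α p) (α q) * (2 * (δ[m,n] * δ[p,q] - δ[m,q] * δ[p,n])) =
        2 * (δ[m,n] * (if p = q then formInner g (α p) (α q) else 0) -
          if m = q then (if p = n then formInner g (α p) (α q) else 0) else 0) := by
      intro p q
      split_ifs <;> ring
    simp only [e1, ← mul_sum, sum_sub_distrib, sum_ite_eq', mem_univ, if_true]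
    congr 2
    rw [sum_eq_single m (fun q _ hq => by simp [hq.symm]) (by simp)]
    simp
  simp only [← mul_sum] at e ⊢
  rw [e]
  norm_num [Nat.factorial]
  ring

lemma contract_fluxFour_mixed (hA : A ≠ 0) (hB : B ≠ 0) (hg : g.det ≠ 0)
    (α : Fin 4 → Λ⁶ 1) (η : Fin 4 → Λ⁶ 3) (μ : Fin 6) (m : Fin 4) :
    contract (warp A g B) (fluxFour c h α η) (inl μ) (inr m) = 0 ∧
    contract (warp A g B) (fluxFour c h α η) (inr m) (inl μ) = 0 := by
  rw [contract_eq_formInner, contract_eq_formInner, interior1_inr_fluxFour, interior1_inl_fluxFour]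
  simp only [formInner_add_left, formInner_add_right, formInner_smul_left, formInner_smul_right,
    formInner_sum_left, formInner_sum_right,
    formInner_bic_of_ne (p := 0) (p' := 1) _ _ hA hB hg (by norm_num),
    formInner_bic_of_ne (p := 0) (p' := 3) _ _ hA hB hg (by norm_num),
    formInner_bic_of_ne (p := 2) (p' := 1) _ _ hA hB hg (by norm_num),
    formInner_bic_of_ne (p := 2) (p' := 3) _ _ hA hB hg (by norm_num),
    formInner_bic_of_ne (p := 1) (p' := 0) _ _ hA hB hg (by norm_num),
    formInner_bic_of_ne (p := 3) (p' := 0) _ _ hA hB hg (by norm_num),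
    formInner_bic_of_ne (p := 1) (p' := 2) _ _ hA hB hg (by norm_num),
    formInner_bic_of_ne (p := 3) (p' := 2) _ _ hA hB hg (by norm_num)]
  simp

lemma formInner_sum_sDelta (b : ℝ⁴) :
    formInner 1 (∑ m, b m • sDelta m) (∑ m, b m • sDelta m) = 6 * ∑ m, b m ^ 2 := by
  simp only [formInner_sum_left, formInner_sum_right, formInner_smul_left, formInner_smul_right,
    formInner_sDelta, mul_ite, mul_zero, sum_ite_eq', mem_univ, if_true, mul_sum]
  exact sum_congr rfl fun m _ => by ring

lemma contract_sum_sDelta (b : ℝ⁴) (m n : Fin 4) : contract (p := 2) 1 (∑ p, b p • sDelta p) m n =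
      2 * (δ[m,n] * ∑ p, b p ^ 2 - b m * b n) := by
  rw [contract_eq_formInner]
  simp only [interior1_sum, interior1_smul, formInner_sum_left, formInner_sum_right,
    formInner_smul_left, formInner_smul_right, formInner_interior1_sDelta]
  fin_cases m <;> fin_cases n <;> simp [Fin.sum_univ_four] <;> ring

end Flux

/-- The right-hand side of the Einstein equation. -/
def IIAFields.source (S : IIAFields) (z : ℝ¹⁰) (M N : Ten) : ℝ :=
  1 / 2 * pd M S.Phi z * pd N S.Phi z + 1 / 4 * exp (-S.Phi z) *
      (contract (S.metric z) (S.H3 z) M N -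
        1 / 12 * S.metric z M N * normSq (S.metric z) (S.H3 z)) +
    1 / 2 * exp (3 / 2 * S.Phi z) * (contract (S.metric z) (S.F2 z) M N -
        1 / 16 * S.metric z M N * normSq (S.metric z) (S.F2 z)) +
    1 / 12 * exp (1 / 2 * S.Phi z) * (contract (S.metric z) (S.F4 z) M N -
        3 / 32 * S.metric z M N * normSq (S.metric z) (S.F4 z))

namespace UpliftData

lemma formInner_selfDual (S : Uplift) (hSD : F.SelfDual U) (hx : x ∈ U)
    (i j : Fin 4) : formInner (F.metric x) (F.Hm i x) (F.Hm j x) = 0 := by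
  have h := wedge_selfDual hSD S hx i j
  rw [hSD j x hx, star6, wedge_hodge] at h
  have hd : 0 < √|(F.metric x).det| := Real.sqrt_pos.2 (abs_pos.2 (S.lorentzian hx).det_neg.ne)
  exact (mul_eq_zero.1 ((smul_eq_zero.1 h).resolve_right (coordVol_ne_zero _))).resolve_left (by positivity)

lemma uplift_H3_eq_flux (H : ℝ⁴ → ℝ) (F : SixFields) (z : ℝ¹⁰) :
    (uplift H F).H3 z = fluxThree (F.H0 ♯z) (∑ m, (-pd m H ♭z) • sDelta m) := by
  have h : ∑ m, (-pd m H ♭z) • sDelta m = -∑ m, pd m H ♭z • sDelta m := by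
    rw [← sum_neg_distrib]
    refine sum_congr rfl fun m _ => ?_
    ext v
    simp only [Form.smul_apply, Form.neg_apply, neg_mul]
  rw [uplift_H3_eq, starDelta_dScalar, h]
  rfl

lemma uplift_F2_eq_flux (H : ℝ⁴ → ℝ) (F : SixFields) (z : ℝ¹⁰) :
    (uplift H F).F2 z = fluxTwo (1 / √2) (fun m => dScalar (F.phi m) ♯z) := rfl

lemma uplift_F4_eq_flux (H : ℝ⁴ → ℝ) (F : SixFields) (z : ℝ¹⁰) :
    (uplift H F).F4 z = fluxFour (1 / √2) (H ♭z) (fun m => dScalar (F.phi m) ♯z)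
      (fun m => F.Hm m ♯z) := uplift_F4_eq H F z

lemma pd_Phi_inl (S : Uplift) (hz : z ∈ region U Ω) (μ : Fin 6) :
    pd (inl μ) 𝚽 z = -(4 * sDown F μ ♯z) := by
  change dScalar 𝚽 z (fun _ => coordVec (inl μ)) = _
  rw [S.dScalar_Phi hz, bic_smul_left, bic_smul_right, ← inlVec_coordVec]
  have h1 : bic (n := 1) (by rfl) (unitForm _) (dScalar H ♭z)
      (fun _ => inlVec (coordVec μ)) = 0 := by
    rw [← pullY_eq_bic, pullY_apply]
    exact map_zero (fderiv ℝ H ♭z)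
  have h2 : bic (n := 1) (by rfl) (dScalar F.sigma ♯z) (unitForm _)
      (fun _ => inlVec (coordVec μ)) = pd μ F.sigma ♯z := by
    rw [← pullX_eq_bic, pullX_apply]
    rfl
  rw [Form.add_apply, Form.smul_apply, Form.smul_apply, h1, h2, sDown, one_div_sqrt_two]
  ring

lemma pd_Phi_inr (S : Uplift) (hz : z ∈ region U Ω) (m : Fin 4) :
    pd (inr m) 𝚽 z = 4 * hDown H m ♭z := by
  have hp := (S.pos _ hz.2).ne'
  change dScalar 𝚽 z (fun _ => coordVec (inr m)) = _
  rw [S.dScalar_Phi hz, bic_smul_left, bic_smul_right, ← inrVec_coordVec]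
  have h1 : bic (n := 1) (by rfl) (unitForm _) (dScalar H ♭z)
      (fun _ => inrVec (coordVec m)) = pd m H ♭z := by
    rw [← pullY_eq_bic, pullY_apply]
    rfl
  have h2 : bic (n := 1) (by rfl) (dScalar F.sigma ♯z) (unitForm _)
      (fun _ => inrVec (coordVec m)) = 0 := by
    rw [← pullX_eq_bic, pullX_apply]
    exact map_zero (fderiv ℝ F.sigma ♯z)
  rw [Form.add_apply, Form.smul_apply, Form.smul_apply, h1, h2, hDown]
  field_simp
  ring

lemma sum_sq_pd (S : Uplift) (hy : y ∈ Ω) :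
    ∑ m, (-pd m H y) ^ 2 = 64 * H y ^ 2 * ∑ m, hDown H m y ^ 2 := by
  rw [mul_sum]
  refine sum_congr rfl fun m _ => ?_
  have := (S.pos y hy).ne'
  rw [hDown]
  field_simp
  norm_num

/-- All powers of `H` and `e^σ` occurring in the ansatz, in terms of `u = H^{1/4}` and
`w = e^{σ/(2√2)}`. -/
lemma exists_scales (S : Uplift) (hz : z ∈ region U Ω) : ∃ u w : ℝ, 0 < u ∧ 0 < w ∧ H ♭z = u ^ 4 ∧
      𝐠 z = warp (u⁻¹ * w⁻¹) (F.metric ♯z) (u ^ 3 * w) ∧ exp (-𝚽 z) = u⁻¹ ^ 2 * w ^ 2 ∧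
      exp (3 / 2 * 𝚽 z) = u ^ 3 * w⁻¹ ^ 3 ∧ exp (1 / 2 * 𝚽 z) = u * w⁻¹ ∧
      exp (√2 * F.sigma ♯z) = w ^ 4 ∧ exp (-(√2 * F.sigma ♯z)) = w⁻¹ ^ 4 ∧
      exp (1 / √2 * F.sigma ♯z) = w ^ 2 ∧ exp (-(1 / √2) * F.sigma ♯z) = w⁻¹ ^ 2 := by
  have hp := S.pos _ hz.2
  refine ⟨exp (1 / 4 * log (H ♭z)), exp (1 / (2 * √2) * F.sigma ♯z),
    exp_pos _, exp_pos _, ?_, ?_, ?_⟩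
  · rw [← exp_nat_mul]
    nth_rewrite 1 [← exp_log hp]
    congr 1
    push_cast
    ring
  · rw [uplift_metric_eq_warp, uplift_scale_x hp, uplift_scale_y hp]
    simp only [← exp_neg, ← exp_nat_mul, ← exp_add]
    congr 2
    · ring
    · push_cast
      ring
  · have h1 := one_div_sqrt_two
    have h2 := sqrt_two_eq
    simp only [← exp_neg, ← exp_nat_mul, ← exp_add, Real.exp_eq_exp, uplift_Phi_eq F hp, h1]
    push_cast
    refine ⟨by ring, by ring, by ring, ?_, ?_, by ring, by ring⟩
    · linear_combination F.sigma ♯z * h2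
    · linear_combination -F.sigma ♯z * h2

lemma einstein_mixed (S : Uplift) (hz : z ∈ region U Ω) (μ : Fin 6) (m : Fin 4) :
    ricci 𝐠 (inl μ) (inr m) z = (uplift H F).source z (inl μ) (inr m) ∧ ricci 𝐠 (inr m) (inl μ) z =
      (uplift H F).source z (inr m) (inl μ) := by
  have hg := (S.lorentzian hz.1).det_neg.ne
  obtain ⟨u, w, hu, hw, -, hm, -⟩ := S.exists_scales hz
  have hA : u⁻¹ * w⁻¹ ≠ 0 := by positivity
  have hB : u ^ 3 * w ≠ 0 := by positivity
  have z1 : (warp (u⁻¹ * w⁻¹) (F.metric ♯z) (u ^ 3 * w)) (inl μ) (inr m) = 0 := rfl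
  have z2 : (warp (u⁻¹ * w⁻¹) (F.metric ♯z) (u ^ 3 * w)) (inr m) (inl μ) = 0 := rfl
  rw [S.ricci_lr hz, S.ricci_rl hz, IIAFields.source, IIAFields.source, S.pd_Phi_inl hz,
    S.pd_Phi_inr hz, uplift_H3_eq_flux, uplift_F2_eq_flux, uplift_F4_eq_flux, hm, z1, z2]
  simp only [(contract_fluxThree_mixed hA hB hg _ _ μ m).1,
    (contract_fluxThree_mixed hA hB hg _ _ μ m).2, (contract_fluxTwo_mixed hA hB hg _ μ m).1,
    (contract_fluxTwo_mixed hA hB hg _ μ m).2, (contract_fluxFour_mixed hA hB hg _ _ μ m).1,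
    (contract_fluxFour_mixed hA hB hg _ _ μ m).2]
  constructor <;> ring

lemma einstein_rr (S : Uplift) (hSD : F.SelfDual U) (hz : z ∈ region U Ω)
    (hb : boxS F ♯z = -(1 / 8 * exp (-(√2 * F.sigma ♯z)) * ∑ m, formInner (F.metric ♯z) (dφ m ♯z)
          (dφ m ♯z)) +
      1 / 48 * exp (√2 * F.sigma ♯z) * normSq (F.metric ♯z) (F.H0 ♯z))
    (m n : Fin 4) : ricci 𝐠 (inr m) (inr n) z = (uplift H F).source z (inr m) (inr n) := by
  have hg := (S.lorentzian hz.1).det_neg.ne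
  have hsq := S.sum_sq_pd hz.2
  have hpd : ∀ m, pd m H ♭z = 8 * H ♭z * hDown H m ♭z := fun m => by
    have := (S.pos _ hz.2).ne'
    rw [hDown]
    field_simp
  obtain ⟨u, w, hu, hw, hH, hm, e1, e2, e3, e4, e5, e6, -⟩ := S.exists_scales hz
  have hA : u⁻¹ * w⁻¹ ≠ 0 := by positivity
  have hB : u ^ 3 * w ≠ 0 := by positivity
  have z1 : (warp (u⁻¹ * w⁻¹) (F.metric ♯z) (u ^ 3 * w)) (inr m) (inr n) = u ^ 3 * w * δ[m,n] := by
    simp [warp, Matrix.one_apply]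
  have hc : (1 / √2) ^ 2 = 1 / 2 := by rw [div_pow, sq_sqrt (by norm_num), one_pow]
  rw [S.ricci_rr hz, IIAFields.source, S.pd_Phi_inr hz, S.pd_Phi_inr hz, uplift_H3_eq_flux,
    uplift_F2_eq_flux, uplift_F4_eq_flux, hm, z1, hb, e1, e2, e3, e4, e5, e6,
    contract_fluxThree_rr hA hB hg, contract_fluxTwo_rr hA hB hg, contract_fluxFour_rr hA hB hg,
    normSq_fluxThree hA hB hg, normSq_fluxTwo hA hB hg, normSq_fluxFour hA hB hg,
    formInner_sum_sDelta, contract_sum_sDelta, S.formInner_selfDual hSD hz.1, hsq, mul_pow, hc,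
    formInner_comm (S.lorentzian hz.1).transpose_eq (dφ n _), hpd, hpd]
  simp only [normSq_eq_formInner (F.metric ♯z) (F.Hm _ _), S.formInner_selfDual hSD hz.1,
    sum_const_zero, hH]
  generalize ∑ m, formInner (F.metric ♯z) (dφ m ♯z)
          (dφ m ♯z) = X
  generalize ∑ m, hDown H m ♭z ^ 2 = Y
  generalize δ[m,n] = d
  field_simp
  ring

lemma einstein_ll_iff (S : Uplift) (hSD : F.SelfDual U) (hz : z ∈ region U Ω)
    (hb : boxS F ♯z = -(1 / 8 * exp (-(√2 * F.sigma ♯z)) * ∑ m, formInner (F.metric ♯z) (dφ m ♯z)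
          (dφ m ♯z)) +
      1 / 48 * exp (√2 * F.sigma ♯z) * normSq (F.metric ♯z) (F.H0 ♯z))
    (μ ν : Fin 6) : ricci 𝐠 (inl μ) (inl ν) z = (uplift H F).source z (inl μ) (inl ν) ↔
    ricci F.metric μ ν ♯z = 1 / 2 * pd μ F.sigma ♯z * pd ν F.sigma ♯z +
        1 / 2 * exp (-(√2 * F.sigma ♯z)) * ∑ m, pd μ (F.phi m) ♯z * pd ν (F.phi m) ♯z +
        1 / 4 * ∑ m, contract (F.metric ♯z) (F.Hm m ♯z) μ ν + 1 / 4 * exp (√2 * F.sigma ♯z) *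
          (contract (F.metric ♯z) (F.H0 ♯z) μ ν -
            1 / 6 * F.metric ♯z μ ν * normSq (F.metric ♯z) (F.H0 ♯z)) := by
  have hg := (S.lorentzian hz.1).det_neg.ne
  have hsq := S.sum_sq_pd hz.2
  obtain ⟨u, w, hu, hw, hH, hm, e1, e2, e3, e4, e5, -, e7⟩ := S.exists_scales hz
  have hA : u⁻¹ * w⁻¹ ≠ 0 := by positivity
  have hB : u ^ 3 * w ≠ 0 := by positivity
  have z1 : (warp (u⁻¹ * w⁻¹) (F.metric ♯z) (u ^ 3 * w)) (inl μ) (inl ν) =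
      u⁻¹ * w⁻¹ * F.metric ♯z μ ν := rfl
  have hc : (1 / √2) ^ 2 = 1 / 2 := by rw [div_pow, sq_sqrt (by norm_num), one_pow]
  have hss : 16 * (sDown F μ ♯z * sDown F ν ♯z) = 1 / 2 * pd μ F.sigma ♯z * pd ν F.sigma ♯z := by
    rw [sDown, sDown]
    linear_combination (pd μ F.sigma ♯z * pd ν F.sigma ♯z) * hc
  rw [← hss, S.ricci_ll hz, IIAFields.source, S.pd_Phi_inl hz, S.pd_Phi_inl hz, uplift_H3_eq_flux,
    uplift_F2_eq_flux, uplift_F4_eq_flux, hm, z1, hb, e1, e2, e3, e4, e5, e7,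
    contract_fluxThree_ll hA hB hg, contract_fluxTwo_ll hA hB hg, contract_fluxFour_ll hA hB hg,
    normSq_fluxThree hA hB hg, normSq_fluxTwo hA hB hg, normSq_fluxFour hA hB hg,
    formInner_sum_sDelta, hsq, mul_pow, hc]
  simp only [normSq_eq_formInner (F.metric ♯z) (F.Hm _ _), S.formInner_selfDual hSD hz.1,
    sum_const_zero, hH, dScalar_coordVec]
  generalize ∑ m, formInner (F.metric ♯z) (dφ m ♯z)
          (dφ m ♯z) = X
  generalize ∑ m, hDown H m ♭z ^ 2 = Y
  rw [← sub_eq_zero, ← sub_eq_zero (b := _ + _ + _ + _)]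
  refine Eq.congr ?_ rfl
  field_simp
  ring

lemma einstein_iff (S : Uplift) (hSD : F.SelfDual U) (hz : z ∈ region U Ω)
    (hσ : extDeriv (fun w => ⋆₁ (F.metric w) (dScalar F.sigma w)) ♯z +
      (1 / √2 * exp (-(√2 * F.sigma ♯z))) • ∑ m, wedge (dφ m ♯z) (⋆₁ (F.metric ♯z) (dφ m ♯z)) -
      (1 / √2 * exp (√2 * F.sigma ♯z)) • wedge (F.H0 ♯z) (⋆₃ (F.metric ♯z) (F.H0 ♯z)) = 0) :
    (∀ M N, ricci 𝐠 M N z = (uplift H F).source z M N) ↔ ∀ μ ν, ricci F.metric μ ν ♯z =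
      1 / 2 * pd μ F.sigma ♯z * pd ν F.sigma ♯z + 1 / 2 * exp (-(√2 * F.sigma ♯z)) *
          ∑ m, pd μ (F.phi m) ♯z * pd ν (F.phi m) ♯z +
        1 / 4 * ∑ m, contract (F.metric ♯z) (F.Hm m ♯z) μ ν + 1 / 4 * exp (√2 * F.sigma ♯z) *
          (contract (F.metric ♯z) (F.H0 ♯z) μ ν -
            1 / 6 * F.metric ♯z μ ν * normSq (F.metric ♯z) (F.H0 ♯z)) := by
  have hb := (S.eom_sigma_iff hz.1).1 hσ
  constructor
  · exact fun h μ ν => (S.einstein_ll_iff hSD hz hb μ ν).1 (h _ _)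
  · rintro h (μ | m) (ν | n)
    · exact (S.einstein_ll_iff hSD hz hb μ ν).2 (h _ _)
    · exact (S.einstein_mixed hz μ n).1
    · exact (S.einstein_mixed hz ν m).2
    · exact S.einstein_rr hSD hz hb m n

end UpliftData

section Regularity

lemma IsLorentzian.warp {g : Mat₆} (hg : IsLorentzian g) {A B : ℝ}
    (hA : 0 < A) (hB : 0 < B) : IsLorentzian (warp A g B) := by
  obtain ⟨t, P, hP, h⟩ := hg
  have hA' : (√A)⁻¹ * (A * (√A)⁻¹) = 1 := by
    have := mul_self_sqrt hA.le
    have := Real.sqrt_pos.2 hA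
    field_simp
    rw [sq_sqrt hA.le]
  have hB' : (√B)⁻¹ * (B * (√B)⁻¹) = 1 := by
    have := Real.sqrt_pos.2 hB
    field_simp
    rw [sq_sqrt hB.le]
  refine ⟨inl t, fromBlocks ((√A)⁻¹ • P) 0 0 ((√B)⁻¹ • 1), ?_, ?_⟩
  · rw [Matrix.det_fromBlocks_zero₂₁, Matrix.det_smul, Matrix.det_smul, isUnit_iff_ne_zero]
    have := Real.sqrt_pos.2 hA
    have := Real.sqrt_pos.2 hB
    have := hP.ne_zero
    simp only [det_one]
    positivity
  · rw [_root_.warp, Matrix.fromBlocks_transpose, Matrix.fromBlocks_multiply,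
      Matrix.fromBlocks_multiply]
    simp only [Matrix.transpose_smul, Matrix.transpose_zero, Matrix.transpose_one, Matrix.mul_zero,
      Matrix.zero_mul, add_zero, zero_add, Matrix.smul_mul, Matrix.mul_smul, smul_smul,
      Matrix.mul_one]
    ext (i | i) (j | j)
    · have hij := congrFun (congrFun h i) j
      rw [Matrix.diagonal_apply] at hij
      simp only [fromBlocks_apply₁₁, Matrix.smul_apply, smul_eq_mul, Matrix.diagonal_apply, hij,
        Sum.inl.injEq]
      linear_combination (if i = j then (if i = t then (-1 : ℝ) else 1) else 0) * hA'
    · simp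
    · simp
    · simp only [fromBlocks_apply₂₂, Matrix.smul_apply, smul_eq_mul, Matrix.diagonal_apply,
        Matrix.one_apply, Sum.inr.injEq, reduceCtorEq, if_false]
      linear_combination δ[i,j] * hB'

lemma ContDiffOn.comp_projX {E : Type*} [NormedAddCommGroup E] [NormedSpace ℝ E]
    {f : ℝ⁶ → E} (hf : ContDiffOn ℝ ∞ f U) : ContDiffOn ℝ ∞ (fun z => f ♯z) (region U Ω) :=
  hf.comp projX.contDiff.contDiffOn fun _ hz => hz.1

lemma ContDiffOn.comp_projY {E : Type*} [NormedAddCommGroup E] [NormedSpace ℝ E]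
    {f : ℝ⁴ → E} (hf : ContDiffOn ℝ ∞ f Ω) : ContDiffOn ℝ ∞ (fun z => f ♭z) (region U Ω) :=
  hf.comp projY.contDiff.contDiffOn fun _ hz => hz.2

lemma ContDiffOn.pullX {s : Set ℝ¹⁰} {α : ℝ¹⁰ → Λ⁶ p}
    (hα : ContDiffOn ℝ ∞ α s) : ContDiffOn ℝ ∞ (fun z => pullX (α z)) s :=
  (ContinuousLinearMap.contDiff (E := Λ⁶ p) (F := Form Ten p)
    (ContinuousAlternatingMap.compContinuousLinearMapCLM projX)).comp_contDiffOn hα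

lemma ContDiffOn.pullY {s : Set ℝ¹⁰} {α : ℝ¹⁰ → Λ⁴ p}
    (hα : ContDiffOn ℝ ∞ α s) : ContDiffOn ℝ ∞ (fun z => pullY (α z)) s :=
  (ContinuousLinearMap.contDiff (E := Λ⁴ p) (F := Form Ten p)
    (ContinuousAlternatingMap.compContinuousLinearMapCLM projY)).comp_contDiffOn hα

end Regularity

namespace UpliftData

lemma regular (S : Uplift) : (uplift H F).Regular (region U Ω) where
  metric := by
    have hA : ContDiffOn ℝ ∞ (fun z => H ♭z ^ (-(1 / 4) : ℝ) *
        exp (-(1 / (2 * √2) * F.sigma ♯z))) (region U Ω) :=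
      (S.smooth.comp_projY.rpow_const_of_ne fun z hz => (S.pos _ hz.2).ne').mul
        (contDiffOn_const.mul S.reg.sigma.comp_projX).neg.exp
    have hB : ContDiffOn ℝ ∞ (fun z => H ♭z ^ (3 / 4 : ℝ) *
        exp (1 / (2 * √2) * F.sigma ♯z)) (region U Ω) :=
      (S.smooth.comp_projY.rpow_const_of_ne fun z hz => (S.pos _ hz.2).ne').mul
        (contDiffOn_const.mul S.reg.sigma.comp_projX).exp
    refine ⟨?_, fun z hz => ?_⟩
    · rintro (i | i) (j | j)
      · exact hA.mul (S.reg.metric.1 i j).comp_projX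
      · exact contDiffOn_const
      · exact contDiffOn_const
      · exact hB.mul contDiffOn_const
    · rw [uplift_metric_eq_warp]
      exact (S.lorentzian hz.1).warp (S.scale_x_pos hz) (S.scale_y_pos hz)
  Phi := by
    refine ContDiffOn.log ?_ fun z hz => ?_
    · exact (S.smooth.comp_projY.rpow_const_of_ne fun z hz => (S.pos _ hz.2).ne').mul
        (contDiffOn_const.mul S.reg.sigma.comp_projX).neg.exp
    · exact (mul_pos (Real.rpow_pos_of_pos (S.pos _ hz.2) _) (exp_pos _)).ne'
  H3 := by
    have h : ContDiffOn ℝ ∞ (fun y => starDelta 1 3 rfl (dScalar H y)) Ω := by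
      simp only [starDelta_dScalar]
      exact ContDiffOn.sum fun m _ => (S.smooth.pd S.isOpenΩ m).smul contDiffOn_const
    exact (h.comp_projY.pullY).neg.add S.reg.H0.comp_projX.pullX
  F2 := by
    have h : ContDiffOn ℝ ∞ (fun z => ∑ m, wedge (pullX (dφ m ♯z))
        (pullY (dCoord m))) (region U Ω) := ContDiffOn.sum fun m _ =>
      (((S.reg.phi m).dScalar S.isOpenU).comp_projX.pullX).wedge contDiffOn_const
    exact h.const_smul (1 / √2)
  F4 := (ContDiffOn.sum fun m _ => ((S.reg.Hm m).comp_projX.pullX).wedge contDiffOn_const).add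
    ((contDiffOn_const.mul S.smooth.comp_projY).smul (ContDiffOn.sum fun m _ =>
      (((S.reg.phi m).dScalar S.isOpenU).comp_projX.pullX).wedge contDiffOn_const))

lemma isSolution_iff (S : Uplift) (hne : Ω.Nonempty) (hSD : F.SelfDual U) :
    (uplift H F).IsSolution (region U Ω) ↔ F.Bianchi U ∧ F.EOM U := by
  constructor
  · intro h
    obtain ⟨y, hy⟩ := hne
    have hz : ∀ x ∈ U, Sum.elim x y ∈ region U Ω := fun x hx => ⟨hx, hy⟩
    have hX : ∀ x, projX (Sum.elim x y) = x := fun x => rfl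
    have hσ := fun x hx => (S.eom_Phi_iff hSD (hz x hx)).1 (h.eom_Phi _ (hz x hx))
    have hE := fun x hx => (S.einstein_iff hSD (hz x hx) (hσ x hx)).1 (h.einstein _ (hz x hx))
    have h1 := fun x hx => (S.bianchi_H3_iff (hz x hx)).1 (h.bianchi_H3 _ (hz x hx))
    have h2 := fun x hx => (S.bianchi_F4_iff (hz x hx)).1 (h.bianchi_F4 _ (hz x hx))
    have h3 := fun x hx => (S.eom_H3_iff hSD (hz x hx)).1 (h.eom_H3 _ (hz x hx))
    have h4 := fun x hx => (S.eom_F2_iff hSD (hz x hx)).1 (h.eom_F2 _ (hz x hx))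
    simp only [hX] at hσ hE h1 h2 h3 h4
    exact ⟨⟨h1, fun m x hx => h2 x hx m⟩, h3, fun m x hx => h4 x hx m, hσ, hE⟩
  · rintro ⟨hB, hE⟩
    exact {
      bianchi_H3 := fun z hz => (S.bianchi_H3_iff hz).2 (hB.H0 _ hz.1)
      bianchi_F2 := fun z hz => S.bianchi_F2 hz
      bianchi_F4 := fun z hz => (S.bianchi_F4_iff hz).2 fun m => hB.Hm m _ hz.1
      eom_F2 := fun z hz => (S.eom_F2_iff hSD hz).2 fun m => hE.eom_phi m _ hz.1
      eom_F4 := fun z hz => S.eom_F4_of hSD hz (fun m => hB.Hm m _ hz.1)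
        fun m => hE.eom_phi m _ hz.1
      eom_H3 := fun z hz => (S.eom_H3_iff hSD hz).2 (hE.eom_H0 _ hz.1)
      eom_Phi := fun z hz => (S.eom_Phi_iff hSD hz).2 (hE.eom_sigma _ hz.1)
      einstein := fun z hz => (S.einstein_iff hSD hz (hE.eom_sigma _ hz.1)).2
        (hE.einstein _ hz.1) }

lemma isSolution_iff_of_no_isometry (S : Uplift) (hne : Ω.Nonempty)
    (hiso : ∀ c : ℝ⁴, (∀ y ∈ Ω, ∑ m, c m * pd m H y = 0) → c = 0) :
    (uplift H F).IsSolution (region U Ω) ↔ F.IsSolution U := by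
  constructor
  · intro h
    have hSD := S.selfDual_of_eom_F4 hiso h.eom_F4
    have h2 := (S.isSolution_iff hne hSD).1 h
    exact ⟨h2.1, h2.2, hSD⟩
  · rintro ⟨hB, hE, hSD⟩
    exact (S.isSolution_iff hne hSD).2 ⟨hB, hE⟩

end UpliftData

section Vacuum

lemma vacuum_regular (U : Set ℝ⁶) : SixFields.vacuum.Regular U where
  metric := ⟨fun i j => contDiffOn_const, fun x _ => ⟨0, 1, by simp, by
    simp [SixFields.vacuum]⟩⟩
  sigma := contDiffOn_const
  phi := fun _ => contDiffOn_const
  H0 := contDiffOn_const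
  Hm := fun _ => contDiffOn_const

lemma dScalar_zero {ι : Type} [Fintype ι] (x : ι → ℝ) : dScalar (0 : (ι → ℝ) → ℝ) x = 0 := by
  ext v
  change fderiv ℝ (fun _ => (0 : ℝ)) x _ = 0
  simp

lemma ricci_const (g : Matrix ι ι ℝ) (i j : ι) (x : ι → ℝ) : ricci (fun _ => g) i j x = 0 := by
  have h : ∀ k i j, christoffel (fun _ : ι → ℝ => g) k i j = fun _ => 0 := fun k i j => by
    funext x
    simp [christoffel, pd_const]
  simp [ricci, h, pd_const]

lemma extDeriv_of_eq_zero
    {a : (ι → ℝ) → Form ι p} (h : ∀ x, a x = 0) (x : ι → ℝ) : extDeriv a x = 0 := by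
  rw [show a = fun _ => 0 from funext h, extDeriv_const]

lemma vacuum_selfDual (U : Set ℝ⁶) : SixFields.vacuum.SelfDual U :=
  fun _ _ _ => (hodge_zero _ _).symm

lemma vacuum_bianchi (U : Set ℝ⁶) : SixFields.vacuum.Bianchi U where
  H0 := fun x _ => extDeriv_of_eq_zero (fun _ => rfl) x
  Hm := fun m x _ => by
    rw [extDeriv_of_eq_zero (a := SixFields.vacuum.Hm m) (fun _ => rfl) x]
    have h : SixFields.vacuum.H0 x = 0 := rfl
    rw [h, wedge_zero_left, smul_zero]

lemma vacuum_eom (U : Set ℝ⁶) : SixFields.vacuum.EOM U := by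
  have h0 : ∀ x, SixFields.vacuum.H0 x = 0 := fun _ => rfl
  have hm : ∀ m x, SixFields.vacuum.Hm m x = 0 := fun _ _ => rfl
  have hp : ∀ m x, dScalar (SixFields.vacuum.phi m) x = 0 := fun _ => dScalar_zero
  have hs : ∀ x, dScalar SixFields.vacuum.sigma x = 0 := dScalar_zero
  have pp : ∀ m i x, pd i (SixFields.vacuum.phi m) x = 0 := fun _ i x => pd_const i 0 x
  have ps : ∀ i x, pd i SixFields.vacuum.sigma x = 0 := fun i x => pd_const i 0 x
  have s3 : ∀ g, ⋆₃ g 0 = 0 := fun g => hodge_zero _ _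
  have s1 : ∀ g, ⋆₁ g 0 = 0 := fun g => hodge_zero _ _
  refine ⟨fun x _ => ?_, fun m x _ => ?_, fun x _ => ?_, fun x _ μ ν => ?_⟩
  · rw [extDeriv_of_eq_zero fun x => by rw [h0, s3, smul_zero]]
    simp [hm, wedge_zero_left]
  · rw [extDeriv_of_eq_zero fun x => by rw [hp, s1, smul_zero]]
    simp [h0, wedge_zero_left]
  · rw [extDeriv_of_eq_zero fun x => by rw [hs, s1]]
    simp [hp, h0, wedge_zero_left]
  · have hr : ricci SixFields.vacuum.metric μ ν x = 0 := ricci_const _ _ _ _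
    have hc : ∀ g, contract g (0 : Λ⁶ 3) μ ν = 0 := fun g =>
      contract_eq_zero_of_eq_zero (p := 2) g rfl μ ν
    have hn : ∀ g, normSq g (0 : Λ⁶ 3) = 0 := fun g => formInner_zero_left g _
    simp [hr, ps, pp, hm, h0, hc, hn]

lemma uplift_vacuum (H : ℝ⁴ → ℝ) : uplift H SixFields.vacuum = ns5Background H := by
  have h0 : ∀ x, SixFields.vacuum.H0 x = 0 := fun _ => rfl
  have hm : ∀ m x, SixFields.vacuum.Hm m x = 0 := fun _ _ => rfl
  have hp : ∀ m x, dScalar (SixFields.vacuum.phi m) x = 0 := fun _ => dScalar_zero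
  have hs : ∀ x, SixFields.vacuum.sigma x = 0 := fun _ => rfl
  have px : ∀ p, pullX (0 : Λ⁶ p) = 0 := fun p => by ext v; rfl
  unfold uplift ns5Background
  congr 1
  · funext z
    simp [SixFields.vacuum]
  · funext z
    simp [hs]
  · funext z
    simp [h0, px]
  · funext z
    simp [hp, px, wedge_zero_left]
  · funext z
    simp [hp, hm, px, wedge_zero_left]

end Vacuum

lemma ContDiffOn.extDeriv {s : Set (ι → ℝ)}
    {a : (ι → ℝ) → Form ι p} (hs : IsOpen s) (ha : ContDiffOn ℝ ∞ a s) :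
    ContDiffOn ℝ ∞ (extDeriv a) s :=
  (ContinuousLinearMap.contDiff (E := (ι → ℝ) →L[ℝ] Form ι p) (F := Form ι (p + 1))
    (ContinuousAlternatingMap.alternatizeUncurryFinCLM ℝ (ι → ℝ) ℝ)).comp_contDiffOn
      (ha.fderiv_of_isOpen hs (by simp))

lemma extDeriv_extDeriv_of_contDiffOn
    {s : Set (ι → ℝ)} {a : (ι → ℝ) → Form ι p} (hs : IsOpen s) (ha : ContDiffOn ℝ ∞ a s)
    {x : ι → ℝ} (hx : x ∈ s) : extDeriv (extDeriv a) x = 0 :=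
  extDeriv_extDeriv_apply (ha.contDiffAt (hs.mem_nhds hx)) two_le_smooth

lemma wedge_one_three (a : Λ⁶ 1) (b : Λ⁶ 3) :
    castForm (Nat.add_comm 1 3) (wedge a b) = -wedge b a := by
  rw [wedge_comm b a]
  module

lemma dScalar_const_mul {f : (ι → ℝ) → ℝ} {x : ι → ℝ} (hf : Diff f x) (c : ℝ) :
    dScalar (fun x => c * f x) x = c • dScalar f x := by
  ext v
  change fderiv ℝ (fun x => c * f x) x (v 0) = c • fderiv ℝ f x (v 0)
  rw [fderiv_const_mul hf]
  rfl

lemma extDeriv_fun_sub {a b : (ι → ℝ) → Form ι p} {x : ι → ℝ} (ha : Diff a x) (hb : Diff b x) :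
    extDeriv (fun x => a x - b x) x = extDeriv a x - extDeriv b x := by
  simp only [sub_eq_add_neg]
  rw [extDeriv_fun_add ha hb.fun_neg, extDeriv_neg]

lemma bianchi_ofPotentials {U : Set ℝ⁶} (hU : IsOpen U) (g : ℝ⁶ → Mat₆) (σ : ℝ⁶ → ℝ)
    (φ : Fin 4 → ℝ⁶ → ℝ) (B0 : ℝ⁶ → Λ⁶ 2)
    (Bm : Fin 4 → ℝ⁶ → Λ⁶ 2) (hφ : ∀ m, ContDiffOn ℝ ∞ (φ m) U)
    (h0 : ContDiffOn ℝ ∞ B0 U) (hm : ∀ m, ContDiffOn ℝ ∞ (Bm m) U) :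
    (SixFields.ofPotentials g σ φ B0 Bm).Bianchi U where
  H0 := fun x hx => extDeriv_extDeriv_of_contDiffOn hU h0 hx
  Hm := fun m x hx => by
    have d1 := ((hm m).extDeriv hU).differentiableAt_of_isOpen hU hx
    have d0 := (h0.extDeriv hU).differentiableAt_of_isOpen hU hx
    have df := ((hφ m).differentiableAt_of_isOpen hU hx)
    have df' := df.const_mul (1 / √2)
    change extDeriv (fun x => extDeriv (Bm m) x - (1 / √2 * φ m x) • extDeriv B0 x) x =
      (1 / √2) • wedge (extDeriv B0 x) (dScalar (φ m) x)
    rw [extDeriv_fun_sub d1 (df'.fun_smul d0), extDeriv_smul_fun df' d0,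
      extDeriv_extDeriv_of_contDiffOn hU h0 hx, extDeriv_extDeriv_of_contDiffOn hU (hm m) hx,
      wedge_one_three, dScalar_const_mul df, wedge_smul_right]
    simp

/-! ### Horospherical coordinates -/

lemma eta_mul_eta : eta * eta = 1 := by
  rw [eta, Matrix.diagonal_mul_diagonal, ← Matrix.diagonal_one]
  congr 1
  funext i
  fin_cases i <;> simp

lemma IsSO15.mul_eta_mul_transpose {L : Mat₆} (h : IsSO15 L) : L * eta * L.transpose = eta := by
  have h1 : (eta * L.transpose * eta) * L = 1 := by
    rw [mul_assoc, mul_assoc, ← mul_assoc L.transpose, h.1, eta_mul_eta]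
  have h2 : L * (eta * L.transpose * eta) = 1 := mul_eq_one_comm.1 h1
  calc L * eta * L.transpose = L * (eta * L.transpose * eta) * eta := by
        simp only [mul_assoc, eta_mul_eta, mul_one]
    _ = eta := by rw [h2, one_mul]

/-- The coset representative, in terms of `a = e^{-σ/√2}`, `b = e^{σ/√2}` and `p = φ/√2`. -/
def horo (a b : ℝ) (p : ℝ⁴) : Mat₆ := !![1, 0, 0, 0, -p 0, p 0;
     0, 1, 0, 0, -p 1, p 1;
     0, 0, 1, 0, -p 2, p 2;
     0, 0, 0, 1, -p 3, p 3;
     a * p 0, a * p 1, a * p 2, a * p 3,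
       (a * (1 - ∑ m, p m ^ 2) + b) / 2, (a * (1 + ∑ m, p m ^ 2) - b) / 2;
     a * p 0, a * p 1, a * p 2, a * p 3,
       (a * (1 - ∑ m, p m ^ 2) - b) / 2, (a * (1 + ∑ m, p m ^ 2) + b) / 2]

lemma cosetRep_eq_horo (σ : ℝ) (φ : ℝ⁴) : cosetRep σ φ =
    horo (exp (-(σ / √2))) (exp (σ / √2)) (fun m => φ m / √2) := by
  have hn : ∑ m, φ m ^ 2 = 2 * ∑ m, (φ m / √2) ^ 2 := by
    rw [mul_sum]
    refine sum_congr rfl fun m _ => ?_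
    rw [div_pow, sq_sqrt (by norm_num)]
    ring
  unfold cosetRep horo
  simp only [hn, mul_div_assoc]
  generalize ∑ m, (φ m / √2) ^ 2 = s
  congr! 10 <;> ring_nf

section Coset

variable {a b : ℝ} {p : ℝ⁴}

lemma horo_mul_eta (hab : a * b = 1) : horo a b p * eta * (horo a b p).transpose = eta := by
  ext i j
  rw [eta, Matrix.mul_apply]
  simp only [mul_diagonal, transpose_apply, Fin.sum_univ_six]
  fin_cases i <;> fin_cases j <;> simp [horo, Fin.sum_univ_four] <;>
    first | ring1 | linear_combination hab | linear_combination -hab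

lemma horo_det (hab : a * b = 1) : (horo a b p).det = 1 := by
  rw [← Matrix.det_submatrix_equiv_self (finSumFinEquiv : Fin 4 ⊕ Fin 2 ≃ Fin 6)]
  have h : (horo a b p).submatrix (finSumFinEquiv : Fin 4 ⊕ Fin 2 ≃ Fin 6) finSumFinEquiv =
      fromBlocks 1 (Matrix.of fun m j => ![-p m, p m] j)
        (Matrix.of fun _ m => a * p m)
        !![(a * (1 - ∑ m, p m ^ 2) + b) / 2, (a * (1 + ∑ m, p m ^ 2) - b) / 2;
           (a * (1 - ∑ m, p m ^ 2) - b) / 2, (a * (1 + ∑ m, p m ^ 2) + b) / 2] := by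
    ext (i | i) (j | j) <;> fin_cases i <;> fin_cases j <;> rfl
  rw [h, Matrix.det_fromBlocks_one₁₁, Matrix.det_fin_two]
  simp [Matrix.mul_apply, Fin.sum_univ_four]
  linear_combination hab

end Coset

section Coset

variable (σ : ℝ) (φ : ℝ⁴)

lemma exp_neg_mul_exp_div : exp (-(σ / √2)) * exp (σ / √2) = 1 := by
  rw [← exp_add]
  simp

lemma isSO15_cosetRep : IsSO15 (cosetRep σ φ) := by
  have hab := exp_neg_mul_exp_div σ
  rw [cosetRep_eq_horo]
  have ha := exp_pos (-(σ / √2))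
  have hb := exp_pos (σ / √2)
  generalize exp (-(σ / √2)) = a at *
  generalize exp (σ / √2) = b at *
  generalize (fun m => φ m / √2) = p
  refine ⟨?_, horo_det hab, ?_⟩
  · have h := horo_mul_eta (p := p) hab
    have h1 : (eta * horo a b p * eta) * (horo a b p).transpose = 1 := by
      rw [mul_assoc, mul_assoc, ← mul_assoc (horo a b p), h, eta_mul_eta]
    have h2 := mul_eq_one_comm.1 h1
    calc (horo a b p).transpose * eta * horo a b p =
          (horo a b p).transpose * (eta * horo a b p * eta) * eta := by
          simp only [mul_assoc, eta_mul_eta, mul_one]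
      _ = eta := by rw [h2, one_mul]
  · change 0 < (a * (1 + ∑ m, p m ^ 2) + b) / 2
    have : 0 ≤ ∑ m, p m ^ 2 := Finset.sum_nonneg fun m _ => sq_nonneg _
    positivity

/-- The last row of the coset representative determines the coordinates. -/
lemma cosetRep_last (m : Fin 4) : cosetRep σ φ 5 (m.castAdd 2) = exp (-(σ / √2)) * (φ m / √2) ∧
    cosetRep σ φ 5 4 + cosetRep σ φ 5 5 = exp (-(σ / √2)) := by
  rw [cosetRep_eq_horo]
  refine ⟨by fin_cases m <;> rfl, ?_⟩
  change (exp (-(σ / √2)) * (1 - ∑ m, (φ m / √2) ^ 2) - exp (σ / √2)) / 2 +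
    (exp (-(σ / √2)) * (1 + ∑ m, (φ m / √2) ^ 2) + exp (σ / √2)) / 2 = _
  ring

/-- The horospherical coordinates of a unit timelike vector. -/
def horoSigma (r : ℝ⁶) : ℝ := -(√2 * log (r 4 + r 5))

/-- The horospherical coordinates of a unit timelike vector. -/
def horoPhi (r : ℝ⁶) (m : Fin 4) : ℝ := √2 * r (m.castAdd 2) / (r 4 + r 5)

lemma horoSigma_cosetRep : horoSigma (cosetRep σ φ 5) = σ := by
  have hs : √2 ≠ 0 := by positivity
  rw [horoSigma, (cosetRep_last σ φ 0).2, Real.log_exp]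
  field_simp

lemma horoPhi_cosetRep : horoPhi (cosetRep σ φ 5) = φ := by
  have hs : √2 ≠ 0 := by positivity
  funext m
  rw [horoPhi, (cosetRep_last σ φ m).2, (cosetRep_last σ φ m).1]
  have := exp_pos (-(σ / √2))
  field_simp

lemma exp_horoSigma {r : ℝ⁶} (hr : 0 < r 4 + r 5) :
    exp (-(horoSigma r / √2)) = r 4 + r 5 ∧ exp (horoSigma r / √2) = (r 4 + r 5)⁻¹ := by
  have hs : √2 ≠ 0 := by positivity
  have h : horoSigma r / √2 = -log (r 4 + r 5) := by
    rw [horoSigma]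
    field_simp
  rw [h, neg_neg, exp_neg, exp_log hr]
  exact ⟨rfl, rfl⟩

lemma cosetRep_horo {r : ℝ⁶} (hr : 0 < r 4 + r 5)
    (h1 : ∑ m : Fin 4, r (m.castAdd 2) ^ 2 + r 4 ^ 2 - r 5 ^ 2 = -1) :
    cosetRep (horoSigma r) (horoPhi r) 5 = r := by
  have hs : √2 ≠ 0 := by positivity
  have hp : (fun m => horoPhi r m / √2) = fun m => r (m.castAdd 2) / (r 4 + r 5) := by
    funext m
    rw [horoPhi]
    field_simp
  rw [cosetRep_eq_horo, (exp_horoSigma hr).1, (exp_horoSigma hr).2, hp]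
  have hq : ∑ m : Fin 4, (r (m.castAdd 2) / (r 4 + r 5)) ^ 2 =
      (r 5 ^ 2 - r 4 ^ 2 - 1) / (r 4 + r 5) ^ 2 := by
    simp only [div_pow]
    rw [← Finset.sum_div]
    congr 1
    linarith
  have hm : ∀ m : Fin 4, (r 4 + r 5) * (r (m.castAdd 2) / (r 4 + r 5)) = r (m.castAdd 2) :=
    fun m => mul_div_cancel₀ _ hr.ne'
  funext I
  fin_cases I
  · exact hm 0
  · exact hm 1
  · exact hm 2
  · exact hm 3
  · change ((r 4 + r 5) * (1 - ∑ m : Fin 4, (r (m.castAdd 2) / (r 4 + r 5)) ^ 2) -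
      (r 4 + r 5)⁻¹) / 2 = r 4
    rw [hq]
    field_simp
    ring
  · change ((r 4 + r 5) * (1 + ∑ m : Fin 4, (r (m.castAdd 2) / (r 4 + r 5)) ^ 2) +
      (r 4 + r 5)⁻¹) / 2 = r 5
    rw [hq]
    field_simp
    ring

end Coset

section Embed

variable {L : Mat₆}

lemma IsSO15.row_norm (h : IsSO15 L) (A B : Fin 6) : ∑ I, L A I * eta I I * L B I = eta A B := by
  have := congrFun (congrFun h.mul_eta_mul_transpose A) B
  rw [Matrix.mul_apply] at this
  rw [← this]
  refine sum_congr rfl fun I _ => ?_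
  rw [transpose_apply, eta, mul_diagonal, diagonal_apply_eq]

lemma IsSO15.col_norm (h : IsSO15 L) (I J : Fin 6) : ∑ A, L A I * eta A A * L A J = eta I J := by
  have := congrFun (congrFun h.1 I) J
  rw [Matrix.mul_apply] at this
  rw [← this]
  refine sum_congr rfl fun A _ => ?_
  rw [eta, mul_diagonal, diagonal_apply_eq, transpose_apply]

lemma IsSO15.last_row (h : IsSO15 L) :
    0 < L 5 4 + L 5 5 ∧ ∑ m : Fin 4, L 5 (m.castAdd 2) ^ 2 + L 5 4 ^ 2 - L 5 5 ^ 2 = -1 := by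
  have h1 := h.row_norm 5 5
  have h2 : ∑ m : Fin 4, L 5 (m.castAdd 2) ^ 2 + L 5 4 ^ 2 - L 5 5 ^ 2 = -1 := by
    simp [Fin.sum_univ_six, eta] at h1
    rw [Fin.sum_univ_four]
    change L 5 0 ^ 2 + L 5 1 ^ 2 + L 5 2 ^ 2 + L 5 3 ^ 2 + L 5 4 ^ 2 - L 5 5 ^ 2 = -1
    linarith
  refine ⟨?_, h2⟩
  have h3 : 0 ≤ ∑ m : Fin 4, L 5 (m.castAdd 2) ^ 2 := Finset.sum_nonneg fun m _ => sq_nonneg _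
  have h4 := h.2.2
  have h5 : |L 5 4| < |L 5 5| := sq_lt_sq.1 (by linarith)
  rw [abs_of_pos h4] at h5
  linarith [neg_abs_le (L 5 4)]

lemma embed5_castSucc (k : Matrix (Fin 5) (Fin 5) ℝ) (i j : Fin 5) :
    embed5 k i.castSucc j.castSucc = k i j := by
  have e : ∀ i : Fin 5, finSumFinEquiv.symm (Fin.castSucc i : Fin (5 + 1)) = inl i := fun i =>
    finSumFinEquiv_symm_apply_castAdd i
  simp only [embed5, Matrix.reindex_apply, Matrix.submatrix_apply, e, fromBlocks_apply₁₁]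

lemma finSumFinEquiv_symm_last' : finSumFinEquiv.symm (Fin.last 5 : Fin (5 + 1)) = inr 0 :=
  finSumFinEquiv_symm_apply_natAdd (m := 5) (n := 1) 0

lemma embed5_last (k : Matrix (Fin 5) (Fin 5) ℝ) (i : Fin 5) :
    embed5 k i.castSucc (Fin.last 5) = 0 ∧ embed5 k (Fin.last 5) i.castSucc = 0 ∧
      embed5 k (Fin.last 5) (Fin.last 5) = 1 := by
  have e : ∀ i : Fin 5, finSumFinEquiv.symm (Fin.castSucc i : Fin (5 + 1)) = inl i := fun i =>
    finSumFinEquiv_symm_apply_castAdd i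
  simp only [embed5, Matrix.reindex_apply, Matrix.submatrix_apply, e, finSumFinEquiv_symm_last',
    fromBlocks_apply₁₂, fromBlocks_apply₂₁, fromBlocks_apply₂₂, Matrix.zero_apply,
    Matrix.one_apply_eq, and_self]

lemma embed5_mul_last (k : Matrix (Fin 5) (Fin 5) ℝ) (M : Mat₆) (I : Fin 6) :
    (embed5 k * M) (Fin.last 5) I = M (Fin.last 5) I := by
  rw [Matrix.mul_apply, Fin.sum_univ_castSucc]
  rw [(embed5_last k 0).2.2, one_mul, sum_eq_zero, zero_add]
  intro i _
  rw [(embed5_last k i).2.1, zero_mul]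

lemma embed5_mul_castSucc (k : Matrix (Fin 5) (Fin 5) ℝ) (M : Mat₆) (i : Fin 5) (I : Fin 6) :
    (embed5 k * M) i.castSucc I = ∑ j, k i j * M j.castSucc I := by
  rw [Matrix.mul_apply, Fin.sum_univ_castSucc]
  rw [(embed5_last k i).1, zero_mul, add_zero]
  simp only [embed5_castSucc]

lemma embed5_det (k : Matrix (Fin 5) (Fin 5) ℝ) : (embed5 k).det = k.det := by
  rw [embed5, Matrix.det_reindex_self, Matrix.det_fromBlocks_zero₂₁]
  simp

lemma eta_castSucc (i j : Fin 5) : eta i.castSucc j.castSucc = if i = j then 1 else 0 := by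
  rw [eta, Matrix.diagonal_apply]
  simp only [Fin.castSucc_inj]
  split_ifs with h
  · subst h
    fin_cases i <;> rfl
  · rfl

lemma eta_last : eta (Fin.last 5) (Fin.last 5) = -1 := by
  rw [eta, diagonal_apply_eq]
  rfl

/-- Two elements of the group with the same last row differ by an element of the stabilizer. -/
lemma exists_embed5 {M : Mat₆} (hL : IsSO15 L) (hM : IsSO15 M) (h : L 5 = M 5) :
    ∃ k ∈ specialOrthogonalGroup (Fin 5) ℝ, L = embed5 k * M := by
  have hMinv : (eta * M.transpose * eta) * M = 1 := by
    rw [mul_assoc, mul_assoc, ← mul_assoc M.transpose, hM.1, eta_mul_eta]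
  let K := L * (eta * M.transpose * eta)
  have hK : L = K * M := by rw [mul_assoc, hMinv, mul_one]
  have heta : eta.transpose = eta := Matrix.diagonal_transpose _
  have hKO : K * eta * K.transpose = eta := by
    have : K * eta * K.transpose = L * (eta * (M.transpose * (eta * eta * eta) * M) * eta) *
        L.transpose := by
      simp only [K, Matrix.transpose_mul, heta, Matrix.transpose_transpose, mul_assoc]
    rw [this, eta_mul_eta, one_mul, hM.1, eta_mul_eta, one_mul, hL.mul_eta_mul_transpose]
  have hMr : M * (eta * M.transpose * eta) = 1 := mul_eq_one_comm.1 hMinv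
  have hK5 : ∀ I, K 5 I = (1 : Mat₆) 5 I := by
    intro I
    rw [← hMr]
    change ∑ j, L 5 j * (eta * M.transpose * eta) j I = ∑ j, M 5 j * (eta * M.transpose * eta) j I
    rw [h]
  have hKc : ∀ i : Fin 5, K i.castSucc 5 = 0 := by
    intro i
    have := congrFun (congrFun hKO i.castSucc) 5
    rw [Matrix.mul_apply, sum_eq_single 5 (fun J _ hJ => ?_) (by simp)] at this
    · rw [transpose_apply, hK5, Matrix.one_apply_eq, mul_one, eta, mul_diagonal,
        Matrix.diagonal_apply_ne _ (show i.castSucc ≠ (5 : Fin 6) from (Fin.castSucc_lt_last i).ne)]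
        at this
      simpa using this
    · rw [transpose_apply, hK5, Matrix.one_apply_ne hJ.symm, mul_zero]
  let k : Matrix (Fin 5) (Fin 5) ℝ := Matrix.of fun i j => K i.castSucc j.castSucc
  have hKk : K = embed5 k := by
    ext i j
    refine lastCases ?_ (fun i => ?_) i <;> refine lastCases ?_ (fun j => ?_) j
    · rw [(embed5_last k 0).2.2]
      exact hK5 5
    · rw [(embed5_last k j).2.1]
      exact (hK5 _).trans (Matrix.one_apply_ne (Fin.castSucc_lt_last j).ne')
    · rw [(embed5_last k i).1]
      exact hKc i
    · rw [embed5_castSucc]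
      rfl
  refine ⟨k, ?_, by rw [← hKk, ← hK]⟩
  rw [Matrix.mem_specialOrthogonalGroup_iff, Matrix.mem_orthogonalGroup_iff]
  constructor
  · ext i j
    have := congrFun (congrFun hKO i.castSucc) j.castSucc
    rw [eta_castSucc, Matrix.mul_apply, Fin.sum_univ_castSucc] at this
    have h5 : K.transpose (Fin.last 5) j.castSucc = 0 := hKc j
    rw [h5, mul_zero, add_zero] at this
    rw [Matrix.one_apply, ← this, Matrix.mul_apply]
    refine sum_congr rfl fun l _ => ?_
    rw [eta, mul_diagonal]
    have : (![1, 1, 1, 1, 1, -1] : ℝ⁶) l.castSucc = 1 := by fin_cases l <;> rfl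
    rw [this, mul_one]
    rfl
  · have hd := congrArg Matrix.det hK
    rw [Matrix.det_mul, hL.2.1, hM.2.1, mul_one, hKk, embed5_det] at hd
    exact hd.symm

lemma existsUnique_horospherical (hL : IsSO15 L) : ∃! s : ℝ × ℝ⁴,
    ∃ k ∈ specialOrthogonalGroup (Fin 5) ℝ, L = embed5 k * cosetRep s.1 s.2 := by
  have hr := hL.last_row
  refine ⟨(horoSigma (L 5), horoPhi (L 5)),
    exists_embed5 hL (isSO15_cosetRep _ _) (cosetRep_horo hr.1 hr.2).symm, ?_⟩
  rintro ⟨σ, φ⟩ ⟨k, -, hk⟩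
  have h5 : L 5 = cosetRep σ φ 5 := by
    funext I
    rw [hk]
    exact embed5_mul_last k _ I
  rw [h5, horoSigma_cosetRep, horoPhi_cosetRep]

end Embed

section MaurerCartan

variable {E : Type*} [NormedAddCommGroup E] [NormedSpace ℝ E]

lemma sum_univ_four_add_two {M : Type*} [AddCommMonoid M] (f : Fin 6 → M) :
    ∑ I, f I = ∑ m : Fin 4, f m.castSucc.castSucc + f 4 + f 5 := by
  rw [Fin.sum_univ_castSucc, Fin.sum_univ_castSucc]
  rfl

/-- The one-form `η^{IJ} V^A_I dV^B_J`. -/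
def maurerCartanForm (V : E → Mat₆) (A B : Fin 6) (x : E) : E →L[ℝ] ℝ :=
  ∑ I, (eta I I * V x A I) • fderiv ℝ (fun w => V w B I) x

lemma maurerCartanForm_antisymm {V : E → Mat₆} {x : E}
    (hV : ∀ A I, Diff (fun w => V w A I) x) (h : ∀ᶠ w in nhds x, IsSO15 (V w))
    (A B : Fin 6) : maurerCartanForm V A B x = -maurerCartanForm V B A x := by
  have h1 : (fun w => ∑ I, V w A I * eta I I * V w B I) =ᶠ[nhds x] fun _ => eta A B :=
    h.mono fun w hw => hw.row_norm A B
  have h2 := h1.fderiv_eq (𝕜 := ℝ)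
  rw [fderiv_fun_sum (𝕜 := ℝ) fun I _ => ((hV A I).mul_const (eta I I)).fun_mul (hV B I)] at h2
  simp only [fderiv_fun_const, Pi.zero_apply] at h2
  rw [eq_neg_iff_add_eq_zero, ← h2, maurerCartanForm, maurerCartanForm, ← sum_add_distrib]
  refine sum_congr rfl fun I _ => ?_
  rw [fderiv_fun_mul ((hV A I).mul_const _) (hV B I), fderiv_mul_const (hV A I)]
  ext v
  simp only [add_apply, smul_apply, smul_eq_mul]
  ring

variable {σ : E → ℝ} {φ : Fin 4 → E → ℝ} {x : E}

lemma cosetRep_vector (s : ℝ) (f : ℝ⁴) (m : Fin 4) :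
    (∀ n : Fin 4, cosetRep s f m.castSucc.castSucc n.castSucc.castSucc = if m = n then 1 else 0) ∧
    cosetRep s f m.castSucc.castSucc 4 = -(f m / √2) ∧
    cosetRep s f m.castSucc.castSucc 5 = f m / √2 := by
  refine ⟨fun n => ?_, ?_, ?_⟩
  · fin_cases m <;> fin_cases n <;> rfl
  · fin_cases m <;> rfl
  · fin_cases m <;> rfl

lemma cosetRep_four (s : ℝ) (f : ℝ⁴) :
    (∀ n : Fin 4, cosetRep s f 4 n.castSucc.castSucc = cosetRep s f 5 n.castSucc.castSucc) ∧
    cosetRep s f 4 4 = cosetRep s f 5 4 + exp (s / √2) ∧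
    cosetRep s f 4 5 = cosetRep s f 5 5 - exp (s / √2) := by
  refine ⟨fun n => ?_, ?_, ?_⟩
  · fin_cases n <;> rfl
  · rw [cosetRep_eq_horo]
    change (exp (-(s / √2)) * (1 - ∑ m, (f m / √2) ^ 2) + exp (s / √2)) / 2 =
      (exp (-(s / √2)) * (1 - ∑ m, (f m / √2) ^ 2) - exp (s / √2)) / 2 + exp (s / √2)
    ring
  · rw [cosetRep_eq_horo]
    change (exp (-(s / √2)) * (1 + ∑ m, (f m / √2) ^ 2) - exp (s / √2)) / 2 =
      (exp (-(s / √2)) * (1 + ∑ m, (f m / √2) ^ 2) + exp (s / √2)) / 2 - exp (s / √2)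
    ring

lemma eta_four : eta 4 4 = 1 := by
  rw [eta, diagonal_apply_eq]
  rfl

lemma eta_five : eta 5 5 = -1 := eta_last

lemma contDiff_cosetRep (A I : Fin 6) : ContDiff ℝ ∞ fun r : ℝ × ℝ⁴ => cosetRep r.1 r.2 A I := by
  have h5 : ∀ I, ContDiff ℝ ∞ fun r : ℝ × ℝ⁴ => cosetRep r.1 r.2 5 I := by
    intro I
    refine lastCases ?_ (fun I => lastCases ?_ (fun n => ?_) I) I
    · change ContDiff ℝ ∞ fun r : ℝ × ℝ⁴ => (exp (-(r.1 / √2)) *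
        (2 + ∑ m, r.2 m ^ 2) + 2 * exp (r.1 / √2)) / 4
      fun_prop
    · change ContDiff ℝ ∞ fun r : ℝ × ℝ⁴ => (exp (-(r.1 / √2)) *
        (2 - ∑ m, r.2 m ^ 2) - 2 * exp (r.1 / √2)) / 4
      fun_prop
    · have h := fun r : ℝ × ℝ⁴ => (cosetRep_last r.1 r.2 n).1
      refine (funext h ▸ ?_ : ContDiff ℝ ∞ fun r : ℝ × ℝ⁴ =>
        cosetRep r.1 r.2 5 (n.castAdd 2))
      fun_prop
  refine lastCases (h5 I) (fun A => lastCases ?_ (fun m => ?_) A) A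
  · have h4 := fun r : ℝ × ℝ⁴ => cosetRep_four r.1 r.2
    change ContDiff ℝ ∞ fun r : ℝ × ℝ⁴ => cosetRep r.1 r.2 4 I
    have hb : ContDiff ℝ ∞ fun r : ℝ × ℝ⁴ => exp (r.1 / √2) := by fun_prop
    refine lastCases ?_ (fun I => lastCases ?_ (fun n => ?_) I) I
    · exact funext (fun r => (h4 r).2.2) ▸ (h5 5).sub hb
    · exact funext (fun r => (h4 r).2.1) ▸ (h5 4).add hb
    · exact funext (fun r => (h4 r).1 n) ▸ h5 n.castSucc.castSucc
  · have hm := fun r : ℝ × ℝ⁴ => cosetRep_vector r.1 r.2 m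
    refine lastCases ?_ (fun I => lastCases ?_ (fun n => ?_) I) I
    · refine (funext (fun r => (hm r).2.2) ▸ ?_ :
        ContDiff ℝ ∞ fun r : ℝ × ℝ⁴ => cosetRep r.1 r.2 m.castSucc.castSucc 5)
      fun_prop
    · refine (funext (fun r => (hm r).2.1) ▸ ?_ :
        ContDiff ℝ ∞ fun r : ℝ × ℝ⁴ => cosetRep r.1 r.2 m.castSucc.castSucc 4)
      fun_prop
    · exact funext (fun r => (hm r).1 n) ▸ contDiff_const

lemma differentiableAt_cosetRep (hσ : Diff σ x) (hφ : ∀ m, Diff (φ m) x) (A I : Fin 6) :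
    Diff (fun w => cosetRep (σ w) (fun m => φ m w) A I) x :=
  DifferentiableAt.comp (g := fun r : ℝ × ℝ⁴ => cosetRep r.1 r.2 A I)
    (f := fun w => (σ w, fun m => φ m w)) x
    ((contDiff_cosetRep A I).contDiffAt.differentiableAt (by simp))
    (hσ.prodMk (differentiableAt_pi.2 hφ))

lemma maurerCartanForm_vector (hφ : ∀ m, Diff (φ m) x) (A : Fin 6) (m : Fin 4) :
    maurerCartanForm (fun w => cosetRep (σ w) fun m => φ m w) A m.castSucc.castSucc x =
      (-(cosetRep (σ x) (fun m => φ m x) A 4 + cosetRep (σ x) (fun m => φ m x) A 5) / √2) •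
        fderiv ℝ (φ m) x := by
  rw [maurerCartanForm, sum_univ_four_add_two]
  simp only [(cosetRep_vector _ _ m).1, (cosetRep_vector _ _ m).2.1, (cosetRep_vector _ _ m).2.2,
    eta_four, eta_five, fderiv_fun_const, Pi.zero_apply, smul_zero, sum_const_zero, zero_add]
  have h : fderiv ℝ (fun w => φ m w / √2) x = (√2)⁻¹ • fderiv ℝ (φ m) x := by
    simp only [div_eq_mul_inv]
    exact fderiv_mul_const (hφ m) _
  rw [fderiv_fun_neg, h]
  ext v
  simp only [add_apply, smul_apply, neg_apply, smul_eq_mul]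
  ring

lemma maurerCartanForm_self {V : E → Mat₆} {x : E}
    (hV : ∀ A I, Diff (fun w => V w A I) x) (h : ∀ᶠ w in nhds x, IsSO15 (V w))
    (A : Fin 6) : maurerCartanForm V A A x = 0 := by
  ext v
  have := DFunLike.congr_fun (maurerCartanForm_antisymm hV h A A) v
  exact self_eq_neg.1 this

lemma cosetRep_four_sum (s : ℝ) (f : ℝ⁴) :
    cosetRep s f 4 4 + cosetRep s f 4 5 = exp (-(s / √2)) := by
  rw [(cosetRep_four s f).2.1, (cosetRep_four s f).2.2, ← (cosetRep_last s f 0).2]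
  ring

lemma maurerCartanForm_last_four (hσ : Diff σ x) (hφ : ∀ m, Diff (φ m) x) :
    maurerCartanForm (fun w => cosetRep (σ w) fun m => φ m w) 5 4 x = (√2)⁻¹ • fderiv ℝ σ x := by
  have hV := differentiableAt_cosetRep hσ hφ
  have h0 := maurerCartanForm_self hV (.of_forall fun w => isSO15_cosetRep _ _) 4
  have h1 : fderiv ℝ (fun w => cosetRep (σ w) (fun m => φ m w) 4 4) x +
      fderiv ℝ (fun w => cosetRep (σ w) (fun m => φ m w) 4 5) x =
      (-(exp (-(σ x / √2)) / √2)) • fderiv ℝ σ x := by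
    rw [← fderiv_fun_add (hV 4 4) (hV 4 5)]
    simp only [cosetRep_four_sum]
    have : HasFDerivAt (fun w => exp (-(σ w / √2)))
        (exp (-(σ x / √2)) • -((√2)⁻¹ • fderiv ℝ σ x)) x :=
      ((hσ.hasFDerivAt.mul_const (√2)⁻¹).neg).exp
    rw [this.fderiv]
    ext v
    simp only [smul_apply, neg_apply, smul_eq_mul]
    simp only [div_eq_mul_inv]
    ring
  have h2 : maurerCartanForm (fun w => cosetRep (σ w) fun m => φ m w) 5 4 x =
      maurerCartanForm (fun w => cosetRep (σ w) fun m => φ m w) 4 4 x -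
        exp (σ x / √2) • (fderiv ℝ (fun w => cosetRep (σ w) (fun m => φ m w) 4 4) x +
          fderiv ℝ (fun w => cosetRep (σ w) (fun m => φ m w) 4 5) x) := by
    rw [maurerCartanForm, maurerCartanForm, sum_univ_four_add_two, sum_univ_four_add_two]
    simp only [(cosetRep_four (σ x) _).1, (cosetRep_four (σ x) _).2.1, (cosetRep_four (σ x) _).2.2,
      eta_four, eta_five]
    ext v
    simp only [add_apply, smul_apply, sub_apply, smul_eq_mul]
    ring
  rw [h2, h0, h1, zero_sub, smul_smul]
  ext v
  simp only [smul_apply, neg_apply, smul_eq_mul]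
  linear_combination (√2)⁻¹ * fderiv ℝ σ x v * exp_neg_mul_exp_div (σ x)

lemma exp_neg_div_sq (s : ℝ) : exp (-(s / √2)) ^ 2 = exp (-(√2 * s)) := by
  rw [← exp_nat_mul]
  congr 1
  have h : √2 * √2 = 2 := mul_self_sqrt (by norm_num)
  field_simp
  push_cast
  linear_combination s * h

lemma exp_div_sq (s : ℝ) : exp (s / √2) ^ 2 = exp (√2 * s) := by
  have := exp_neg_div_sq (-s)
  simpa [neg_div] using this

/-- The invariant metric in horospherical coordinates. -/
lemma sum_sq_maurerCartanForm_cosetRep (s u : ℝ × ℝ⁴) :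
    ∑ i : Fin 5, (∑ I, eta I I * cosetRep s.1 s.2 (Fin.last 5) I *
        fderiv ℝ (fun r : ℝ × ℝ⁴ => cosetRep r.1 r.2 i.castSucc I) s u) ^ 2 =
      1 / 2 * (u.1 ^ 2 + exp (-(√2 * s.1)) * ∑ m, u.2 m ^ 2) := by
  have hφ : ∀ m : Fin 4, Diff (fun r : ℝ × ℝ⁴ => r.2 m) s := fun m => by
    fun_prop
  have h : ∀ i : Fin 5, ∑ I, eta I I * cosetRep s.1 s.2 (Fin.last 5) I *
      fderiv ℝ (fun r : ℝ × ℝ⁴ => cosetRep r.1 r.2 i.castSucc I) s u =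
      maurerCartanForm (fun r : ℝ × ℝ⁴ => cosetRep r.1 fun m => r.2 m) 5 i.castSucc s u :=
    fun i => by
      simp only [maurerCartanForm, sum_apply, smul_apply, smul_eq_mul]
      rfl
  simp only [h]
  rw [Fin.sum_univ_castSucc]
  have h4 := maurerCartanForm_last_four (x := s) differentiableAt_fst hφ
  simp only [maurerCartanForm_vector (σ := fun r : ℝ × ℝ⁴ => r.1) hφ]
  rw [show (Fin.last 4).castSucc = (4 : Fin 6) from rfl, h4, (cosetRep_last _ _ 0).2]
  have hd : ∀ m : Fin 4, fderiv ℝ (fun r : ℝ × ℝ⁴ => r.2 m) s u = u.2 m := fun m => by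
    have : HasFDerivAt (fun r : ℝ × ℝ⁴ => r.2 m)
        ((ContinuousLinearMap.proj (R := ℝ) (φ := fun _ : Fin 4 => ℝ) m).comp
          (ContinuousLinearMap.snd ℝ ℝ ℝ⁴)) s :=
      ((ContinuousLinearMap.proj (R := ℝ) (φ := fun _ : Fin 4 => ℝ) m).comp
          (ContinuousLinearMap.snd ℝ ℝ ℝ⁴)).hasFDerivAt
    rw [this.fderiv]
    rfl
  have h2 : (√2)⁻¹ ^ 2 = (1 / 2 : ℝ) := by
    rw [inv_pow, sq_sqrt (by norm_num)]
    norm_num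
  simp only [smul_apply, smul_eq_mul, hd, mul_pow, div_eq_mul_inv, neg_sq, fderiv_fst,
    ContinuousLinearMap.coe_fst', h2]
  rw [← mul_sum, ← div_eq_mul_inv, exp_neg_div_sq]
  ring

end MaurerCartan

lemma TwoZeroFields.maurerCartan_eq (T : TwoZeroFields) (A B : Fin 6) (x : ℝ⁶) :
    T.maurerCartan A B x = oneForm (maurerCartanForm T.V A B x) := by
  ext v
  rw [TwoZeroFields.maurerCartan, Form.sum_apply, oneForm_apply, maurerCartanForm, sum_apply]
  rfl

lemma sum_smul_sum_smul {M : Type*} [AddCommGroup M] [Module ℝ M] {ι κ : Type*} [Fintype ι]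
    [Fintype κ] (N : Matrix ι κ ℝ) (c : ι → ℝ) (D : κ → M) :
    ∑ I, c I • ∑ B, N I B • D B = ∑ B, (∑ I, c I * N I B) • D B := by
  simp only [smul_sum, smul_smul, sum_smul]
  exact sum_comm

lemma IsSO15.mul_inv {L : Mat₆} (h : IsSO15 L) : L * (eta * L.transpose * eta) = 1 := by
  rw [← mul_assoc, ← mul_assoc, h.mul_eta_mul_transpose, eta_mul_eta]

lemma eta_mul_mul_eta (L : Mat₆) (I A : Fin 6) :
    (eta * L * eta) I A = eta I I * L I A * eta A A := by
  rw [eta, mul_diagonal, Matrix.diagonal_mul, diagonal_apply_eq, diagonal_apply_eq]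

namespace SixFields

lemma toTwoZero_dressed (F : SixFields) (A : Fin 6) (x : ℝ⁶) :
    F.toTwoZero.dressed A x = F.dressedForms x A := by
  have h := (isSO15_cosetRep (F.sigma x) fun m => F.phi m x).mul_inv
  refine (sum_smul_sum_smul (eta * (cosetRep (F.sigma x) fun m => F.phi m x).transpose * eta)
    (cosetRep (F.sigma x) (fun m => F.phi m x) A) (F.dressedForms x)).trans ?_
  simp only [← Matrix.mul_apply, h, Matrix.one_apply, ite_smul, one_smul, zero_smul, sum_ite_eq,
    mem_univ, if_true]

lemma dressedForms_vector (F : SixFields) (x : ℝ⁶) (m : Fin 4) :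
    F.dressedForms x m.castSucc.castSucc = F.Hm m x := by fin_cases m <;> rfl

lemma eta_vector (m : Fin 4) : eta m.castSucc.castSucc m.castSucc.castSucc = 1 := by
  rw [eta_castSucc, if_pos rfl]

lemma toTwoZero_G_apply (F : SixFields) (I : Fin 6) (x : ℝ⁶) (v : Fin 3 → ℝ⁶) :
    F.toTwoZero.G I x v = eta I I *
      (∑ m : Fin 4, cosetRep (F.sigma x) (fun m => F.phi m x) m.castSucc.castSucc I * F.Hm m x v +
        cosetRep (F.sigma x) (fun m => F.phi m x) 4 I * F.dressedForms x 4 v -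
        cosetRep (F.sigma x) (fun m => F.phi m x) 5 I * F.dressedForms x 5 v) := by
  rw [SixFields.toTwoZero, Form.sum_apply, sum_univ_four_add_two]
  simp only [Form.smul_apply, eta_mul_mul_eta, eta_vector, eta_four, eta_five, transpose_apply,
    dressedForms_vector]
  rw [mul_sub, mul_add, mul_sum]
  simp only [mul_assoc, one_mul]
  ring

lemma dressedForms_four (F : SixFields) (x : ℝ⁶) :
    F.dressedForms x 4 = (1 / 2 * exp (F.sigma x / √2)) • (⋆₃ (F.metric x) (F.H0 x) + F.H0 x) := by
  simp only [dressedForms, Matrix.cons_val]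

lemma dressedForms_four_apply (F : SixFields) (x : ℝ⁶) (v : Fin 3 → ℝ⁶) :
    F.dressedForms x 4 v = 1 / 2 * exp (F.sigma x / √2) *
      (⋆₃ (F.metric x) (F.H0 x) v + F.H0 x v) := by
  rw [dressedForms_four]
  rfl

lemma dressedForms_five (F : SixFields) (x : ℝ⁶) :
    F.dressedForms x 5 = (1 / 2 * exp (F.sigma x / √2)) • (⋆₃ (F.metric x) (F.H0 x) - F.H0 x) := by
  simp only [dressedForms, Matrix.cons_val]

lemma dressedForms_five_apply (F : SixFields) (x : ℝ⁶) (v : Fin 3 → ℝ⁶) :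
    F.dressedForms x 5 v = 1 / 2 * exp (F.sigma x / √2) *
      (⋆₃ (F.metric x) (F.H0 x) v - F.H0 x v) := by
  rw [dressedForms_five]
  rfl

lemma toTwoZero_G_vector (F : SixFields) (m : Fin 4) :
    F.toTwoZero.G m.castSucc.castSucc = fun x => F.Hm m x + (F.phi m x / √2) • F.H0 x := by
  funext x
  ext v
  rw [toTwoZero_G_apply, eta_vector]
  simp only [(cosetRep_vector _ _ _).1, ite_mul, one_mul, zero_mul, sum_ite_eq', mem_univ, if_true,
    (cosetRep_four _ _).1]
  rw [show cosetRep (F.sigma x) (fun m => F.phi m x) 5 m.castSucc.castSucc = _ from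
    (cosetRep_last _ _ m).1, dressedForms_four_apply, dressedForms_five_apply]
  simp only [Form.add_apply, Form.smul_apply]
  linear_combination (F.phi m x / √2 * F.H0 x v) * exp_neg_mul_exp_div (F.sigma x)

lemma toTwoZero_G_sub (F : SixFields) : F.H0 = fun x => F.toTwoZero.G 4 x - F.toTwoZero.G 5 x := by
  funext x
  ext v
  rw [Form.sub_apply, toTwoZero_G_apply, toTwoZero_G_apply, eta_four, eta_five]
  simp only [(cosetRep_vector _ _ _).2.1, (cosetRep_vector _ _ _).2.2, neg_mul, sum_neg_distrib]
  have h4 := cosetRep_four_sum (F.sigma x) fun m => F.phi m x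
  have h5 := (cosetRep_last (F.sigma x) (fun m => F.phi m x) 0).2
  rw [dressedForms_four_apply, dressedForms_five_apply]
  linear_combination -(F.H0 x v) * exp_neg_mul_exp_div (F.sigma x) - (1 / 2 * exp (F.sigma x / √2) *
      (⋆₃ (F.metric x) (F.H0 x) v + F.H0 x v)) * h4 +
    (1 / 2 * exp (F.sigma x / √2) * (⋆₃ (F.metric x) (F.H0 x) v - F.H0 x v)) * h5

lemma toTwoZero_G_add (F : SixFields) : (fun x => F.toTwoZero.G 4 x + F.toTwoZero.G 5 x) = fun x =>
      exp (√2 * F.sigma x) • ⋆₃ (F.metric x) (F.H0 x) -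
        √2 • ∑ m, F.phi m x • F.toTwoZero.G m.castSucc.castSucc x +
        (1 / 2 * ∑ m, F.phi m x ^ 2) • F.H0 x := by
  funext x
  ext v
  have hs : √2 * √2 = 2 := mul_self_sqrt (by norm_num)
  have hs0 : √2 ≠ 0 := by positivity
  have hab := exp_neg_mul_exp_div (F.sigma x)
  simp only [toTwoZero_G_vector, Form.sub_apply, Form.add_apply, Form.smul_apply, Form.sum_apply,
    mul_add, sum_add_distrib, ← exp_div_sq, toTwoZero_G_apply, eta_four, eta_five,
    (cosetRep_vector _ _ _).2.1, (cosetRep_vector _ _ _).2.2, dressedForms_four_apply,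
    dressedForms_five_apply]
  have hX : √2 * ∑ m, F.phi m x * F.Hm m x v = 2 * ∑ m, F.phi m x / √2 * F.Hm m x v := by
    rw [mul_sum, mul_sum]
    refine sum_congr rfl fun m _ => ?_
    field_simp
    linear_combination F.phi m x * F.Hm m x v * hs
  have hY : √2 * ∑ m, F.phi m x * (F.phi m x / √2 * F.H0 x v) =
      (∑ m, F.phi m x ^ 2) * F.H0 x v := by
    rw [mul_sum, sum_mul]
    refine sum_congr rfl fun m _ => ?_
    field_simp
  have h4 : cosetRep (F.sigma x) (fun m => F.phi m x) 4 4 -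
      cosetRep (F.sigma x) (fun m => F.phi m x) 4 5 = exp (F.sigma x / √2) -
      1 / 2 * exp (-(F.sigma x / √2)) * ∑ m, F.phi m x ^ 2 := by
    change (exp (-(F.sigma x / √2)) * (2 - ∑ m, F.phi m x ^ 2) +
      2 * exp (F.sigma x / √2)) / 4 - (exp (-(F.sigma x / √2)) *
      (2 + ∑ m, F.phi m x ^ 2) - 2 * exp (F.sigma x / √2)) / 4 = _
    ring
  have h5 : cosetRep (F.sigma x) (fun m => F.phi m x) 5 4 -
      cosetRep (F.sigma x) (fun m => F.phi m x) 5 5 = -exp (F.sigma x / √2) -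
      1 / 2 * exp (-(F.sigma x / √2)) * ∑ m, F.phi m x ^ 2 := by
    change (exp (-(F.sigma x / √2)) * (2 - ∑ m, F.phi m x ^ 2) -
      2 * exp (F.sigma x / √2)) / 4 - (exp (-(F.sigma x / √2)) *
      (2 + ∑ m, F.phi m x ^ 2) + 2 * exp (F.sigma x / √2)) / 4 = _
    ring
  simp only [neg_mul, sum_neg_distrib]
  linear_combination hX + hY + (1 / 2 * exp (F.sigma x / √2) *
      (⋆₃ (F.metric x) (F.H0 x) v + F.H0 x v)) * h4 -
    (1 / 2 * exp (F.sigma x / √2) * (⋆₃ (F.metric x) (F.H0 x) v - F.H0 x v)) * h5 -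
    1 / 2 * (∑ m, F.phi m x ^ 2) * F.H0 x v * hab

lemma Regular.dressedForms (hF : F.Regular U) (A : Fin 6) :
    ContDiffOn ℝ ∞ (fun x => F.dressedForms x A) U := by
  have hb : ContDiffOn ℝ ∞ (fun x => 1 / 2 * exp (F.sigma x / √2)) U :=
    contDiffOn_const.mul ((hF.sigma.div_const _).exp)
  have hs := ContDiffOn.star6 (q := 3) rfl hF.metric hF.H0
  fin_cases A
  · exact hF.Hm 0
  · exact hF.Hm 1
  · exact hF.Hm 2
  · exact hF.Hm 3
  · exact (hb.smul (hs.add hF.H0)).congr fun x _ => F.dressedForms_four x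
  · exact (hb.smul (hs.sub hF.H0)).congr fun x _ => F.dressedForms_five x

lemma Regular.toTwoZero (hF : F.Regular U) : F.toTwoZero.Regular U := by
  have hV : ∀ A I, ContDiffOn ℝ ∞
      (fun x => cosetRep (F.sigma x) (fun m => F.phi m x) A I) U := fun A I =>
    ContDiff.comp_contDiffOn (g := fun r : ℝ × ℝ⁴ => cosetRep r.1 r.2 A I)
      (f := fun w => (F.sigma w, fun m => F.phi m w)) (contDiff_cosetRep A I)
      (hF.sigma.prodMk (contDiffOn_pi.2 hF.phi))
  refine ⟨hF.metric, hV, fun x _ => isSO15_cosetRep (F.sigma x) fun m => F.phi m x, fun I => ?_⟩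
  change ContDiffOn ℝ ∞ (fun x => ∑ A, (eta * (cosetRep (F.sigma x)
    fun m => F.phi m x).transpose * eta) I A • F.dressedForms x A) U
  refine ContDiffOn.sum fun A _ => ?_
  have h : ContDiffOn ℝ ∞ (fun x => eta I I * cosetRep (F.sigma x) (fun m => F.phi m x) A I *
      eta A A) U := (contDiffOn_const.mul (hV A I)).mul contDiffOn_const
  exact (h.congr fun x _ =>
    eta_mul_mul_eta (cosetRep (F.sigma x) fun m => F.phi m x).transpose I A).smul
      (hF.dressedForms A)

lemma toTwoZero_closed_iff (hU : IsOpen U) (hF : F.Regular U) :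
    (∀ I, ∀ x ∈ U, extDeriv (F.toTwoZero.G I) x = 0) ↔ F.Bianchi U ∧ ∀ x ∈ U,
      extDeriv (fun w => exp (√2 * F.sigma w) • ⋆₃ (F.metric w) (F.H0 w)) x +
        √2 • ∑ m, wedge (F.Hm m x) (dφ m x) = 0 := by
  have hs0 : √2 ≠ 0 := by positivity
  have dG : ∀ I, ∀ x ∈ U, Diff (F.toTwoZero.G I) x := fun I x hx =>
    (hF.toTwoZero.G I).differentiableAt_of_isOpen hU hx
  have dp : ∀ m, ∀ x ∈ U, Diff (F.phi m) x := fun m x hx =>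
    (hF.phi m).differentiableAt_of_isOpen hU hx
  have d0 : ∀ x ∈ U, Diff F.H0 x := fun x hx =>
    hF.H0.differentiableAt_of_isOpen hU hx
  have e1 : ∀ x ∈ U, extDeriv F.H0 x =
      extDeriv (F.toTwoZero.G 4) x - extDeriv (F.toTwoZero.G 5) x := fun x hx => by
    conv_lhs => rw [F.toTwoZero_G_sub]
    exact extDeriv_fun_sub (dG 4 x hx) (dG 5 x hx)
  have e2 : ∀ m, ∀ x ∈ U, extDeriv (F.toTwoZero.G m.castSucc.castSucc) x =
      extDeriv (F.Hm m) x + (F.phi m x / √2) • extDeriv F.H0 x -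
        (1 / √2) • wedge (F.H0 x) (dφ m x) := fun m x hx => by
    have hf : Diff (fun w => F.phi m w / √2) x := by
      simpa only [div_eq_mul_inv] using (dp m x hx).mul_const (√2)⁻¹
    have hd : dScalar (fun w => F.phi m w / √2) x = (1 / √2) • dφ m x := by
      rw [← dScalar_const_mul (dp m x hx)]
      simp only [div_eq_mul_inv, one_mul, mul_comm]
    rw [toTwoZero_G_vector,
      extDeriv_fun_add ((hF.Hm m).differentiableAt_of_isOpen hU hx) (hf.fun_smul (d0 x hx)),
      extDeriv_smul_fun hf (d0 x hx), wedge_one_three, hd, wedge_smul_right]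
    abel
  have e3 : ∀ x ∈ U, extDeriv (F.toTwoZero.G 4) x + extDeriv (F.toTwoZero.G 5) x =
      extDeriv (fun w => exp (√2 * F.sigma w) • ⋆₃ (F.metric w) (F.H0 w)) x +
        √2 • ∑ m, wedge (F.Hm m x) (dφ m x) -
        √2 • ∑ m, F.phi m x • extDeriv (F.toTwoZero.G m.castSucc.castSucc) x +
        (1 / 2 * ∑ m, F.phi m x ^ 2) • extDeriv F.H0 x := fun x hx => by
    have hn : Diff (fun w => 1 / 2 * ∑ m, F.phi m w ^ 2) x :=
      (DifferentiableAt.fun_sum fun m _ => (dp m x hx).pow 2).const_mul _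
    have hdn : dScalar (fun w => 1 / 2 * ∑ m, F.phi m w ^ 2) x = ∑ m, F.phi m x • dφ m x := by
      have : HasFDerivAt (fun w => 1 / 2 * ∑ m, F.phi m w ^ 2)
          ((1 / 2 : ℝ) • ∑ m, (2 * F.phi m x ^ 1) • fderiv ℝ (F.phi m) x) x :=
        (HasFDerivAt.fun_sum fun m _ => by
          simpa using (dp m x hx).hasFDerivAt.pow 2).const_mul _
      ext v
      rw [Form.sum_apply, dScalar_apply, this.fderiv]
      simp only [smul_apply, sum_apply, smul_eq_mul, mul_sum, Form.smul_apply, dScalar_apply]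
      exact sum_congr rfl fun m _ => by ring
    have hS : Diff
        (fun w => exp (√2 * F.sigma w) • ⋆₃ (F.metric w) (F.H0 w)) x :=
      ((contDiffOn_const.mul hF.sigma).exp.smul
        (ContDiffOn.star6 (q := 3) rfl hF.metric hF.H0)).differentiableAt_of_isOpen hU hx
    have hφG : ∀ m : Fin 4, Diff
        (fun w => F.phi m w • F.toTwoZero.G m.castSucc.castSucc w) x := fun m =>
      (dp m x hx).fun_smul (dG _ x hx)
    have hφG' := DifferentiableAt.fun_sum (u := Finset.univ) fun m _ => hφG m
    rw [← extDeriv_fun_add (dG 4 x hx) (dG 5 x hx), F.toTwoZero_G_add,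
      extDeriv_fun_add (hS.fun_sub (hφG'.fun_const_smul (√2))) (hn.fun_smul (d0 x hx)),
      extDeriv_fun_sub hS (hφG'.fun_const_smul (√2)), extDeriv_const_smul,
      extDeriv_sum _ fun m _ => hφG m, extDeriv_smul_fun hn (d0 x hx), hdn, wedge_one_three,
      wedge_sum_right]
    have h1 : ∀ m : Fin 4, extDeriv (fun w => F.phi m w • F.toTwoZero.G m.castSucc.castSucc w) x =
        F.phi m x • extDeriv (F.toTwoZero.G m.castSucc.castSucc) x - wedge (F.Hm m x) (dφ m x) -
          (F.phi m x / √2) • wedge (F.H0 x) (dφ m x) := fun m => by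
      rw [extDeriv_smul_fun (dp m x hx) (dG _ x hx), wedge_one_three]
      simp only [toTwoZero_G_vector]
      rw [wedge_add_left, wedge_smul_left]
      abel
    simp only [h1, wedge_smul_right, sum_sub_distrib]
    ext v
    simp only [Form.sub_apply, Form.add_apply, Form.smul_apply, Form.neg_apply, Form.sum_apply]
    have : √2 * ∑ m, F.phi m x / √2 * wedge (F.H0 x) (dφ m x) v =
        ∑ m, F.phi m x * wedge (F.H0 x) (dφ m x) v := by
      rw [mul_sum]
      refine sum_congr rfl fun m _ => ?_
      field_simp
    linear_combination this
  constructor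
  · intro h
    have hH0 : ∀ x ∈ U, extDeriv F.H0 x = 0 := fun x hx => by
      rw [e1 x hx, h 4 x hx, h 5 x hx, sub_zero]
    refine ⟨⟨hH0, fun m x hx => ?_⟩, fun x hx => ?_⟩
    · have := e2 m x hx
      rw [h _ x hx, hH0 x hx, smul_zero, add_zero] at this
      exact (sub_eq_zero.1 this.symm)
    · have := e3 x hx
      simp only [h _ x hx, hH0 x hx, smul_zero, sum_const_zero, add_zero, sub_zero] at this
      exact this.symm
  · rintro ⟨hB, hE⟩
    have hv : ∀ m : Fin 4, ∀ x ∈ U, extDeriv (F.toTwoZero.G m.castSucc.castSucc) x = 0 :=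
      fun m x hx => by rw [e2 m x hx, hB.H0 x hx, hB.Hm m x hx, smul_zero, add_zero, sub_self]
    have h45 : ∀ x ∈ U, extDeriv (F.toTwoZero.G 4) x = 0 ∧ extDeriv (F.toTwoZero.G 5) x = 0 := by
      intro x hx
      have h1 := e1 x hx
      have h3 := e3 x hx
      simp only [hv _ x hx, hB.H0 x hx, hE x hx, smul_zero, sum_const_zero, add_zero,
        sub_zero] at h1 h3
      have h1' := sub_eq_zero.1 h1.symm
      rw [← h1', ← two_smul ℝ] at h3
      have h4 := (smul_eq_zero.1 h3).resolve_left (by norm_num)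
      exact ⟨h4, h1' ▸ h4⟩
    intro I x hx
    refine lastCases (h45 x hx).2 (fun I => lastCases (h45 x hx).1 (fun m => ?_) I) I
    exact hv m x hx

end SixFields

lemma eq_iff_of_sub_eq_smul {M : Type*} [AddCommGroup M] [Module ℝ M] {a b d : M} {c : ℝ} (hc : c ≠ 0)
    (h : a - b = c • d) : a = b ↔ d = 0 := by rw [← sub_eq_zero, h, smul_eq_zero_iff_right hc]

lemma oneForm_neg {ι : Type} [Fintype ι] (w : (ι → ℝ) →L[ℝ] ℝ) : oneForm (-w) = -oneForm w := rfl

lemma star6_add {p q : ℕ} (h : 6 = p + q) (g : Mat₆) (a b : Λ⁶ p) :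
    star6 p q h g (a + b) = star6 p q h g a + star6 p q h g b := hodge_add _ _ _ _

lemma star6_sub {p q : ℕ} (h : 6 = p + q) (g : Mat₆) (a b : Λ⁶ p) :
    star6 p q h g (a - b) = star6 p q h g a - star6 p q h g b := hodge_sub _ _ _ _

namespace TwoZeroFields

variable {T : TwoZeroFields}

lemma Regular.maurerCartan_antisymm (hU : IsOpen U) (hT : T.Regular U) (hx : x ∈ U)
    (A B : Fin 6) : T.maurerCartan A B x = -T.maurerCartan B A x := by
  rw [TwoZeroFields.maurerCartan_eq, TwoZeroFields.maurerCartan_eq, ← oneForm_neg]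
  exact congrArg oneForm (maurerCartanForm_antisymm
    (fun A I => (hT.V A I).differentiableAt_of_isOpen hU hx)
    (Filter.eventually_of_mem (hU.mem_nhds hx) hT.isSO15) A B)

lemma Regular.maurerCartan_self (hU : IsOpen U) (hT : T.Regular U) (hx : x ∈ U) (A : Fin 6) :
    T.maurerCartan A A x = 0 := by
  ext v
  exact self_eq_neg.1 (congrArg (fun θ => θ v) (hT.maurerCartan_antisymm hU hx A A))

end TwoZeroFields

namespace SixFields

lemma toTwoZero_maurerCartan_vector (hU : IsOpen U) (hF : F.Regular U) (hx : x ∈ U) (A : Fin 6)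
    (m : Fin 4) : F.toTwoZero.maurerCartan A m.castSucc.castSucc x =
      (-(cosetRep (F.sigma x) (fun m => F.phi m x) A 4 +
        cosetRep (F.sigma x) (fun m => F.phi m x) A 5) / √2) • dφ m x := by
  rw [TwoZeroFields.maurerCartan_eq]
  exact congrArg oneForm (maurerCartanForm_vector (σ := F.sigma) (φ := F.phi)
    (fun m => (hF.phi m).differentiableAt_of_isOpen hU hx) A m)

lemma toTwoZero_P_vector (hU : IsOpen U) (hF : F.Regular U) (hx : x ∈ U) (m : Fin 4) :
    F.toTwoZero.P m.castSucc x = (-exp (-(F.sigma x / √2)) / √2) • dφ m x := by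
  have h := toTwoZero_maurerCartan_vector hU hF hx 5 m
  rw [(cosetRep_last _ _ 0).2] at h
  exact h

lemma toTwoZero_P_last (hU : IsOpen U) (hF : F.Regular U) (hx : x ∈ U) :
    F.toTwoZero.P (Fin.last 4) x = (√2)⁻¹ • dScalar F.sigma x := by
  rw [TwoZeroFields.P, TwoZeroFields.maurerCartan_eq]
  exact congrArg oneForm (maurerCartanForm_last_four (σ := F.sigma) (φ := F.phi)
    (hF.sigma.differentiableAt_of_isOpen hU hx)
    (fun m => (hF.phi m).differentiableAt_of_isOpen hU hx))

lemma toTwoZero_Q_vector (hU : IsOpen U) (hF : F.Regular U) (hx : x ∈ U) (m n : Fin 4) :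
    F.toTwoZero.Q m.castSucc n.castSucc x = 0 := by
  have h := toTwoZero_maurerCartan_vector hU hF hx m.castSucc.castSucc n
  rw [(cosetRep_vector _ _ m).2.1, (cosetRep_vector _ _ m).2.2, neg_add_cancel, neg_zero, zero_div,
    zero_smul] at h
  exact h

lemma toTwoZero_Q_last_vector (hU : IsOpen U) (hF : F.Regular U) (hx : x ∈ U) (m : Fin 4) :
    F.toTwoZero.Q (Fin.last 4) m.castSucc x = (-exp (-(F.sigma x / √2)) / √2) • dφ m x := by
  have h := toTwoZero_maurerCartan_vector hU hF hx 4 m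
  rw [cosetRep_four_sum] at h
  exact h

lemma toTwoZero_Q_vector_last (hU : IsOpen U) (hF : F.Regular U) (hx : x ∈ U) (m : Fin 4) :
    F.toTwoZero.Q m.castSucc (Fin.last 4) x = (exp (-(F.sigma x / √2)) / √2) • dφ m x := by
  have h := toTwoZero_Q_last_vector hU hF hx m
  have h2 : F.toTwoZero.Q m.castSucc (Fin.last 4) x = -F.toTwoZero.Q (Fin.last 4) m.castSucc x :=
    hF.toTwoZero.maurerCartan_antisymm hU hx _ _
  rw [h2, h]
  module

lemma toTwoZero_Q_last_last (hU : IsOpen U) (hF : F.Regular U) (hx : x ∈ U) :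
    F.toTwoZero.Q (Fin.last 4) (Fin.last 4) x = 0 :=
  hF.toTwoZero.maurerCartan_self hU hx _

lemma star6_dressedForms_four (hg : IsLorentzian (F.metric x)) :
    ⋆₃ (F.metric x) (F.dressedForms x 4) = F.dressedForms x 4 := by
  rw [dressedForms_four, star6_smul, star6_add, star6_star6 hg, add_comm]

lemma star6_dressedForms_five (hg : IsLorentzian (F.metric x)) :
    ⋆₃ (F.metric x) (F.dressedForms x 5) = -F.dressedForms x 5 := by
  rw [dressedForms_five, star6_smul, star6_sub, star6_star6 hg]
  module

lemma wedge_dressedForms_vector (hg : IsLorentzian (F.metric x)) (m : Fin 4)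
    (hm : F.Hm m x = ⋆₃ (F.metric x) (F.Hm m x)) : wedge (F.Hm m x) (F.dressedForms x 5) =
      exp (F.sigma x / √2) • wedge (F.H0 x) (F.Hm m x) := by
  have h : wedge (F.Hm m x) (⋆₃ (F.metric x) (F.H0 x)) = wedge (F.H0 x) (F.Hm m x) := by
    rw [star6_one_symm hg, ← hm]
  rw [dressedForms_five, wedge_smul_right, wedge_sub_right, h, wedge_three_three (F.Hm m x)]
  module

lemma wedge_dressedForms_four (F : SixFields) (x : ℝ⁶) :
    wedge (F.dressedForms x 4) (F.dressedForms x 5) = (1 / 2 * exp (√2 * F.sigma x)) •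
      wedge (F.H0 x) (⋆₃ (F.metric x) (F.H0 x)) := by
  rw [dressedForms_four, dressedForms_five, wedge_smul_left, wedge_smul_right, wedge_add_left,
    wedge_sub_right, wedge_sub_right, wedge_three_self, wedge_three_self,
    wedge_three_three (⋆₃ (F.metric x) (F.H0 x)), ← exp_div_sq]
  have h0 : ∀ v, (0 : Λ⁶ (3 + 3)) v = 0 := fun _ => rfl
  module

lemma toTwoZero_scalar_vector_iff (hU : IsOpen U) (hF : F.Regular U) (hx : x ∈ U) (m : Fin 4)
    (hm : F.Hm m x = ⋆₃ (F.metric x) (F.Hm m x)) :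
    (extDeriv (fun w => ⋆₁ (F.metric w) (F.toTwoZero.P m.castSucc w)) x +
      ∑ j, wedge (F.toTwoZero.Q m.castSucc j x) (⋆₁ (F.metric x) (F.toTwoZero.P j x)) =
      -wedge (F.dressedForms x m.castSucc.castSucc) (⋆₃ (F.metric x) (F.dressedForms x 5))) ↔
    extDeriv (fun w => exp (-(√2 * F.sigma w)) • ⋆₁ (F.metric w) (dφ m w)) x +
      √2 • wedge (F.H0 x) (F.Hm m x) = 0 := by
  have hg := hF.metric.2 x hx
  have hσ := hF.sigma.differentiableAt_of_isOpen hU hx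
  have hb : HasFDerivAt (fun w => -(exp (F.sigma w / √2) / √2))
      (-(exp (F.sigma x / √2) / 2) • fderiv ℝ F.sigma x) x := by
    have h : HasFDerivAt (fun w => -(exp (F.sigma w / √2) / √2))
        (-((√2)⁻¹ • exp (F.sigma x / √2) • ((√2)⁻¹ • fderiv ℝ F.sigma x))) x :=
      ((hσ.hasFDerivAt.mul_const (√2)⁻¹).exp.mul_const (√2)⁻¹).neg
    convert h using 1
    have h2 : (√2)⁻¹ * (√2)⁻¹ = (1 / 2 : ℝ) := by
      rw [← mul_inv, mul_self_sqrt (by norm_num)]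
      norm_num
    ext v
    simp only [smul_apply, neg_apply, smul_eq_mul]
    linear_combination exp (F.sigma x / √2) * fderiv ℝ F.sigma x v * h2
  have hS : Diff (fun w => exp (-(√2 * F.sigma w)) • ⋆₁ (F.metric w) (dφ m w)) x :=
    ((contDiffOn_const.mul hF.sigma).neg.exp.smul (ContDiffOn.star6 (q := 5) rfl hF.metric
      ((hF.phi m).dScalar hU))).differentiableAt_of_isOpen hU hx
  have hab := exp_neg_mul_exp_div
  have he : (fun w => ⋆₁ (F.metric w) (F.toTwoZero.P m.castSucc w)) =ᶠ[nhds x]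
      fun w => -(exp (F.sigma w / √2) / √2) • (exp (-(√2 * F.sigma w)) •
        ⋆₁ (F.metric w) (dφ m w)) := by
    filter_upwards [hU.mem_nhds hx] with w hw
    rw [toTwoZero_P_vector hU hF hw, star6_smul, smul_smul, ← exp_neg_div_sq]
    congr 1
    linear_combination exp (-(F.sigma w / √2)) / √2 * hab (F.sigma w)
  rw [he.extDeriv_eq, extDeriv_smul_fun hb.differentiableAt hS, Fin.sum_univ_castSucc]
  have hdb : dScalar (fun w => -(exp (F.sigma w / √2) / √2)) x =
      -(exp (F.sigma x / √2) / 2) • dScalar F.sigma x := congrArg oneForm hb.fderiv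
  have hc : ∀ θ : Λ⁶ (1 + 5), castForm (Nat.add_comm 1 5) θ = θ := fun _ => rfl
  have hw0 : ∀ θ : Λ⁶ 5, wedge (0 : Λ⁶ 1) θ = 0 := wedge_zero_left
  simp only [toTwoZero_Q_vector hU hF hx, hw0, sum_const_zero, zero_add]
  rw [toTwoZero_Q_vector_last hU hF hx, toTwoZero_P_last hU hF hx, dressedForms_vector,
    star6_dressedForms_five hg, wedge_neg_right, neg_neg, wedge_dressedForms_vector hg m hm, hdb,
    star6_smul, wedge_smul_left, wedge_smul_left, wedge_smul_right, wedge_smul_right, hc,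
    star6_one_symm hg (dScalar F.sigma x)]
  generalize extDeriv (fun w => exp (-(√2 * F.sigma w)) • ⋆₁ (F.metric w) (dφ m w)) x = X
  generalize wedge (dφ m x) (⋆₁ (F.metric x) (dScalar F.sigma x)) = Y
  generalize wedge (F.H0 x) (F.Hm m x) = Z
  have hs : √2 * √2 = 2 := mul_self_sqrt (by norm_num)
  have hs0 : √2 ≠ 0 := by positivity
  have hb0 := (exp_pos (F.sigma x / √2)).ne'
  have hab := hab (F.sigma x)
  rw [← exp_neg_div_sq]
  generalize exp (F.sigma x / √2) = b at *
  generalize exp (-(F.sigma x / √2)) = a at *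
  refine eq_iff_of_sub_eq_smul (neg_ne_zero.2 (div_ne_zero hb0 hs0)) ?_
  ext v
  change -(b / √2) * X v + -(b / 2) * (a ^ 2 * Y v) + a / √2 * ((√2)⁻¹ * Y v) - b * Z v =
    -(b / √2) * (X v + √2 * Z v)
  have h2 : (√2)⁻¹ * (√2)⁻¹ = (1 / 2 : ℝ) := by
    rw [← mul_inv, hs]
    norm_num
  have h3 : √2 * (√2)⁻¹ = 1 := mul_inv_cancel₀ hs0
  simp only [div_eq_mul_inv]
  linear_combination (-(1 / 2) * a * Y v) * hab + a * Y v * h2 + b * Z v * h3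

lemma toTwoZero_scalar_last_iff (hU : IsOpen U) (hF : F.Regular U) (hx : x ∈ U) :
    (extDeriv (fun w => ⋆₁ (F.metric w) (F.toTwoZero.P (Fin.last 4) w)) x +
      ∑ j, wedge (F.toTwoZero.Q (Fin.last 4) j x) (⋆₁ (F.metric x) (F.toTwoZero.P j x)) =
      -wedge (F.dressedForms x 4) (⋆₃ (F.metric x) (F.dressedForms x 5))) ↔
    extDeriv (fun w => ⋆₁ (F.metric w) (dScalar F.sigma w)) x + (1 / √2 * exp (-(√2 * F.sigma x))) •
        ∑ m, wedge (dφ m x) (⋆₁ (F.metric x) (dφ m x)) -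
      (1 / √2 * exp (√2 * F.sigma x)) • wedge (F.H0 x) (⋆₃ (F.metric x) (F.H0 x)) = 0 := by
  have hg := hF.metric.2 x hx
  have he : (fun w => ⋆₁ (F.metric w) (F.toTwoZero.P (Fin.last 4) w)) =ᶠ[nhds x]
      fun w => (√2)⁻¹ • ⋆₁ (F.metric w) (dScalar F.sigma w) := by
    filter_upwards [hU.mem_nhds hx] with w hw
    rw [toTwoZero_P_last hU hF hw, star6_smul]
  have hw0 : ∀ θ : Λ⁶ 5, wedge (0 : Λ⁶ 1) θ = 0 := wedge_zero_left
  rw [he.extDeriv_eq, extDeriv_const_smul, Fin.sum_univ_castSucc, toTwoZero_Q_last_last hU hF hx,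
    hw0, add_zero, star6_dressedForms_five hg, wedge_neg_right, neg_neg, wedge_dressedForms_four]
  simp only [toTwoZero_Q_last_vector hU hF hx, toTwoZero_P_vector hU hF hx, star6_smul,
    wedge_smul_left, wedge_smul_right, ← smul_sum]
  rw [smul_smul, show -exp (-(F.sigma x / √2)) / √2 * (-exp (-(F.sigma x / √2)) / √2) =
    (√2)⁻¹ * (√2)⁻¹ * exp (-(√2 * F.sigma x)) by rw [← exp_neg_div_sq]; ring]
  generalize extDeriv (fun w => ⋆₁ (F.metric w) (dScalar F.sigma w)) x = X
  generalize ∑ m, wedge (dφ m x)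
    (⋆₁ (F.metric x) (dφ m x)) = Y
  generalize wedge (F.H0 x) (⋆₃ (F.metric x) (F.H0 x)) = Z
  generalize exp (√2 * F.sigma x) = b
  generalize exp (-(√2 * F.sigma x)) = a
  have h2 : (√2)⁻¹ * (√2)⁻¹ = (1 / 2 : ℝ) := by
    rw [← mul_inv, mul_self_sqrt (by norm_num)]
    norm_num
  have hs0 : (√2)⁻¹ ≠ 0 := by positivity
  refine eq_iff_of_sub_eq_smul hs0 ?_
  ext v
  change (√2)⁻¹ * X v + ((√2)⁻¹ * (√2)⁻¹ * a) * Y v - (1 / 2 * b) * Z v =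
    (√2)⁻¹ * (X v + (1 / √2 * a) * Y v - (1 / √2 * b) * Z v)
  simp only [one_div] at h2 ⊢
  linear_combination b * Z v * h2

end SixFields

lemma contract_add_sub (g : Matrix ι ι ℝ) (c : ℝ) (a b : Form ι (p + 1)) (i j : ι) :
    contract g (c • (a + b)) i j + contract g (c • (a - b)) i j =
      2 * c ^ 2 * (contract g a i j + contract g b i j) := by
  simp only [contract, Form.smul_apply, Form.add_apply, Form.sub_apply, ← sum_add_distrib, mul_sum]
  exact sum_congr rfl fun I _ => by ring

namespace SixFields

lemma toTwoZero_einstein (hU : IsOpen U) (hF : F.Regular U) (hx : x ∈ U) (μ ν : Fin 6) :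
    ∑ i, F.toTwoZero.P i x (fun _ => coordVec μ) * F.toTwoZero.P i x (fun _ => coordVec ν) +
        1 / 4 * ∑ A, contract (F.metric x) (F.toTwoZero.dressed A x) μ ν =
      1 / 2 * pd μ F.sigma x * pd ν F.sigma x +
        1 / 2 * exp (-(√2 * F.sigma x)) * ∑ m, pd μ (F.phi m) x * pd ν (F.phi m) x +
        1 / 4 * ∑ m, contract (F.metric x) (F.Hm m x) μ ν + 1 / 4 * exp (√2 * F.sigma x) *
          (contract (F.metric x) (F.H0 x) μ ν -
            1 / 6 * F.metric x μ ν * normSq (F.metric x) (F.H0 x)) := by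
  have hP : ∀ (f : ℝ⁶ → ℝ) (c : ℝ) (ρ : Fin 6),
      (c • dScalar f x) (fun _ => coordVec ρ) = c * pd ρ f x := fun f c ρ => rfl
  rw [Fin.sum_univ_castSucc, sum_univ_four_add_two]
  simp only [toTwoZero_P_vector hU hF hx, toTwoZero_P_last hU hF hx, hP, toTwoZero_dressed,
    dressedForms_vector]
  have hD := contract_add_sub (F.metric x) (1 / 2 * exp (F.sigma x / √2))
    (⋆₃ (F.metric x) (F.H0 x)) (F.H0 x) μ ν
  rw [← dressedForms_four, ← dressedForms_five, contract_star6 (hF.metric.2 x hx)] at hD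
  have h2 : (√2)⁻¹ * (√2)⁻¹ = (1 / 2 : ℝ) := by
    rw [← mul_inv, mul_self_sqrt (by norm_num)]
    norm_num
  have hS : ∑ m, -exp (-(F.sigma x / √2)) / √2 * pd μ (F.phi m) x *
      (-exp (-(F.sigma x / √2)) / √2 * pd ν (F.phi m) x) =
      1 / 2 * exp (-(√2 * F.sigma x)) * ∑ m, pd μ (F.phi m) x * pd ν (F.phi m) x := by
    rw [mul_sum, ← exp_neg_div_sq, ← h2]
    exact sum_congr rfl fun m _ => by ring
  rw [hS, ← exp_div_sq]
  linear_combination 1 / 4 * hD + pd μ F.sigma x * pd ν F.sigma x * h2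

lemma isSolution_iff_toTwoZero (hU : IsOpen U) (hF : F.Regular U) :
    F.IsSolution U ↔ F.toTwoZero.IsSolution U := by
  have hc := toTwoZero_closed_iff hU hF
  have e4 : (Fin.last 4).castSucc = (4 : Fin 6) := rfl
  have e5 : Fin.last 5 = (5 : Fin 6) := rfl
  have hg : F.toTwoZero.metric = F.metric := rfl
  constructor
  · rintro ⟨hB, hE, hSD⟩
    refine ⟨hc.2 ⟨hB, hE.eom_H0⟩, fun i x hx => ?_, fun x hx => ?_, fun i x hx => ?_,
      fun x hx μ ν => (hE.einstein x hx μ ν).trans (toTwoZero_einstein hU hF hx μ ν).symm⟩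
    · rw [toTwoZero_dressed]
      refine lastCases (star6_dressedForms_four (hF.metric.2 x hx)) (fun m => ?_) i
      rw [dressedForms_vector]
      exact (hSD m x hx).symm
    · rw [toTwoZero_dressed]
      exact star6_dressedForms_five (hF.metric.2 x hx)
    · rw [toTwoZero_dressed, toTwoZero_dressed]
      simp only [hg, e5]
      refine lastCases ?_ (fun m => ?_) i
      · rw [e4]
        exact (toTwoZero_scalar_last_iff hU hF hx).2 (hE.eom_sigma x hx)
      · have := (toTwoZero_scalar_vector_iff hU hF hx m (hSD m x hx)).2 (hE.eom_phi m x hx)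
        convert this using 3
  · intro h
    obtain ⟨hB, hE0⟩ := hc.1 h.closed
    have hSD : F.SelfDual U := fun m x hx => by
      have := h.self_dual m.castSucc x hx
      rw [toTwoZero_dressed, dressedForms_vector] at this
      exact this.symm
    have hs := h.scalar
    simp only [toTwoZero_dressed, e5, hg] at hs
    have hv : ∀ m, ∀ x ∈ U, _ := fun m x hx =>
      (toTwoZero_scalar_vector_iff hU hF hx m (hSD m x hx)).1 (by
        have := hs m.castSucc x hx
        convert this using 3)
    exact ⟨hB, ⟨hE0, hv,
      fun x hx => (toTwoZero_scalar_last_iff hU hF hx).1 (by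
        have := hs (Fin.last 4) x hx
        simp only [e4] at this
        convert this using 3),
      fun x hx μ ν => (h.einstein x hx μ ν).trans (toTwoZero_einstein hU hF hx μ ν)⟩, hSD⟩

end SixFields

section Rotation

variable {k : Matrix (Fin 5) (Fin 5) ℝ}

lemma sum_col_mul_col (hk : k ∈ specialOrthogonalGroup (Fin 5) ℝ) (j l : Fin 5) :
    ∑ i, k i j * k i l = if j = l then 1 else 0 := by
  have h := (Matrix.mem_orthogonalGroup_iff' (Fin 5) ℝ).1
    (Matrix.mem_specialOrthogonalGroup_iff.1 hk).1
  have := congrFun (congrFun h j) l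
  rw [Matrix.mul_apply, Matrix.one_apply] at this
  exact this

lemma sum_row_mul_row (hk : k ∈ specialOrthogonalGroup (Fin 5) ℝ) (i l : Fin 5) :
    ∑ j, k i j * k l j = if i = l then 1 else 0 := by
  have h := (Matrix.mem_orthogonalGroup_iff (Fin 5) ℝ).1
    (Matrix.mem_specialOrthogonalGroup_iff.1 hk).1
  have := congrFun (congrFun h i) l
  rw [Matrix.mul_apply, Matrix.one_apply] at this
  exact this

lemma sum_rotate_mul_rotate (hk : k ∈ specialOrthogonalGroup (Fin 5) ℝ) (a b : Fin 5 → ℝ) :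
    ∑ j, (∑ i, k i j * a i) * ∑ l, k l j * b l = ∑ i, a i * b i := by
  calc ∑ j, (∑ i, k i j * a i) * ∑ l, k l j * b l =
        ∑ l, ∑ i, (∑ j, k i j * k l j) * (a i * b l) := by
        simp only [sum_mul, mul_sum]
        rw [sum_comm]
        refine sum_congr rfl fun l _ => ?_
        rw [sum_comm]
        exact sum_congr rfl fun i _ => sum_congr rfl fun j _ => by ring
    _ = _ := by simp [sum_row_mul_row hk]

lemma rotate_row (hk : k ∈ specialOrthogonalGroup (Fin 5) ℝ)
    {L M : Mat₆} (h : L = embed5 k * M) (j : Fin 5) (I : Fin 6) :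
    M j.castSucc I = ∑ i, k i j * L i.castSucc I := by
  simp only [h, embed5_mul_castSucc, mul_sum]
  rw [sum_comm]
  simp only [← mul_assoc, ← sum_mul, sum_col_mul_col hk]
  simp

/-- Rows of the coset representative enter linearly in what they dress. -/
lemma rotate_sum {W : Type*} [AddCommGroup W] [Module ℝ W]
    (hk : k ∈ specialOrthogonalGroup (Fin 5) ℝ)
    {L M : Mat₆} (h : L = embed5 k * M) (j : Fin 5) (w : Fin 6 → W) :
    ∑ I, M j.castSucc I • w I = ∑ i, k i j • ∑ I, L i.castSucc I • w I := by
  simp only [rotate_row hk h, sum_smul, smul_sum, smul_smul]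
  exact sum_comm

lemma sum_contract_rotate (hk : k ∈ specialOrthogonalGroup (Fin 5) ℝ) (g : Matrix ι ι ℝ)
    {D D' : Fin 5 → Form ι (p + 1)} (hD : ∀ j, D' j = ∑ i, k i j • D i) (μ ν : ι) :
    ∑ j, contract g (D' j) μ ν = ∑ i, contract g (D i) μ ν := by
  simp only [contract, hD, Form.sum_apply, Form.smul_apply]
  rw [sum_comm, sum_comm (s := Finset.univ (α := Fin 5))]
  simp only [sum_rotate_mul_rotate hk]

lemma sum_wedge_star6_rotate (hk : k ∈ specialOrthogonalGroup (Fin 5) ℝ)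
    (g : Mat₆) {D D' : Fin 5 → Λ⁶ 1} (hD : ∀ j, D' j = ∑ i, k i j • D i) :
    ∑ j, wedge (D' j) (⋆₁ g (D' j)) = ∑ i, wedge (D i) (⋆₁ g (D i)) := by
  have h : ∑ j, formInner g (D' j) (D' j) = ∑ i, formInner g (D i) (D i) := by
    simp only [formInner, hD, Form.sum_apply, Form.smul_apply]
    rw [sum_comm, sum_comm (s := Finset.univ (α := Fin 5))]
    simp only [sum_rotate_mul_rotate hk]
  simp only [star6, wedge_hodge, ← sum_smul, ← mul_sum, h]

end Rotation

lemma IsSO15.sum_smul_dress {W : Type*} [AddCommGroup W] [Module ℝ W]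
    {L : Mat₆} (h : IsSO15 L) (I : Fin 6) (w : Fin 6 → W) :
    ∑ i : Fin 5, L i.castSucc I • ∑ J, L i.castSucc J • w J =
      eta I I • w I + L 5 I • ∑ J, L 5 J • w J := by
  have hc : ∀ J, ∑ i : Fin 5, L i.castSucc I * L i.castSucc J = eta I J + L 5 I * L 5 J := by
    intro J
    have := h.col_norm I J
    rw [Fin.sum_univ_castSucc, eta_last] at this
    simp only [eta_castSucc, if_true, mul_one] at this
    rw [← this]
    change _ = _ + L 5 I * -1 * L 5 J + _
    ring
  have hd : ∑ J, eta I J • w J = eta I I • w I :=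
    sum_eq_single I (fun J _ hJ => by rw [eta, Matrix.diagonal_apply_ne _ hJ.symm, zero_smul])
      (by simp)
  calc _ = ∑ J, (∑ i : Fin 5, L i.castSucc I * L i.castSucc J) • w J := by
        simp only [smul_sum, smul_smul, sum_smul]
        exact sum_comm
    _ = _ := by simp only [hc, add_smul, sum_add_distrib, hd, smul_sum, smul_smul]

namespace TwoZeroFields

variable {T T' : TwoZeroFields}

lemma maurerCartan_eq_sum (T : TwoZeroFields) (A B : Fin 6) (x : ℝ⁶) :
    T.maurerCartan A B x = ∑ I, T.V x A I • eta I I • dScalar (fun w => T.V w B I) x := by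
  simp only [maurerCartan, smul_smul, mul_comm]

lemma eta_sq (I : Fin 6) : eta I I * eta I I = 1 := by
  have := congrFun (congrFun eta_mul_eta I) I
  rwa [eta, Matrix.diagonal_mul, ← eta, Matrix.one_apply_eq, eta, diagonal_apply_eq] at *

lemma sum_smul_maurerCartan (hV : IsSO15 (T.V x)) (B I : Fin 6) :
    ∑ i : Fin 5, T.V x i.castSucc I • T.maurerCartan i.castSucc B x =
      dScalar (fun w => T.V w B I) x + T.V x 5 I • T.maurerCartan 5 B x := by
  simp only [maurerCartan_eq_sum]
  refine (hV.sum_smul_dress I fun J => eta J J • dScalar (fun w => T.V w B J) x).trans ?_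
  rw [smul_smul, eta_sq, one_smul]

/-- The left-hand side of the scalar equation. -/
def scalarLHS (T : TwoZeroFields) (i : Fin 5) (x : ℝ⁶) : Λ⁶ (5 + 1) :=
  extDeriv (fun w => ⋆₁ (T.metric w) (T.P i w)) x +
      ∑ j, wedge (T.Q i j x) (⋆₁ (T.metric x) (T.P j x))

lemma Regular.contDiffOn_maurerCartan (hU : IsOpen U) (hT : T.Regular U) (A B : Fin 6) :
    ContDiffOn ℝ ∞ (T.maurerCartan A B) U := by
  change ContDiffOn ℝ ∞ (fun x => ∑ I, (eta I I * T.V x A I) • dScalar (fun w => T.V w B I) x) U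
  exact ContDiffOn.sum fun I _ => (contDiffOn_const.mul (hT.V A I)).smul ((hT.V B I).dScalar hU)

/-- The scalar equation, dressed back to an equation for the singlet row of `V`. -/
lemma Regular.sum_smul_scalarLHS (hU : IsOpen U) (hT : T.Regular U) (hx : x ∈ U) (I : Fin 6) :
    ∑ i : Fin 5, T.V x i.castSucc I • T.scalarLHS i x =
      T.V x 5 I • ∑ j, wedge (T.P j x) (⋆₁ (T.metric x) (T.P j x)) -
      extDeriv (fun w => ⋆₁ (T.metric w) (dScalar (fun w => T.V w 5 I) w)) x := by
  have dV : ∀ i : Fin 5, Diff (fun w => T.V w i.castSucc I) x := fun i =>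
    (hT.V _ I).differentiableAt_of_isOpen hU hx
  have dP : ∀ i, Diff (fun w => ⋆₁ (T.metric w) (T.P i w)) x := fun i =>
    (ContDiffOn.star6 (q := 5) rfl hT.metric
      (hT.contDiffOn_maurerCartan hU _ _)).differentiableAt_of_isOpen hU hx
  have hP : ∀ w ∈ U, ∑ i : Fin 5, T.V w i.castSucc I • T.P i w =
      -dScalar (fun w => T.V w 5 I) w := fun w hw => by
    have h1 : ∀ i : Fin 5, T.V w i.castSucc I • T.P i w =
        -(T.V w i.castSucc I • T.maurerCartan i.castSucc 5 w) := fun i => by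
      rw [P, show Fin.last 5 = (5 : Fin 6) from rfl, hT.maurerCartan_antisymm hU hw, smul_neg]
    simp only [h1, sum_neg_distrib]
    rw [sum_smul_maurerCartan (hT.isSO15 w hw), hT.maurerCartan_self hU hw, smul_zero, add_zero]
  have he : (fun w => ∑ i : Fin 5, T.V w i.castSucc I • ⋆₁ (T.metric w) (T.P i w))
      =ᶠ[nhds x] fun w => -⋆₁ (T.metric w) (dScalar (fun w => T.V w 5 I) w) := by
    filter_upwards [hU.mem_nhds hx] with w hw
    simp only [← star6_smul]
    rw [star6, ← hodge_neg, ← hP w hw, hodge_sum]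
    rfl
  have hd := he.extDeriv_eq
  rw [extDeriv_neg, extDeriv_sum _ fun i _ => (dV i).fun_smul (dP i)] at hd
  simp only [extDeriv_smul_fun (dV _) (dP _), sum_add_distrib] at hd
  have hQ : ∑ i : Fin 5, T.V x i.castSucc I • ∑ j, wedge (T.Q i j x) (⋆₁ (T.metric x) (T.P j x)) =
      ∑ j : Fin 5, wedge (dScalar (fun w => T.V w j.castSucc I) x)
        (⋆₁ (T.metric x) (T.P j x)) +
      T.V x 5 I • ∑ j, wedge (T.P j x) (⋆₁ (T.metric x) (T.P j x)) := by
    have h1 : ∀ j : Fin 5, ∑ i : Fin 5, T.V x i.castSucc I • T.Q i j x =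
        dScalar (fun w => T.V w j.castSucc I) x + T.V x 5 I • T.P j x := fun j =>
      sum_smul_maurerCartan (hT.isSO15 x hx) j.castSucc I
    simp only [smul_sum, ← wedge_smul_left]
    rw [sum_comm]
    simp only [← wedge_sum_left, h1, wedge_add_left, sum_add_distrib]
  have hc : ∀ θ : Λ⁶ (1 + 5), castForm (Nat.add_comm 1 5) θ = θ := fun _ => rfl
  simp only [scalarLHS, smul_add, sum_add_distrib]
  simp only [hc] at hd
  generalize T.V x 5 I • ∑ j, wedge (T.P j x) (⋆₁ (T.metric x) (T.P j x)) = A at hQ ⊢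
  generalize ∑ j : Fin 5, wedge (dScalar (fun w => T.V w j.castSucc I) x)
        (⋆₁ (T.metric x) (T.P j x)) = B at hd hQ
  generalize extDeriv (fun w => ⋆₁ (T.metric w) (dScalar (fun w => T.V w 5 I) w)) x = C
    at hd ⊢
  generalize ∑ i : Fin 5, T.V x i.castSucc I •
      ∑ j, wedge (T.Q i j x) (⋆₁ (T.metric x) (T.P j x)) = D at hQ ⊢
  generalize ∑ i : Fin 5, T.V x i.castSucc I •
      extDeriv (fun w => ⋆₁ (T.metric w) (T.P i w)) x = E at hd ⊢
  subst hQ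
  ext v
  have hv : E v + B v = -C v := congrArg (fun θ => θ v) hd
  change E v + (B v + A v) = A v - C v
  linear_combination hv

end TwoZeroFields

lemma IsSO15.sum_smul_undress {W : Type*} [AddCommGroup W] [Module ℝ W]
    {L : Mat₆} (h : IsSO15 L) (l : Fin 5) (E : Fin 5 → W) :
    ∑ I, L l.castSucc I • eta I I • ∑ i : Fin 5, L i.castSucc I • E i = E l := by
  have hr : ∀ i : Fin 5, ∑ I, L l.castSucc I * eta I I * L i.castSucc I = if l = i then 1 else 0 :=
    fun i => (h.row_norm _ _).trans (eta_castSucc l i)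
  simp only [smul_smul, smul_sum]
  rw [sum_comm]
  simp only [← sum_smul, ← mul_assoc, hr, ite_smul, one_smul, zero_smul, sum_ite_eq, mem_univ,
    if_true]

namespace TwoZeroFields

variable {T T' : TwoZeroFields}
  {k : Matrix (Fin 5) (Fin 5) ℝ}

lemma dressed_last_congr (hrow : T'.V x 5 = T.V x 5) (hG : ∀ I, T'.G I x = T.G I x) :
    T'.dressed (Fin.last 5) x = T.dressed (Fin.last 5) x := by
  change ∑ I, T'.V x 5 I • T'.G I x = ∑ I, T.V x 5 I • T.G I x
  simp only [hrow, hG]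

lemma dressed_rotate (hk : k ∈ specialOrthogonalGroup (Fin 5) ℝ)
    (h : T.V x = embed5 k * T'.V x) (hG : ∀ I, T'.G I x = T.G I x) (j : Fin 5) :
    T'.dressed j.castSucc x = ∑ i : Fin 5, k i j • T.dressed i.castSucc x := by
  refine Eq.trans ?_ (rotate_sum hk h j fun I => T.G I x)
  simp only [dressed, hG]

lemma dScalar_last_congr (hU : IsOpen U) (hrow : ∀ x ∈ U, T'.V x 5 = T.V x 5) (hx : x ∈ U)
    (I : Fin 6) : dScalar (fun w => T'.V w 5 I) x = dScalar (fun w => T.V w 5 I) x := by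
  have h : (fun w => T'.V w 5 I) =ᶠ[nhds x] fun w => T.V w 5 I := by
    filter_upwards [hU.mem_nhds hx] with w hw
    rw [hrow w hw]
  exact congrArg oneForm h.fderiv_eq

lemma P_rotate (hU : IsOpen U) (hT : T.Regular U) (hT' : T'.Regular U)
    (hrow : ∀ x ∈ U, T'.V x 5 = T.V x 5) (hx : x ∈ U)
    (hk : k ∈ specialOrthogonalGroup (Fin 5) ℝ) (h : T.V x = embed5 k * T'.V x)
    (j : Fin 5) : T'.P j x = ∑ i, k i j • T.P i x := by
  have hP : ∀ {S : TwoZeroFields}, S.Regular U → ∀ i : Fin 5, S.P i x =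
      ∑ I, S.V x i.castSucc I • (-(eta I I • dScalar (fun w => S.V w 5 I) x)) := fun hS i => by
    simp only [smul_neg, sum_neg_distrib]
    rw [← maurerCartan_eq_sum]
    exact hS.maurerCartan_antisymm hU hx _ _
  rw [hP hT']
  simp only [hP hT, dScalar_last_congr hU hrow hx]
  exact rotate_sum hk h j fun I => -(eta I I • dScalar (fun w => T.V w 5 I) x)

lemma scalarLHS_rotate (hU : IsOpen U) (hT : T.Regular U) (hT' : T'.Regular U)
    (hm : T'.metric = T.metric) (hrow : ∀ x ∈ U, T'.V x 5 = T.V x 5) (hx : x ∈ U)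
    (hk : k ∈ specialOrthogonalGroup (Fin 5) ℝ) (h : T.V x = embed5 k * T'.V x)
    (l : Fin 5) : T'.scalarLHS l x = ∑ i, k i l • T.scalarLHS i x := by
  have hR : ∀ I, ∑ i : Fin 5, T'.V x i.castSucc I • T'.scalarLHS i x =
      ∑ i : Fin 5, T.V x i.castSucc I • T.scalarLHS i x := by
    intro I
    have he : (fun w => ⋆₁ (T.metric w) (dScalar (fun w => T'.V w 5 I) w)) =ᶠ[nhds x]
        fun w => ⋆₁ (T.metric w) (dScalar (fun w => T.V w 5 I) w) := by
      filter_upwards [hU.mem_nhds hx] with w hw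
      rw [dScalar_last_congr hU hrow hw]
    rw [hT.sum_smul_scalarLHS hU hx, hT'.sum_smul_scalarLHS hU hx, hm, he.extDeriv_eq,
      sum_wedge_star6_rotate hk _ (P_rotate hU hT hT' hrow hx hk h), hrow x hx]
  have h1 := (hT'.isSO15 x hx).sum_smul_undress l fun i => T'.scalarLHS i x
  rw [← h1, rotate_sum hk h l]
  refine sum_congr rfl fun i _ => ?_
  simp only [hR]
  rw [(hT.isSO15 x hx).sum_smul_undress i fun i => T.scalarLHS i x]

set_option maxRecDepth 4000 in
/-- The field equations only depend on the singlet row of `V`. -/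
lemma IsSolution.of_last_row (hU : IsOpen U) (hT : T.Regular U) (hT' : T'.Regular U)
    (hm : T'.metric = T.metric) (hrow : ∀ x ∈ U, T'.V x 5 = T.V x 5)
    (hG : ∀ I, ∀ x ∈ U, T'.G I x = T.G I x) (h : T.IsSolution U) : T'.IsSolution U := by
  have hk : ∀ x ∈ U, ∃ k ∈ specialOrthogonalGroup (Fin 5) ℝ,
      T.V x = embed5 k * T'.V x := fun x hx =>
    exists_embed5 (hT.isSO15 x hx) (hT'.isSO15 x hx) (hrow x hx).symm
  have hl : ∀ x ∈ U, T'.dressed (Fin.last 5) x = T.dressed (Fin.last 5) x := fun x hx =>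
    dressed_last_congr (hrow x hx) fun I => hG I x hx
  refine ⟨fun I x hx => ?_, fun j x hx => ?_, fun x hx => ?_, fun j x hx => ?_,
    fun x hx μ ν => ?_⟩
  · have he : T'.G I =ᶠ[nhds x] T.G I := by
      filter_upwards [hU.mem_nhds hx] with w hw
      exact hG I w hw
    rw [he.extDeriv_eq, h.closed I x hx]
  · obtain ⟨k, hk, hV⟩ := hk x hx
    rw [dressed_rotate hk hV (fun I => hG I x hx), hm, star6, hodge_sum]
    refine sum_congr rfl fun i _ => ?_
    rw [hodge_smul]
    exact congrArg _ (h.self_dual i x hx)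
  · rw [hl x hx, hm]
    exact h.anti_self_dual x hx
  · obtain ⟨k, hk, hV⟩ := hk x hx
    have h1 := scalarLHS_rotate hU hT hT' hm hrow hx hk hV j
    have h2 : ∀ i, T.scalarLHS i x = -wedge (T.dressed i.castSucc x)
      (⋆₃ (T.metric x) (T.dressed (Fin.last 5) x)) := fun i => by
      rw [scalarLHS]
      exact h.scalar i x hx
    refine h1.trans ?_
    rw [dressed_rotate hk hV (fun I => hG I x hx), hl x hx, hm, wedge_sum_left, ← sum_neg_distrib]
    refine sum_congr rfl fun i _ => ?_
    rw [h2, wedge_smul_left, smul_neg]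
  · obtain ⟨k, hk, hV⟩ := hk x hx
    rw [hm, h.einstein x hx μ ν, Fin.sum_univ_castSucc (n := 5), Fin.sum_univ_castSucc (n := 5),
      hl x hx, sum_contract_rotate hk _ (dressed_rotate hk hV fun I => hG I x hx)]
    simp only [P_rotate hU hT hT' hrow hx hk hV, Form.sum_apply, Form.smul_apply,
      sum_rotate_mul_rotate hk]

/-- The horospherical fields of a solution. -/
def toSix (T : TwoZeroFields) : SixFields where
  metric := T.metric
  sigma := fun x => horoSigma (T.V x 5)
  phi := fun m x => horoPhi (T.V x 5) m
  H0 := fun x => T.G 4 x - T.G 5 x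
  Hm := fun m x => T.G m.castSucc.castSucc x - (horoPhi (T.V x 5) m / √2) • (T.G 4 x - T.G 5 x)

lemma Regular.toSix (hT : T.Regular U) : T.toSix.Regular U := by
  have hs : ContDiffOn ℝ ∞ (fun x => T.V x 5 4 + T.V x 5 5) U := (hT.V 5 4).add (hT.V 5 5)
  have hpos : ∀ x ∈ U, T.V x 5 4 + T.V x 5 5 ≠ 0 := fun x hx => (hT.isSO15 x hx).last_row.1.ne'
  have hφ : ∀ m, ContDiffOn ℝ ∞ (fun x => horoPhi (T.V x 5) m) U := fun m =>
    ContDiffOn.div (contDiffOn_const.mul (hT.V 5 _)) hs hpos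
  refine ⟨hT.metric, ?_, hφ, (hT.G 4).sub (hT.G 5), fun m => ?_⟩
  · exact (contDiffOn_const.mul (hs.log hpos)).neg
  · exact (hT.G _).sub (((hφ m).div_const _).smul ((hT.G 4).sub (hT.G 5)))

lemma toSix_last_row (hT : T.Regular U) (hx : x ∈ U) : T.toSix.toTwoZero.V x 5 = T.V x 5 :=
  cosetRep_horo (hT.isSO15 x hx).last_row.1 (hT.isSO15 x hx).last_row.2

lemma exists_embed5_toSix (hT : T.Regular U) (hx : x ∈ U) :
    ∃ k ∈ specialOrthogonalGroup (Fin 5) ℝ, T.V x = embed5 k * T.toSix.toTwoZero.V x :=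
  exists_embed5 (hT.isSO15 x hx) (hT.toSix.toTwoZero.isSO15 x hx) (toSix_last_row hT hx).symm

set_option maxRecDepth 4000 in
lemma toSix_dressedForms (hT : T.Regular U) (h : T.IsSolution U) (hx : x ∈ U) (A : Fin 6) :
    ∑ I, T.toSix.toTwoZero.V x A I • T.G I x = T.toSix.dressedForms x A := by
  obtain ⟨k, hk, hV⟩ := exists_embed5_toSix hT hx
  have h5 : ∑ I, T.toSix.toTwoZero.V x 5 I • T.G I x = T.dressed (Fin.last 5) x := by
    simp only [toSix_last_row hT hx]
    rfl
  have hsd : ⋆₃ (T.metric x) (∑ I, T.toSix.toTwoZero.V x 4 I • T.G I x) =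
      ∑ I, T.toSix.toTwoZero.V x 4 I • T.G I x := by
    rw [show ∑ I, T.toSix.toTwoZero.V x 4 I • T.G I x = ∑ i : Fin 5, k i (Fin.last 4) •
      T.dressed i.castSucc x from rotate_sum hk hV (Fin.last 4) fun I => T.G I x, star6, hodge_sum]
    refine sum_congr rfl fun i _ => ?_
    rw [hodge_smul]
    exact congrArg _ (h.self_dual i x hx)
  have h4 : ∑ I, T.toSix.toTwoZero.V x 4 I • T.G I x =
      T.dressed (Fin.last 5) x + exp (T.toSix.sigma x / √2) • T.toSix.H0 x := by
    rw [← h5, sum_univ_four_add_two, sum_univ_four_add_two]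
    have hc := cosetRep_four (T.toSix.sigma x) fun m => T.toSix.phi m x
    change ∑ m : Fin 4, cosetRep (T.toSix.sigma x) (fun m => T.toSix.phi m x) 4
        m.castSucc.castSucc • T.G m.castSucc.castSucc x +
      cosetRep (T.toSix.sigma x) (fun m => T.toSix.phi m x) 4 4 • T.G 4 x +
      cosetRep (T.toSix.sigma x) (fun m => T.toSix.phi m x) 4 5 • T.G 5 x =
      ∑ m : Fin 4, cosetRep (T.toSix.sigma x) (fun m => T.toSix.phi m x) 5
        m.castSucc.castSucc • T.G m.castSucc.castSucc x +
      cosetRep (T.toSix.sigma x) (fun m => T.toSix.phi m x) 5 4 • T.G 4 x +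
      cosetRep (T.toSix.sigma x) (fun m => T.toSix.phi m x) 5 5 • T.G 5 x +
      exp (T.toSix.sigma x / √2) • (T.G 4 x - T.G 5 x)
    simp only [hc.1, hc.2.1, hc.2.2]
    module
  have ha := h.anti_self_dual x hx
  generalize T.dressed (Fin.last 5) x = X at h5 h4 ha
  have hX : X = (1 / 2 * exp (T.toSix.sigma x / √2)) •
      (⋆₃ (T.metric x) (T.toSix.H0 x) - T.toSix.H0 x) := by
    rw [h4, star6_add, ha, star6_smul] at hsd
    generalize ⋆₃ (T.metric x) (T.toSix.H0 x) = S at hsd ⊢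
    ext v
    have hv : -X v + exp (T.toSix.sigma x / √2) * S v =
        X v + exp (T.toSix.sigma x / √2) * T.toSix.H0 x v := congrArg (fun θ => θ v) hsd
    change X v = 1 / 2 * exp (T.toSix.sigma x / √2) * (S v - T.toSix.H0 x v)
    linear_combination -(1 / 2 : ℝ) * hv
  refine lastCases ?_ (fun A => lastCases ?_ (fun m => ?_) A) A
  · have := h5.trans (hX.trans (T.toSix.dressedForms_five x).symm)
    exact this
  · have h4' : X + exp (T.toSix.sigma x / √2) • T.toSix.H0 x =
        (1 / 2 * exp (T.toSix.sigma x / √2)) • (⋆₃ (T.metric x) (T.toSix.H0 x) + T.toSix.H0 x) := by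
      rw [hX]
      module
    have := h4.trans (h4'.trans (T.toSix.dressedForms_four x).symm)
    exact this
  · rw [SixFields.dressedForms_vector, sum_univ_four_add_two]
    have hc := cosetRep_vector (T.toSix.sigma x) (fun m => T.toSix.phi m x) m
    change ∑ n : Fin 4, cosetRep (T.toSix.sigma x) (fun m => T.toSix.phi m x) m.castSucc.castSucc
        n.castSucc.castSucc • T.G n.castSucc.castSucc x +
      cosetRep (T.toSix.sigma x) (fun m => T.toSix.phi m x) m.castSucc.castSucc 4 • T.G 4 x +
      cosetRep (T.toSix.sigma x) (fun m => T.toSix.phi m x) m.castSucc.castSucc 5 • T.G 5 x =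
      T.G m.castSucc.castSucc x - (T.toSix.phi m x / √2) • (T.G 4 x - T.G 5 x)
    simp only [hc.1, hc.2.1, hc.2.2, ite_smul, one_smul, zero_smul, sum_ite_eq, mem_univ, if_true]
    module

lemma toSix_toTwoZero_G (hT : T.Regular U) (h : T.IsSolution U) (I : Fin 6) (hx : x ∈ U) :
    T.toSix.toTwoZero.G I x = T.G I x := by
  have hV := mul_eq_one_comm.1 (hT.toSix.toTwoZero.isSO15 x hx).mul_inv
  change ∑ A, (eta * (T.toSix.toTwoZero.V x).transpose * eta) I A • T.toSix.dressedForms x A = _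
  simp only [← toSix_dressedForms hT h hx]
  refine (sum_smul_sum_smul (T.toSix.toTwoZero.V x) _ _).trans ?_
  simp only [← Matrix.mul_apply, hV, Matrix.one_apply, ite_smul, one_smul, zero_smul, sum_ite_eq,
    mem_univ, if_true]

lemma IsSolution.toSix (hU : IsOpen U) (hT : T.Regular U) (h : T.IsSolution U) :
    T.toSix.IsSolution U :=
  (SixFields.isSolution_iff_toTwoZero hU hT.toSix).2
    (h.of_last_row hU hT hT.toSix.toTwoZero rfl (fun _ hx => toSix_last_row hT hx)
      fun I _ hx => toSix_toTwoZero_G hT h I hx)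

end TwoZeroFields

end

theorem mainTheorem2
    (U : Set (Fin 6 → ℝ)) (hU : IsOpen U)
    (Ω : Set (Fin 4 → ℝ)) (hΩ : IsOpen Ω) (hΩne : Ω.Nonempty)
    (H : (Fin 4 → ℝ) → ℝ) (hHsmooth : ContDiffOn ℝ ∞ H Ω) (hHpos : ∀ y ∈ Ω, 0 < H y)
    (hHharm : ∀ y ∈ Ω, ∑ m, pd m (pd m H) y = 0) :
    -- the ansatz deforms the brane background
    (uplift H SixFields.vacuum = ns5Background H ∧
      (ns5Background H).Regular (region U Ω) ∧ (ns5Background H).IsSolution (region U Ω)) ∧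
    -- the ten-dimensional equations reduce exactly to the six-dimensional ones
    (∀ F : SixFields, F.Regular U →
      (uplift H F).Regular (region U Ω) ∧
      (F.SelfDual U → ((uplift H F).IsSolution (region U Ω) ↔ F.Bianchi U ∧ F.EOM U))) ∧
    -- self-duality itself is forced when no direction of the transverse space is an isometry of `H`
    ((∀ c : Fin 4 → ℝ, (∀ y ∈ Ω, ∑ m, c m * pd m H y = 0) → c = 0) →
      ∀ F : SixFields, F.Regular U →
        ((uplift H F).IsSolution (region U Ω) ↔ F.IsSolution U)) ∧
    -- the Bianchi identities are solved by two-form potentials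
    (∀ (g : (Fin 6 → ℝ) → Matrix (Fin 6) (Fin 6) ℝ) (σ : (Fin 6 → ℝ) → ℝ)
        (φ : Fin 4 → (Fin 6 → ℝ) → ℝ) (B0 : (Fin 6 → ℝ) → Form (Fin 6) 2)
        (Bm : Fin 4 → (Fin 6 → ℝ) → Form (Fin 6) 2),
      (∀ m, ContDiffOn ℝ ∞ (φ m) U) → ContDiffOn ℝ ∞ B0 U → (∀ m, ContDiffOn ℝ ∞ (Bm m) U) →
      (SixFields.ofPotentials g σ φ B0 Bm).Bianchi U) ∧
    -- the scalars are horospherical coordinates on `SO(1,5)/SO(5)`, with its invariant metric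
    ((∀ (σ : ℝ) (φ : Fin 4 → ℝ), IsSO15 (cosetRep σ φ)) ∧
      (∀ Λ : Matrix (Fin 6) (Fin 6) ℝ, IsSO15 Λ → ∃! s : ℝ × (Fin 4 → ℝ),
        ∃ k ∈ Matrix.specialOrthogonalGroup (Fin 5) ℝ, Λ = embed5 k * cosetRep s.1 s.2) ∧
      (∀ s u : ℝ × (Fin 4 → ℝ),
        ∑ i : Fin 5, (∑ I, eta I I * cosetRep s.1 s.2 (Fin.last 5) I *
            fderiv ℝ (fun r : ℝ × (Fin 4 → ℝ) => cosetRep r.1 r.2 i.castSucc I) s u) ^ 2 =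
          1 / 2 * (u.1 ^ 2 + Real.exp (-(√2 * s.1)) * ∑ m, u.2 m ^ 2))) ∧
    -- the truncated theory is `(2,0)` supergravity with one tensor multiplet
    (∀ F : SixFields, F.Regular U →
      F.toTwoZero.Regular U ∧ (F.IsSolution U ↔ F.toTwoZero.IsSolution U)) ∧
    (∀ T : TwoZeroFields, T.Regular U → T.IsSolution U →
      ∃ F : SixFields, F.Regular U ∧ F.IsSolution U ∧
        ∀ x ∈ U, F.metric x = T.metric x ∧
          (∃ k ∈ Matrix.specialOrthogonalGroup (Fin 5) ℝ, T.V x = embed5 k * F.toTwoZero.V x) ∧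
          ∀ I, F.toTwoZero.G I x = T.G I x) := by
  refine ⟨⟨uplift_vacuum H, ?_, ?_⟩, fun F hF => ?_, fun hiso F hF => ?_, ?_, ⟨isSO15_cosetRep,
    fun Λ hΛ => existsUnique_horospherical hΛ, sum_sq_maurerCartanForm_cosetRep⟩,
    fun F hF => ⟨hF.toTwoZero, F.isSolution_iff_toTwoZero hU hF⟩, fun T hT h => ?_⟩
  · have S : UpliftData U Ω H SixFields.vacuum :=
      ⟨hU, hΩ, hHsmooth, hHpos, hHharm, vacuum_regular U⟩
    rw [← uplift_vacuum H]
    exact S.regular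
  · have S : UpliftData U Ω H SixFields.vacuum :=
      ⟨hU, hΩ, hHsmooth, hHpos, hHharm, vacuum_regular U⟩
    rw [← uplift_vacuum H]
    exact (S.isSolution_iff hΩne (vacuum_selfDual U)).2 ⟨vacuum_bianchi U, vacuum_eom U⟩
  · have S : UpliftData U Ω H F := ⟨hU, hΩ, hHsmooth, hHpos, hHharm, hF⟩
    exact ⟨S.regular, S.isSolution_iff hΩne⟩
  · have S : UpliftData U Ω H F := ⟨hU, hΩ, hHsmooth, hHpos, hHharm, hF⟩
    exact S.isSolution_iff_of_no_isometry hΩne hiso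
  · exact bianchi_ofPotentials hU
  · exact ⟨T.toSix, hT.toSix, h.toSix hU hT, fun x hx =>
      ⟨rfl, TwoZeroFields.exists_embed5_toSix hT hx, fun I =>
        TwoZeroFields.toSix_toTwoZero_G hT h I hx⟩⟩
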